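/- **Lemma (Additivity).** *Setting.* Let $M$ be a smooth $n$-dimensional manifold (Hausdorff, second countable), let $f(u,\cdot)$, $u\in\mathbb R^k$, be vector fields on $M$ and $L:\mathbb R^k\times M\to\mathbb R$ a function, both smooth in $(u,q)$, and let $N_0\subset M$ be a (possibly immersed) submanifold. Let $(\tilde q,\tilde u)$ be an admissible pair on $[0,T]$: $\tilde u\in L^\infty([0,T],\mathbb R^k)$, $\dot{\tilde q}=f(\tilde u,\tilde q)$ a.e., $\tilde q(0)\in N_0$. Let $\pi_\tau$, $\tau\in[0,T]$, be a measurable field of orthogonal projections of $\mathbb R^k$ onto the directions of two-sided control variations ($\pi_\tau=\mathrm{id}$ if the controls are unconstrained). For $0<t\le T$ let $E_t$ and $J_t$ denote the end-point $q(t)$ and the cost $\int_0^tL(u,q)\,d\tau$, as functions of the initial point in $N_0$ and of the control $\tilde u+\pi v$, $v\in L^\infty([0,t],\mathbb R^k)$; the space of variations is $T_{\tilde q(0)}N_0\times L^\infty([0,t],\mathbb R^k)$. Let $\nu\in\{0,1\}$, $h(u,\lambda)=\langle\lambda,f(u,q)\rangle-\nu L(u,q)$ for $\lambda\in T_q^*M$,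 let $\Phi_t$ be the flow on $T^*M$ of the Hamiltonian $h(\tilde u(t),\cdot)$ from time $0$ to time $t$, let $\lambda(0)\in T^*_{\tilde q(0)}M$ and $\lambda(t)=\Phi_t(\lambda(0))$. Assume that the reference pair with $\lambda(T)$ is a Lagrangian point: $\langle\lambda(T),dE_T(w)\rangle-\nu\,dJ_T(w)=0$ for all variations $w$. Let $\sigma$ be the symplectic form of $T_{\lambda(0)}(T^*M)$, in canonical coordinates $\sigma=dp\wedge dq$. Put $H(t,u,\cdot)=(h(u,\cdot)-h(\tilde u(t),\cdot))\circ\Phi_t$ and $$X(t)v=\Big(\partial_u\vec H(t,u,\lambda(0))\big|_{u=\tilde u(t)}\Big)\pi_tv,\qquad b(t)(v,w)=\partial_u^2h(u,\lambda(t))\big|_{u=\tilde u(t)}(\pi_tv,\pi_tw).$$ For a finite-dimensional space $V$ of variations on $[0,t]$ let $\mathcal L(E_t,\nu J_t)(V)\subset T_{\lambda(t)}(T^*M)$ be the set of all $(\xi,dE_t(v))$ (in canonical coordinates) with $v\in V$ and $$\langle\xi,dE_t(w)\rangle+\langle\lambda(t),d^2E_t(v,w)\rangle-\nu\,d^2J_t(v,w)=0\qquad\forall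 w\in V,$$ let $\mathcal L_t(V)=\Phi_t^*\mathcal L(E_t,\nu J_t)(V)\subset T_{\lambda(0)}(T^*M)$ be its preimage under the differential of $\Phi_t$ at $\lambda(0)$, and let $\mathcal L_t=\lim_V\mathcal L_t(V)$ be the generalized limit (limit of the net, in the Grassmannian, indexed by the finite-dimensional subspaces $V$ ordered by inclusion), when it exists. *Statement.* Let $0<t_1<t_2\le T$ and suppose that the negative or the positive inertia index of the Hessian $\big(\nu\,d^2J_{t_2}-\langle\lambda(t_2),d^2E_{t_2}\rangle\big)\big|_{\ker dE_{t_2}}$ is finite. Then $\mathcal L_{t_1}$ and $\mathcal L_{t_2}$ exist and are Lagrangian. For a finite-dimensional subspace $V_2\subset L^2([t_1,t_2],\mathbb R^k)$ let $$K(V_2)=\Big\{\lambda+\int_{t_1}^{t_2}X(\tau)v(\tau)\,d\tau\Big\},$$ where $\lambda\in\mathcal L_{t_1}$ and $v\in V_2$ range over all pairs with $$\int_{t_1}^{t_2}\Big[\sigma\Big(\lambda+\int_{t_1}^{\tau}X(\theta)v(\theta)\,d\theta,\;X(\tau)w(\tau)\Big)+b(\tau)\big(v(\tau),w(\tau)\big)\Big]d\tau=0\qquad\forall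 w\in V_2 .$$ Then every $K(V_2)$ is a Lagrangian subspace of $T_{\lambda(0)}(T^*M)$, and $\mathcal L_{t_2}$ is the generalized limit of the $K(V_2)$ over the finite-dimensional subspaces $V_2\subset L^2([t_1,t_2],\mathbb R^k)$ ordered by inclusion. -/

import Mathlib

open Set Filter MeasureTheory Topology
open scoped Manifold ContDiff ENNReal InnerProductSpace

noncomputable section

namespace OptControl

/-! ### Linear symplectic algebra and generalized limits -/

/-- Coordinate space. -/
abbrev Vec (n : ℕ) : Type := EuclideanSpace ℝ (Fin n)

/-- `T_μ(T*M)` in canonical coordinates: first component the momentum `p`, second component the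
position `x`. Covectors on `Vec n` are written as vectors by means of the Euclidean pairing. -/
abbrev Phase (n : ℕ) : Type := WithLp 2 (Vec n × Vec n)

/-- The symplectic form `σ = dp ∧ dx`. With this sign the Hamiltonian vector field of `H` is
determined by `σ(η, H⃗) = dH(η)`. -/
def sympl {n : ℕ} (z w : Phase n) : ℝ := ⟪z.fst, w.snd⟫_ℝ - ⟪w.fst, z.snd⟫_ℝ

/-- Lagrangian subspaces: isotropic of half the dimension. -/
def IsLagrangian {n : ℕ} (Λ : Submodule ℝ (Phase n)) : Prop :=
  (∀ z ∈ Λ, ∀ w ∈ Λ, sympl z w = 0) ∧ Module.finrank ℝ Λ = n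

/-- The finite-dimensional subspaces of `W`, a directed set for inclusion. -/
abbrev FinSub (W : Type*) [AddCommGroup W] [Module ℝ W] : Type _ :=
  {V : Submodule ℝ W // FiniteDimensional ℝ V}

/-- `Λ` is the generalized limit of the net `L`, indexed by the finite-dimensional subspaces of `W`
ordered by inclusion. The topology of the Grassmannian is that of the orthogonal projectors. -/
def IsGeneralizedLimit {n : ℕ} {W : Type*} [AddCommGroup W] [Module ℝ W]
    (L : FinSub W → Submodule ℝ (Phase n)) (Λ : Submodule ℝ (Phase n)) : Prop :=
  Tendsto (fun V => (L V).starProjection) atTop (𝓝 Λ.starProjection)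

/-! ### `𝓛`-derivative and Hessian of a constrained problem

`F : W → ℝⁿ` and `J : W → ℝ` are local coordinate representations near `0 ∈ W` of a constraint and
of a functional with smooth restrictions to finite-dimensional subspaces, `p` is a covector and `ν`
the multiplier of the functional. -/

section LDerivative

variable {n : ℕ} {W : Type*} [NormedAddCommGroup W] [NormedSpace ℝ W]

/-- First differential at `0` of the restriction to `V`. -/
def d1 {G : Type*} [NormedAddCommGroup G] [NormedSpace ℝ G] (F : W → G) (V : Submodule ℝ W) :
    V →L[ℝ] G :=
  fderiv ℝ (fun x : V => F x) 0

/-- Second differential at `0` of the restriction to `V`. -/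
def d2 {G : Type*} [NormedAddCommGroup G] [NormedSpace ℝ G] (F : W → G) (V : Submodule ℝ W) :
    V →L[ℝ] V →L[ℝ] G :=
  fderiv ℝ (fderiv ℝ (fun x : V => F x)) 0

/-- `Q(v, w) = ⟨p, d²F(v, w)⟩ - ν d²J(v, w)` on `V`. -/
def qForm (F : W → Vec n) (J : W → ℝ) (p : Vec n) (ν : ℝ) (V : Submodule ℝ W) (v w : V) : ℝ :=
  ⟪p, d2 F V v w⟫_ℝ - ν * d2 J V v w

/-- `0` is a Lagrangian point with multipliers `(p, -ν)` with respect to all directions in `W`. -/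
def IsLagrangePoint (F : W → Vec n) (J : W → ℝ) (p : Vec n) (ν : ℝ) : Prop :=
  ∀ w : W, ⟪p, lineDeriv ℝ F 0 w⟫_ℝ - ν * lineDeriv ℝ J 0 w = 0

/-- The `𝓛`-derivative constructed over `V`: all `(ξ, dF(v))` with `v ∈ V` such that
`⟨ξ, dF(w)⟩ + Q(v, w) = 0` for all `w ∈ V`. -/
def lDeriv (F : W → Vec n) (J : W → ℝ) (p : Vec n) (ν : ℝ) (V : Submodule ℝ W) :
    Submodule ℝ (Phase n) where
  carrier := {z | ∃ v : V, z.snd = d1 F V v ∧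
    ∀ w : V, ⟪z.fst, d1 F V w⟫_ℝ + qForm F J p ν V v w = 0}
  zero_mem' := ⟨0, by simp, by simp [qForm]⟩
  add_mem' := by
    rintro a b ⟨v, hv, hv'⟩ ⟨v', hw, hw'⟩
    refine ⟨v + v', by simp [hv, hw], fun w => ?_⟩
    have h1 := hv' w
    have h2 := hw' w
    simp only [qForm, map_add, add_apply, inner_add_left, inner_add_right,
      WithLp.add_fst] at h1 h2 ⊢
    linarith
  smul_mem' := by
    rintro c a ⟨v, hv, hv'⟩
    refine ⟨c • v, by simp [hv], fun w => ?_⟩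
    have h1 := hv' w
    simp only [qForm, map_smul, smul_apply, inner_smul_left, inner_smul_right,
      WithLp.smul_fst, smul_eq_mul, RCLike.conj_to_real] at h1 ⊢
    linear_combination c * h1

/-- The quadratic form of the Hessian, `ν d²J - ⟨p, d²F⟩` (to be used on `ker dF`). -/
def hessForm (F : W → Vec n) (J : W → ℝ) (p : Vec n) (ν : ℝ) (V : Submodule ℝ W) (v : V) : ℝ :=
  -qForm F J p ν V v v

/-- Negative inertia index of the Hessian: the supremum of the dimensions of finite-dimensional
subspaces of `ker dF` on which the Hessian is negative definite. -/
def hessNegIndex (F : W → Vec n) (J : W → ℝ) (p : Vec n) (ν : ℝ) : ℕ∞ :=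
  ⨆ V : {V : FinSub W // d1 F V.1 = 0 ∧ ∀ v : V.1, v ≠ 0 → hessForm F J p ν V.1 v < 0},
    (Module.finrank ℝ V.1.1 : ℕ∞)

/-- Positive inertia index of the Hessian. -/
def hessPosIndex (F : W → Vec n) (J : W → ℝ) (p : Vec n) (ν : ℝ) : ℕ∞ :=
  ⨆ V : {V : FinSub W // d1 F V.1 = 0 ∧ ∀ v : V.1, v ≠ 0 → 0 < hessForm F J p ν V.1 v},
    (Module.finrank ℝ V.1.1 : ℕ∞)

end LDerivative

/-! ### The optimal control problem -/

variable {n k d : ℕ} {M : Type*} [TopologicalSpace M] [ChartedSpace (Vec n) M]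
  [IsManifold 𝓘(ℝ, Vec n) ∞ M]
  {N : Type*} [TopologicalSpace N] [ChartedSpace (Vec d) N] [IsManifold 𝓘(ℝ, Vec d) ∞ N]

/-- The control system `q̇ = f(u, q)`, `u ∈ ℝᵏ`, `q ∈ M`, with running cost `L(u, q)`. -/
structure ControlProblem (n k : ℕ) (M : Type*) [TopologicalSpace M] [ChartedSpace (Vec n) M]
    [IsManifold 𝓘(ℝ, Vec n) ∞ M] where
  f : Vec k → (q : M) → TangentSpace 𝓘(ℝ, Vec n) q
  L : Vec k → M → ℝ
  smooth_f : ContMDiff (𝓘(ℝ, Vec k).prod 𝓘(ℝ, Vec n)) 𝓘(ℝ, Vec n).tangent ∞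
    (fun x : Vec k × M => (⟨x.2, f x.1 x.2⟩ : TangentBundle 𝓘(ℝ, Vec n) M))
  smooth_L : ContMDiff (𝓘(ℝ, Vec k).prod 𝓘(ℝ, Vec n)) 𝓘(ℝ, ℝ) ∞ (fun x : Vec k × M => L x.1 x.2)

namespace ControlProblem

/-- `q` is the Lipschitz solution of `q̇ = f(u(t), q)` almost everywhere on `[0, t]`, in integrated
form against smooth functions on `M` (`u` is essentially bounded). -/
def IsTrajectory (P : ControlProblem n k M) (t : ℝ) (u : ℝ → Vec k) (q : ℝ → M) : Prop :=
  ContinuousOn q (Icc 0 t) ∧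
    ∀ φ : M → ℝ, ContMDiff 𝓘(ℝ, Vec n) 𝓘(ℝ, ℝ) ∞ φ → ∀ s ∈ Icc (0 : ℝ) t,
      φ (q s) = φ (q 0) +
        ∫ τ in (0 : ℝ)..s, (show ℝ from mfderiv 𝓘(ℝ, Vec n) 𝓘(ℝ, ℝ) φ (q τ) (P.f (u τ) (q τ)))

open Classical in
/-- The trajectory on `[0, t]` of the control `u` starting at `a` (a constant curve if there is
none; there is one for all data close to a reference trajectory, and it is unique). -/
def trajectory (P : ControlProblem n k M) (t : ℝ) (u : ℝ → Vec k) (a : M) : ℝ → M :=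
  if h : ∃ q : ℝ → M, P.IsTrajectory t u q ∧ q 0 = a then h.choose else fun _ => a

/-- `q(t)` as a function of the control and of the initial point. -/
def endpoint (P : ControlProblem n k M) (t : ℝ) (u : ℝ → Vec k) (a : M) : M :=
  P.trajectory t u a t

/-- `J_t = ∫₀ᵗ L(u, q)` as a function of the control and of the initial point. -/
def cost (P : ControlProblem n k M) (t : ℝ) (u : ℝ → Vec k) (a : M) : ℝ :=
  ∫ τ in (0 : ℝ)..t, P.L (u τ) (P.trajectory t u a τ)

end ControlProblem

/-- An optimal control problem with initial points in a submanifold (the image of the injective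
immersion `ι`), a reference admissible pair `(q, u)` on `[0, T]`, Lagrange multipliers `lam0`, `ν`
(with `lam0 = λ(0)`), and a measurable field `proj` of orthogonal projections onto the directions
in which the control may be varied to both sides; `proj = id` when the control set is `ℝᵏ`. -/
structure Reference (n k d : ℕ) (M : Type*) [TopologicalSpace M] [ChartedSpace (Vec n) M]
    [IsManifold 𝓘(ℝ, Vec n) ∞ M] (N : Type*) [TopologicalSpace N] [ChartedSpace (Vec d) N]
    [IsManifold 𝓘(ℝ, Vec d) ∞ N] extends ControlProblem n k M where
  ι : N → M
  smooth_ι : ContMDiff 𝓘(ℝ, Vec d) 𝓘(ℝ, Vec n) ∞ ι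
  injective_ι : Function.Injective ι
  immersion_ι : ∀ x, Function.Injective (mfderiv 𝓘(ℝ, Vec d) 𝓘(ℝ, Vec n) ι x)
  T : ℝ
  x0 : N
  q : ℝ → M
  q_zero : q 0 = ι x0
  u : ℝ → Vec k
  u_mem : MemLp u ∞ (volume.restrict (Icc 0 T))
  traj : toControlProblem.IsTrajectory T u q
  proj : ℝ → Vec k →L[ℝ] Vec k
  proj_meas : AEStronglyMeasurable proj (volume.restrict (Icc 0 T))
  proj_star : ∀ τ, IsStarProjection (proj τ)
  ν : ℝ
  ν_eq : ν = 0 ∨ ν = 1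
  lam0 : TangentSpace 𝓘(ℝ, Vec n) (q 0) →L[ℝ] ℝ

namespace Reference

/-- The chart of `M` used near `q(t)`. -/
abbrev chart (S : Reference n k d M N) (t : ℝ) : PartialEquiv M (Vec n) :=
  extChartAt 𝓘(ℝ, Vec n) (S.q t)

/-- The space of variations on `[0, t]`, `T_{q(0)} N₀ × L^∞([0, t], ℝᵏ)`. -/
abbrev Var (d k : ℕ) (t : ℝ) : Type :=
  Vec d × Lp (Vec k) ∞ (volume.restrict (Icc 0 t))

/-- The varied control. -/
def control (S : Reference n k d M N) (t : ℝ) (w : Var d k t) (τ : ℝ) : Vec k :=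
  S.u τ + S.proj τ (w.2 τ)

/-- The varied initial point, in the chart of `N` at `x0`. -/
def start (S : Reference n k d M N) (y : Vec d) : M :=
  S.ι ((extChartAt 𝓘(ℝ, Vec d) S.x0).symm (extChartAt 𝓘(ℝ, Vec d) S.x0 S.x0 + y))

/-- The end-point map `E_{N₀,t}` in local coordinates, centred at the reference pair. -/
def endMap (S : Reference n k d M N) (t : ℝ) (w : Var d k t) : Vec n :=
  S.chart t (S.endpoint t (S.control t w) (S.start w.1))

/-- The functional `J_t` in local coordinates, centred at the reference pair. -/
def costMap (S : Reference n k d M N) (t : ℝ) (w : Var d k t) : ℝ :=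
  S.cost t (S.control t w) (S.start w.1)

/-- The covector `λ(0)` as a point of `T*M` in canonical coordinates. -/
def z0 (S : Reference n k d M N) : Phase n :=
  WithLp.toLp 2
    ((InnerProductSpace.toDual ℝ (Vec n)).symm
      ((show Vec n →L[ℝ] ℝ from S.lam0 ∘L (mfderiv 𝓘(ℝ, Vec n) 𝓘(ℝ, Vec n) (S.chart 0) (S.q 0)).inverse)),
     S.chart 0 (S.q 0))

/-- The flow `Pᵗ` of the reference control, in coordinates. -/
def refFlow (S : Reference n k d M N) (t : ℝ) (x : Vec n) : Vec n :=
  S.chart t (S.endpoint t S.u ((S.chart 0).symm x))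

/-- The cost along the flow of the reference control, in coordinates. -/
def refCost (S : Reference n k d M N) (t : ℝ) (x : Vec n) : ℝ :=
  S.cost t S.u ((S.chart 0).symm x)

/-- The flow `Φ_t` on `T*M` of the Hamiltonian `⟨λ, f(u(t), q)⟩ - ν L(u(t), q)`, in canonical
coordinates: `Φ_t(x, p) = (Pᵗ(x), p')` where `p' ∘ dPᵗ - ν dJ_t = p`, that is, `(p', -ν)` is
transported to `(p, -ν)` by the pull-back of the flow `(Pᵗ(x), y + J_t(x))` of the extended
system. -/
def hamFlow (S : Reference n k d M N) (t : ℝ) (z : Phase n) : Phase n :=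
  WithLp.toLp 2
    (ContinuousLinearMap.adjoint (fderiv ℝ (S.refFlow t) z.snd).inverse
      (z.fst + S.ν • gradient (S.refCost t) z.snd),
     S.refFlow t z.snd)

/-- The covector `λ(t)` as a point of `T*M` in canonical coordinates. -/
def lam (S : Reference n k d M N) (t : ℝ) : Phase n := S.hamFlow t S.z0

/-- The Hamiltonian `h(u, λ) = ⟨λ, f(u, q)⟩ - ν L(u, q)` in canonical coordinates near `q(t)`. -/
def ham (S : Reference n k d M N) (t : ℝ) (u : Vec k) (z : Phase n) : ℝ :=
  ⟪z.fst, (show Vec n from mfderiv 𝓘(ℝ, Vec n) 𝓘(ℝ, Vec n) (S.chart t) ((S.chart t).symm z.snd)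
      (S.f u ((S.chart t).symm z.snd)))⟫_ℝ
    - S.ν * S.L u ((S.chart t).symm z.snd)

/-- `H(t, u, ·) = (h(u, ·) - h(u(t), ·)) ∘ Φ_t` near `λ(0)`. -/
def pulledHam (S : Reference n k d M N) (t : ℝ) (u : Vec k) (z : Phase n) : ℝ :=
  S.ham t u (S.hamFlow t z) - S.ham t (S.u t) (S.hamFlow t z)

/-- The Hamiltonian vector field of `H(t, u, ·)` at `λ(0)`. -/
def pulledField (S : Reference n k d M N) (t : ℝ) (u : Vec k) : Phase n :=
  WithLp.toLp 2 (-(gradient (S.pulledHam t u) S.z0).snd, (gradient (S.pulledHam t u) S.z0).fst)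

/-- `X(t)`, the derivative in `u` of that field at the reference control, on the admissible
directions. -/
def X (S : Reference n k d M N) (t : ℝ) : Vec k →L[ℝ] Phase n :=
  fderiv ℝ (S.pulledField t) (S.u t) ∘L S.proj t

/-- `b(t)`, the second derivative of `u ↦ h(u, λ(t))` at the reference control, on the admissible
directions. -/
def b (S : Reference n k d M N) (t : ℝ) (v w : Vec k) : ℝ :=
  fderiv ℝ (fderiv ℝ (fun u => S.ham t u (S.lam t))) (S.u t) (S.proj t v) (S.proj t w)

/-- The reference pair with the covector `λ(t)` is a Lagrangian point of `(E_{N₀,t}, J_t)`. -/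
def IsExtremal (S : Reference n k d M N) (t : ℝ) : Prop :=
  IsLagrangePoint (S.endMap t) (S.costMap t) (S.lam t).fst S.ν

/-- One of the inertia indices of the Hessian of `(E_{N₀,t}, ν J_t)` at the Lagrangian point is
finite. -/
def HessIndexFinite (S : Reference n k d M N) (t : ℝ) : Prop :=
  hessNegIndex (S.endMap t) (S.costMap t) (S.lam t).fst S.ν < ⊤ ∨
    hessPosIndex (S.endMap t) (S.costMap t) (S.lam t).fst S.ν < ⊤

/-- `𝓛_t(V) = Φ_t^* 𝓛(E_{N₀,t}, ν J_t)(V)`, a subspace of `T_{λ(0)}(T*M)`. -/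
def jacobiOver (S : Reference n k d M N) (t : ℝ) (V : Submodule ℝ (Var d k t)) :
    Submodule ℝ (Phase n) :=
  (lDeriv (S.endMap t) (S.costMap t) (S.lam t).fst S.ν V).comap
    (fderiv ℝ (S.hamFlow t) S.z0).toLinearMap

/-- `Λ = 𝓛_t`, the value at `t` of the Jacobi curve. -/
def IsJacobi (S : Reference n k d M N) (t : ℝ) (Λ : Submodule ℝ (Phase n)) : Prop :=
  IsGeneralizedLimit (fun V : FinSub (Var d k t) => S.jacobiOver t V.1) Λ

/-- The vectors `l + ∫_{t₁}^{t₂} X v` with `l ∈ Λ`, `v ∈ V` such that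
`∫_{t₁}^{t₂} [σ(l + ∫_{t₁}^τ X v, X(τ) w(τ)) + b(τ)(v(τ), w(τ))] dτ = 0` for all `w ∈ V`. -/
def extension (S : Reference n k d M N) (t₁ t₂ : ℝ) (Λ : Submodule ℝ (Phase n))
    (V : Submodule ℝ (Lp (Vec k) 2 (volume.restrict (Icc t₁ t₂)))) : Set (Phase n) :=
  {z | ∃ l ∈ Λ, ∃ v ∈ V,
    (∀ w ∈ V, ∫ τ in t₁..t₂,
      (sympl (l + ∫ θ in t₁..τ, S.X θ (v θ)) (S.X τ (w τ)) + S.b τ (v τ) (w τ)) = 0) ∧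
    z = l + ∫ τ in t₁..t₂, S.X τ (v τ)}

end Reference

end OptControl

end

namespace OptControl

/-! ### Lagrangian subspaces -/

section Symplectic

variable {n : ℕ}

/-! Everything is transported to time zero by the reference Hamiltonian flow. For a
finite-dimensional space V of variations, 𝓛_t(V) then becomes the set of all l + Yv with l vertical
and v ∈ V such that σ(l, Yw) + s(v, w) = 0 for every w ∈ V. Here Yv is the tangent vector of the
initial submanifold plus ∫ X v, and s is a bilinear form built from b, σ and the second differential
of the initial submanifold, whose antisymmetric part is σ(Y·, Y·). `kext` is this construction with
an arbitrary subspace Λ in place of the vertical one; a dimension count (`kext_isLagrangian`) shows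
that it preserves Lagrangian subspaces.

Cutting [0, t₂] at t₁ gives Y = Y₁ + Y₂ and s = s₁ + s₂ + σ(Y₁·, Y₂·), so an extension by V₁ × V₂ is
an extension by V₂ of an extension by V₁ (`kext_prod`). At the finite-dimensional level additivity
is therefore an algebraic identity, and K(V₂) is the extension of 𝓛_{t₁} by V₂. What remains is to
let V₁ grow under the extension by a fixed V₂. Such extensions are not continuous on the Lagrangian
Grassmannian in general, and this is where the finite index enters.

If the negative index of s is finite on the kernel of the position component of Y, a maximal
negative subspace V₀ is split off. In fixed symplectic coordinates the Jacobi space over any V ⊇ V₀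
is a graph {(η, -R_V η)}, and ⟨η, R_V η⟩ is the maximum of a concave quadratic function over the
complement of V₀ in V. So R_V increases with V, has norm at most one, and converges to some R from
below (`exists_graph_form`). Along families approaching from below the extension is continuous
(`kext_graph_continuous`), because |(R - R')η|² ≤ ‖R - R'‖ ⟨η, (R - R')η⟩. `additivity_of_negIndex`
then exchanges the limits; `additivity_of_posIndex` follows by reversing momenta.

The analytic half identifies 𝓛_t(V) with a `kext`. Trajectories in a chart solve an integral
equation, to which the implicit function theorem in L^∞ applies on short intervals
(`exists_flat_flow`); chaining these intervals gives `trajectory_family`. If p is the reference flow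
of the extended system (state, cost) and y a family of trajectories, the first two derivatives of
p⁻¹ ∘ y satisfy equations driven only by control derivatives of the pulled-back field
(`SolvesVariational.pull_ode`, `IsFamily.variation_ode`). Computing the differentials of the
Hamiltonian flow and of the pulled Hamiltonian (`fderiv_hamFlow`, `fderiv_pulledField`,
`fderiv_two_ham`) expresses these equations through X and b (`varD_ode`), and `jacobiOver_eq_kext`
follows. Since X and b are bounded and measurable, Y and s extend continuously to square integrable
controls. Bounded controls are dense there, which makes limits over bounded and over square
integrable variations comparable. -/

instance continuousSMul_phase : ContinuousSMul ℝ (Phase n) := IsBoundedSMul.continuousSMul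

instance isTopologicalAddGroup_phase : IsTopologicalAddGroup (Phase n) := inferInstance

lemma phase_continuous {G : Type*} [NormedAddCommGroup G] [NormedSpace ℝ G]
    (f : Phase n →ₗ[ℝ] G) : Continuous f := LinearMap.continuous_of_finiteDimensional f

/-- The complex structure `J` with `σ(z, w) = ⟪z, J w⟫`. -/
noncomputable def symplJ (n : ℕ) : Phase n →ₗ[ℝ] Phase n where
  toFun w := WithLp.toLp 2 (w.snd, -w.fst)
  map_add' a b := by
    apply (WithLp.equiv 2 _).injective
    ext <;> simp [add_comm]
  map_smul' c a := by
    apply (WithLp.equiv 2 _).injective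
    ext <;> simp

@[simp] lemma symplJ_fst (w : Phase n) : (symplJ n w).fst = w.snd := rfl
@[simp] lemma symplJ_snd (w : Phase n) : (symplJ n w).snd = -w.fst := rfl

lemma Phase.ext {z w : Phase n} (h1 : z.fst = w.fst) (h2 : z.snd = w.snd) : z = w :=
  (WithLp.equiv 2 _).injective (Prod.ext h1 h2)

lemma phase_inner (z w : Phase n) : ⟪z, w⟫_ℝ = ⟪z.fst, w.fst⟫_ℝ + ⟪z.snd, w.snd⟫_ℝ := rfl

lemma phase_norm_sq (z : Phase n) : ‖z‖ ^ 2 = ‖z.fst‖ ^ 2 + ‖z.snd‖ ^ 2 := by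
  rw [← real_inner_self_eq_norm_sq, phase_inner, real_inner_self_eq_norm_sq,
    real_inner_self_eq_norm_sq]

lemma sympl_eq_inner (z w : Phase n) : sympl z w = ⟪z, symplJ n w⟫_ℝ := by
  rw [phase_inner, sympl, symplJ_fst, symplJ_snd, inner_neg_right, real_inner_comm w.fst z.snd]
  ring

lemma norm_symplJ (w : Phase n) : ‖symplJ n w‖ = ‖w‖ := by
  have h1 := phase_norm_sq (symplJ n w)
  have h2 := phase_norm_sq w
  rw [symplJ_fst, symplJ_snd, norm_neg] at h1
  exact (sq_eq_sq₀ (norm_nonneg _) (norm_nonneg _)).1 (by linarith)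

lemma symplJ_injective : Function.Injective (symplJ n) := by
  rw [← LinearMap.ker_eq_bot, LinearMap.ker_eq_bot']
  intro w hw
  rw [← norm_eq_zero, ← norm_symplJ, hw, norm_zero]

@[simp] lemma sympl_add_left (a b c : Phase n) : sympl (a + b) c = sympl a c + sympl b c := by
  simp only [sympl_eq_inner, inner_add_left]

@[simp] lemma sympl_add_right (a b c : Phase n) : sympl a (b + c) = sympl a b + sympl a c := by
  simp only [sympl_eq_inner, map_add, inner_add_right]

@[simp] lemma sympl_smul_left (r : ℝ) (a c : Phase n) : sympl (r • a) c = r * sympl a c := by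
  simp only [sympl_eq_inner, real_inner_smul_left]

@[simp] lemma sympl_smul_right (r : ℝ) (a c : Phase n) : sympl a (r • c) = r * sympl a c := by
  simp only [sympl_eq_inner, map_smul, real_inner_smul_right]

@[simp] lemma sympl_zero_left (c : Phase n) : sympl 0 c = 0 := by
  simp only [sympl_eq_inner, inner_zero_left]

@[simp] lemma sympl_zero_right (c : Phase n) : sympl c 0 = 0 := by
  simp only [sympl_eq_inner, map_zero, inner_zero_right]

@[simp] lemma sympl_neg_left (a c : Phase n) : sympl (-a) c = -sympl a c := by
  simp only [sympl_eq_inner, inner_neg_left]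

@[simp] lemma sympl_neg_right (a c : Phase n) : sympl a (-c) = -sympl a c := by
  simp only [sympl_eq_inner, map_neg, inner_neg_right]

lemma sympl_sub_left (a b c : Phase n) : sympl (a - b) c = sympl a c - sympl b c := by
  simp only [sympl_eq_inner, inner_sub_left]

lemma sympl_swap (a b : Phase n) : sympl b a = -sympl a b := by
  simp [sympl]

lemma abs_sympl_le (a b : Phase n) : |sympl a b| ≤ ‖a‖ * ‖b‖ := by
  rw [sympl_eq_inner, ← norm_symplJ b]
  exact abs_real_inner_le_norm _ _

/-- The symplectic form as a bilinear map. -/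
noncomputable def symplL (n : ℕ) : Phase n →ₗ[ℝ] Phase n →ₗ[ℝ] ℝ :=
  LinearMap.mk₂ ℝ sympl sympl_add_left (fun r a c => by simp) sympl_add_right
    (fun r a c => by simp)

@[simp] lemma symplL_apply (a b : Phase n) : symplL n a b = sympl a b := rfl

lemma finrank_phase : Module.finrank ℝ (Phase n) = n + n := by
  rw [(WithLp.linearEquiv 2 ℝ (Vec n × Vec n)).finrank_eq, Module.finrank_prod]
  simp

lemma finrank_map_of_inj (f : Phase n →ₗ[ℝ] Phase n) (hf : Function.Injective f)
    (Λ : Submodule ℝ (Phase n)) : Module.finrank ℝ (Λ.map f) = Module.finrank ℝ Λ :=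
  (Submodule.equivMapOfInjective f hf Λ).finrank_eq.symm

/-- Because σ(z, w) = ⟨z, Jw⟩, isotropy of Λ says exactly that JΛ is orthogonal to Λ. Since J is
injective, comparing dimensions bounds dim Λ by n, and turns the inclusion into an equality in the
Lagrangian case. -/
lemma map_symplJ_le_orthogonal {Λ : Submodule ℝ (Phase n)}
    (h : ∀ z ∈ Λ, ∀ w ∈ Λ, sympl z w = 0) : Λ.map (symplJ n) ≤ Λᗮ := by
  rintro _ ⟨w, hw, rfl⟩
  rw [Submodule.mem_orthogonal]
  intro z hz
  rw [← sympl_eq_inner, h z hz w hw]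

lemma finrank_le_of_isotropic {Λ : Submodule ℝ (Phase n)}
    (h : ∀ z ∈ Λ, ∀ w ∈ Λ, sympl z w = 0) : Module.finrank ℝ Λ ≤ n := by
  have h1 := Submodule.finrank_mono (map_symplJ_le_orthogonal h)
  rw [finrank_map_of_inj _ symplJ_injective] at h1
  have h2 := Submodule.finrank_add_finrank_orthogonal Λ
  rw [finrank_phase] at h2
  omega

lemma isLagrangian_of_le_finrank {Λ : Submodule ℝ (Phase n)}
    (h : ∀ z ∈ Λ, ∀ w ∈ Λ, sympl z w = 0) (h' : n ≤ Module.finrank ℝ Λ) : IsLagrangian Λ :=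
  ⟨h, le_antisymm (finrank_le_of_isotropic h) h'⟩

lemma IsLagrangian.map_symplJ_eq {Λ : Submodule ℝ (Phase n)} (h : IsLagrangian Λ) :
    Λ.map (symplJ n) = Λᗮ := by
  apply Submodule.eq_of_le_of_finrank_eq (map_symplJ_le_orthogonal h.1)
  rw [finrank_map_of_inj _ symplJ_injective, h.2]
  have h2 := Submodule.finrank_add_finrank_orthogonal Λ
  rw [finrank_phase, h.2] at h2
  omega

/-- The residual r = z - P_Λ z lies in Λᗮ = JΛ, so r = Jw with w ∈ Λ and |w| = |r|; then |r|² = ⟨z,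
Jw⟩ = σ(z, w), which the hypothesis controls. -/
lemma IsLagrangian.norm_sub_starProjection_le {L Λ : Submodule ℝ (Phase n)} (hΛ : IsLagrangian Λ)
    {ε : ℝ} (h : ∀ z ∈ L, ∀ w ∈ Λ, |sympl z w| ≤ ε * ‖z‖ * ‖w‖) {z : Phase n} (hz : z ∈ L) :
    ‖z - Λ.starProjection z‖ ≤ ε * ‖z‖ := by
  set r := z - Λ.starProjection z with hr
  have hrm : r ∈ Λᗮ := Submodule.sub_starProjection_mem_orthogonal z
  obtain ⟨w, hw, hwr⟩ := (hΛ.map_symplJ_eq ▸ hrm : r ∈ Λ.map (symplJ n))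
  have h1 : ‖r‖ ^ 2 = sympl z w := by
    rw [sympl_eq_inner, hwr, ← real_inner_self_eq_norm_sq]
    conv_lhs => rw [hr, inner_sub_left, ← hr]
    rw [Submodule.inner_right_of_mem_orthogonal (Submodule.starProjection_apply_mem Λ z) hrm,
      sub_zero]
  have h2 : ‖w‖ = ‖r‖ := by rw [← hwr, norm_symplJ]
  have h3 := (le_abs_self _).trans (h z hz w hw)
  rw [← h1, h2, sq] at h3
  rcases (norm_nonneg r).eq_or_lt with h0 | h0
  -- Nothing can be divided by |r| = 0 here, and ε is not assumed nonnegative. Its sign is read off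
  -- from the hypothesis at a nonzero w ∈ Λ; if there is none, then n = 0 and z = 0.
  · by_contra hlt
    push Not at hlt
    rw [← h0] at hlt
    have hz0 : z ≠ 0 := by
      rintro rfl
      simp at hlt
    by_cases hJ : ∃ w ∈ Λ, w ≠ 0
    · obtain ⟨w, hw, hw0⟩ := hJ
      have := (abs_nonneg _).trans (h z hz w hw)
      have hwp : 0 < ‖w‖ := norm_pos_iff.2 hw0
      nlinarith
    · push Not at hJ
      have h5 : Λ = ⊥ := (Submodule.eq_bot_iff _).2 hJ
      have h6 := hΛ.2
      rw [h5, finrank_bot] at h6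
      subst h6
      have : z = 0 := Phase.ext (Subsingleton.elim _ _) (Subsingleton.elim _ _)
      exact hz0 this
  · exact le_of_mul_le_mul_right h3 h0

/-- Two Lagrangian subspaces that are almost skew-orthogonal to each other are close. -/
lemma IsLagrangian.norm_starProjection_sub_le {L Λ : Submodule ℝ (Phase n)} (hL : IsLagrangian L)
    (hΛ : IsLagrangian Λ) {ε : ℝ} (hε : 0 ≤ ε)
    (h : ∀ z ∈ L, ∀ w ∈ Λ, |sympl z w| ≤ ε * ‖z‖ * ‖w‖) :
    ‖L.starProjection - Λ.starProjection‖ ≤ 2 * ε := by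
  have h' : ∀ z ∈ Λ, ∀ w ∈ L, |sympl z w| ≤ ε * ‖z‖ * ‖w‖ := by
    intro z hz w hw
    rw [sympl_swap, abs_neg, mul_right_comm]
    exact h w hw z hz
  refine ContinuousLinearMap.opNorm_le_bound _ (by positivity) fun x => ?_
  set y := x - L.starProjection x with hy
  have hyL : y ∈ Lᗮ := Submodule.sub_starProjection_mem_orthogonal x
  have hyn : ‖y‖ ≤ ‖x‖ := by
    have := Submodule.norm_sq_eq_add_norm_sq_projection x L
    have h2 : y = Lᗮ.starProjection x := by
      rw [hy, Submodule.starProjection_orthogonal']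
      simp
    rw [h2]
    exact Submodule.norm_starProjection_apply_le _ _
  -- With x = P_L x + y, the part in L is handled by the one-sided estimate. For y ∈ Lᗮ, the vector
  -- p = P_Λ y satisfies |p|² = ⟨y, p - P_L p⟩, and the one-sided estimate with the roles exchanged
  -- bounds p - P_L p.
  have e : (L.starProjection - Λ.starProjection) x =
      (L.starProjection x - Λ.starProjection (L.starProjection x)) - Λ.starProjection y := by
    rw [hy, map_sub, sub_apply]
    abel
  have h1 : ‖L.starProjection x - Λ.starProjection (L.starProjection x)‖ ≤ ε * ‖x‖ :=
    (hΛ.norm_sub_starProjection_le h (Submodule.starProjection_apply_mem L x)).trans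
      (mul_le_mul_of_nonneg_left (Submodule.norm_starProjection_apply_le _ _) hε)
  have h2 : ‖Λ.starProjection y‖ ≤ ε * ‖x‖ := by
    set p := Λ.starProjection y with hp
    have hpm : p ∈ Λ := Submodule.starProjection_apply_mem Λ y
    have h3 := hL.norm_sub_starProjection_le h' hpm
    have h4 : ‖p‖ ^ 2 = ⟪y, p - L.starProjection p⟫_ℝ := by
      rw [inner_sub_right, Submodule.inner_left_of_mem_orthogonal
        (Submodule.starProjection_apply_mem L p) hyL, sub_zero, ← real_inner_self_eq_norm_sq]
      have h5 := Submodule.sub_starProjection_mem_orthogonal (K := Λ) y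
      have h6 := Submodule.inner_left_of_mem_orthogonal hpm h5
      rw [inner_sub_left, ← hp] at h6
      linarith
    have h5 : ‖p‖ ^ 2 ≤ ‖y‖ * (ε * ‖p‖) := by
      rw [h4]
      exact (real_inner_le_norm _ _).trans (mul_le_mul_of_nonneg_left h3 (norm_nonneg _))
    rcases (norm_nonneg p).eq_or_lt with h0 | h0
    · rw [← h0]; positivity
    · have : ‖p‖ * ‖p‖ ≤ (ε * ‖x‖) * ‖p‖ := by
        nlinarith [mul_le_mul_of_nonneg_right hyn (mul_nonneg hε h0.le)]
      exact le_of_mul_le_mul_right this h0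
  rw [e]
  linarith [norm_sub_le (L.starProjection x - Λ.starProjection (L.starProjection x))
    (Λ.starProjection y)]

end Symplectic

/-! ### Extension of a Lagrangian subspace by additional variations -/

section Kext

variable {n : ℕ} {H : Type*} [AddCommGroup H] [Module ℝ H]

/-- All `l + Y v` with `l ∈ Λ`, `v ∈ V` such that `σ(l, Y w) + s(v, w) = 0` for all `w ∈ V`. -/
def kext (Λ : Submodule ℝ (Phase n)) (Y : H →ₗ[ℝ] Phase n) (s : H →ₗ[ℝ] H →ₗ[ℝ] ℝ)
    (V : Submodule ℝ H) : Submodule ℝ (Phase n) where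
  carrier := {z | ∃ l ∈ Λ, ∃ v ∈ V, (∀ w ∈ V, sympl l (Y w) + s v w = 0) ∧ z = l + Y v}
  zero_mem' := ⟨0, zero_mem _, 0, zero_mem _, by simp, by simp⟩
  add_mem' := by
    rintro _ _ ⟨l, hl, v, hv, h, rfl⟩ ⟨l', hl', v', hv', h', rfl⟩
    refine ⟨l + l', add_mem hl hl', v + v', add_mem hv hv', fun w hw => ?_, ?_⟩
    · simp only [sympl_add_left, map_add, LinearMap.add_apply]
      linarith [h w hw, h' w hw]
    · rw [map_add]; abel
  smul_mem' := by
    rintro c _ ⟨l, hl, v, hv, h, rfl⟩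
    refine ⟨c • l, Λ.smul_mem c hl, c • v, V.smul_mem c hv, fun w hw => ?_, ?_⟩
    · simp only [sympl_smul_left, map_smul, LinearMap.smul_apply, smul_eq_mul]
      linear_combination c * h w hw
    · rw [map_smul, smul_add]

/-- The antisymmetric part of `s` is the form induced by `Y`. -/
def Compatible (Y : H →ₗ[ℝ] Phase n) (s : H →ₗ[ℝ] H →ₗ[ℝ] ℝ) : Prop :=
  ∀ v w, s v w - s w v = sympl (Y v) (Y w)

/-- The defining conditions replace the cross terms σ(l, Yv') and σ(Yv, l') by -s(v, v') and s(v',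
v), and compatibility makes these cancel σ(Yv, Yv'). -/
lemma Compatible.sympl_eq {Y : H →ₗ[ℝ] Phase n} {s : H →ₗ[ℝ] H →ₗ[ℝ] ℝ} (h : Compatible Y s)
    {V : Submodule ℝ H} {l l' : Phase n} {v v' : H} (hv : v ∈ V) (hv' : v' ∈ V)
    (h1 : ∀ w ∈ V, sympl l (Y w) + s v w = 0) (h2 : ∀ w ∈ V, sympl l' (Y w) + s v' w = 0) :
    sympl (l + Y v) (l' + Y v') = sympl l l' := by
  have e1 := h1 v' hv'
  have e2 := h2 v hv
  have e3 := h v v'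
  have e4 := sympl_swap (Y v) l'
  simp only [sympl_add_left, sympl_add_right]
  linarith

lemma kext_isotropic {Y : H →ₗ[ℝ] Phase n} {s : H →ₗ[ℝ] H →ₗ[ℝ] ℝ} (h : Compatible Y s)
    {Λ : Submodule ℝ (Phase n)} (hΛ : ∀ z ∈ Λ, ∀ w ∈ Λ, sympl z w = 0) (V : Submodule ℝ H) :
    ∀ z ∈ kext Λ Y s V, ∀ w ∈ kext Λ Y s V, sympl z w = 0 := by
  rintro _ ⟨l, hl, v, hv, h1, rfl⟩ _ ⟨l', hl', v', hv', h2, rfl⟩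
  rw [h.sympl_eq hv hv' h1 h2, hΛ l hl l' hl']

/-- A dimension count. Let Φ : Λ × V → V* be the constraint map and ψ(l, v) = l + Yv on ker Φ. Then
dim ker Φ = n + dim V - rank Φ, while ker ψ embeds by its V-component into the annihilator of the
range of Φ, of dimension dim V - rank Φ. Hence the range of ψ has dimension at least n, and isotropy
gives equality. -/
theorem kext_isLagrangian {Y : H →ₗ[ℝ] Phase n} {s : H →ₗ[ℝ] H →ₗ[ℝ] ℝ} (h : Compatible Y s)
    {Λ : Submodule ℝ (Phase n)} (hΛ : IsLagrangian Λ) (V : Submodule ℝ H)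
    [FiniteDimensional ℝ V] : IsLagrangian (kext Λ Y s V) := by
  refine isLagrangian_of_le_finrank (kext_isotropic h hΛ.1 V) ?_
  let Φ : Λ × V →ₗ[ℝ] Module.Dual ℝ V :=
    LinearMap.coprod
      ((LinearMap.lcomp ℝ ℝ (Y ∘ₗ V.subtype)) ∘ₗ (symplL n) ∘ₗ Λ.subtype)
      ((LinearMap.lcomp ℝ ℝ V.subtype) ∘ₗ s ∘ₗ V.subtype)
  have hΦ (x : Λ × V) (w : V) : Φ x w = sympl (x.1 : Phase n) (Y w) + s x.2 w := by
    simp [Φ]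
  let ψ : LinearMap.ker Φ →ₗ[ℝ] Phase n :=
    (LinearMap.coprod Λ.subtype (Y ∘ₗ V.subtype)) ∘ₗ (LinearMap.ker Φ).subtype
  have hψ (x : LinearMap.ker Φ) : ψ x = (x.1.1 : Phase n) + Y x.1.2 := by simp [ψ]
  have hker (x : LinearMap.ker Φ) (w : V) : sympl (x.1.1 : Phase n) (Y w) + s x.1.2 w = 0 := by
    rw [← hΦ, LinearMap.mem_ker.1 x.2, LinearMap.zero_apply]
  have hrange : LinearMap.range ψ ≤ kext Λ Y s V := by
    rintro _ ⟨x, rfl⟩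
    exact ⟨x.1.1, x.1.1.2, x.1.2, x.1.2.2, fun w hw => hker x ⟨w, hw⟩, hψ x⟩
  have d1 := LinearMap.finrank_range_add_finrank_ker Φ
  have d2 := LinearMap.finrank_range_add_finrank_ker ψ
  have d3 := Subspace.finrank_add_finrank_dualCoannihilator_eq (LinearMap.range Φ)
  rw [Module.finrank_prod, hΛ.2] at d1
  let κ : LinearMap.ker ψ →ₗ[ℝ] V :=
    (LinearMap.snd ℝ Λ V) ∘ₗ (LinearMap.ker Φ).subtype ∘ₗ (LinearMap.ker ψ).subtype
  have hl (x : LinearMap.ker ψ) : (x.1.1.1 : Phase n) = -Y x.1.1.2 := by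
    have := LinearMap.mem_ker.1 x.2
    rw [hψ] at this
    exact eq_neg_of_add_eq_zero_left this
  have hκ : Function.Injective κ := by
    intro x y hxy
    have hxy2 : x.1.1.2 = y.1.1.2 := hxy
    apply Subtype.ext
    apply Subtype.ext
    refine Prod.ext (Subtype.ext ?_) hxy2
    rw [hl, hl, hxy2]
  -- On ker ψ one has l = -Yv, and both terms of Φ(y)(v) vanish separately: the first because Λ is
  -- isotropic, the second by compatibility together with the constraint tested on the V-component
  -- of y.
  have hκr : LinearMap.range κ ≤ (LinearMap.range Φ).dualCoannihilator := by
    rintro _ ⟨x, rfl⟩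
    rw [Submodule.mem_dualCoannihilator]
    rintro _ ⟨y, rfl⟩
    change Φ y x.1.1.2 = 0
    rw [hΦ]
    have e1 := hker x.1 y.2
    have e2 := h x.1.1.2 y.2
    have e3 := hΛ.1 _ y.1.2 _ x.1.1.1.2
    rw [hl] at e1 e3
    simp only [sympl_neg_left, sympl_neg_right] at e1 e3
    linarith
  have d4 := Submodule.finrank_mono hκr
  rw [LinearMap.finrank_range_of_inj hκ] at d4
  have d5 := Submodule.finrank_mono hrange
  omega

end Kext

end OptControl

namespace OptControl

/-! ### Monotone families of symmetric operators -/

section Monotone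

variable {E : Type*} [NormedAddCommGroup E] [InnerProductSpace ℝ E]

/-- This is T² ≤ ‖T‖ T for a nonnegative symmetric operator, obtained by testing positivity at a -
‖T‖⁻¹ T a. -/
lemma norm_apply_sq_le_of_nonneg {T : E →L[ℝ] E} (hs : ∀ a b, ⟪T a, b⟫_ℝ = ⟪a, T b⟫_ℝ)
    (h0 : ∀ a, 0 ≤ ⟪a, T a⟫_ℝ) (a : E) : ‖T a‖ ^ 2 ≤ ‖T‖ * ⟪a, T a⟫_ℝ := by
  rcases (norm_nonneg T).eq_or_lt with h | h
  · have : T = 0 := norm_eq_zero.1 h.symm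
    simp [this]
  · have h1 := h0 (a - ‖T‖⁻¹ • T a)
    have h2 : ⟪T a, T (T a)⟫_ℝ ≤ ‖T a‖ * (‖T‖ * ‖T a‖) :=
      (real_inner_le_norm _ _).trans (mul_le_mul_of_nonneg_left (T.le_opNorm _) (norm_nonneg _))
    simp only [map_sub, map_smul, inner_sub_left, inner_sub_right, real_inner_smul_left,
      real_inner_smul_right, ← hs a, real_inner_self_eq_norm_sq] at h1
    rw [hs a a] at h1
    have h3 : ‖T‖⁻¹ * (‖T‖⁻¹ * ⟪T a, T (T a)⟫_ℝ) ≤ ‖T‖⁻¹ * ‖T a‖ ^ 2 := by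
      apply mul_le_mul_of_nonneg_left _ (inv_nonneg.2 h.le)
      rw [inv_mul_le_iff₀ h]
      linarith
    have h4 : ‖T‖⁻¹ * ‖T a‖ ^ 2 ≤ ⟪a, T a⟫_ℝ := by linarith
    rwa [inv_mul_le_iff₀ h] at h4

/-- From |Ta|² ≤ ‖T‖ ⟨a, Ta⟩ ≤ ‖T‖ ⟨a, Sa⟩ one gets ‖T‖² ≤ ‖T‖ ‖S‖. Only T has to be symmetric and
nonnegative. -/
lemma norm_le_of_form_le {T S : E →L[ℝ] E} (hs : ∀ a b, ⟪T a, b⟫_ℝ = ⟪a, T b⟫_ℝ)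
    (h0 : ∀ a, 0 ≤ ⟪a, T a⟫_ℝ) (h : ∀ a, ⟪a, T a⟫_ℝ ≤ ⟪a, S a⟫_ℝ) : ‖T‖ ≤ ‖S‖ := by
  have h1 : ‖T‖ ≤ √(‖T‖ * ‖S‖) := by
    refine ContinuousLinearMap.opNorm_le_bound _ (Real.sqrt_nonneg _) fun a => ?_
    apply abs_le_of_sq_le_sq' _ (by positivity) |>.2
    rw [mul_pow, Real.sq_sqrt (by positivity)]
    have h2 : ⟪a, S a⟫_ℝ ≤ ‖a‖ * (‖S‖ * ‖a‖) :=
      (real_inner_le_norm _ _).trans (mul_le_mul_of_nonneg_left (S.le_opNorm _) (norm_nonneg _))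
    calc ‖T a‖ ^ 2 ≤ ‖T‖ * ⟪a, T a⟫_ℝ := norm_apply_sq_le_of_nonneg hs h0 a
      _ ≤ ‖T‖ * (‖a‖ * (‖S‖ * ‖a‖)) :=
        mul_le_mul_of_nonneg_left ((h a).trans h2) (norm_nonneg _)
      _ = _ := by ring
  rcases (norm_nonneg T).eq_or_lt with h2 | h2
  · rw [← h2]; positivity
  · have h3 : ‖T‖ ^ 2 ≤ ‖T‖ * ‖S‖ := by
      have := pow_le_pow_left₀ h2.le h1 2
      rwa [Real.sq_sqrt (by positivity)] at this
    rw [sq] at h3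
    exact le_of_mul_le_mul_left h3 h2

/-- A limit along an ultrafilter finer than `atTop` exists by compactness of a ball of operators,
and monotonicity makes it an upper bound of all the forms. Closeness at a single index is enough,
since `norm_le_of_form_le` propagates it to all later ones. -/
lemma exists_monotone_limit [FiniteDimensional ℝ E] {ι : Type*} [Preorder ι]
    [IsDirectedOrder ι] [Nonempty ι] (R : ι → E →L[ℝ] E)
    (hs : ∀ i a b, ⟪R i a, b⟫_ℝ = ⟪a, R i b⟫_ℝ)
    (hm : ∀ i j, i ≤ j → ∀ a, ⟪a, R i a⟫_ℝ ≤ ⟪a, R j a⟫_ℝ) {C : ℝ} (hb : ∀ i, ‖R i‖ ≤ C) :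
    ∃ S : E →L[ℝ] E, (∀ a b, ⟪S a, b⟫_ℝ = ⟪a, S b⟫_ℝ) ∧
      (∀ i a, ⟪a, R i a⟫_ℝ ≤ ⟪a, S a⟫_ℝ) ∧ ∀ ε > 0, ∃ i, ‖S - R i‖ ≤ ε := by
  let U : Ultrafilter ι := Ultrafilter.of atTop
  have hU : (U : Filter ι) ≤ atTop := Ultrafilter.of_le atTop
  obtain ⟨S, -, hS⟩ := (isCompact_closedBall (0 : E →L[ℝ] E) C).ultrafilter_le_nhds (U.map R)
    (by
      rw [Ultrafilter.coe_map, le_principal_iff]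
      exact Filter.mem_map.2 (Filter.univ_mem' fun i => by simpa using hb i))
  have hS' : Tendsto R U (𝓝 S) := hS
  have hap (a : E) : Tendsto (fun i => R i a) U (𝓝 (S a)) :=
    ((ContinuousLinearMap.apply ℝ E a).continuous.tendsto S).comp hS'
  refine ⟨S, fun a b => ?_, fun i a => ?_, fun ε hε => ?_⟩
  · refine tendsto_nhds_unique ((hap a).inner tendsto_const_nhds)
      ((tendsto_const_nhds (x := a)).inner (hap b) |>.congr fun i => (hs i a b).symm)
  · exact ge_of_tendsto ((tendsto_const_nhds (x := a)).inner (hap a))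
      (Filter.mem_of_superset (hU (Ici_mem_atTop i)) fun j hj => hm i j hj a)
  · have := (Metric.tendsto_nhds.1 hS' ε hε).exists
    obtain ⟨i, hi⟩ := this
    exact ⟨i, by rw [← dist_eq_norm, dist_comm]; exact hi.le⟩

end Monotone

/-! ### Symmetric forms of finite negative index -/

section Index

variable {H : Type*} [AddCommGroup H] [Module ℝ H]

/-- Take V₀ of maximal dimension among negative definite subspaces; a vector of negative square that
is Q-orthogonal to V₀ could be added to it. -/
lemma exists_maximal_negative (Q : H →ₗ[ℝ] H →ₗ[ℝ] ℝ) (hQ : ∀ v w, Q v w = Q w v)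
    (W : Submodule ℝ H) (N : ℕ)
    (hN : ∀ V ≤ W, FiniteDimensional ℝ V → (∀ v ∈ V, v ≠ 0 → Q v v < 0) →
      Module.finrank ℝ V ≤ N) :
    ∃ V₀ ≤ W, FiniteDimensional ℝ V₀ ∧ (∀ v ∈ V₀, v ≠ 0 → Q v v < 0) ∧
      ∀ w ∈ W, (∀ v ∈ V₀, Q w v = 0) → 0 ≤ Q w w := by
  let A : Set ℕ := {m | ∃ V ≤ W, FiniteDimensional ℝ V ∧ (∀ v ∈ V, v ≠ 0 → Q v v < 0) ∧
    Module.finrank ℝ V = m}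
  have hne : A.Nonempty := ⟨0, ⊥, bot_le, inferInstance, by simp, by simp⟩
  have hbd : BddAbove A := ⟨N, by rintro m ⟨V, h1, h2, h3, rfl⟩; exact hN V h1 h2 h3⟩
  obtain ⟨V₀, h1, h2, h3, h4⟩ := Nat.sSup_mem hne hbd
  refine ⟨V₀, h1, h2, h3, fun w hw hort => ?_⟩
  by_contra! hneg
  have hw0 : w ∉ V₀ := fun h => by simp [hort w h] at hneg
  have hmem : Module.finrank ℝ ↥(V₀ ⊔ Submodule.span ℝ {w}) ∈ A := by
    refine ⟨_, sup_le h1 ((Submodule.span_singleton_le_iff_mem _ _).2 hw), inferInstance, ?_, rfl⟩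
    intro x hx hx0
    obtain ⟨v, hv, y, hy, rfl⟩ := Submodule.mem_sup.1 hx
    obtain ⟨t, rfl⟩ := Submodule.mem_span_singleton.1 hy
    have e : Q (v + t • w) (v + t • w) = Q v v + t ^ 2 * Q w w := by
      simp only [map_add, map_smul, LinearMap.add_apply, LinearMap.smul_apply, smul_eq_mul,
        hQ v w, hort v hv]
      ring
    rw [e]
    by_cases hv0 : v = 0
    · subst hv0
      have ht : t ≠ 0 := by
        rintro rfl
        simp at hx0
      have : 0 < t ^ 2 := by positivity
      simp only [map_zero, zero_add]
      nlinarith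
    · have := h3 v hv hv0
      nlinarith [sq_nonneg t]
  have hlt : V₀ < V₀ ⊔ Submodule.span ℝ {w} :=
    lt_of_le_of_ne le_sup_left fun h => hw0 (by
      rw [h]
      exact Submodule.mem_sup_right (Submodule.mem_span_singleton_self w))
  have h5 := Submodule.finrank_lt_finrank_of_lt hlt
  have h6 := le_csSup hbd hmem
  omega

/-- Passing from ker D to the whole space raises the negative index by at most the rank of D, by
rank-nullity on V. -/
lemma finrank_le_of_negative_on_ker {F : Type*} [AddCommGroup F] [Module ℝ F]
    [FiniteDimensional ℝ F] (D : H →ₗ[ℝ] F) (Q : H →ₗ[ℝ] H →ₗ[ℝ] ℝ) (W : Submodule ℝ H) (N : ℕ)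
    (hN : ∀ V ≤ W, FiniteDimensional ℝ V → (∀ v ∈ V, D v = 0) → (∀ v ∈ V, v ≠ 0 → Q v v < 0) →
      Module.finrank ℝ V ≤ N)
    (V : Submodule ℝ H) (hV : V ≤ W) (hfd : FiniteDimensional ℝ V)
    (hneg : ∀ v ∈ V, v ≠ 0 → Q v v < 0) :
    Module.finrank ℝ V ≤ Module.finrank ℝ F + N := by
  have h1 := LinearMap.finrank_range_add_finrank_ker (D ∘ₗ V.subtype)
  have h2 := Submodule.finrank_le (LinearMap.range (D ∘ₗ V.subtype))
  have h3 : Module.finrank ℝ (LinearMap.ker (D ∘ₗ V.subtype)) ≤ N := by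
    rw [(Submodule.equivMapOfInjective V.subtype V.injective_subtype _).finrank_eq]
    refine hN _ ?_ inferInstance ?_ ?_
    · exact (Submodule.map_subtype_le V _).trans hV
    · rintro _ ⟨x, hx, rfl⟩
      exact hx
    · rintro _ ⟨x, hx, rfl⟩ hx0
      exact hneg x x.2 hx0
  omega

/-- The projection along the orthogonal complement of a negative definite subspace. -/
lemma exists_form_projection (Q : H →ₗ[ℝ] H →ₗ[ℝ] ℝ) (hQ : ∀ v w, Q v w = Q w v)
    (V₀ : Submodule ℝ H) [FiniteDimensional ℝ V₀] (hneg : ∀ v ∈ V₀, v ≠ 0 → Q v v < 0)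
    {X : Type*} [AddCommGroup X] [Module ℝ X] (φ : X →ₗ[ℝ] H →ₗ[ℝ] ℝ) :
    ∃ P : X →ₗ[ℝ] H, (∀ x, P x ∈ V₀) ∧ (∀ x, ∀ w ∈ V₀, Q (P x) w = φ x w) ∧
      ∃ (m : ℕ) (c b : Fin m → H), ∀ x, P x = ∑ i, φ x (c i) • b i := by
  let f : V₀ →ₗ[ℝ] Module.Dual ℝ V₀ := (LinearMap.lcomp ℝ ℝ V₀.subtype) ∘ₗ Q ∘ₗ V₀.subtype
  have hf (v w : V₀) : f v w = Q v w := rfl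
  have hinj : Function.Injective f := by
    rw [← LinearMap.ker_eq_bot, LinearMap.ker_eq_bot']
    intro v hv
    by_contra h0
    have := hneg v v.2 (by simpa using h0)
    rw [← hf, hv] at this
    simp at this
  let e : V₀ ≃ₗ[ℝ] Module.Dual ℝ V₀ :=
    LinearEquiv.ofInjectiveOfFinrankEq f hinj Subspace.dual_finrank_eq.symm
  have he (v : V₀) : e v = f v := rfl
  let P : X →ₗ[ℝ] V₀ := e.symm.toLinearMap ∘ₗ (LinearMap.lcomp ℝ ℝ V₀.subtype) ∘ₗ φ
  have hP (x : X) (w : V₀) : Q (P x) w = φ x w := by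
    rw [← hf, ← he]
    simp [P]
  let b := Module.finBasis ℝ V₀
  -- The vectors c i represent the dual basis through Q, so φ x (c i) is the i-th coordinate of P x.
  -- This finite formula is what makes the continuity of P visible when φ is continuous.
  refine ⟨V₀.subtype ∘ₗ P, fun x => (P x).2, fun x w hw => hP x ⟨w, hw⟩, _,
    fun i => (e.symm (b.coord i) : V₀), fun i => (b i : V₀), fun x => ?_⟩
  have h1 (i) : φ x (e.symm (b.coord i) : V₀) = b.repr (P x) i := by
    rw [← hP, hQ, ← hf, ← he, e.apply_symm_apply, Module.Basis.coord_apply]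
  simp only [h1]
  conv_lhs => rw [LinearMap.comp_apply, ← b.sum_repr (P x)]
  simp only [Submodule.subtype_apply, Submodule.coe_sum, Submodule.coe_smul]

end Index

end OptControl

namespace OptControl

/-! ### Jacobi spaces of finite index as graphs of symmetric operators. -/

section GraphForm

variable {n : ℕ}

/-- The Lagrangian graph `{(η, -R η)}`. -/
def graphNeg (R : Vec n →L[ℝ] Vec n) : Submodule ℝ (Phase n) where
  carrier := {z | z.snd = -R z.fst}
  zero_mem' := by simp
  add_mem' := by
    intro a b (ha : _ = _) (hb : _ = _)
    change a.snd + b.snd = -R (a.fst + b.fst)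
    rw [ha, hb, map_add]; abel
  smul_mem' := by
    intro c a (ha : _ = _)
    change c • a.snd = -R (c • a.fst)
    rw [ha, map_smul, smul_neg]

lemma mem_graphNeg {R : Vec n →L[ℝ] Vec n} {z : Phase n} :
    z ∈ graphNeg R ↔ z.snd = -R z.fst := Iff.rfl

lemma sympl_graphNeg {R R' : Vec n →L[ℝ] Vec n} (hs : ∀ a b, ⟪R a, b⟫_ℝ = ⟪a, R b⟫_ℝ)
    {z w : Phase n} (hz : z ∈ graphNeg R) (hw : w ∈ graphNeg R') :
    sympl z w = ⟪z.fst, (R - R') w.fst⟫_ℝ := by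
  rw [mem_graphNeg] at hz hw
  rw [sympl, hz, hw, inner_neg_right, inner_neg_right, sub_apply,
    inner_sub_right, ← hs, real_inner_comm z.fst (R w.fst)]
  ring

/-- Symplectic shears taking a graph over the momenta to a graph of a diagonal type. -/
noncomputable def shear (M : Vec n →ₗ[ℝ] Vec n) : Phase n ≃ₗ[ℝ] Phase n where
  toFun z := WithLp.toLp 2 (z.fst + z.snd, z.snd + M (z.fst + z.snd))
  invFun z := WithLp.toLp 2 (z.fst - (z.snd - M z.fst), z.snd - M z.fst)
  map_add' a b := by
    apply Phase.ext
    · change a.fst + b.fst + (a.snd + b.snd) = a.fst + a.snd + (b.fst + b.snd)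
      abel
    · change a.snd + b.snd + M (a.fst + b.fst + (a.snd + b.snd)) =
        a.snd + M (a.fst + a.snd) + (b.snd + M (b.fst + b.snd))
      simp only [map_add]
      abel
  map_smul' c a := by
    apply Phase.ext
    · change c • a.fst + c • a.snd = c • (a.fst + a.snd)
      rw [smul_add]
    · change c • a.snd + M (c • a.fst + c • a.snd) = c • (a.snd + M (a.fst + a.snd))
      rw [← smul_add, map_smul, smul_add]
  left_inv a := by
    apply Phase.ext
    · change a.fst + a.snd - (a.snd + M (a.fst + a.snd) - M (a.fst + a.snd)) = a.fst
      abel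
    · change a.snd + M (a.fst + a.snd) - M (a.fst + a.snd) = a.snd
      abel
  right_inv a := by
    have e : a.fst - (a.snd - M a.fst) + (a.snd - M a.fst) = a.fst := by abel
    apply Phase.ext
    · exact e
    · change a.snd - M a.fst + M (a.fst - (a.snd - M a.fst) + (a.snd - M a.fst)) = a.snd
      rw [e]
      abel

@[simp] lemma shear_fst (M : Vec n →ₗ[ℝ] Vec n) (z : Phase n) :
    (shear M z).fst = z.fst + z.snd := rfl

@[simp] lemma shear_snd (M : Vec n →ₗ[ℝ] Vec n) (z : Phase n) :
    (shear M z).snd = z.snd + M (z.fst + z.snd) := rfl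

lemma sympl_shear {M : Vec n →ₗ[ℝ] Vec n} (hM : ∀ a b, ⟪M a, b⟫_ℝ = ⟪a, M b⟫_ℝ) (z w : Phase n) :
    sympl (shear M z) (shear M w) = sympl z w := by
  simp only [sympl, shear_fst, shear_snd, inner_add_left, inner_add_right, map_add]
  have h1 := hM z.fst w.fst
  have h2 := hM z.fst w.snd
  have h3 := hM z.snd w.fst
  have h4 := hM z.snd w.snd
  rw [real_inner_comm] at h1 h2 h3 h4
  rw [real_inner_comm z.snd w.snd]
  linarith

/-- A symplectic image of a Lagrangian subspace is Lagrangian. -/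
lemma IsLagrangian.map {Λ : Submodule ℝ (Phase n)} (h : IsLagrangian Λ)
    (g : Phase n ≃ₗ[ℝ] Phase n) (hg : ∀ z w, |sympl (g z) (g w)| = |sympl z w|) :
    IsLagrangian (Λ.map (g : Phase n →ₗ[ℝ] Phase n)) := by
  refine ⟨?_, by rw [finrank_map_of_inj _ g.injective, h.2]⟩
  rintro _ ⟨z, hz, rfl⟩ _ ⟨w, hw, rfl⟩
  rw [← abs_eq_zero]
  exact (hg z w).trans (by rw [h.1 z hz w hw, abs_zero])

/-- Transversality to {fst = 0} and the dimension of G make the momentum projection an isomorphism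
of G; isotropy of G is the symmetry of R. -/
lemma exists_eq_graphNeg {G : Submodule ℝ (Phase n)} (hG : IsLagrangian G)
    (h0 : ∀ z ∈ G, z.fst = 0 → z.snd = 0) :
    ∃ R : Vec n →L[ℝ] Vec n, (∀ a b, ⟪R a, b⟫_ℝ = ⟪a, R b⟫_ℝ) ∧ G = graphNeg R := by
  let f : G →ₗ[ℝ] Vec n :=
    (LinearMap.fst ℝ (Vec n) (Vec n)) ∘ₗ (WithLp.linearEquiv 2 ℝ (Vec n × Vec n)).toLinearMap ∘ₗ
      G.subtype
  have hf (z : G) : f z = (z : Phase n).fst := rfl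
  have hinj : Function.Injective f := by
    rw [← LinearMap.ker_eq_bot, LinearMap.ker_eq_bot']
    intro z hz
    exact Subtype.ext (Phase.ext hz (h0 z z.2 hz))
  let e : G ≃ₗ[ℝ] Vec n := LinearEquiv.ofInjectiveOfFinrankEq f hinj (by rw [hG.2]; simp)
  have he (z : G) : e z = (z : Phase n).fst := rfl
  let R : Vec n →ₗ[ℝ] Vec n := -((LinearMap.snd ℝ (Vec n) (Vec n)) ∘ₗ
    (WithLp.linearEquiv 2 ℝ (Vec n × Vec n)).toLinearMap ∘ₗ G.subtype ∘ₗ e.symm.toLinearMap)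
  have hR (a) : R a = -(e.symm a : Phase n).snd := rfl
  have hfst (a) : (e.symm a : Phase n).fst = a := by rw [← he, e.apply_symm_apply]
  have hGR : G = graphNeg (LinearMap.toContinuousLinearMap R) := by
    ext z
    rw [mem_graphNeg, LinearMap.coe_toContinuousLinearMap', hR, neg_neg]
    constructor
    · intro hz
      have : e.symm z.fst = ⟨z, hz⟩ := by rw [LinearEquiv.symm_apply_eq, he]
      rw [this]
    · intro hz
      have : z = e.symm z.fst := Phase.ext (hfst _).symm hz
      rw [this]
      exact (e.symm z.fst).2
  refine ⟨LinearMap.toContinuousLinearMap R, fun a b => ?_, hGR⟩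
  have h1 := hG.1 _ (e.symm a).2 _ (e.symm b).2
  rw [sympl, hfst, hfst] at h1
  simp only [LinearMap.coe_toContinuousLinearMap', hR, inner_neg_left, inner_neg_right]
  rw [real_inner_comm]
  linarith

variable {H : Type*} [NormedAddCommGroup H] [NormedSpace ℝ H]

/-- `𝓛`-derivatives of a problem of finite negative index are, for large spaces of variations,
graphs of an increasing bounded family of symmetric operators in suitable symplectic coordinates.
-/
theorem exists_graph_form (D : H →ₗ[ℝ] Vec n) (Q : H →ₗ[ℝ] H →ₗ[ℝ] ℝ)
    (hQ : ∀ v w, Q v w = Q w v) (hDc : Continuous D) (hQc : Continuous fun p : H × H => Q p.1 p.2)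
    (L : Submodule ℝ H → Submodule ℝ (Phase n))
    (hL : ∀ V z, z ∈ L V ↔ ∃ v ∈ V, z.snd = D v ∧ ∀ w ∈ V, ⟪z.fst, D w⟫_ℝ + Q v w = 0)
    (hLag : ∀ V : Submodule ℝ H, FiniteDimensional ℝ V → IsLagrangian (L V))
    (W : Submodule ℝ H) (hW : Dense (W : Set H)) (N : ℕ)
    (hN : ∀ V ≤ W, FiniteDimensional ℝ V → (∀ v ∈ V, D v = 0) → (∀ v ∈ V, v ≠ 0 → Q v v < 0) →
      Module.finrank ℝ V ≤ N) :
    ∃ (g : Phase n ≃ₗ[ℝ] Phase n) (R : Vec n →L[ℝ] Vec n),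
      (∀ z w, sympl (g z) (g w) = sympl z w) ∧ (∀ a b, ⟪R a, b⟫_ℝ = ⟪a, R b⟫_ℝ) ∧
      ∀ ε > 0, ∃ V₀ ≤ W, FiniteDimensional ℝ V₀ ∧
        ∀ V : Submodule ℝ H, FiniteDimensional ℝ V → V₀ ≤ V →
        ∃ R' : Vec n →L[ℝ] Vec n, (∀ a b, ⟪R' a, b⟫_ℝ = ⟪a, R' b⟫_ℝ) ∧
          (∀ a, ⟪a, R' a⟫_ℝ ≤ ⟪a, R a⟫_ℝ) ∧ ‖R - R'‖ ≤ ε ∧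
          L V = (graphNeg R').map (g : Phase n →ₗ[ℝ] Phase n) := by
  obtain ⟨V₀, hV₀W, hV₀fd, hneg, hpos⟩ := exists_maximal_negative Q hQ W _
    (finrank_le_of_negative_on_ker D Q W N hN)
  obtain ⟨P, hPm, hPQ, k, c, b, hPe⟩ := exists_form_projection Q hQ V₀ hneg Q
  obtain ⟨m, hmm, hmQ, -⟩ := exists_form_projection Q hQ V₀ hneg
    (-((LinearMap.lcomp ℝ ℝ D) ∘ₗ (innerₗ (Vec n))))
  have hmQ' (p : Vec n) (w : H) (hw : w ∈ V₀) : Q (m p) w = -⟪p, D w⟫_ℝ := by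
    rw [hmQ p w hw]; rfl
  have huniq (v w : H) (hv : v ∈ V₀) (hw : w ∈ V₀) (h : ∀ x ∈ V₀, Q v x = Q w x) : v = w := by
    by_contra hne
    have h1 := hneg (v - w) (sub_mem hv hw) (sub_ne_zero.2 hne)
    have h2 := h _ (sub_mem hv hw)
    rw [map_sub Q, LinearMap.sub_apply, h2, sub_self] at h1
    exact lt_irrefl _ h1
  have hPc : Continuous P := by
    have : (P : H → H) = fun x => ∑ i, Q x (c i) • b i := funext hPe
    rw [this]
    refine continuous_finsetSum _ fun i _ => ?_
    have : Continuous fun x => Q x (c i) := hQc.comp (continuous_id.prodMk continuous_const)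
    fun_prop
  have hort (h : H) (v : H) (hv : v ∈ V₀) : Q (h - P h) v = 0 := by
    rw [map_sub, LinearMap.sub_apply, hPQ h v hv, sub_self]
  have hP0 (w : H) (hw : ∀ v ∈ V₀, Q w v = 0) : P w = 0 :=
    huniq _ _ (hPm w) (zero_mem _) fun x hx => by simp [hPQ w x hx, hw x hx]
  have hQcP : Continuous fun h => Q (h - P h) (h - P h) :=
    hQc.comp ((continuous_id.sub hPc).prodMk (continuous_id.sub hPc))
  -- Maximality of V₀ gives nonnegativity only for vectors of W. Since h ↦ h - P h is continuous and
  -- keeps W inside W, density of W extends it to the whole Q-orthogonal complement of V₀.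
  have hnn (h : H) : 0 ≤ Q (h - P h) (h - P h) := by
    have hcl : IsClosed {h : H | 0 ≤ Q (h - P h) (h - P h)} := isClosed_le continuous_const hQcP
    exact hcl.closure_subset_iff.2
      (fun w hw => hpos _ (sub_mem hw (hV₀W (hPm w))) (hort w)) (hW h)
  have hnn' (w : H) (hw : ∀ v ∈ V₀, Q w v = 0) : 0 ≤ Q w w := by
    have := hnn w
    rwa [hP0 w hw, sub_zero] at this
  -- M is the contribution of V₀: m p solves the constraint for the momentum p within V₀, and the
  -- shear subtracts its end-point D(m p).
  let M : Vec n →ₗ[ℝ] Vec n := D ∘ₗ m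
  have hM (a a' : Vec n) : ⟪M a, a'⟫_ℝ = ⟪a, M a'⟫_ℝ := by
    have h1 := hmQ' a _ (hmm a')
    have h2 := hmQ' a' _ (hmm a)
    rw [hQ] at h1
    rw [real_inner_comm]
    change ⟪a', D (m a)⟫_ℝ = ⟪a, D (m a')⟫_ℝ
    linarith
  let g := shear M
  -- In the new coordinates the component of v in V₀ has disappeared, and the old momentum is the
  -- new one plus Dv. The constraint therefore involves Q + ⟨D·, D·⟩, which on the complement of V₀
  -- also controls |D·|².
  have hkey (V : Submodule ℝ H) (hV : V₀ ≤ V) (z : Phase n) (hz : g z ∈ L V) :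
      ∃ v ∈ V, (∀ x ∈ V₀, Q v x = 0) ∧ z.snd = D v ∧
        ∀ w ∈ V, (∀ x ∈ V₀, Q w x = 0) → ⟪z.fst + z.snd, D w⟫_ℝ + Q v w = 0 := by
    obtain ⟨v, hv, h1, h2⟩ := (hL V _).1 hz
    rw [shear_fst] at h2
    rw [shear_snd] at h1
    have h3 : P v = m (z.fst + z.snd) := by
      refine huniq _ _ (hPm _) (hmm _) fun x hx => ?_
      rw [hPQ v x hx, hmQ' _ x hx]
      linarith [h2 x (hV hx)]
    refine ⟨v - P v, sub_mem hv (hV (hPm v)), hort v, ?_, fun w hw hwo => ?_⟩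
    · rw [map_sub, ← h1, h3]
      change z.snd = z.snd + D (m _) - D (m _)
      abel
    · rw [map_sub, LinearMap.sub_apply, hQ (P v) w, hwo _ (hPm v), sub_zero]
      exact h2 w hw
  have hg (z w : Phase n) : sympl (g z) (g w) = sympl z w := sympl_shear hM z w
  have hg' (z w : Phase n) : sympl (g.symm z) (g.symm w) = sympl z w := by
    rw [← hg, g.apply_symm_apply, g.apply_symm_apply]
  -- Transversality: at new momentum zero, the constraint tested on v itself reads |Dv|² + Q(v, v) =
  -- 0 with Q(v, v) ≥ 0, so Dv = 0.
  have hexR (V : Submodule ℝ H) (hfd : FiniteDimensional ℝ V) (hV : V₀ ≤ V) :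
      ∃ R' : Vec n →L[ℝ] Vec n, (∀ a b, ⟪R' a, b⟫_ℝ = ⟪a, R' b⟫_ℝ) ∧
        L V = (graphNeg R').map (g : Phase n →ₗ[ℝ] Phase n) := by
    obtain ⟨R', hs, hR'⟩ := exists_eq_graphNeg
      (G := (L V).map (g.symm : Phase n →ₗ[ℝ] Phase n))
      ((hLag V hfd).map g.symm fun z w => by rw [hg']) (by
        rintro _ ⟨z, hz, rfl⟩ h0
        obtain ⟨v, hv, ho, h1, h2⟩ := hkey V hV (g.symm z) (by simpa using hz)
        have h3 := h2 v hv ho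
        change (g.symm z).fst = 0 at h0
        rw [h0, zero_add, ← h1, real_inner_self_eq_norm_sq] at h3
        have h4 := hnn' v ho
        have h5 : ‖(g.symm z).snd‖ ^ 2 = 0 := le_antisymm (by linarith) (sq_nonneg _)
        change (g.symm z).snd = 0
        exact norm_eq_zero.1 (pow_eq_zero_iff two_ne_zero |>.1 h5))
    refine ⟨R', hs, ?_⟩
    rw [← hR', ← Submodule.map_comp]
    ext z
    simp
  choose! RV hRs hRL using hexR
  have hform (V : Submodule ℝ H) (hfd : FiniteDimensional ℝ V) (hV : V₀ ≤ V) (a : Vec n) :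
      ∃ v ∈ V, (∀ x ∈ V₀, Q v x = 0) ∧ -RV V a = D v ∧
        ∀ w ∈ V, (∀ x ∈ V₀, Q w x = 0) → ⟪a + -RV V a, D w⟫_ℝ + Q v w = 0 := by
    refine hkey V hV (WithLp.toLp 2 (a, -RV V a)) ?_
    rw [hRL V hfd hV]
    exact ⟨_, (rfl : (-RV V a) = -RV V a), rfl⟩
  -- Variational characterization: ⟨a, R_V a⟩ is the maximum of -2⟨a, Dw⟩ - |Dw|² - Q(w, w) over w ∈
  -- V that are Q-orthogonal to V₀. This gives monotonicity in V. The maximizer has R_V a = -Dv,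
  -- whence |R_V a|² ≤ ⟨a, R_V a⟩ and ‖R_V‖ ≤ 1.
  have hupper (V : Submodule ℝ H) (hfd : FiniteDimensional ℝ V) (hV : V₀ ≤ V) (a : Vec n) (w : H)
      (hw : w ∈ V) (hwo : ∀ x ∈ V₀, Q w x = 0) :
      -2 * ⟪a, D w⟫_ℝ - ‖D w‖ ^ 2 - Q w w ≤ ⟪a, RV V a⟫_ℝ := by
    obtain ⟨v, hv, ho, h1, h2⟩ := hform V hfd hV a
    have h3 := h2 v hv ho
    have h4 := h2 w hw hwo
    have h5 := hnn' (v - w) fun x hx => by rw [map_sub, LinearMap.sub_apply, ho x hx, hwo x hx,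
      sub_zero]
    have h6 : 0 ≤ ‖D v - D w‖ ^ 2 := sq_nonneg _
    have h7 : RV V a = -D v := by rw [← h1, neg_neg]
    rw [norm_sub_sq_real, ← real_inner_self_eq_norm_sq] at h6
    simp only [map_sub, LinearMap.sub_apply, hQ w v] at h5
    rw [h1, inner_add_left] at h3 h4
    rw [h7, inner_neg_right]
    linarith
  have hattain (V : Submodule ℝ H) (hfd : FiniteDimensional ℝ V) (hV : V₀ ≤ V) (a : Vec n) :
      ∃ w ∈ V, (∀ x ∈ V₀, Q w x = 0) ∧
        ⟪a, RV V a⟫_ℝ = -2 * ⟪a, D w⟫_ℝ - ‖D w‖ ^ 2 - Q w w ∧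
        ‖RV V a‖ ^ 2 ≤ ⟪a, RV V a⟫_ℝ := by
    obtain ⟨v, hv, ho, h1, h2⟩ := hform V hfd hV a
    have h3 := h2 v hv ho
    have h7 : RV V a = -D v := by rw [← h1, neg_neg]
    have h8 := hnn' v ho
    rw [h1, inner_add_left, real_inner_self_eq_norm_sq] at h3
    refine ⟨v, hv, ho, ?_, ?_⟩
    · rw [h7, inner_neg_right]
      linarith
    · rw [h7, inner_neg_right, norm_neg]
      linarith
  have hbound (V : Submodule ℝ H) (hfd : FiniteDimensional ℝ V) (hV : V₀ ≤ V) : ‖RV V‖ ≤ 1 := by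
    refine ContinuousLinearMap.opNorm_le_bound _ zero_le_one fun a => ?_
    obtain ⟨-, -, -, -, h⟩ := hattain V hfd hV a
    have h2 := real_inner_le_norm a (RV V a)
    rcases (norm_nonneg (RV V a)).eq_or_lt with h0 | h0
    · rw [← h0]; positivity
    · rw [one_mul]
      exact le_of_mul_le_mul_right (by rw [← sq]; exact h.trans h2) h0
  -- The limit is taken over subspaces of W only, so that the threshold subspace for a given ε can
  -- be chosen inside W.
  let ι := {V : Submodule ℝ H // FiniteDimensional ℝ V ∧ V₀ ≤ V ∧ V ≤ W}
  have hι : Nonempty ι := ⟨⟨V₀, hV₀fd, le_rfl, hV₀W⟩⟩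
  have : IsDirectedOrder ι := ⟨fun A B => by
    have hA := A.2.1
    have hB := B.2.1
    exact ⟨⟨A.1 ⊔ B.1, inferInstance, A.2.2.1.trans le_sup_left, sup_le A.2.2.2 B.2.2.2⟩,
      (le_sup_left : A.1 ≤ A.1 ⊔ B.1), (le_sup_right : B.1 ≤ A.1 ⊔ B.1)⟩⟩
  have hmono (V U : Submodule ℝ H) (hVf : FiniteDimensional ℝ V) (hUf : FiniteDimensional ℝ U)
      (h0 : V₀ ≤ V) (hVU : V ≤ U) (a : Vec n) : ⟪a, RV V a⟫_ℝ ≤ ⟪a, RV U a⟫_ℝ := by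
    obtain ⟨w, hw, hwo, h1, -⟩ := hattain V hVf h0 a
    rw [h1]
    exact hupper U hUf (h0.trans hVU) a w (hVU hw) hwo
  obtain ⟨R, hs, hle, hlim⟩ := exists_monotone_limit (fun V : ι => RV V.1)
    (fun V a b => hRs V.1 V.2.1 V.2.2.1 a b)
    (fun V U hVU a => hmono V.1 U.1 V.2.1 U.2.1 V.2.2.1 hVU a)
    (fun V => hbound V.1 V.2.1 V.2.2.1)
  -- For V not contained in W, the upper bound by R is obtained from the maximization: the
  -- functional is continuous, each projected vector of W is admissible for some subspace of W, and
  -- W is dense.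
  have hleR (V : Submodule ℝ H) (hfd : FiniteDimensional ℝ V) (hV : V₀ ≤ V) (a : Vec n) :
      ⟪a, RV V a⟫_ℝ ≤ ⟪a, R a⟫_ℝ := by
    obtain ⟨w, hw, hwo, h1, -⟩ := hattain V hfd hV a
    rw [h1]
    have hcl : IsClosed {h : H | -2 * ⟪a, D (h - P h)⟫_ℝ - ‖D (h - P h)‖ ^ 2 -
        Q (h - P h) (h - P h) ≤ ⟪a, R a⟫_ℝ} := by
      refine isClosed_le ?_ continuous_const
      have : Continuous fun h => D (h - P h) := hDc.comp (continuous_id.sub hPc)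
      fun_prop
    have hsub := (hcl.closure_subset_iff (s := (W : Set H))).2 (fun x hx => by
      have hfd' : FiniteDimensional ℝ ↥(V₀ ⊔ Submodule.span ℝ {x}) := inferInstance
      refine (hupper _ hfd' le_sup_left a (x - P x) (sub_mem (Submodule.mem_sup_right
        (Submodule.mem_span_singleton_self x)) (Submodule.mem_sup_left (hPm x))) (hort x)).trans ?_
      exact hle ⟨_, hfd', le_sup_left,
        sup_le hV₀W ((Submodule.span_singleton_le_iff_mem _ _).2 hx)⟩ a)
    have := hsub (hW w)
    rw [Set.mem_ofPred_eq, hP0 w hwo, sub_zero] at this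
    exact this
  refine ⟨g, R, hg, hs, fun ε hε => ?_⟩
  obtain ⟨U, hU⟩ := hlim ε hε
  refine ⟨U.1, U.2.2.2, U.2.1, fun V hVf hUV => ⟨RV V, hRs V hVf (U.2.2.1.trans hUV),
    hleR V hVf (U.2.2.1.trans hUV), ?_, hRL V hVf (U.2.2.1.trans hUV)⟩⟩
  refine (norm_le_of_form_le (fun a b => ?_) (fun a => ?_) fun a => ?_).trans hU
  · rw [sub_apply, sub_apply, inner_sub_left, inner_sub_right, hs,
      hRs V hVf (U.2.2.1.trans hUV)]
  · rw [sub_apply, inner_sub_right]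
    linarith [hleR V hVf (U.2.2.1.trans hUV) a]
  · rw [sub_apply, sub_apply, inner_sub_right, inner_sub_right]
    linarith [hmono U.1 V U.2.1 hVf U.2.2.1 hUV a]

end GraphForm

end OptControl

namespace OptControl

/-! ### Continuity of extensions along increasing families of graphs. -/

section Continuity

variable {n : ℕ}

/-- A linear right inverse of T onto its range is automatically bounded in finite dimension. No
injectivity is available where this is applied, so a preimage has to be chosen. -/
lemma LinearMap.exists_bounded_preimage {E F : Type*} [NormedAddCommGroup E] [NormedSpace ℝ E]
    [NormedAddCommGroup F] [NormedSpace ℝ F] [FiniteDimensional ℝ E] (T : E →ₗ[ℝ] F) :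
    ∃ C : ℝ, 0 ≤ C ∧ ∀ x, ∃ y, T y = T x ∧ ‖y‖ ≤ C * ‖T x‖ := by
  obtain ⟨r, hr⟩ := T.rangeRestrict.exists_rightInverse_of_surjective T.range_rangeRestrict
  let r' := LinearMap.toContinuousLinearMap r
  refine ⟨‖r'‖, r'.opNorm_nonneg, fun x => ⟨r (T.rangeRestrict x), ?_, ?_⟩⟩
  · have := LinearMap.congr_fun hr (T.rangeRestrict x)
    exact congrArg Subtype.val this
  · exact r'.le_opNorm (T.rangeRestrict x)

variable {H : Type*} [NormedAddCommGroup H] [NormedSpace ℝ H]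

/-- The parametrization `η ↦ g (η, -R η)` of an image of a graph. -/
noncomputable def graphParam (g : Phase n ≃ₗ[ℝ] Phase n) (R : Vec n →L[ℝ] Vec n) :
    Vec n →ₗ[ℝ] Phase n :=
  g.toLinearMap ∘ₗ (WithLp.linearEquiv 2 ℝ (Vec n × Vec n)).symm.toLinearMap ∘ₗ
    (LinearMap.prod LinearMap.id (-R.toLinearMap))

lemma mem_map_graphNeg {g : Phase n ≃ₗ[ℝ] Phase n} {R : Vec n →L[ℝ] Vec n} {z : Phase n} :
    z ∈ (graphNeg R).map (g : Phase n →ₗ[ℝ] Phase n) ↔ ∃ η, z = graphParam g R η := by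
  constructor
  · rintro ⟨y, hy, rfl⟩
    exact ⟨y.fst, congrArg g (Phase.ext rfl hy)⟩
  · rintro ⟨η, rfl⟩
    exact ⟨WithLp.toLp 2 (η, -R η), rfl, rfl⟩

lemma sympl_graphParam {g : Phase n ≃ₗ[ℝ] Phase n} (hg : ∀ z w, sympl (g z) (g w) = sympl z w)
    {R R' : Vec n →L[ℝ] Vec n} (hs : ∀ a b, ⟪R a, b⟫_ℝ = ⟪a, R b⟫_ℝ) (η η' : Vec n) :
    sympl (graphParam g R η) (graphParam g R' η') = ⟪η, (R - R') η'⟫_ℝ := by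
  have h1 : WithLp.toLp 2 (η, -R η) ∈ graphNeg R := (rfl : -R η = -R η)
  have h2 : WithLp.toLp 2 (η', -R' η') ∈ graphNeg R' := (rfl : -R' η' = -R' η')
  exact (hg _ _).trans (sympl_graphNeg hs h1 h2)

lemma isLagrangian_map_graphNeg {g : Phase n ≃ₗ[ℝ] Phase n}
    (hg : ∀ z w, sympl (g z) (g w) = sympl z w)
    {R : Vec n →L[ℝ] Vec n} (hs : ∀ a b, ⟪R a, b⟫_ℝ = ⟪a, R b⟫_ℝ) :
    IsLagrangian ((graphNeg R).map (g : Phase n →ₗ[ℝ] Phase n)) := by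
  refine isLagrangian_of_le_finrank ?_ ?_
  · rintro _ hz _ hw
    obtain ⟨η, rfl⟩ := mem_map_graphNeg.1 hz
    obtain ⟨η', rfl⟩ := mem_map_graphNeg.1 hw
    rw [sympl_graphParam hg hs, sub_self]
    simp
  · have hinj : Function.Injective (graphParam g R) := by
      intro a b hab
      exact congrArg WithLp.fst (g.injective hab)
    have : LinearMap.range (graphParam g R) ≤ (graphNeg R).map (g : Phase n →ₗ[ℝ] Phase n) := by
      rintro _ ⟨η, rfl⟩
      exact mem_map_graphNeg.2 ⟨η, rfl⟩
    have h := Submodule.finrank_mono this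
    rw [LinearMap.finrank_range_of_inj hinj] at h
    simpa using h

/-- Solutions of the extension problem have bounded representatives. -/
lemma exists_bounded_solution (p : Vec n →ₗ[ℝ] Phase n) (Y : H →ₗ[ℝ] Phase n)
    (s : H →ₗ[ℝ] H →ₗ[ℝ] ℝ) (V : Submodule ℝ H) [FiniteDimensional ℝ V] :
    ∃ C : ℝ, 0 ≤ C ∧ ∀ (η : Vec n), ∀ v ∈ V, ∀ B : ℝ, 0 ≤ B →
      (∀ w ∈ V, |sympl (p η) (Y w) + s v w| ≤ B * ‖w‖) →
      ∃ η', ∃ v' ∈ V, p η' + Y v' = p η + Y v ∧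
        (∀ w ∈ V, sympl (p η') (Y w) + s v' w = sympl (p η) (Y w) + s v w) ∧
        ‖η'‖ ≤ C * (‖p η + Y v‖ + B) := by
  let S : Vec n × V →ₗ[ℝ] Phase n :=
    LinearMap.coprod p (Y ∘ₗ V.subtype)
  let c : Vec n × V →ₗ[ℝ] Module.Dual ℝ V :=
    LinearMap.coprod ((LinearMap.lcomp ℝ ℝ (Y ∘ₗ V.subtype)) ∘ₗ (symplL n) ∘ₗ p)
      ((LinearMap.lcomp ℝ ℝ V.subtype) ∘ₗ s ∘ₗ V.subtype)
  -- T records both the point p η + Y v and the defect functional of the constraint. A bounded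
  -- preimage of the same value of T is another pair with the same point and the same defect.
  let T : Vec n × V →ₗ[ℝ] Phase n × (V →L[ℝ] ℝ) :=
    S.prod ((LinearMap.toContinuousLinearMap (E := V) (F' := ℝ)).toLinearMap ∘ₗ c)
  have hS (x : Vec n × V) : (T x).1 = p x.1 + Y x.2 := rfl
  have hc (x : Vec n × V) (w : V) : (T x).2 w = sympl (p x.1) (Y w) + s x.2 w := rfl
  obtain ⟨C, hC0, hC⟩ := LinearMap.exists_bounded_preimage (E := Vec n × V)
    (F := Phase n × (V →L[ℝ] ℝ)) T
  refine ⟨C, hC0, fun η v hv B hB hb => ?_⟩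
  obtain ⟨x, hx, hxn⟩ := hC (η, ⟨v, hv⟩)
  refine ⟨x.1, x.2, x.2.2, ?_, fun w hw => ?_, ?_⟩
  · rw [← hS, hx, hS]
  · rw [← hc x ⟨w, hw⟩, hx, hc]
  · refine (norm_fst_le x).trans (hxn.trans (mul_le_mul_of_nonneg_left ?_ hC0))
    refine (max_le ?_ ?_ : ‖T (η, ⟨v, hv⟩)‖ ≤ _)
    · rw [hS]
      linarith
    · refine ((T (η, ⟨v, hv⟩)).2.opNorm_le_bound hB fun w => hb w w.2).trans ?_
      linarith [norm_nonneg (p η + Y v)]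

lemma exists_linear_bound {F : Type*} [NormedAddCommGroup F] [NormedSpace ℝ F]
    [FiniteDimensional ℝ F] {G : Type*} [NormedAddCommGroup G] [NormedSpace ℝ G]
    (f : F →ₗ[ℝ] G) : ∃ C : ℝ, 0 ≤ C ∧ ∀ x, ‖f x‖ ≤ C * ‖x‖ :=
  ⟨_, ContinuousLinearMap.opNorm_nonneg (LinearMap.toContinuousLinearMap f),
    (LinearMap.toContinuousLinearMap f).le_opNorm⟩

/-- Extensions by a fixed finite-dimensional space of variations depend continuously on the
Lagrangian subspace along increasing families. -/
theorem kext_graph_continuous {g : Phase n ≃ₗ[ℝ] Phase n}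
    (hg : ∀ z w, sympl (g z) (g w) = sympl z w) {R : Vec n →L[ℝ] Vec n}
    (hR : ∀ a b, ⟪R a, b⟫_ℝ = ⟪a, R b⟫_ℝ) {Y : H →ₗ[ℝ] Phase n} {s : H →ₗ[ℝ] H →ₗ[ℝ] ℝ}
    (h : Compatible Y s) (V : Submodule ℝ H) [FiniteDimensional ℝ V] {ε : ℝ} (hε : 0 < ε) :
    ∃ δ > 0, ∀ R' : Vec n →L[ℝ] Vec n, (∀ a b, ⟪R' a, b⟫_ℝ = ⟪a, R' b⟫_ℝ) →
      (∀ a, ⟪a, R' a⟫_ℝ ≤ ⟪a, R a⟫_ℝ) → ‖R - R'‖ ≤ δ →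
      ‖(kext ((graphNeg R').map (g : Phase n →ₗ[ℝ] Phase n)) Y s V).starProjection -
        (kext ((graphNeg R).map (g : Phase n →ₗ[ℝ] Phase n)) Y s V).starProjection‖ ≤ ε := by
  obtain ⟨C, hC0, hC⟩ := exists_bounded_solution (graphParam g R) Y s V
  let g0 : Vec n →ₗ[ℝ] Phase n :=
    g.toLinearMap ∘ₗ (WithLp.linearEquiv 2 ℝ (Vec n × Vec n)).symm.toLinearMap ∘ₗ
      (LinearMap.inr ℝ (Vec n) (Vec n))
  obtain ⟨G, hG0, hG⟩ := exists_linear_bound g0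
  obtain ⟨B, hB0, hB⟩ := exists_linear_bound (F := V) (Y ∘ₗ V.subtype)
  have hshift (R' : Vec n →L[ℝ] Vec n) (η : Vec n) :
      graphParam g R' η = graphParam g R η + g0 ((R - R') η) := by
    change g _ = g _ + g _
    rw [← map_add]
    congr 1
    apply Phase.ext
    · change η = η + 0
      rw [add_zero]
    · change -R' η = -R η + (R η - R' η)
      abel
  -- One constant that absorbs the bound C for representatives, the bound G for the momentum-free
  -- part of g and the bound B for Y on V.
  obtain ⟨C₁, hC₁0, hCC₁, hC₁⟩ : ∃ C₁ : ℝ, 0 ≤ C₁ ∧ C ≤ C₁ ∧ ∀ x y : ℝ, 0 ≤ x → 0 ≤ y →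
      C * (x + G * y + G * y * B) ≤ C₁ * (x + y) := by
    refine ⟨C * (1 + G + G * B), by positivity, ?_, fun x y hx hy => ?_⟩
    · exact le_mul_of_one_le_right hC0 (by linarith [mul_nonneg hG0 hB0])
    · rw [mul_assoc C]
      refine mul_le_mul_of_nonneg_left ?_ hC0
      nlinarith [mul_nonneg hG0 hx, mul_nonneg (mul_nonneg hG0 hB0) hx]
  -- The first entry gives δ C₁ ≤ 1/2, which lets |m| be absorbed in its own estimate; the second
  -- gives 4 δ C₁² ≤ ε.
  refine ⟨min (1 / (2 * (C₁ + 1))) (ε / (4 * (C₁ + 1) * (C₁ + 1))), by positivity, ?_⟩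
  intro R' hR' hle hδ
  obtain ⟨δ, hδd⟩ : ∃ δ, δ = ‖R - R'‖ := ⟨_, rfl⟩
  have hδ0 : 0 ≤ δ := hδd ▸ norm_nonneg _
  rw [← hδd] at hδ
  have hδ1 : δ * C₁ ≤ 1 / 2 := by
    have h1 : δ * (2 * (C₁ + 1)) ≤ 1 :=
      (le_div_iff₀ (by positivity)).1 (hδ.trans (min_le_left _ _))
    nlinarith
  have hδ2 : 4 * (δ * C₁ * C₁) ≤ ε := by
    have h1 : δ * (4 * (C₁ + 1) * (C₁ + 1)) ≤ ε :=
      (le_div_iff₀ (by positivity)).1 (hδ.trans (min_le_right _ _))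
    nlinarith [mul_nonneg hδ0 hC₁0]
  have hL := kext_isLagrangian h (isLagrangian_map_graphNeg hg hR) V
  have hL' := kext_isLagrangian h (isLagrangian_map_graphNeg hg hR') V
  refine (IsLagrangian.norm_starProjection_sub_le hL' hL (ε := 2 * (δ * C₁ * C₁))
    (by positivity) ?_).trans (by linarith)
  rintro z ⟨l, hl, v, hv, hlv, rfl⟩ z' ⟨l', hl', v', hv', hlv', rfl⟩
  obtain ⟨η, rfl⟩ := mem_map_graphNeg.1 hl
  obtain ⟨η₀, rfl⟩ := mem_map_graphNeg.1 hl'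
  -- The defect between the two graphs at η. Pairing a vector of the extension of graph R' with one
  -- of the extension of graph R yields -⟨m, ζ⟩, so everything reduces to |m| ≤ const · δ |z|. There
  -- is no a priori bound on η, because the representation of z need not be unique.
  obtain ⟨m, hm⟩ : ∃ m, m = (R - R') η := ⟨_, rfl⟩
  have hpair (ζ : Vec n) (ν : H) (hν : ν ∈ V)
      (hζ : ∀ w ∈ V, sympl (graphParam g R ζ) (Y w) + s ν w = 0) :
      sympl (graphParam g R' η + Y v) (graphParam g R ζ + Y ν) = -⟪m, ζ⟫_ℝ := by
    rw [h.sympl_eq hv hν hlv hζ, sympl_graphParam hg hR', hm]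
    simp only [sub_apply, inner_sub_left, inner_sub_right, hR, hR']
    ring
  -- The vector z' satisfies its constraint exactly, so the defect bound is 0 and a representative
  -- with momentum bounded by a multiple of |z'| exists.
  obtain ⟨ζ', ν', hν', hz1, hz2, hζ'⟩ := hC η₀ v' hv' 0 le_rfl
    fun w hw => by rw [hlv' w hw, abs_zero, zero_mul]
  rw [add_zero] at hζ'
  rw [← hz1] at hζ' ⊢
  rw [hpair ζ' ν' hν' fun w hw => by rw [hz2 w hw, hlv' w hw], abs_neg]
  obtain ⟨z, hz⟩ : ∃ z, z = graphParam g R' η + Y v := ⟨_, rfl⟩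
  have hzm : graphParam g R η + Y v = z - g0 m := by
    rw [hz, hshift R', hm]
    abel
  have hfun (w : H) (hw : w ∈ V) : sympl (graphParam g R η) (Y w) + s v w = -sympl (g0 m) (Y w) := by
    have := hlv w hw
    rw [hshift R', sympl_add_left, ← hm] at this
    linarith
  obtain ⟨η₁, v₁, hv₁, hT1, hT2, hη₁⟩ := hC η v hv (G * ‖m‖ * B) (by positivity) fun w hw => by
    rw [hfun w hw, abs_neg]
    calc |sympl (g0 m) (Y w)| ≤ ‖g0 m‖ * ‖Y w‖ := abs_sympl_le _ _
      _ ≤ (G * ‖m‖) * (B * ‖w‖) :=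
        mul_le_mul (hG m) (hB ⟨w, hw⟩) (norm_nonneg _) (by positivity)
      _ = _ := by ring
  -- The ambiguity of η is harmless: the difference of the two representations solves the constraint
  -- for R and represents the zero vector, so its pairing with z, which is -⟨m, η - η₁⟩, vanishes.
  have hmη : ⟪m, η⟫_ℝ = ⟪m, η₁⟫_ℝ := by
    have h4 := hpair (η - η₁) (v - v₁) (sub_mem hv hv₁) fun w hw => by
      rw [map_sub, map_sub, sympl_sub_left, LinearMap.sub_apply]
      linarith [hT2 w hw]
    have h5 : graphParam g R (η - η₁) + Y (v - v₁) = 0 := by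
      rw [map_sub, map_sub, ← sub_eq_zero.2 hT1.symm]
      abel
    rw [h5, sympl_zero_right, inner_sub_right] at h4
    linarith
  have hη₁n : ‖η₁‖ ≤ C₁ * (‖z‖ + ‖m‖) := by
    refine (hη₁.trans (mul_le_mul_of_nonneg_left ?_ hC0)).trans
      (hC₁ ‖z‖ ‖m‖ (norm_nonneg _) (norm_nonneg _))
    rw [hzm]
    linarith [norm_sub_le z (g0 m), hG m]
  -- The only use of R' ≤ R. Combined with the bounded substitute η₁ it gives |m|² ≤ δ |m| C₁ (|z| +
  -- |m|).
  have hm2 : ‖m‖ ^ 2 ≤ δ * ⟪m, η⟫_ℝ := by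
    rw [real_inner_comm, hδd, hm]
    refine norm_apply_sq_le_of_nonneg (T := R - R') (fun a b => ?_) (fun a => ?_) η
    · simp only [sub_apply, inner_sub_left, inner_sub_right, hR, hR']
    · rw [sub_apply, inner_sub_right]
      linarith [hle a]
  have hm3 : ‖m‖ ≤ 2 * (δ * C₁ * ‖z‖) := by
    rcases (norm_nonneg m).eq_or_lt with h0 | h0
    · rw [← h0]; positivity
    · have h1 : ⟪m, η⟫_ℝ ≤ ‖m‖ * (C₁ * (‖z‖ + ‖m‖)) := by
        rw [hmη]
        exact (real_inner_le_norm _ _).trans (mul_le_mul_of_nonneg_left hη₁n h0.le)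
      have h2 : ‖m‖ * ‖m‖ ≤ ‖m‖ * (δ * C₁ * (‖z‖ + ‖m‖)) := by
        have := mul_le_mul_of_nonneg_left h1 hδ0
        nlinarith
      have h3 := le_of_mul_le_mul_left h2 h0
      nlinarith
  rw [← hz]
  calc |⟪m, ζ'⟫_ℝ| ≤ ‖m‖ * ‖ζ'‖ := abs_real_inner_le_norm _ _
    _ ≤ (2 * (δ * C₁ * ‖z‖)) * (C₁ * ‖graphParam g R ζ' + Y ν'‖) :=
      mul_le_mul hm3 (hζ'.trans (mul_le_mul_of_nonneg_right hCC₁ (norm_nonneg _)))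
        (norm_nonneg _) (by positivity)
    _ = _ := by ring

end Continuity

end OptControl

namespace OptControl

/-! ### Abstract additivity for forms of finite negative index. -/

section Additivity

variable {n : ℕ}

/-- The vertical Lagrangian subspace. -/
def vert (n : ℕ) : Submodule ℝ (Phase n) where
  carrier := {z | z.snd = 0}
  zero_mem' := rfl
  add_mem' := by
    intro a b (ha : _ = _) (hb : _ = _)
    change a.snd + b.snd = 0
    rw [ha, hb, add_zero]
  smul_mem' := by
    intro c a (ha : _ = _)
    change c • a.snd = 0
    rw [ha, smul_zero]

lemma mem_vert {z : Phase n} : z ∈ vert n ↔ z.snd = 0 := Iff.rfl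

lemma vert_isLagrangian : IsLagrangian (vert n) := by
  refine isLagrangian_of_le_finrank (fun z hz w hw => ?_) ?_
  · rw [mem_vert] at hz hw
    rw [sympl, hz, hw, inner_zero_right, inner_zero_right, sub_zero]
  · let f : Vec n →ₗ[ℝ] Phase n :=
      (WithLp.linearEquiv 2 ℝ (Vec n × Vec n)).symm.toLinearMap ∘ₗ LinearMap.inl ℝ (Vec n) (Vec n)
    have hinj : Function.Injective f := fun a b hab => congrArg WithLp.fst hab
    have : LinearMap.range f ≤ vert n := by
      rintro _ ⟨η, rfl⟩
      rfl
    have h := Submodule.finrank_mono this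
    rw [LinearMap.finrank_range_of_inj hinj] at h
    simpa using h

/-- Convergence of a family of subspaces indexed by the finite-dimensional subspaces of `H`, along
the finite-dimensional subspaces of `W`. -/
def ConvAlong {H : Type*} [AddCommGroup H] [Module ℝ H] (W : Submodule ℝ H)
    (L : Submodule ℝ H → Submodule ℝ (Phase n)) (Λ : Submodule ℝ (Phase n)) : Prop :=
  ∀ ε > 0, ∃ V₀ ≤ W, FiniteDimensional ℝ V₀ ∧ ∀ V : Submodule ℝ H, FiniteDimensional ℝ V →
    V₀ ≤ V → ‖(L V).starProjection - Λ.starProjection‖ ≤ ε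

section Prod

variable {H₁ H₂ : Type*} [AddCommGroup H₁] [Module ℝ H₁] [AddCommGroup H₂] [Module ℝ H₂]

/-- The form of the concatenation of two problems. -/
noncomputable def prodForm (Y₁ : H₁ →ₗ[ℝ] Phase n) (s₁ : H₁ →ₗ[ℝ] H₁ →ₗ[ℝ] ℝ) (Y₂ : H₂ →ₗ[ℝ] Phase n)
    (s₂ : H₂ →ₗ[ℝ] H₂ →ₗ[ℝ] ℝ) : H₁ × H₂ →ₗ[ℝ] H₁ × H₂ →ₗ[ℝ] ℝ :=
  s₁.compl₁₂ (LinearMap.fst ℝ H₁ H₂) (LinearMap.fst ℝ H₁ H₂) +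
    s₂.compl₁₂ (LinearMap.snd ℝ H₁ H₂) (LinearMap.snd ℝ H₁ H₂) +
    (symplL n).compl₁₂ (Y₁ ∘ₗ LinearMap.fst ℝ H₁ H₂) (Y₂ ∘ₗ LinearMap.snd ℝ H₁ H₂)

lemma prodForm_apply (Y₁ : H₁ →ₗ[ℝ] Phase n) (s₁ : H₁ →ₗ[ℝ] H₁ →ₗ[ℝ] ℝ)
    (Y₂ : H₂ →ₗ[ℝ] Phase n) (s₂ : H₂ →ₗ[ℝ] H₂ →ₗ[ℝ] ℝ) (v w : H₁ × H₂) :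
    prodForm Y₁ s₁ Y₂ s₂ v w = s₁ v.1 w.1 + s₂ v.2 w.2 + sympl (Y₁ v.1) (Y₂ w.2) := rfl

lemma Compatible.prod {Y₁ : H₁ →ₗ[ℝ] Phase n} {s₁ : H₁ →ₗ[ℝ] H₁ →ₗ[ℝ] ℝ}
    {Y₂ : H₂ →ₗ[ℝ] Phase n} {s₂ : H₂ →ₗ[ℝ] H₂ →ₗ[ℝ] ℝ} (h₁ : Compatible Y₁ s₁)
    (h₂ : Compatible Y₂ s₂) : Compatible (Y₁.coprod Y₂) (prodForm Y₁ s₁ Y₂ s₂) := by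
  intro v w
  simp only [prodForm_apply, LinearMap.coprod_apply, sympl_add_left, sympl_add_right,
    ← h₁ v.1 w.1, ← h₂ v.2 w.2]
  rw [sympl_swap (Y₁ w.1)]
  ring

/-- Testing the joint constraint on (w, 0) and on (0, w) decouples it into the two successive ones.
The mixed term σ(Y₁v₁, Y₂w₂) is exactly what turns l into l + Y₁v₁ in the second. -/
lemma kext_prod (Λ : Submodule ℝ (Phase n)) (Y₁ : H₁ →ₗ[ℝ] Phase n) (s₁ : H₁ →ₗ[ℝ] H₁ →ₗ[ℝ] ℝ)
    (Y₂ : H₂ →ₗ[ℝ] Phase n) (s₂ : H₂ →ₗ[ℝ] H₂ →ₗ[ℝ] ℝ) (V₁ : Submodule ℝ H₁)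
    (V₂ : Submodule ℝ H₂) :
    kext Λ (Y₁.coprod Y₂) (prodForm Y₁ s₁ Y₂ s₂) (V₁.prod V₂) =
      kext (kext Λ Y₁ s₁ V₁) Y₂ s₂ V₂ := by
  ext z
  constructor
  · rintro ⟨l, hl, v, hv, h, rfl⟩
    refine ⟨l + Y₁ v.1, ⟨l, hl, v.1, hv.1, fun w hw => ?_, rfl⟩, v.2, hv.2, fun w hw => ?_, ?_⟩
    · simpa [prodForm_apply] using h (w, 0) ⟨hw, zero_mem _⟩
    · have := h (0, w) ⟨zero_mem _, hw⟩
      simp only [prodForm_apply, LinearMap.coprod_apply, map_zero, zero_add] at this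
      rw [sympl_add_left]
      linarith
    · rw [LinearMap.coprod_apply, add_assoc]
  · rintro ⟨_, ⟨l, hl, v₁, hv₁, h₁, rfl⟩, v₂, hv₂, h₂, rfl⟩
    refine ⟨l, hl, (v₁, v₂), ⟨hv₁, hv₂⟩, fun w hw => ?_, ?_⟩
    · have e1 := h₁ w.1 hw.1
      have e2 := h₂ w.2 hw.2
      simp only [prodForm_apply, LinearMap.coprod_apply, sympl_add_right]
      rw [sympl_add_left] at e2
      linarith
    · rw [LinearMap.coprod_apply, add_assoc]

end Prod

section Single

variable {H : Type*} [NormedAddCommGroup H] [NormedSpace ℝ H]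

/-- A vertical l is a free momentum, which can be eliminated. The extension of the vertical subspace
is thereby an 𝓛-derivative with differential (Y·).snd and form s - ⟨(Y·).fst, (Y·).snd⟩. -/
lemma mem_kext_vert {Y : H →ₗ[ℝ] Phase n} {s : H →ₗ[ℝ] H →ₗ[ℝ] ℝ} {V : Submodule ℝ H}
    {z : Phase n} : z ∈ kext (vert n) Y s V ↔ ∃ v ∈ V, z.snd = (Y v).snd ∧
      ∀ w ∈ V, ⟪z.fst, (Y w).snd⟫_ℝ + (s v w - ⟪(Y v).fst, (Y w).snd⟫_ℝ) = 0 := by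
  constructor
  · rintro ⟨l, hl, v, hv, h, rfl⟩
    rw [mem_vert] at hl
    refine ⟨v, hv, by rw [WithLp.add_snd, hl, zero_add], fun w hw => ?_⟩
    have := h w hw
    rw [sympl, hl, inner_zero_right, sub_zero] at this
    rw [WithLp.add_fst, inner_add_left]
    linarith
  · rintro ⟨v, hv, h1, h2⟩
    have hl : (z - Y v).snd = 0 := by rw [WithLp.sub_snd, h1, sub_self]
    refine ⟨z - Y v, hl, v, hv, fun w hw => ?_, (sub_add_cancel _ _).symm⟩
    rw [sympl, hl, inner_zero_right, sub_zero, WithLp.sub_fst, inner_sub_left]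
    linarith [h2 w hw]

/-- The form s - ⟨(Y·).fst, (Y·).snd⟩ is symmetric precisely by compatibility. On the kernel of
(Y·).snd it has the same quadratic form as s, so the index bound carries over. -/
lemma exists_graph_form_kext (Y : H →ₗ[ℝ] Phase n) (s : H →ₗ[ℝ] H →ₗ[ℝ] ℝ) (h : Compatible Y s)
    (hY : Continuous Y) (hs : Continuous fun p : H × H => s p.1 p.2)
    (W : Submodule ℝ H) (hW : Dense (W : Set H)) (N : ℕ)
    (hN : ∀ V ≤ W, FiniteDimensional ℝ V → (∀ v ∈ V, (Y v).snd = 0) →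
      (∀ v ∈ V, v ≠ 0 → s v v < 0) → Module.finrank ℝ V ≤ N) :
    ∃ (g : Phase n ≃ₗ[ℝ] Phase n) (R : Vec n →L[ℝ] Vec n),
      (∀ z w, sympl (g z) (g w) = sympl z w) ∧ (∀ a b, ⟪R a, b⟫_ℝ = ⟪a, R b⟫_ℝ) ∧
      ∀ ε > 0, ∃ V₀ ≤ W, FiniteDimensional ℝ V₀ ∧
        ∀ V : Submodule ℝ H, FiniteDimensional ℝ V → V₀ ≤ V →
        ∃ R' : Vec n →L[ℝ] Vec n, (∀ a b, ⟪R' a, b⟫_ℝ = ⟪a, R' b⟫_ℝ) ∧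
          (∀ a, ⟪a, R' a⟫_ℝ ≤ ⟪a, R a⟫_ℝ) ∧ ‖R - R'‖ ≤ ε ∧
          kext (vert n) Y s V = (graphNeg R').map (g : Phase n →ₗ[ℝ] Phase n) := by
  let pf : Phase n →ₗ[ℝ] Vec n :=
    LinearMap.fst ℝ (Vec n) (Vec n) ∘ₗ (WithLp.linearEquiv 2 ℝ (Vec n × Vec n)).toLinearMap
  let ps : Phase n →ₗ[ℝ] Vec n :=
    LinearMap.snd ℝ (Vec n) (Vec n) ∘ₗ (WithLp.linearEquiv 2 ℝ (Vec n × Vec n)).toLinearMap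
  have hpf : Continuous pf := phase_continuous pf
  have hps : Continuous ps := phase_continuous ps
  let Q : H →ₗ[ℝ] H →ₗ[ℝ] ℝ := s - (innerₗ (Vec n)).compl₁₂ (pf ∘ₗ Y) (ps ∘ₗ Y)
  have hQ (v w : H) : Q v w = s v w - ⟪(Y v).fst, (Y w).snd⟫_ℝ := rfl
  refine exists_graph_form (ps ∘ₗ Y) Q (fun v w => ?_) (hps.comp hY) ?_
    (fun V => kext (vert n) Y s V) (fun V z => mem_kext_vert)
    (fun V hV => kext_isLagrangian h vert_isLagrangian V) W hW N fun V hVW hfd h0 hneg => ?_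
  · have := h v w
    rw [sympl] at this
    rw [hQ, hQ]
    linarith
  · exact hs.sub ((hpf.comp (hY.comp continuous_fst)).inner (hps.comp (hY.comp continuous_snd)))
  · refine hN V hVW hfd h0 fun v hv hv0 => ?_
    have := hneg v hv hv0
    rw [hQ, show (Y v).snd = 0 from h0 v hv, inner_zero_right, sub_zero] at this
    exact this

lemma kext_bot (Λ : Submodule ℝ (Phase n)) (Y : H →ₗ[ℝ] Phase n) (s : H →ₗ[ℝ] H →ₗ[ℝ] ℝ) :
    kext Λ Y s ⊥ = Λ := by
  ext z
  constructor
  · rintro ⟨l, hl, v, hv, -, rfl⟩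
    rw [(Submodule.mem_bot ℝ).1 hv, map_zero, add_zero]
    exact hl
  · intro hz
    refine ⟨z, hz, 0, zero_mem _, fun w hw => ?_, by rw [map_zero, add_zero]⟩
    rw [(Submodule.mem_bot ℝ).1 hw, map_zero, map_zero, sympl_zero_right, add_zero]

/-- Convergence of the graphs themselves is the case of `kext_graph_continuous` without additional
variations. -/
lemma convAlong_of_graph_form {W : Submodule ℝ H} {L : Submodule ℝ H → Submodule ℝ (Phase n)}
    {g : Phase n ≃ₗ[ℝ] Phase n} (hg : ∀ z w, sympl (g z) (g w) = sympl z w)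
    {R : Vec n →L[ℝ] Vec n} (hR : ∀ a b, ⟪R a, b⟫_ℝ = ⟪a, R b⟫_ℝ)
    (hL : ∀ ε > 0, ∃ V₀ ≤ W, FiniteDimensional ℝ V₀ ∧
        ∀ V : Submodule ℝ H, FiniteDimensional ℝ V → V₀ ≤ V →
        ∃ R' : Vec n →L[ℝ] Vec n, (∀ a b, ⟪R' a, b⟫_ℝ = ⟪a, R' b⟫_ℝ) ∧
          (∀ a, ⟪a, R' a⟫_ℝ ≤ ⟪a, R a⟫_ℝ) ∧ ‖R - R'‖ ≤ ε ∧
          L V = (graphNeg R').map (g : Phase n →ₗ[ℝ] Phase n)) :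
    ConvAlong W L ((graphNeg R).map (g : Phase n →ₗ[ℝ] Phase n)) := by
  intro ε hε
  obtain ⟨δ, hδ, h⟩ := kext_graph_continuous hg hR (Y := (0 : H →ₗ[ℝ] Phase n))
    (s := (0 : H →ₗ[ℝ] H →ₗ[ℝ] ℝ)) (fun v w => by simp) ⊥ hε
  obtain ⟨V₀, hV₀, hfd, hV⟩ := hL δ hδ
  refine ⟨V₀, hV₀, hfd, fun V hVf hVV => ?_⟩
  obtain ⟨R', hs, hle, hd, he⟩ := hV V hVf hVV
  have := h R' hs hle hd
  rwa [kext_bot, kext_bot, ← he] at this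

end Single

section Main

variable {H₁ H₂ : Type*} [NormedAddCommGroup H₁] [NormedSpace ℝ H₁] [NormedAddCommGroup H₂]
  [NormedSpace ℝ H₂]

/-- For a fixed V, the extension of the vertical subspace by V₁ × V is close to Λ₂ as soon as it
contains the threshold subspace of the full problem. By `kext_prod` it is also the extension by V of
the Jacobi space over V₁, which is close to that of Λ₁ for large V₁. The triangle inequality
concludes. -/
theorem additivity_of_negIndex (Y₁ : H₁ →ₗ[ℝ] Phase n) (s₁ : H₁ →ₗ[ℝ] H₁ →ₗ[ℝ] ℝ)
    (h₁ : Compatible Y₁ s₁) (Y₂ : H₂ →ₗ[ℝ] Phase n) (s₂ : H₂ →ₗ[ℝ] H₂ →ₗ[ℝ] ℝ)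
    (h₂ : Compatible Y₂ s₂) (hY₁ : Continuous Y₁) (hY₂ : Continuous Y₂)
    (hs₁ : Continuous fun p : H₁ × H₁ => s₁ p.1 p.2)
    (hs₂ : Continuous fun p : H₂ × H₂ => s₂ p.1 p.2)
    (W₁ : Submodule ℝ H₁) (hW₁ : Dense (W₁ : Set H₁))
    (W : Submodule ℝ (H₁ × H₂)) (hW : Dense (W : Set (H₁ × H₂))) (hWW : ∀ w ∈ W₁, (w, 0) ∈ W)
    (N : ℕ) (hN : ∀ V ≤ W, FiniteDimensional ℝ V → (∀ v ∈ V, (Y₁.coprod Y₂ v).snd = 0) →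
      (∀ v ∈ V, v ≠ 0 → prodForm Y₁ s₁ Y₂ s₂ v v < 0) → Module.finrank ℝ V ≤ N) :
    ∃ Λ₁ Λ₂ : Submodule ℝ (Phase n), IsLagrangian Λ₁ ∧ IsLagrangian Λ₂ ∧
      ConvAlong W₁ (kext (vert n) Y₁ s₁) Λ₁ ∧
      ConvAlong W (kext (vert n) (Y₁.coprod Y₂) (prodForm Y₁ s₁ Y₂ s₂)) Λ₂ ∧
      ConvAlong ⊤ (kext Λ₁ Y₂ s₂) Λ₂ := by
  have hs : Continuous fun p : (H₁ × H₂) × (H₁ × H₂) => prodForm Y₁ s₁ Y₂ s₂ p.1 p.2 := by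
    simp only [prodForm_apply, sympl_eq_inner]
    have e1 : Continuous fun p : (H₁ × H₂) × (H₁ × H₂) => s₁ p.1.1 p.2.1 :=
      hs₁.comp ((continuous_fst.comp continuous_fst).prodMk (continuous_fst.comp continuous_snd))
    have e2 : Continuous fun p : (H₁ × H₂) × (H₁ × H₂) => s₂ p.1.2 p.2.2 :=
      hs₂.comp ((continuous_snd.comp continuous_fst).prodMk (continuous_snd.comp continuous_snd))
    have hJ : Continuous (symplJ n) := phase_continuous _
    exact (e1.add e2).add ((hY₁.comp (continuous_fst.comp continuous_fst)).inner
      (hJ.comp (hY₂.comp (continuous_snd.comp continuous_snd))))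
  have hY : Continuous (Y₁.coprod Y₂) := by
    have : Continuous fun p : H₁ × H₂ => Y₁ p.1 + Y₂ p.2 :=
      (hY₁.comp continuous_fst).add (hY₂.comp continuous_snd)
    exact this
  -- The index of the first problem is bounded by that of the whole one: extending variations by
  -- zero preserves both the constraint and the form.
  obtain ⟨g₁, R₁, hg₁, hR₁, hL₁⟩ := exists_graph_form_kext Y₁ s₁ h₁ hY₁ hs₁ W₁ hW₁ N
    fun V hVW hfd h0 hneg => by
      rw [(Submodule.equivMapOfInjective (LinearMap.inl ℝ H₁ H₂) LinearMap.inl_injective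
        V).finrank_eq]
      refine hN _ ?_ inferInstance ?_ ?_
      · rintro _ ⟨v, hv, rfl⟩
        exact hWW v (hVW hv)
      · rintro _ ⟨v, hv, rfl⟩
        simpa using h0 v hv
      · rintro _ ⟨v, hv, rfl⟩ hv0
        have : v ≠ 0 := by
          rintro rfl
          simp at hv0
        simpa [prodForm_apply] using hneg v hv this
  obtain ⟨g₂, R₂, hg₂, hR₂, hL₂⟩ := exists_graph_form_kext _ _ (h₁.prod h₂) hY hs W hW N hN
  have hc₂ := convAlong_of_graph_form hg₂ hR₂ hL₂
  refine ⟨_, _, isLagrangian_map_graphNeg hg₁ hR₁, isLagrangian_map_graphNeg hg₂ hR₂,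
    convAlong_of_graph_form hg₁ hR₁ hL₁, hc₂, fun ε hε => ?_⟩
  obtain ⟨V₀, -, hfd₀, hV₀⟩ := hc₂ (ε / 2) (half_pos hε)
  refine ⟨V₀.map (LinearMap.snd ℝ H₁ H₂), le_top, inferInstance, fun V hV hle => ?_⟩
  obtain ⟨δ, hδ, hcont⟩ := kext_graph_continuous hg₁ hR₁ h₂ V (half_pos hε)
  obtain ⟨U₀, -, hU₀f, hU₀⟩ := hL₁ δ hδ
  -- U₀ serves the continuity of the extension by V, and the projection of V₀ ensures that V₀ ≤ V₁ ×
  -- V. The choice may depend on V, since the estimate to be proved does not mention V₁.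
  let V₁ := U₀ ⊔ V₀.map (LinearMap.fst ℝ H₁ H₂)
  have hV₁ : FiniteDimensional ℝ V₁ := inferInstance
  obtain ⟨R', hs', hle', hd', he'⟩ := hU₀ V₁ hV₁ le_sup_left
  have e1 := hcont R' hs' hle' hd'
  have hfin : FiniteDimensional ℝ (V₁.prod V) := by
    have : V₁.prod V ≤ (V₁.map (LinearMap.inl ℝ H₁ H₂)) ⊔ (V.map (LinearMap.inr ℝ H₁ H₂)) := by
      rintro ⟨a, b⟩ ⟨ha, hb⟩
      have : (a, b) = LinearMap.inl ℝ H₁ H₂ a + LinearMap.inr ℝ H₁ H₂ b := by simp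
      rw [this]
      exact add_mem (Submodule.mem_sup_left ⟨a, ha, rfl⟩) (Submodule.mem_sup_right ⟨b, hb, rfl⟩)
    exact Submodule.finiteDimensional_of_le this
  have e2 := hV₀ (V₁.prod V) hfin fun x hx =>
    ⟨Submodule.mem_sup_right ⟨x, hx, rfl⟩, hle ⟨x, hx, rfl⟩⟩
  simp only [kext_prod, he'] at e2
  set A := (kext ((graphNeg R').map (g₁ : Phase n →ₗ[ℝ] Phase n)) Y₂ s₂ V).starProjection
  rw [← dist_eq_norm] at e1 e2 ⊢
  have := dist_triangle_left ((kext ((graphNeg R₁).map (g₁ : Phase n →ₗ[ℝ] Phase n)) Y₂ s₂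
    V).starProjection) (((graphNeg R₂).map (g₂ : Phase n →ₗ[ℝ] Phase n)).starProjection) A
  linarith

end Main

end Additivity

end OptControl

namespace OptControl

/-! ### Positive index, by reversal of momenta. -/

section Reversal

variable {n : ℕ}

/-- Reversal of momenta, an anti-symplectic isometry. -/
noncomputable def reversal (n : ℕ) : Phase n ≃ₗᵢ[ℝ] Phase n where
  toFun z := WithLp.toLp 2 (-z.fst, z.snd)
  invFun z := WithLp.toLp 2 (-z.fst, z.snd)
  left_inv z := Phase.ext (neg_neg _) rfl
  right_inv z := Phase.ext (neg_neg _) rfl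
  map_add' z w := Phase.ext (neg_add _ _) rfl
  map_smul' c z := Phase.ext (smul_neg _ _).symm rfl
  norm_map' z := by
    have : ‖(WithLp.toLp 2 (-z.fst, z.snd) : Phase n)‖ ^ 2 = ‖z‖ ^ 2 := by
      rw [phase_norm_sq, phase_norm_sq]
      simp
    exact (sq_eq_sq₀ (norm_nonneg _) (norm_nonneg _)).1 this

@[simp] lemma reversal_fst (z : Phase n) : (reversal n z).fst = -z.fst := rfl

@[simp] lemma reversal_snd (z : Phase n) : (reversal n z).snd = z.snd := rfl

@[simp] lemma reversal_reversal (z : Phase n) : reversal n (reversal n z) = z :=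
  (reversal n).left_inv z

lemma sympl_reversal (z w : Phase n) : sympl (reversal n z) (reversal n w) = -sympl z w := by
  simp [sympl]
  ring

lemma IsLagrangian.map_reversal {Λ : Submodule ℝ (Phase n)} (h : IsLagrangian Λ) :
    IsLagrangian (Λ.map ((reversal n).toLinearEquiv : Phase n →ₗ[ℝ] Phase n)) := by
  constructor
  · rintro _ ⟨z, hz, rfl⟩ _ ⟨w, hw, rfl⟩
    change sympl (reversal n z) (reversal n w) = 0
    rw [sympl_reversal, h.1 z hz w hw, neg_zero]
  · rw [LinearEquiv.finrank_map_eq, h.2]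

lemma norm_starProjection_map_reversal (L Λ : Submodule ℝ (Phase n)) :
    ‖(L.map ((reversal n).toLinearEquiv : Phase n →ₗ[ℝ] Phase n)).starProjection -
      (Λ.map ((reversal n).toLinearEquiv : Phase n →ₗ[ℝ] Phase n)).starProjection‖ ≤
    ‖L.starProjection - Λ.starProjection‖ := by
  refine ContinuousLinearMap.opNorm_le_bound _ (norm_nonneg _) fun z => ?_
  rw [sub_apply, Submodule.starProjection_map_apply (reversal n) L z,
    Submodule.starProjection_map_apply (reversal n) Λ z, ← map_sub, LinearIsometryEquiv.norm_map,
    ← sub_apply, ← (reversal n).symm.norm_map z]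
  exact ContinuousLinearMap.le_opNorm _ _

/-- Reversal changes the sign of σ, so the constraint survives if Y is reversed and s is replaced by
-s. -/
lemma kext_map_reversal {H : Type*} [AddCommGroup H] [Module ℝ H] (Λ : Submodule ℝ (Phase n))
    (Y : H →ₗ[ℝ] Phase n) (s : H →ₗ[ℝ] H →ₗ[ℝ] ℝ) (V : Submodule ℝ H) :
    kext (Λ.map ((reversal n).toLinearEquiv : Phase n →ₗ[ℝ] Phase n)) Y s V =
      (kext Λ (((reversal n).toLinearEquiv : Phase n →ₗ[ℝ] Phase n) ∘ₗ Y) (-s) V).map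
        ((reversal n).toLinearEquiv : Phase n →ₗ[ℝ] Phase n) := by
  have key (l : Phase n) (v w : H) : sympl (reversal n l) (Y w) + s v w =
      -(sympl l (reversal n (Y w)) + (-s) v w) := by
    have := sympl_reversal l (reversal n (Y w))
    rw [reversal_reversal] at this
    rw [this]
    simp
    ring
  ext z
  constructor
  · rintro ⟨_, ⟨l, hl, rfl⟩, v, hv, h, rfl⟩
    refine ⟨l + reversal n (Y v), ⟨l, hl, v, hv, fun w hw => ?_, rfl⟩, ?_⟩
    · exact neg_eq_zero.1 ((key l v w).symm.trans (h w hw))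
    · change reversal n (l + reversal n (Y v)) = reversal n l + Y v
      rw [map_add, reversal_reversal]
  · rintro ⟨_, ⟨l, hl, v, hv, h, rfl⟩, rfl⟩
    refine ⟨_, ⟨l, hl, rfl⟩, v, hv, fun w hw => ?_, ?_⟩
    · exact (key l v w).trans (neg_eq_zero.2 (h w hw))
    · change reversal n (l + reversal n (Y v)) = reversal n l + Y v
      rw [map_add, reversal_reversal]

lemma vert_map_reversal :
    (vert n).map ((reversal n).toLinearEquiv : Phase n →ₗ[ℝ] Phase n) = vert n := by
  ext z
  constructor
  · rintro ⟨w, hw, rfl⟩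
    exact hw
  · intro hz
    exact ⟨reversal n z, hz, reversal_reversal z⟩

lemma kext_vert_map_reversal {H : Type*} [AddCommGroup H] [Module ℝ H] (Y : H →ₗ[ℝ] Phase n)
    (s : H →ₗ[ℝ] H →ₗ[ℝ] ℝ) (V : Submodule ℝ H) :
    kext (vert n) Y s V =
      (kext (vert n) (((reversal n).toLinearEquiv : Phase n →ₗ[ℝ] Phase n) ∘ₗ Y) (-s) V).map
        ((reversal n).toLinearEquiv : Phase n →ₗ[ℝ] Phase n) := by
  rw [← kext_map_reversal, vert_map_reversal]

lemma Compatible.reversal {H : Type*} [AddCommGroup H] [Module ℝ H] {Y : H →ₗ[ℝ] Phase n}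
    {s : H →ₗ[ℝ] H →ₗ[ℝ] ℝ} (h : Compatible Y s) :
    Compatible (((reversal n).toLinearEquiv : Phase n →ₗ[ℝ] Phase n) ∘ₗ Y) (-s) := by
  intro v w
  have := h v w
  change -s v w - -s w v = sympl (OptControl.reversal n (Y v)) (OptControl.reversal n (Y w))
  rw [sympl_reversal]
  linarith

lemma ConvAlong.map_reversal {H : Type*} [AddCommGroup H] [Module ℝ H] {W : Submodule ℝ H}
    {L L' : Submodule ℝ H → Submodule ℝ (Phase n)} {Λ : Submodule ℝ (Phase n)}
    (h : ConvAlong W L Λ)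
    (hL : ∀ V, L' V = (L V).map ((reversal n).toLinearEquiv : Phase n →ₗ[ℝ] Phase n)) :
    ConvAlong W L' (Λ.map ((reversal n).toLinearEquiv : Phase n →ₗ[ℝ] Phase n)) := by
  intro ε hε
  obtain ⟨V₀, h1, h2, h3⟩ := h ε hε
  refine ⟨V₀, h1, h2, fun V hV hle => ?_⟩
  simp only [hL V]
  exact (norm_starProjection_map_reversal _ _).trans (h3 V hV hle)

variable {H₁ H₂ : Type*} [NormedAddCommGroup H₁] [NormedSpace ℝ H₁] [NormedAddCommGroup H₂]
  [NormedSpace ℝ H₂]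

/-- Replacing s by -s exchanges the inertia indices. Reversal maps the negated problem back and is
an isometry, so it carries limits of subspaces to limits. -/
theorem additivity_of_posIndex (Y₁ : H₁ →ₗ[ℝ] Phase n) (s₁ : H₁ →ₗ[ℝ] H₁ →ₗ[ℝ] ℝ)
    (h₁ : Compatible Y₁ s₁) (Y₂ : H₂ →ₗ[ℝ] Phase n) (s₂ : H₂ →ₗ[ℝ] H₂ →ₗ[ℝ] ℝ)
    (h₂ : Compatible Y₂ s₂) (hY₁ : Continuous Y₁) (hY₂ : Continuous Y₂)
    (hs₁ : Continuous fun p : H₁ × H₁ => s₁ p.1 p.2)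
    (hs₂ : Continuous fun p : H₂ × H₂ => s₂ p.1 p.2)
    (W₁ : Submodule ℝ H₁) (hW₁ : Dense (W₁ : Set H₁))
    (W : Submodule ℝ (H₁ × H₂)) (hW : Dense (W : Set (H₁ × H₂))) (hWW : ∀ w ∈ W₁, (w, 0) ∈ W)
    (N : ℕ) (hN : ∀ V ≤ W, FiniteDimensional ℝ V → (∀ v ∈ V, (Y₁.coprod Y₂ v).snd = 0) →
      (∀ v ∈ V, v ≠ 0 → 0 < prodForm Y₁ s₁ Y₂ s₂ v v) → Module.finrank ℝ V ≤ N) :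
    ∃ Λ₁ Λ₂ : Submodule ℝ (Phase n), IsLagrangian Λ₁ ∧ IsLagrangian Λ₂ ∧
      ConvAlong W₁ (kext (vert n) Y₁ s₁) Λ₁ ∧
      ConvAlong W (kext (vert n) (Y₁.coprod Y₂) (prodForm Y₁ s₁ Y₂ s₂)) Λ₂ ∧
      ConvAlong ⊤ (kext Λ₁ Y₂ s₂) Λ₂ := by
  set ρ := ((reversal n).toLinearEquiv : Phase n →ₗ[ℝ] Phase n) with hρ
  have hρc : Continuous ρ := phase_continuous ρ
  have hco : (ρ ∘ₗ Y₁).coprod (ρ ∘ₗ Y₂) = ρ ∘ₗ (Y₁.coprod Y₂) := by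
    ext v <;> simp
  have hpf : prodForm (ρ ∘ₗ Y₁) (-s₁) (ρ ∘ₗ Y₂) (-s₂) = -prodForm Y₁ s₁ Y₂ s₂ := by
    refine LinearMap.ext fun v => LinearMap.ext fun w => ?_
    rw [LinearMap.neg_apply, LinearMap.neg_apply, prodForm_apply, prodForm_apply]
    change -s₁ v.1 w.1 + -s₂ v.2 w.2 + sympl (reversal n (Y₁ v.1)) (reversal n (Y₂ w.2)) = _
    rw [sympl_reversal]
    ring
  obtain ⟨Λ₁, Λ₂, e1, e2, e3, e4, e5⟩ := additivity_of_negIndex (ρ ∘ₗ Y₁) (-s₁) h₁.reversal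
    (ρ ∘ₗ Y₂) (-s₂) h₂.reversal (hρc.comp hY₁) (hρc.comp hY₂) hs₁.neg hs₂.neg W₁ hW₁ W hW hWW N
    fun V hVW hfd h0 hneg => by
      rw [hco] at h0
      rw [hpf] at hneg
      refine hN V hVW hfd h0 fun v hv hv0 => ?_
      have : -prodForm Y₁ s₁ Y₂ s₂ v v < 0 := hneg v hv hv0
      linarith
  rw [hco, hpf] at e4
  exact ⟨_, _, e1.map_reversal, e2.map_reversal, e3.map_reversal (kext_vert_map_reversal _ _),
    e4.map_reversal (kext_vert_map_reversal _ _), e5.map_reversal (kext_map_reversal _ _ _)⟩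

end Reversal

end OptControl

namespace OptControl

/-! ### Lipschitz curves and their almost everywhere derivatives. -/

section ACDeriv

variable {E F G : Type*} [NormedAddCommGroup E] [NormedSpace ℝ E] [NormedAddCommGroup F]
  [NormedSpace ℝ F] [NormedAddCommGroup G] [NormedSpace ℝ G]

/-- `y` is Lipschitz on `[a, b]` with derivative `y'` almost everywhere. -/
structure ACDeriv (y y' : ℝ → E) (a b : ℝ) : Prop where
  lip : ∃ C, LipschitzOnWith C y (Icc a b)
  deriv : ∀ᵐ τ, τ ∈ Ioo a b → HasDerivAt y (y' τ) τ

lemma MemLp.exists_norm_le {E : Type*} [NormedAddCommGroup E] {α : Type*} [MeasurableSpace α] {μ : Measure α} {f : α → E}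
    (h : MemLp f ∞ μ) : ∃ C, 0 ≤ C ∧ ∀ᵐ τ ∂μ, ‖f τ‖ ≤ C := by
  refine ⟨(eLpNorm f ∞ μ).toReal, ENNReal.toReal_nonneg, ?_⟩
  have h1 := h.2.ne
  rw [eLpNorm_exponent_top] at h1 ⊢
  filter_upwards [ae_le_eLpNormEssSup (f := f) (μ := μ)] with τ hτ
  rw [← toReal_enorm]
  exact ENNReal.toReal_mono h1 hτ

lemma memLp_top_intervalIntegrable {E : Type*} [NormedAddCommGroup E] {a b : ℝ} {f : ℝ → E}
    (h : MemLp f ∞ (volume.restrict (Icc a b))) {c e : ℝ} (hc : c ∈ Icc a b) (he : e ∈ Icc a b) :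
    IntervalIntegrable f volume c e := by
  have h1 : IntegrableOn f (Icc a b) := by
    refine (h.mono_exponent (p := 1) le_top).integrable le_rfl
  exact (h1.mono_set ((uIcc_subset_Icc hc he))).intervalIntegrable

lemma norm_integral_le_of_ae_bound {a b C : ℝ} {f : ℝ → E}
    (h : ∀ᵐ τ ∂(volume.restrict (Icc a b)), ‖f τ‖ ≤ C) {c e : ℝ} (hc : c ∈ Icc a b)
    (he : e ∈ Icc a b) : ‖∫ τ in c..e, f τ‖ ≤ C * |e - c| := by
  refine intervalIntegral.norm_integral_le_of_norm_le_const_ae ?_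
  rw [ae_restrict_iff' measurableSet_Icc] at h
  filter_upwards [h] with τ hτ hm
  exact hτ (uIcc_subset_Icc hc he (uIoc_subset_uIcc hm))

namespace ACDeriv

variable {y y' : ℝ → E} {z z' : ℝ → F} {a b : ℝ}

lemma of_integral [CompleteSpace E] (hm : MemLp y' ∞ (volume.restrict (Icc a b)))
    (h : ∀ τ ∈ Icc a b, y τ = y a + ∫ θ in a..τ, y' θ) : ACDeriv y y' a b := by
  obtain ⟨C, hC0, hC⟩ := MemLp.exists_norm_le hm
  constructor
  · refine ⟨⟨C, hC0⟩, LipschitzOnWith.of_dist_le_mul fun σ hσ τ hτ => ?_⟩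
    have ha : a ∈ Icc a b := ⟨le_rfl, hσ.1.trans hσ.2⟩
    rw [dist_eq_norm, h σ hσ, h τ hτ, add_sub_add_left_eq_sub,
      intervalIntegral.integral_interval_sub_left (memLp_top_intervalIntegrable hm ha hσ)
        (memLp_top_intervalIntegrable hm ha hτ)]
    exact norm_integral_le_of_ae_bound hC hτ hσ
  · rcases le_or_gt a b with hab | hab
    · have h1 := (memLp_top_intervalIntegrable hm (left_mem_Icc.2 hab)
        (right_mem_Icc.2 hab)).ae_hasDerivAt_integral
      rw [uIcc_of_le hab] at h1
      filter_upwards [h1] with τ hτ hτI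
      refine ((hτ (Ioo_subset_Icc_self hτI) a (left_mem_Icc.2 hab)).const_add (y a)).congr_of_eventuallyEq ?_
      filter_upwards [Icc_mem_nhds hτI.1 hτI.2] with σ hσ
      exact h σ hσ
    · filter_upwards with τ hτ
      exact absurd (hτ.1.trans hτ.2) (not_lt.2 hab.le)

lemma congr_deriv {y'' : ℝ → E} (h : ACDeriv y y' a b)
    (h' : ∀ᵐ τ ∂(volume.restrict (Icc a b)), y'' τ = y' τ) : ACDeriv y y'' a b := by
  refine ⟨h.lip, ?_⟩
  rw [ae_restrict_iff' measurableSet_Icc] at h'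
  filter_upwards [h.deriv, h'] with τ h1 h2 hτ
  rw [h2 (Ioo_subset_Icc_self hτ)]
  exact h1 hτ

lemma congr {w : ℝ → E} (h : ACDeriv y y' a b) (h' : EqOn w y (Icc a b)) : ACDeriv w y' a b := by
  constructor
  · obtain ⟨C, hC⟩ := h.lip
    exact ⟨C, fun σ hσ τ hτ => by rw [h' hσ, h' hτ]; exact hC hσ hτ⟩
  · filter_upwards [h.deriv] with τ hd hτ
    exact (hd hτ).congr_of_eventuallyEq (h'.eventuallyEq_of_mem (Icc_mem_nhds hτ.1 hτ.2))

lemma mono {c e : ℝ} (h : ACDeriv y y' a b) (hac : a ≤ c) (heb : e ≤ b) : ACDeriv y y' c e := by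
  obtain ⟨C, hC⟩ := h.lip
  refine ⟨⟨C, hC.mono (Icc_subset_Icc hac heb)⟩, ?_⟩
  filter_upwards [h.deriv] with τ hd hτ
  exact hd (Ioo_subset_Ioo hac heb hτ)

lemma continuousOn (h : ACDeriv y y' a b) : ContinuousOn y (Icc a b) :=
  h.lip.choose_spec.continuousOn

lemma exists_bound (h : ACDeriv y y' a b) : ∃ C, 0 ≤ C ∧ ∀ τ ∈ Icc a b, ‖y τ‖ ≤ C := by
  obtain ⟨C, hC⟩ := isCompact_Icc.exists_bound_of_continuousOn h.continuousOn
  exact ⟨max C 0, le_max_right _ _, fun τ hτ => (hC τ hτ).trans (le_max_left _ _)⟩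

/-- No measurability of y' is assumed: almost everywhere it equals `deriv y`, which is strongly
measurable, and the Lipschitz constant bounds it. Measurability of X and b is later obtained in this
way. -/
lemma memLp [CompleteSpace E] (h : ACDeriv y y' a b) :
    MemLp y' ∞ (volume.restrict (Icc a b)) := by
  obtain ⟨C, hC⟩ := h.lip
  have key : ∀ᵐ τ ∂(volume.restrict (Icc a b)), y' τ = _root_.deriv y τ ∧ ‖y' τ‖ ≤ C := by
    rw [← restrict_Ioo_eq_restrict_Icc, ae_restrict_iff' measurableSet_Ioo]
    filter_upwards [h.deriv] with τ hd hτ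
    refine ⟨(hd hτ).deriv.symm, ?_⟩
    rw [← (hd hτ).deriv]
    exact norm_deriv_le_of_lipschitzOn (Icc_mem_nhds hτ.1 hτ.2) hC
  refine memLp_top_of_bound ?_ C (key.mono fun τ hτ => hτ.2)
  exact (stronglyMeasurable_deriv y).aestronglyMeasurable.congr
    (key.mono fun τ hτ => hτ.1.symm)

/-- The difference of y and the integral of y' is absolutely continuous with derivative zero almost
everywhere, hence constant. -/
lemma eq_integral [CompleteSpace E] (h : ACDeriv y y' a b) {τ : ℝ} (hτ : τ ∈ Icc a b) :
    y τ = y a + ∫ θ in a..τ, y' θ := by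
  have hab := hτ.1.trans hτ.2
  have hm := h.memLp
  have hI : ACDeriv (fun τ => y a + ∫ θ in a..τ, y' θ) y' a b :=
    of_integral hm fun τ hτ => by simp
  obtain ⟨C₁, h₁⟩ := h.lip
  obtain ⟨C₂, h₂⟩ := hI.lip
  have hac := (uIcc_of_le hab ▸ h₁).absolutelyContinuousOnInterval.sub
    (uIcc_of_le hab ▸ h₂).absolutelyContinuousOnInterval
  obtain ⟨c, hc⟩ := hac.const_of_ae_hasDerivAt_zero (by
    have e1 : ∀ᵐ x : ℝ, x ≠ a := by simp [ae_iff, measure_singleton]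
    have e2 : ∀ᵐ x : ℝ, x ≠ b := by simp [ae_iff, measure_singleton]
    filter_upwards [h.deriv, hI.deriv, e1, e2] with x d1 d2 n1 n2 hx
    rw [uIcc_of_le hab] at hx
    have hx' : x ∈ Ioo a b := ⟨lt_of_le_of_ne hx.1 n1.symm, lt_of_le_of_ne hx.2 n2⟩
    simpa using (d1 hx').sub (d2 hx'))
  rw [uIcc_of_le hab] at hc
  have ca := hc a (left_mem_Icc.2 hab)
  have ct := hc τ hτ
  simp only [Pi.sub_apply, intervalIntegral.integral_same, add_zero, sub_self] at ca ct
  rw [← ca] at ct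
  exact sub_eq_zero.1 ct

lemma add {w w' : ℝ → E} (h : ACDeriv y y' a b) (h' : ACDeriv w w' a b) :
    ACDeriv (fun τ => y τ + w τ) (fun τ => y' τ + w' τ) a b := by
  obtain ⟨C₁, h₁⟩ := h.lip
  obtain ⟨C₂, h₂⟩ := h'.lip
  refine ⟨⟨C₁ + C₂, h₁.add h₂⟩, ?_⟩
  filter_upwards [h.deriv, h'.deriv] with τ d1 d2 hτ
  exact (d1 hτ).add (d2 hτ)

lemma clm (L : E →L[ℝ] F) (h : ACDeriv y y' a b) :
    ACDeriv (fun τ => L (y τ)) (fun τ => L (y' τ)) a b := by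
  obtain ⟨C, hC⟩ := h.lip
  refine ⟨⟨‖L‖₊ * C, L.lipschitz.comp_lipschitzOnWith hC⟩, ?_⟩
  filter_upwards [h.deriv] with τ d hτ
  exact L.hasFDerivAt.comp_hasDerivAt τ (d hτ)

lemma neg (h : ACDeriv y y' a b) : ACDeriv (fun τ => -y τ) (fun τ => -y' τ) a b :=
  h.clm (-ContinuousLinearMap.id ℝ E)

lemma sub {w w' : ℝ → E} (h : ACDeriv y y' a b) (h' : ACDeriv w w' a b) :
    ACDeriv (fun τ => y τ - w τ) (fun τ => y' τ - w' τ) a b := by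
  simpa only [sub_eq_add_neg] using h.add h'.neg

lemma const (c : E) : ACDeriv (fun _ => c) (fun _ => 0) a b :=
  ⟨⟨0, (LipschitzWith.const c).lipschitzOnWith⟩, by
    filter_upwards with τ _ using hasDerivAt_const τ c⟩

lemma bilin (B : E →L[ℝ] F →L[ℝ] G) (h : ACDeriv y y' a b) (h' : ACDeriv z z' a b) :
    ACDeriv (fun τ => B (y τ) (z τ)) (fun τ => B (y' τ) (z τ) + B (y τ) (z' τ)) a b := by
  obtain ⟨C₁, h₁⟩ := h.lip
  obtain ⟨C₂, h₂⟩ := h'.lip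
  obtain ⟨M₁, hM₁, b₁⟩ := h.exists_bound
  obtain ⟨M₂, hM₂, b₂⟩ := h'.exists_bound
  constructor
  · refine ⟨NNReal.mk (‖B‖ * (C₁ * M₂ + M₁ * C₂)) (by positivity),
      LipschitzOnWith.of_dist_le_mul fun σ hσ τ hτ => ?_⟩
    have e : B (y σ) (z σ) - B (y τ) (z τ) =
        B (y σ - y τ) (z σ) + B (y τ) (z σ - z τ) := by
      simp
    have d1 := h₁.dist_le_mul σ hσ τ hτ
    have d2 := h₂.dist_le_mul σ hσ τ hτ
    rw [dist_eq_norm] at d1 d2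
    rw [dist_eq_norm, e, NNReal.coe_mk]
    calc _ ≤ ‖B‖ * ‖y σ - y τ‖ * ‖z σ‖ + ‖B‖ * ‖y τ‖ * ‖z σ - z τ‖ :=
          (norm_add_le _ _).trans (add_le_add (B.le_opNorm₂ _ _) (B.le_opNorm₂ _ _))
      _ ≤ ‖B‖ * (C₁ * dist σ τ) * M₂ + ‖B‖ * M₁ * (C₂ * dist σ τ) := by
          gcongr
          · exact b₂ σ hσ
          · exact b₁ τ hτ
      _ = _ := by ring
  · filter_upwards [h.deriv, h'.deriv] with τ d1 d2 hτ
    have := B.hasFDerivAt_of_bilinear (d1 hτ).hasFDerivAt (d2 hτ).hasFDerivAt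
    refine this.hasDerivAt.congr_deriv ?_
    simp [add_comm]

lemma clm_apply {A A' : ℝ → E →L[ℝ] F} (h : ACDeriv A A' a b) (h' : ACDeriv y y' a b) :
    ACDeriv (fun τ => A τ (y τ)) (fun τ => A' τ (y τ) + A τ (y' τ)) a b :=
  h.bilin (ContinuousLinearMap.id ℝ (E →L[ℝ] F)) h'

/-- The inverse of an operator-valued function. -/
lemma inverse [CompleteSpace E] {A A' : ℝ → E →L[ℝ] E} (h : ACDeriv A A' a b)
    (hu : ∀ τ ∈ Icc a b, IsUnit (A τ)) :
    ACDeriv (fun τ => Ring.inverse (A τ))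
      (fun τ => -(Ring.inverse (A τ) * A' τ * Ring.inverse (A τ))) a b := by
  have hc : ContinuousOn (fun τ => Ring.inverse (A τ)) (Icc a b) := by
    intro τ hτ
    obtain ⟨x, hx⟩ := hu τ hτ
    have := NormedRing.inverse_continuousAt x
    rw [hx] at this
    exact this.comp_continuousWithinAt (h.continuousOn τ hτ)
  obtain ⟨M, hM⟩ := isCompact_Icc.exists_bound_of_continuousOn hc
  obtain ⟨C, hC⟩ := h.lip
  constructor
  · refine ⟨NNReal.mk (|M| * C * |M|) (by positivity),
      LipschitzOnWith.of_dist_le_mul fun σ hσ τ hτ => ?_⟩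
    have e : Ring.inverse (A σ) - Ring.inverse (A τ) =
        Ring.inverse (A σ) * (A τ - A σ) * Ring.inverse (A τ) := by
      rw [mul_sub, sub_mul, Ring.inverse_mul_cancel _ (hu σ hσ), one_mul, mul_assoc,
        Ring.mul_inverse_cancel _ (hu τ hτ), mul_one]
    rw [dist_eq_norm, e, NNReal.coe_mk]
    have d1 := hC.dist_le_mul τ hτ σ hσ
    rw [dist_eq_norm, dist_comm] at d1
    calc _ ≤ ‖Ring.inverse (A σ)‖ * ‖A τ - A σ‖ * ‖Ring.inverse (A τ)‖ :=
          (norm_mul_le _ _).trans (mul_le_mul_of_nonneg_right (norm_mul_le _ _) (norm_nonneg _))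
      _ ≤ |M| * (C * dist σ τ) * |M| := by
          gcongr
          · exact (hM σ hσ).trans (le_abs_self M)
          · exact (hM τ hτ).trans (le_abs_self M)
      _ = _ := by ring
  · filter_upwards [h.deriv] with τ d hτ
    obtain ⟨x, hx⟩ := hu τ (Ioo_subset_Icc_self hτ)
    have h1 := hasFDerivAt_ringInverse (𝕜 := ℝ) x
    rw [hx] at h1
    have h2 := h1.comp_hasDerivAt τ (d hτ)
    refine h2.congr_deriv ?_
    rw [← hx, Ring.inverse_unit]
    rfl

end ACDeriv

end ACDeriv

end OptControl

namespace OptControl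

/-! ### Superposition operators on essentially bounded functions. -/

section Nemytskii

universe w

variable {α : Type*} [MeasurableSpace α] {μ : Measure α} [IsFiniteMeasure μ]

omit [IsFiniteMeasure μ] in
lemma Lp_top_ae_norm_le {E : Type*} [NormedAddCommGroup E] (g : Lp E ∞ μ) :
    ∀ᵐ x ∂μ, ‖g x‖ ≤ ‖g‖ := by
  have h := ae_le_eLpNormEssSup (f := g) (μ := μ)
  have h1 := (Lp.memLp g).2.ne
  rw [Lp.norm_def]
  rw [eLpNorm_exponent_top] at h1 ⊢
  filter_upwards [h] with x hx
  rw [← toReal_enorm]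
  exact ENNReal.toReal_mono h1 hx

lemma Lp_top_norm_le {E : Type*} [NormedAddCommGroup E] {g : Lp E ∞ μ} {C : ℝ} (hC : 0 ≤ C)
    (h : ∀ᵐ x ∂μ, ‖g x‖ ≤ C) : ‖g‖ ≤ C := by
  simpa using Lp.norm_le_of_ae_bound hC h

variable {E G : Type w} [NormedAddCommGroup E] [NormedSpace ℝ E] [FiniteDimensional ℝ E]
  [NormedAddCommGroup G] [NormedSpace ℝ G]

omit [IsFiniteMeasure μ] [NormedSpace ℝ G] in
lemma memLp_top_comp {X : Type*} [NormedAddCommGroup X] [ProperSpace X] {f : X → G}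
    (hf : Continuous f) {g : α → X} (hg : MemLp g ∞ μ) : MemLp (fun x => f (g x)) ∞ μ := by
  obtain ⟨C, -, hC⟩ := MemLp.exists_norm_le hg
  obtain ⟨M, hM⟩ := (isCompact_closedBall (0 : X) C).exists_bound_of_continuousOn hf.continuousOn
  refine memLp_top_of_bound (hf.comp_aestronglyMeasurable hg.1) M ?_
  filter_upwards [hC] with x hx
  exact hM _ (mem_closedBall_zero_iff.2 hx)

/-- The superposition operator on bounded functions. -/
noncomputable def nemytskii (f : E → G) (hf : Continuous f) (g : Lp E ∞ μ) : Lp G ∞ μ :=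
  haveI := FiniteDimensional.proper ℝ E
  (memLp_top_comp hf (Lp.memLp g)).toLp

omit [IsFiniteMeasure μ] [NormedSpace ℝ G] in
lemma coeFn_nemytskii (f : E → G) (hf : Continuous f) (g : Lp E ∞ μ) :
    nemytskii f hf g =ᵐ[μ] fun x => f (g x) := MemLp.coeFn_toLp _

/-- In the supremum norm all values stay in a fixed compact ball, on which f' is uniformly
continuous; the pointwise mean value inequality is then uniform. -/
lemma hasFDerivAt_nemytskii (f : E → G) (hf : ContDiff ℝ 1 f) (g : Lp E ∞ μ) :
    HasFDerivAt (nemytskii f hf.continuous : Lp E ∞ μ → Lp G ∞ μ)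
      ((ContinuousLinearMap.id ℝ (E →L[ℝ] G)).holderL μ ∞ ∞ ∞
        (nemytskii (fderiv ℝ f) (hf.continuous_fderiv one_ne_zero) g)) g := by
  have := FiniteDimensional.proper ℝ E
  rw [hasFDerivAt_iff_isLittleO, Asymptotics.isLittleO_iff]
  intro ε hε
  have huc : UniformContinuousOn (fderiv ℝ f) (Metric.closedBall 0 (‖g‖ + 1)) :=
    (isCompact_closedBall _ _).uniformContinuousOn_of_continuous
      (hf.continuous_fderiv one_ne_zero).continuousOn
  obtain ⟨δ, hδ, hd⟩ := Metric.uniformContinuousOn_iff.1 huc ε hε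
  filter_upwards [Metric.ball_mem_nhds g (lt_min hδ one_pos)] with g' hg'
  rw [Metric.mem_ball, dist_eq_norm] at hg'
  refine Lp_top_norm_le (by positivity) ?_
  filter_upwards [Lp_top_ae_norm_le g, Lp_top_ae_norm_le (g' - g), Lp.coeFn_sub g' g,
    coeFn_nemytskii f hf.continuous g, coeFn_nemytskii f hf.continuous g',
    coeFn_nemytskii (fderiv ℝ f) (hf.continuous_fderiv one_ne_zero) g,
    Lp.coeFn_sub (nemytskii f hf.continuous g') (nemytskii f hf.continuous g),
    Lp.coeFn_sub (nemytskii f hf.continuous g' - nemytskii f hf.continuous g)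
      ((ContinuousLinearMap.id ℝ (E →L[ℝ] G)).holderL μ ∞ ∞ ∞
        (nemytskii (fderiv ℝ f) (hf.continuous_fderiv one_ne_zero) g) (g' - g)),
    (ContinuousLinearMap.id ℝ (E →L[ℝ] G)).coeFn_holder (r := ∞)
      (nemytskii (fderiv ℝ f) (hf.continuous_fderiv one_ne_zero) g) (g' - g)]
    with x h1 h2 h3 h4 h5 h6 h7 h8 h9
  rw [h8, Pi.sub_apply, h7, Pi.sub_apply, h4, h5, ContinuousLinearMap.holderL_apply_apply, h9, h6,
    ContinuousLinearMap.id_apply, h3, Pi.sub_apply]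
  rw [h3, Pi.sub_apply] at h2
  have hlt := h2.trans_lt hg'
  refine (((convex_ball (g x) (min δ 1)).norm_image_sub_le_of_norm_fderiv_le'
    (fun z _ => (hf.differentiable one_ne_zero) z) (fun z hz => ?_)
    (Metric.mem_ball_self (lt_min hδ one_pos))
    (by rw [Metric.mem_ball, dist_eq_norm]; exact hlt)).trans
      (mul_le_mul_of_nonneg_left h2 hε.le))
  rw [Metric.mem_ball] at hz
  rw [← dist_eq_norm]
  refine (hd z ?_ (g x) ?_ (hz.trans_le (min_le_left _ _))).le
  · rw [mem_closedBall_zero_iff]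
    have := norm_le_norm_add_norm_sub' z (g x)
    rw [dist_eq_norm] at hz
    linarith [hz.trans_le (min_le_right δ 1)]
  · rw [mem_closedBall_zero_iff]
    linarith

/-- The derivative is the superposition operator of `fderiv ℝ f` followed by a continuous linear
map. The induction must therefore allow all targets G, and E and G share a universe so that E →L[ℝ]
G is again admissible. -/
lemma contDiff_nemytskii_nat (r : ℕ) : ∀ {G : Type w} [NormedAddCommGroup G] [NormedSpace ℝ G]
    (f : E → G) (hf : ContDiff ℝ ∞ f),
      ContDiff ℝ r (nemytskii f hf.continuous : Lp E ∞ μ → Lp G ∞ μ) := by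
  induction r with
  | zero =>
    intro G _ _ f hf
    refine contDiff_zero.2 (continuous_iff_continuousAt.2 fun g => ?_)
    exact (hasFDerivAt_nemytskii f (hf.of_le (by simp)) g).continuousAt
  | succ r ih =>
    intro G _ _ f hf
    have h1 : ContDiff ℝ 1 f := hf.of_le (by simp)
    have h2 : ContDiff ℝ ∞ (fderiv ℝ f) := hf.fderiv_right (by simp)
    refine contDiff_succ_iff_hasFDerivAt.2 ⟨_, ?_, fun g => hasFDerivAt_nemytskii f h1 g⟩
    exact (ContinuousLinearMap.contDiff _).comp (ih (fderiv ℝ f) h2)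

lemma contDiff_nemytskii (f : E → G) (hf : ContDiff ℝ ∞ f) :
    ContDiff ℝ ∞ (nemytskii f hf.continuous : Lp E ∞ μ → Lp G ∞ μ) :=
  contDiff_infty.2 fun r => contDiff_nemytskii_nat r f hf

end Nemytskii

/-! ### Integration as an operator on essentially bounded functions. -/

section Volterra

variable {E : Type*} [NormedAddCommGroup E] [NormedSpace ℝ E] {a b : ℝ}

/-- Integration up to `τ` of a bounded function on `[a, b]`. -/
noncomputable def intL (E : Type*) [NormedAddCommGroup E] [NormedSpace ℝ E] (a b τ : ℝ) :
    Lp E ∞ (volume.restrict (Icc a b)) →L[ℝ] E :=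
  LinearMap.mkContinuous
    { toFun := fun h => ∫ θ in Iic τ, h θ ∂(volume.restrict (Icc a b))
      map_add' := fun g h => by
        have hi (g : Lp E ∞ (volume.restrict (Icc a b))) :
            Integrable g ((volume.restrict (Icc a b)).restrict (Iic τ)) :=
          (((Lp.memLp g).mono_exponent (p := 1) le_top).integrable le_rfl).restrict
        rw [← integral_add (hi g) (hi h)]
        exact integral_congr_ae (ae_restrict_of_ae (Lp.coeFn_add g h))
      map_smul' := fun c h => by
        rw [RingHom.id_apply, ← integral_smul]
        exact integral_congr_ae (ae_restrict_of_ae (Lp.coeFn_smul c h)) }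
    ((volume.restrict (Icc a b)).real univ) fun h => by
      have := norm_setIntegral_le_of_norm_le_const_ae' (μ := volume.restrict (Icc a b))
        (s := Iic τ) (C := ‖h‖) (f := h) (measure_lt_top _ _) (by
          filter_upwards [Lp_top_ae_norm_le h] with x hx _ using hx)
      refine this.trans ?_
      rw [mul_comm]
      exact mul_le_mul_of_nonneg_right (measureReal_mono (subset_univ _)) (norm_nonneg _)

lemma intL_apply {τ : ℝ} (hτ : τ ∈ Icc a b) (h : Lp E ∞ (volume.restrict (Icc a b))) :
    intL E a b τ h = ∫ θ in a..τ, h θ := by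
  change ∫ θ in Iic τ, h θ ∂(volume.restrict (Icc a b)) = _
  rw [intervalIntegral.integral_of_le hτ.1, ← integral_Icc_eq_integral_Ioc,
    Measure.restrict_restrict measurableSet_Iic]
  congr 2
  ext x
  simp only [mem_inter_iff, mem_Iic, mem_Icc]
  exact ⟨fun h => ⟨h.2.1, h.1⟩, fun h => ⟨h.2, h.1, h.2.trans hτ.2⟩⟩

lemma norm_intL_le {τ : ℝ} (hτ : τ ∈ Icc a b) (h : Lp E ∞ (volume.restrict (Icc a b))) :
    ‖intL E a b τ h‖ ≤ (b - a) * ‖h‖ := by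
  rw [intL_apply hτ]
  refine (norm_integral_le_of_ae_bound (Lp_top_ae_norm_le h) ⟨le_rfl, hτ.1.trans hτ.2⟩ hτ).trans ?_
  rw [abs_of_nonneg (sub_nonneg.2 hτ.1), mul_comm]
  exact mul_le_mul_of_nonneg_right (sub_le_sub_right hτ.2 a) (norm_nonneg _)

lemma memLp_intL (h : Lp E ∞ (volume.restrict (Icc a b))) :
    MemLp (fun τ => intL E a b τ h) ∞ (volume.restrict (Icc a b)) := by
  refine memLp_top_of_bound ?_ ((b - a) * ‖h‖) ?_
  · rcases le_or_gt a b with hab | hab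
    · have hc : ContinuousOn (fun τ => ∫ θ in a..τ, h θ) (Icc a b) := by
        have := intervalIntegral.continuousOn_primitive_interval (a := a) (b := b) (f := h)
          (μ := volume) (by
            rw [uIcc_of_le hab]
            exact (((Lp.memLp h).mono_exponent (p := 1) le_top).integrable le_rfl))
        rwa [uIcc_of_le hab] at this
      refine (hc.aestronglyMeasurable measurableSet_Icc).congr ?_
      filter_upwards [ae_restrict_mem measurableSet_Icc] with τ hτ
      exact (intL_apply hτ h).symm
    · generalize (fun τ => intL E a b τ h) = f
      rw [Icc_eq_empty (not_le.2 hab), Measure.restrict_empty]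
      exact aestronglyMeasurable_zero_measure _
  · filter_upwards [ae_restrict_mem measurableSet_Icc] with τ hτ
    exact norm_intL_le hτ h

/-- The operator `h ↦ ∫ₐ h` on bounded functions. -/
noncomputable def volterra (E : Type*) [NormedAddCommGroup E] [NormedSpace ℝ E] (a b : ℝ) :
    Lp E ∞ (volume.restrict (Icc a b)) →L[ℝ] Lp E ∞ (volume.restrict (Icc a b)) :=
  LinearMap.mkContinuous
    { toFun := fun h => (memLp_intL h).toLp
      map_add' := fun g h => by
        rw [← MemLp.toLp_add]
        exact MemLp.toLp_congr _ _ (ae_of_all _ fun τ => map_add _ _ _)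
      map_smul' := fun c h => by
        rw [RingHom.id_apply, ← MemLp.toLp_const_smul]
        exact MemLp.toLp_congr _ _ (ae_of_all _ fun τ => map_smul _ _ _) }
    |b - a| fun h => by
      refine Lp_top_norm_le (by positivity) ?_
      filter_upwards [ae_restrict_mem measurableSet_Icc, (memLp_intL h).coeFn_toLp] with τ hτ h1
      refine (le_of_eq (congrArg norm h1)).trans ((norm_intL_le hτ h).trans ?_)
      exact mul_le_mul_of_nonneg_right (le_abs_self _) (norm_nonneg _)

lemma coeFn_volterra (h : Lp E ∞ (volume.restrict (Icc a b))) :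
    volterra E a b h =ᵐ[volume.restrict (Icc a b)] fun τ => intL E a b τ h :=
  (memLp_intL h).coeFn_toLp

lemma norm_volterra_le (hab : a ≤ b) : ‖volterra E a b‖ ≤ b - a := by
  refine ContinuousLinearMap.opNorm_le_bound _ (sub_nonneg.2 hab) fun h => ?_
  refine Lp_top_norm_le (mul_nonneg (sub_nonneg.2 hab) (norm_nonneg _)) ?_
  filter_upwards [ae_restrict_mem measurableSet_Icc, coeFn_volterra h] with τ hτ h1
  rw [h1]
  exact norm_intL_le hτ h

end Volterra

section FlatFlow

universe w

variable {𝒲 : Type*} [NormedAddCommGroup 𝒲] [NormedSpace ℝ 𝒲] [FiniteDimensional ℝ 𝒲]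
  {E K : Type w} [NormedAddCommGroup E] [NormedSpace ℝ E] [FiniteDimensional ℝ E]
  [NormedAddCommGroup K] [NormedSpace ℝ K] [FiniteDimensional ℝ K] {a b : ℝ}

/-- The pairing of two bounded functions. -/
noncomputable def pairL (K E : Type w) [NormedAddCommGroup E] [NormedSpace ℝ E]
    [NormedAddCommGroup K] [NormedSpace ℝ K] {α : Type*} [MeasurableSpace α] (μ : Measure α) :
    Lp K ∞ μ × Lp E ∞ μ →L[ℝ] Lp (K × E) ∞ μ :=
  ((ContinuousLinearMap.inl ℝ K E).compLpL ∞ μ).coprod ((ContinuousLinearMap.inr ℝ K E).compLpL ∞ μ)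

omit [FiniteDimensional ℝ E] [FiniteDimensional ℝ K] in
lemma coeFn_pairL {α : Type*} [MeasurableSpace α] {μ : Measure α} (u : Lp K ∞ μ) (y : Lp E ∞ μ) :
    pairL K E μ (u, y) =ᵐ[μ] fun x => (u x, y x) := by
  have h1 := (ContinuousLinearMap.inl ℝ K E).coeFn_compLpL (p := ∞) u
  have h2 := (ContinuousLinearMap.inr ℝ K E).coeFn_compLpL (p := ∞) y
  filter_upwards [h1, h2, Lp.coeFn_add ((ContinuousLinearMap.inl ℝ K E).compLpL ∞ μ u)
    ((ContinuousLinearMap.inr ℝ K E).compLpL ∞ μ y)] with x e1 e2 e3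
  change (((ContinuousLinearMap.inl ℝ K E).compLpL ∞ μ u) +
    ((ContinuousLinearMap.inr ℝ K E).compLpL ∞ μ y) : Lp (K × E) ∞ μ) x = _
  rw [e3, Pi.add_apply, e1, e2]
  simp

end FlatFlow

end OptControl

namespace OptControl

section SecondDerivative

variable {E F : Type*} [NormedAddCommGroup E] [NormedSpace ℝ E] [NormedAddCommGroup F]
  [NormedSpace ℝ F]

lemma ContDiffAt.hasFDerivAt_fderiv_apply {f : E → F} {x : E} (h : ContDiffAt ℝ 2 f x) (v : E) :
    HasFDerivAt (fun w => fderiv ℝ f w v) ((fderiv ℝ (fderiv ℝ f) x).flip v) x := by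
  have h1 : ContDiffAt ℝ 1 (fderiv ℝ f) x := h.fderiv_right (m := 1) (by norm_num)
  have h2 := (ContinuousLinearMap.apply ℝ F v).hasFDerivAt.comp x
    (h1.differentiableAt one_ne_zero).hasFDerivAt
  exact h2

lemma ContDiffAt.eventually_hasFDerivAt {f : E → F} {x : E} (h : ContDiffAt ℝ 2 f x) :
    ∀ᶠ w in 𝓝 x, HasFDerivAt f (fderiv ℝ f w) w := by
  filter_upwards [(h.of_le (by norm_num : (1 : ℕ∞ω) ≤ 2)).eventually (by simp)] with w hw
  exact (hw.differentiableAt one_ne_zero).hasFDerivAt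

lemma ContinuousLinearMap.isInvertible_one_sub [CompleteSpace E] {A : E →L[ℝ] E} (h : ‖A‖ < 1) :
    (1 - A).IsInvertible := by
  obtain ⟨x, hx⟩ := isUnit_one_sub_of_norm_lt_one h
  refine ContinuousLinearMap.IsInvertible.of_inverse (g := x.inv) ?_ ?_
  · rw [← hx]
    exact x.mul_inv
  · rw [← hx]
    exact x.inv_mul

end SecondDerivative

/-! ### Twice differentiable dependence on parameters, on short intervals. -/

section FlatFlow

universe w

variable {𝒲 : Type*} [NormedAddCommGroup 𝒲] [NormedSpace ℝ 𝒲] [CompleteSpace 𝒲]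
  {E K : Type w} [NormedAddCommGroup E] [NormedSpace ℝ E] [FiniteDimensional ℝ E]
  [NormedAddCommGroup K] [NormedSpace ℝ K] [FiniteDimensional ℝ K] {a b : ℝ}

/-- The application of operator-valued bounded functions to bounded functions. -/
noncomputable def applyL {α : Type*} [MeasurableSpace α] (X Y : Type*) [NormedAddCommGroup X]
    [NormedSpace ℝ X] [NormedAddCommGroup Y] [NormedSpace ℝ Y] (μ : Measure α) :
    Lp (X →L[ℝ] Y) ∞ μ →L[ℝ] Lp X ∞ μ →L[ℝ] Lp Y ∞ μ :=
  (ContinuousLinearMap.id ℝ (X →L[ℝ] Y)).holderL μ ∞ ∞ ∞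

lemma coeFn_applyL {α : Type*} [MeasurableSpace α] {X Y : Type*} [NormedAddCommGroup X]
    [NormedSpace ℝ X] [NormedAddCommGroup Y] [NormedSpace ℝ Y] {μ : Measure α}
    (p : Lp (X →L[ℝ] Y) ∞ μ) (q : Lp X ∞ μ) : ∀ᵐ θ ∂μ, applyL X Y μ p q θ = p θ (q θ) :=
  ContinuousLinearMap.coeFn_holder _ p q

set_option maxHeartbeats 1000000 in
/-- Differentiable dependence on parameters for `y' = F(u, y)`. -/
theorem exists_flat_flow (hab : a ≤ b) {F : K × E → E} (hF : ContDiff ℝ ∞ F)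
    (U : Lp K ∞ (volume.restrict (Icc a b))) (β : 𝒲 →L[ℝ] Lp K ∞ (volume.restrict (Icc a b)))
    (w₀ : 𝒲) {e : 𝒲 → E} (he : ContDiffAt ℝ 2 e w₀) {y₀ : ℝ → E}
    (hy₀c : ContinuousOn y₀ (Icc a b))
    (hy₀ : ∀ τ ∈ Icc a b, y₀ τ = e w₀ + ∫ θ in a..τ, F ((U + β w₀ : Lp K ∞ _) θ, y₀ θ))
    {C : ℝ} (hC0 : 0 ≤ C) (hC : ∀ᵐ θ ∂(volume.restrict (Icc a b)),
      ‖fderiv ℝ F ((U + β w₀ : Lp K ∞ _) θ, y₀ θ)‖ ≤ C) (hC1 : (b - a) * C < 1) :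
    ∃ h : 𝒲 → Lp E ∞ (volume.restrict (Icc a b)), ContDiffAt ℝ 2 h w₀ ∧
      (∀ᶠ w in 𝓝 w₀, ∀ᵐ θ ∂(volume.restrict (Icc a b)),
        h w θ = F ((U + β w : Lp K ∞ _) θ, e w + intL E a b θ (h w))) ∧
      (∀ τ ∈ Icc a b, e w₀ + intL E a b τ (h w₀) = y₀ τ) ∧
      (∀ v, ∀ᵐ θ ∂(volume.restrict (Icc a b)), fderiv ℝ h w₀ v θ =
        fderiv ℝ F ((U + β w₀ : Lp K ∞ _) θ, y₀ θ)
          (β v θ, fderiv ℝ e w₀ v + intL E a b θ (fderiv ℝ h w₀ v))) ∧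
      (∀ v v', ∀ᵐ θ ∂(volume.restrict (Icc a b)), fderiv ℝ (fderiv ℝ h) w₀ v v' θ =
        fderiv ℝ (fderiv ℝ F) ((U + β w₀ : Lp K ∞ _) θ, y₀ θ)
          (β v θ, fderiv ℝ e w₀ v + intL E a b θ (fderiv ℝ h w₀ v))
          (β v' θ, fderiv ℝ e w₀ v' + intL E a b θ (fderiv ℝ h w₀ v')) +
        fderiv ℝ F ((U + β w₀ : Lp K ∞ _) θ, y₀ θ) (0, fderiv ℝ (fderiv ℝ e) w₀ v v' +
          intL E a b θ (fderiv ℝ (fderiv ℝ h) w₀ v v'))) := by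
  have := FiniteDimensional.proper ℝ E
  have := FiniteDimensional.proper ℝ K
  have hFc : Continuous F := hF.continuous
  have hF1 : ContDiff ℝ 1 F := hF.of_le (by simp)
  have hF' : ContDiff ℝ ∞ (fderiv ℝ F) := hF.fderiv_right (by simp)
  have hF1' : ContDiff ℝ 1 (fderiv ℝ F) := hF'.of_le (by simp)
  let N : Lp (K × E) ∞ (volume.restrict (Icc a b)) → Lp E ∞ (volume.restrict (Icc a b)) := nemytskii F hFc
  let N₁ : Lp (K × E) ∞ (volume.restrict (Icc a b)) → Lp (K × E →L[ℝ] E) ∞ (volume.restrict (Icc a b)) := nemytskii (fderiv ℝ F) hF'.continuous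
  let N₂ : Lp (K × E) ∞ (volume.restrict (Icc a b)) → Lp (K × E →L[ℝ] K × E →L[ℝ] E) ∞ (volume.restrict (Icc a b)) :=
    nemytskii (fderiv ℝ (fderiv ℝ F)) (hF1'.continuous_fderiv one_ne_zero)
  have hNs : ContDiff ℝ ∞ N := contDiff_nemytskii F hF
  let B := applyL (K × E) E (volume.restrict (Icc a b))
  let B₁ := applyL (K × E) (K × E →L[ℝ] E) (volume.restrict (Icc a b))
  have hBc (p : Lp (K × E →L[ℝ] E) ∞ (volume.restrict (Icc a b))) (q : Lp (K × E) ∞ (volume.restrict (Icc a b))) :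
      ∀ᵐ θ ∂(volume.restrict (Icc a b)), B p q θ = p θ (q θ) := coeFn_applyL p q
  have hB₁c (p : Lp (K × E →L[ℝ] K × E →L[ℝ] E) ∞ (volume.restrict (Icc a b))) (q : Lp (K × E) ∞ (volume.restrict (Icc a b))) :
      ∀ᵐ θ ∂(volume.restrict (Icc a b)), B₁ p q θ = p θ (q θ) := coeFn_applyL p q
  have hNd (g) : HasFDerivAt N (B (N₁ g)) g := hasFDerivAt_nemytskii F hF1 g
  have hN₁d (g) : HasFDerivAt N₁ (B₁ (N₂ g)) g := hasFDerivAt_nemytskii (fderiv ℝ F) hF1' g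
  let P := pairL K E (volume.restrict (Icc a b))
  let c := Lp.constL ∞ (volume.restrict (Icc a b)) ℝ (E := E)
  let Vo := volterra E a b
  -- the reference solution
  have hY₀m : MemLp y₀ ∞ (volume.restrict (Icc a b)) := by
    obtain ⟨M, hM⟩ := isCompact_Icc.exists_bound_of_continuousOn hy₀c
    refine memLp_top_of_bound (hy₀c.aestronglyMeasurable measurableSet_Icc) M ?_
    filter_upwards [ae_restrict_mem measurableSet_Icc] with τ hτ using hM τ hτ
  let Y₀ : Lp E ∞ (volume.restrict (Icc a b)) := hY₀m.toLp
  have hY₀ : ∀ᵐ θ ∂(volume.restrict (Icc a b)), Y₀ θ = y₀ θ := hY₀m.coeFn_toLp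
  let g₀ := P (U + β w₀, Y₀)
  have hg₀ : ∀ᵐ θ ∂(volume.restrict (Icc a b)), g₀ θ = ((U + β w₀ : Lp K ∞ (volume.restrict (Icc a b))) θ, y₀ θ) := by
    filter_upwards [hY₀, coeFn_pairL (U + β w₀) Y₀] with θ h1 h2
    rw [← h1]
    exact h2
  have hNg₀ : ∀ᵐ θ ∂(volume.restrict (Icc a b)), N g₀ θ = F ((U + β w₀ : Lp K ∞ (volume.restrict (Icc a b))) θ, y₀ θ) := by
    filter_upwards [hg₀, coeFn_nemytskii F hFc g₀] with θ h1 h2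
    rw [← h1]
    exact h2
  have hint : ∀ τ ∈ Icc a b, e w₀ + intL E a b τ (N g₀) = y₀ τ := by
    intro τ hτ
    rw [hy₀ τ hτ, intL_apply hτ]
    congr 1
    refine intervalIntegral.integral_congr_ae ?_
    rw [ae_restrict_iff' measurableSet_Icc] at hNg₀
    filter_upwards [hNg₀] with θ h1 h2
    rw [uIoc_of_le hτ.1] at h2
    exact h1 ⟨h2.1.le, h2.2.trans hτ.2⟩
  -- the implicit equation
  let Θ : 𝒲 × Lp E ∞ (volume.restrict (Icc a b)) → Lp E ∞ (volume.restrict (Icc a b)) := fun p => p.2 - c (e p.1) - Vo (N (P (U + β p.1, p.2)))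
  have hΘ : ContDiffAt ℝ 2 Θ (w₀, Y₀) := by
    have e1 : ContDiffAt ℝ 2 (fun p : 𝒲 × Lp E ∞ (volume.restrict (Icc a b)) => e p.1) (w₀, Y₀) :=
      ContDiffAt.comp (w₀, Y₀) (f := Prod.fst) (by exact he) contDiffAt_fst
    have e2 : ContDiffAt ℝ 2 (fun p : 𝒲 × Lp E ∞ (volume.restrict (Icc a b)) => P (U + β p.1, p.2)) (w₀, Y₀) := by
      fun_prop
    have e3 : ContDiffAt ℝ 2 (fun p : 𝒲 × Lp E ∞ (volume.restrict (Icc a b)) => N (P (U + β p.1, p.2))) (w₀, Y₀) :=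
      (contDiff_infty.1 hNs 2).contDiffAt.comp (w₀, Y₀) e2
    exact (contDiffAt_snd.sub (c.contDiff.contDiffAt.comp (w₀, Y₀) e1)).sub
      (Vo.contDiff.contDiffAt.comp (w₀, Y₀) e3)
  have hΘ0 : Θ (w₀, Y₀) = 0 := by
    have : Y₀ = c (e w₀) + Vo (N g₀) := by
      refine Lp.ext ?_
      filter_upwards [hY₀, Lp.coeFn_add (c (e w₀)) (Vo (N g₀)), coeFn_volterra (N g₀),
        Lp.coeFn_const (p := ∞) (μ := volume.restrict (Icc a b)) (e w₀), ae_restrict_mem measurableSet_Icc]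
        with θ h1 h2 h3 h4 h5
      rw [h1, h2, Pi.add_apply, h3, ← hint θ h5]
      congr 1
      exact h4.symm
    change Y₀ - c (e w₀) - Vo (N g₀) = 0
    rw [sub_sub, sub_eq_zero]
    exact this
  -- The partial differential of Θ in the curve is 1 - A. The Volterra operator has norm at most b -
  -- a and the linearized field at most C, so ‖A‖ < 1 and the implicit function theorem applies.
  let A : Lp E ∞ (volume.restrict (Icc a b)) →L[ℝ] Lp E ∞ (volume.restrict (Icc a b)) :=
    Vo ∘L B (N₁ g₀) ∘L P ∘L ContinuousLinearMap.inr ℝ (Lp K ∞ (volume.restrict (Icc a b))) (Lp E ∞ (volume.restrict (Icc a b)))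
  have hA : ‖A‖ < 1 := by
    refine lt_of_le_of_lt (ContinuousLinearMap.opNorm_le_bound _
      (mul_nonneg (sub_nonneg.2 hab) hC0) fun Y => ?_) hC1
    have hb : ‖B (N₁ g₀) (P (0, Y))‖ ≤ C * ‖Y‖ := by
      refine Lp_top_norm_le (by positivity) ?_
      filter_upwards [hBc (N₁ g₀) (P (0, Y)), coeFn_nemytskii _ hF'.continuous g₀, hg₀, hC,
        coeFn_pairL (0 : Lp K ∞ (volume.restrict (Icc a b))) Y, Lp.coeFn_zero K ∞ (volume.restrict (Icc a b)), Lp_top_ae_norm_le Y]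
        with θ h1 h2 h3 h4 h5 h6 h7
      have e1 : N₁ g₀ θ = fderiv ℝ F ((U + β w₀ : Lp K ∞ (volume.restrict (Icc a b))) θ, y₀ θ) := by
        rw [← h3]
        exact h2
      have e2 : P (0, Y) θ = (0, Y θ) := by
        rw [h6] at h5
        exact h5
      rw [h1, e1, e2]
      refine (ContinuousLinearMap.le_of_opNorm_le _ h4 _).trans ?_
      refine mul_le_mul_of_nonneg_left ?_ hC0
      rw [Prod.norm_mk, norm_zero]
      exact max_le (norm_nonneg _) h7
    calc ‖A Y‖ ≤ ‖Vo‖ * ‖B (N₁ g₀) (P (0, Y))‖ := Vo.le_opNorm _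
      _ ≤ (b - a) * (C * ‖Y‖) :=
          mul_le_mul (norm_volterra_le hab) hb (norm_nonneg _) (sub_nonneg.2 hab)
      _ = _ := by ring
  have hinv : (fderiv ℝ Θ (w₀, Y₀) ∘L .inr ℝ 𝒲 (Lp E ∞ (volume.restrict (Icc a b)))).IsInvertible := by
    have h1 : HasFDerivAt (fun Y : Lp E ∞ (volume.restrict (Icc a b)) => Θ (w₀, Y))
        (fderiv ℝ Θ (w₀, Y₀) ∘L .inr ℝ 𝒲 (Lp E ∞ (volume.restrict (Icc a b)))) Y₀ :=
      (hΘ.differentiableAt two_ne_zero).hasFDerivAt.comp Y₀ (hasFDerivAt_prodMk_right w₀ Y₀)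
    have h2 : HasFDerivAt (fun Y : Lp E ∞ (volume.restrict (Icc a b)) => Θ (w₀, Y)) (1 - A) Y₀ := by
      have e1 : HasFDerivAt (fun Y : Lp E ∞ (volume.restrict (Icc a b)) => P (U + β w₀, Y)) (P ∘L .inr ℝ _ _) Y₀ :=
        P.hasFDerivAt.comp Y₀ (hasFDerivAt_prodMk_right (U + β w₀) Y₀)
      have e2 : HasFDerivAt (fun Y => N (P (U + β w₀, Y))) (B (N₁ g₀) ∘L P ∘L .inr ℝ _ _) Y₀ :=
        HasFDerivAt.comp (𝕜 := ℝ) (f := fun Y => P (U + β w₀, Y)) Y₀ (hNd g₀) e1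
      have e3 : HasFDerivAt (fun Y => Vo (N (P (U + β w₀, Y)))) A Y₀ :=
        HasFDerivAt.comp (𝕜 := ℝ) (f := fun Y => N (P (U + β w₀, Y))) Y₀
          (Vo.hasFDerivAt (x := N g₀)) e2
      have e4 : HasFDerivAt (fun Y : Lp E ∞ (volume.restrict (Icc a b)) => Y - c (e w₀))
          (1 : Lp E ∞ (volume.restrict (Icc a b)) →L[ℝ] Lp E ∞ (volume.restrict (Icc a b))) Y₀ :=
        (hasFDerivAt_id Y₀).sub_const (c (e w₀))
      exact e4.sub e3
    rw [h1.unique h2]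
    exact ContinuousLinearMap.isInvertible_one_sub hA
  let ψ : 𝒲 → Lp E ∞ (volume.restrict (Icc a b)) := hΘ.implicitFunction two_ne_zero hinv
  have hψ : ContDiffAt ℝ 2 ψ w₀ := hΘ.contDiffAt_implicitFunction two_ne_zero hinv
  have hψ0 : ψ w₀ = Y₀ := hΘ.implicitFunction_apply_self two_ne_zero hinv
  have hψe : ∀ᶠ w in 𝓝 w₀, Θ (w, ψ w) = Θ (w₀, Y₀) :=
    hΘ.eventually_apply_implicitFunction two_ne_zero hinv
  let g : 𝒲 → Lp (K × E) ∞ (volume.restrict (Icc a b)) := fun w => P (U + β w, ψ w)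
  have hg : ContDiffAt ℝ 2 g w₀ :=
    P.contDiff.contDiffAt.comp w₀ ((contDiff_const.add β.contDiff).contDiffAt.prodMk hψ)
  have hgw₀ : g w₀ = g₀ := by
    change P (U + β w₀, ψ w₀) = _
    rw [hψ0]
  -- The velocity instead of the curve ψ: as a class in L^∞ the curve has no values at individual
  -- times, whereas e w + ∫ h w is defined at every τ.
  let h : 𝒲 → Lp E ∞ (volume.restrict (Icc a b)) := fun w => N (g w)
  have hh : ContDiffAt ℝ 2 h w₀ :=
    (contDiff_infty.1 hNs 2).contDiffAt.comp w₀ hg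
  have hψh : ψ =ᶠ[𝓝 w₀] fun w => c (e w) + Vo (h w) := by
    filter_upwards [hψe] with w hw
    rw [hΘ0] at hw
    change ψ w - c (e w) - Vo (h w) = 0 at hw
    rwa [sub_sub, sub_eq_zero] at hw
  have hcv (x : E) (p : Lp E ∞ (volume.restrict (Icc a b))) : ∀ᵐ θ ∂(volume.restrict (Icc a b)), (c x + Vo p : Lp E ∞ (volume.restrict (Icc a b))) θ = x + intL E a b θ p := by
    filter_upwards [Lp.coeFn_add (c x) (Vo p), coeFn_volterra p,
      Lp.coeFn_const (p := ∞) (μ := volume.restrict (Icc a b)) x] with θ h2 h3 h4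
    rw [h2, Pi.add_apply, h3]
    congr 1
  -- first derivatives
  have dψ : ∀ᶠ w in 𝓝 w₀, ∀ v, fderiv ℝ ψ w v = c (fderiv ℝ e w v) + Vo (fderiv ℝ h w v) := by
    filter_upwards [hψh.fderiv (𝕜 := ℝ), ContDiffAt.eventually_hasFDerivAt he,
      ContDiffAt.eventually_hasFDerivAt hh] with w h1 h2 h3 v
    have e1 := (c.hasFDerivAt.comp w h2).add (Vo.hasFDerivAt.comp w h3)
    rw [h1]
    exact DFunLike.congr_fun e1.fderiv v
  have dg : ∀ᶠ w in 𝓝 w₀, ∀ v, fderiv ℝ g w v = P (β v, fderiv ℝ ψ w v) := by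
    filter_upwards [ContDiffAt.eventually_hasFDerivAt hψ] with w h1 v
    have e1 := P.hasFDerivAt.comp w ((β.hasFDerivAt.const_add U).prodMk h1)
    exact DFunLike.congr_fun e1.fderiv v
  have dh : ∀ᶠ w in 𝓝 w₀, ∀ v, fderiv ℝ h w v = B (N₁ (g w)) (fderiv ℝ g w v) := by
    filter_upwards [ContDiffAt.eventually_hasFDerivAt hg] with w h1 v
    have e1 := (hNd (g w)).comp w h1
    exact DFunLike.congr_fun e1.fderiv v
  -- second derivatives
  have d2ψ (v v') : fderiv ℝ (fderiv ℝ ψ) w₀ v v' =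
      c (fderiv ℝ (fderiv ℝ e) w₀ v v') + Vo (fderiv ℝ (fderiv ℝ h) w₀ v v') := by
    have e1 := ContDiffAt.hasFDerivAt_fderiv_apply hψ v'
    have e2 := (c.hasFDerivAt.comp w₀ (ContDiffAt.hasFDerivAt_fderiv_apply he v')).add
      (Vo.hasFDerivAt.comp w₀ (ContDiffAt.hasFDerivAt_fderiv_apply hh v'))
    have e3 := e2.congr_of_eventuallyEq (dψ.mono fun w hw => hw v')
    exact DFunLike.congr_fun (e1.unique e3) v
  have d2g (v v') : fderiv ℝ (fderiv ℝ g) w₀ v v' = P (0, fderiv ℝ (fderiv ℝ ψ) w₀ v v') := by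
    have e1 := ContDiffAt.hasFDerivAt_fderiv_apply hg v'
    have e2 := P.hasFDerivAt.comp w₀ ((hasFDerivAt_const (β v') w₀).prodMk
      (ContDiffAt.hasFDerivAt_fderiv_apply hψ v'))
    have e3 := e2.congr_of_eventuallyEq (dg.mono fun w hw => hw v')
    exact DFunLike.congr_fun (e1.unique e3) v
  have d2h (v v') : fderiv ℝ (fderiv ℝ h) w₀ v v' =
      B (B₁ (N₂ g₀) (fderiv ℝ g w₀ v)) (fderiv ℝ g w₀ v') +
        B (N₁ g₀) (fderiv ℝ (fderiv ℝ g) w₀ v v') := by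
    have e1 := ContDiffAt.hasFDerivAt_fderiv_apply hh v'
    have e2 := B.hasFDerivAt_of_bilinear
      ((hN₁d (g w₀)).comp w₀ (ContDiffAt.eventually_hasFDerivAt hg).self_of_nhds)
      (ContDiffAt.hasFDerivAt_fderiv_apply hg v')
    have e3 := e2.congr_of_eventuallyEq (dh.mono fun w hw => hw v')
    rw [← hgw₀, add_comm]
    exact DFunLike.congr_fun (e1.unique e3) v
  have hdg (v) : ∀ᵐ θ ∂(volume.restrict (Icc a b)), fderiv ℝ g w₀ v θ =
      (β v θ, fderiv ℝ e w₀ v + intL E a b θ (fderiv ℝ h w₀ v)) := by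
    filter_upwards [coeFn_pairL (β v) (fderiv ℝ ψ w₀ v),
      hcv (fderiv ℝ e w₀ v) (fderiv ℝ h w₀ v)] with θ h1 h2
    rw [← h2, ← dψ.self_of_nhds v, dg.self_of_nhds v]
    exact h1
  have hN₁c : ∀ᵐ θ ∂(volume.restrict (Icc a b)), N₁ g₀ θ = fderiv ℝ F ((U + β w₀ : Lp K ∞ (volume.restrict (Icc a b))) θ, y₀ θ) := by
    filter_upwards [coeFn_nemytskii _ hF'.continuous g₀, hg₀] with θ h1 h2
    rw [← h2]
    exact h1
  refine ⟨h, hh, ?_, ?_, fun v => ?_, fun v v' => ?_⟩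
  · filter_upwards [hψh] with w hw
    filter_upwards [coeFn_nemytskii F hFc (g w), coeFn_pairL (U + β w) (ψ w), hcv (e w) (h w)]
      with θ h1 h2 h3
    rw [← h3, ← hw, ← h2]
    exact h1
  · intro τ hτ
    rw [← hint τ hτ, ← hgw₀]
  · filter_upwards [hBc (N₁ g₀) (fderiv ℝ g w₀ v), hdg v, hN₁c] with θ h1 h2 h3
    rw [← h2, ← h3, ← h1, dh.self_of_nhds v, hgw₀]
  · filter_upwards [hBc (N₁ g₀) (fderiv ℝ (fderiv ℝ g) w₀ v v'), hdg v, hdg v', hN₁c,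
      hBc (B₁ (N₂ g₀) (fderiv ℝ g w₀ v)) (fderiv ℝ g w₀ v'),
      hB₁c (N₂ g₀) (fderiv ℝ g w₀ v), coeFn_nemytskii _ (hF1'.continuous_fderiv one_ne_zero) g₀,
      hg₀, Lp.coeFn_add (B (B₁ (N₂ g₀) (fderiv ℝ g w₀ v)) (fderiv ℝ g w₀ v'))
        (B (N₁ g₀) (fderiv ℝ (fderiv ℝ g) w₀ v v')),
      coeFn_pairL (0 : Lp K ∞ (volume.restrict (Icc a b))) (fderiv ℝ (fderiv ℝ ψ) w₀ v v'), Lp.coeFn_zero K ∞ (volume.restrict (Icc a b)),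
      hcv (fderiv ℝ (fderiv ℝ e) w₀ v v') (fderiv ℝ (fderiv ℝ h) w₀ v v')]
      with θ h1 h2 h3 h4 h5 h6 h7 h8 h9 h10 h11 h12
    have e7 : N₂ g₀ θ = fderiv ℝ (fderiv ℝ F) ((U + β w₀ : Lp K ∞ (volume.restrict (Icc a b))) θ, y₀ θ) := by
      rw [← h8]
      exact h7
    have e10 : fderiv ℝ (fderiv ℝ g) w₀ v v' θ = (0, fderiv ℝ (fderiv ℝ ψ) w₀ v v' θ) := by
      rw [d2g]
      rw [h11] at h10
      exact h10
    have key : fderiv ℝ (fderiv ℝ h) w₀ v v' θ =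
        B (B₁ (N₂ g₀) (fderiv ℝ g w₀ v)) (fderiv ℝ g w₀ v') θ +
          N₁ g₀ θ (0, fderiv ℝ (fderiv ℝ ψ) w₀ v v' θ) := by
      rw [d2h v v', h9, Pi.add_apply, h1, e10]
    rw [key, ← h2, ← h3, ← h4, ← e7, ← h6, ← h5, d2ψ v v', h12]

end FlatFlow

end OptControl

namespace OptControl

/-! ### Uniqueness for contracting integral equations. -/

section Gronwall

variable {E : Type*} [NormedAddCommGroup E] [NormedSpace ℝ E] {a b : ℝ}

/-- At a maximum point of |δ| the bound reads |δ| ≤ (b - a) C |δ|. The base point c is arbitrary in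
[a, b], which gives uniqueness backwards in time as well. -/
lemma eq_zero_of_integral_bound {δ g : ℝ → E} {c C : ℝ} (hc : c ∈ Icc a b)
    (hδ : ContinuousOn δ (Icc a b)) (h : ∀ τ ∈ Icc a b, δ τ = ∫ θ in c..τ, g θ) (hC0 : 0 ≤ C)
    (hg : ∀ᵐ θ ∂(volume.restrict (Icc a b)), ‖g θ‖ ≤ C * ‖δ θ‖) (hC : (b - a) * C < 1) :
    ∀ τ ∈ Icc a b, δ τ = 0 := by
  obtain ⟨σ, hσ, hmax⟩ := isCompact_Icc.exists_isMaxOn ⟨c, hc⟩ hδ.norm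
  have hb : ∀ᵐ θ ∂(volume.restrict (Icc a b)), ‖g θ‖ ≤ C * ‖δ σ‖ := by
    filter_upwards [hg, ae_restrict_mem measurableSet_Icc] with θ h1 h2
    exact h1.trans (mul_le_mul_of_nonneg_left (hmax h2) hC0)
  have h1 := norm_integral_le_of_ae_bound hb hc hσ
  rw [← h σ hσ] at h1
  have h2 : |σ - c| ≤ b - a := abs_sub_le_iff.2 ⟨by linarith [hσ.2, hc.1], by linarith [hσ.1, hc.2]⟩
  have h3 : ‖δ σ‖ ≤ (b - a) * C * ‖δ σ‖ := by
    refine h1.trans ?_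
    calc C * ‖δ σ‖ * |σ - c| ≤ C * ‖δ σ‖ * (b - a) := by gcongr
      _ = _ := by ring
  have h4 : ‖δ σ‖ = 0 := by
    by_contra hne
    have : 0 < ‖δ σ‖ := lt_of_le_of_ne (norm_nonneg _) (Ne.symm hne)
    nlinarith
  intro τ hτ
  exact norm_le_zero_iff.1 (h4 ▸ hmax hτ)

end Gronwall

section ControlFamily

variable {𝒲 K : Type*} [NormedAddCommGroup 𝒲] [NormedSpace ℝ 𝒲]
  [NormedAddCommGroup K] [NormedSpace ℝ K]

/-- The controls `u w`, `w ∈ 𝒲`, form an affine family with linear part `β`. -/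
structure ControlFamily (u β : 𝒲 → ℝ → K) (μ : Measure ℝ) : Prop where
  mem_zero : MemLp (u 0) ∞ μ
  mem : ∀ w, MemLp (β w) ∞ μ
  add : ∀ w w', ∀ᵐ τ ∂μ, β (w + w') τ = β w τ + β w' τ
  smul : ∀ (c : ℝ) w, ∀ᵐ τ ∂μ, β (c • w) τ = c • β w τ
  affine : ∀ w, ∀ᵐ τ ∂μ, u w τ = u 0 τ + β w τ

variable {u β : 𝒲 → ℝ → K} {μ : Measure ℝ}

omit [NormedSpace ℝ 𝒲] in
lemma ControlFamily.mono [NormedSpace ℝ 𝒲] {ν : Measure ℝ} (h : ControlFamily u β μ)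
    (hν : ν ≤ μ) : ControlFamily u β ν where
  mem_zero := h.mem_zero.mono_measure hν
  mem w := (h.mem w).mono_measure hν
  add w w' := ae_mono hν (h.add w w')
  smul c w := ae_mono hν (h.smul c w)
  affine w := ae_mono hν (h.affine w)

lemma ControlFamily.mem_control (h : ControlFamily u β μ) (w : 𝒲) : MemLp (u w) ∞ μ := by
  refine (h.mem_zero.add (h.mem w)).ae_eq ?_
  filter_upwards [h.affine w] with τ hτ
  exact hτ.symm

lemma ControlFamily.exists_bound [FiniteDimensional ℝ 𝒲] (h : ControlFamily u β μ) :
    ∃ b : 𝒲 →L[ℝ] Lp K ∞ μ, ∀ w, ∀ᵐ τ ∂μ, b w τ = β w τ := by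
  let b : 𝒲 →ₗ[ℝ] Lp K ∞ μ :=
    { toFun := fun w => (h.mem w).toLp
      map_add' := fun w w' => by
        rw [← MemLp.toLp_add]
        exact MemLp.toLp_congr _ _ (h.add w w')
      map_smul' := fun c w => by
        rw [RingHom.id_apply, ← MemLp.toLp_const_smul]
        exact MemLp.toLp_congr _ _ (h.smul c w) }
  exact ⟨LinearMap.toContinuousLinearMap b, fun w => (h.mem w).coeFn_toLp⟩

end ControlFamily

/-! ### The variational equations for affine families of controls. -/

section FlatFlow

universe w

variable {𝒲 : Type*} [NormedAddCommGroup 𝒲] [NormedSpace ℝ 𝒲] [FiniteDimensional ℝ 𝒲]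
  {E K : Type w} [NormedAddCommGroup E] [NormedSpace ℝ E] [FiniteDimensional ℝ E]
  [NormedAddCommGroup K] [NormedSpace ℝ K] [FiniteDimensional ℝ K] {a b : ℝ}

/-- Along `(u, y₀)`, the first and second derivatives at `w₀` of the family of curves `y` solve on
`[a, b]` the variational equations of `y' = F(u, y)`. -/
structure SolvesVariational (F : K × E → E) (u β : 𝒲 → ℝ → K) (w₀ : 𝒲) (y : 𝒲 → ℝ → E)
    (a b : ℝ) : Prop where
  contDiffAt : ∀ τ ∈ Icc a b, ContDiffAt ℝ 2 (fun w => y w τ) w₀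
  first : ∀ v, ACDeriv (fun τ => fderiv ℝ (fun w => y w τ) w₀ v)
    (fun τ => fderiv ℝ F (u w₀ τ, y w₀ τ) (β v τ, fderiv ℝ (fun w => y w τ) w₀ v)) a b
  second : ∀ v v', ACDeriv (fun τ => fderiv ℝ (fderiv ℝ (fun w => y w τ)) w₀ v v')
    (fun τ => fderiv ℝ (fderiv ℝ F) (u w₀ τ, y w₀ τ)
        (β v τ, fderiv ℝ (fun w => y w τ) w₀ v) (β v' τ, fderiv ℝ (fun w => y w τ) w₀ v') +
      fderiv ℝ F (u w₀ τ, y w₀ τ) (0, fderiv ℝ (fderiv ℝ (fun w => y w τ)) w₀ v v')) a b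

omit [FiniteDimensional ℝ 𝒲] [FiniteDimensional ℝ E] [FiniteDimensional ℝ K] in
lemma SolvesVariational.congr {F : K × E → E} {u β : 𝒲 → ℝ → K} {w₀ : 𝒲} {y z : 𝒲 → ℝ → E}
    (h : SolvesVariational F u β w₀ y a b)
    (hz : ∀ τ ∈ Icc a b, (fun w => z w τ) =ᶠ[𝓝 w₀] fun w => y w τ) :
    SolvesVariational F u β w₀ z a b := by
  have h0 : ∀ τ ∈ Icc a b, z w₀ τ = y w₀ τ := fun τ hτ => (hz τ hτ).self_of_nhds
  have h1 : ∀ τ ∈ Icc a b, fderiv ℝ (fun w => z w τ) w₀ = fderiv ℝ (fun w => y w τ) w₀ :=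
    fun τ hτ => (hz τ hτ).fderiv_eq
  have h2 : ∀ τ ∈ Icc a b, fderiv ℝ (fderiv ℝ (fun w => z w τ)) w₀ =
      fderiv ℝ (fderiv ℝ (fun w => y w τ)) w₀ := fun τ hτ => (hz τ hτ).fderiv.fderiv_eq
  refine ⟨fun τ hτ => (h.contDiffAt τ hτ).congr_of_eventuallyEq (hz τ hτ), fun v => ?_,
    fun v v' => ?_⟩
  · refine ((h.first v).congr fun τ hτ => by rw [h1 τ hτ]).congr_deriv ?_
    filter_upwards [ae_restrict_mem measurableSet_Icc] with τ hτ
    rw [h0 τ hτ, h1 τ hτ]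
  · refine ((h.second v v').congr fun τ hτ => by rw [h2 τ hτ]).congr_deriv ?_
    filter_upwards [ae_restrict_mem measurableSet_Icc] with τ hτ
    rw [h0 τ hτ, h1 τ hτ, h2 τ hτ]

/-- Solutions of `y' = F(u, y)` for all parameters near the reference parameter. -/
theorem exists_solvesVariational (hab : a ≤ b) {F : K × E → E} (hF : ContDiff ℝ ∞ F)
    {u β : 𝒲 → ℝ → K} (hu : ControlFamily u β (volume.restrict (Icc a b)))
    (w₀ : 𝒲) {e : 𝒲 → E} (he : ContDiffAt ℝ 2 e w₀) {y₀ : ℝ → E}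
    (hy₀c : ContinuousOn y₀ (Icc a b))
    (hy₀ : ∀ τ ∈ Icc a b, y₀ τ = e w₀ + ∫ θ in a..τ, F (u w₀ θ, y₀ θ))
    {C : ℝ} (hC0 : 0 ≤ C) (hC : ∀ᵐ θ ∂(volume.restrict (Icc a b)),
      ‖fderiv ℝ F (u w₀ θ, y₀ θ)‖ ≤ C) (hC1 : (b - a) * C < 1) :
    ∃ y : 𝒲 → ℝ → E, SolvesVariational F u β w₀ y a b ∧
      (∀ w, ContinuousOn (y w) (Icc a b)) ∧
      (∀ᶠ w in 𝓝 w₀, ∀ τ ∈ Icc a b, y w τ = e w + ∫ θ in a..τ, F (u w θ, y w θ)) ∧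
      (∀ τ ∈ Icc a b, y w₀ τ = y₀ τ) ∧
      (∀ ε > 0, ∀ᶠ w in 𝓝 w₀, ∀ τ ∈ Icc a b, ‖y w τ - y₀ τ‖ < ε) := by
  have := FiniteDimensional.complete ℝ E
  have := FiniteDimensional.complete ℝ 𝒲
  obtain ⟨bL, hb⟩ := hu.exists_bound
  let U := hu.mem_zero.toLp
  have hU : ∀ w, ∀ᵐ θ ∂(volume.restrict (Icc a b)), (U + bL w : Lp K ∞ _) θ = u w θ := by
    intro w
    filter_upwards [hu.affine w, hb w, Lp.coeFn_add U (bL w), hu.mem_zero.coeFn_toLp]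
      with θ h1 h2 h3 h4
    rw [h3, Pi.add_apply, h2, h1]
    exact congrArg (· + _) h4
  have hsub {τ : ℝ} (hτ : τ ∈ Icc a b) {p : ℝ → Prop}
      (h : ∀ᵐ θ ∂(volume.restrict (Icc a b)), p θ) : ∀ᵐ θ, θ ∈ uIoc a τ → p θ := by
    rw [ae_restrict_iff' measurableSet_Icc] at h
    filter_upwards [h] with θ h1 h2
    rw [uIoc_of_le hτ.1] at h2
    exact h1 ⟨h2.1.le, h2.2.trans hτ.2⟩
  obtain ⟨h, hh, h1, h2, h3, h4⟩ := exists_flat_flow hab hF U bL w₀ he hy₀c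
    (fun τ hτ => by
      rw [hy₀ τ hτ]
      congr 1
      refine intervalIntegral.integral_congr_ae (hsub hτ ?_)
      filter_upwards [hU w₀] with θ hθ
      rw [hθ]) hC0
    (by filter_upwards [hU w₀, hC] with θ h1 h2; rwa [h1]) hC1
  have hd (τ : ℝ) : ∀ᶠ w in 𝓝 w₀, fderiv ℝ (fun w => e w + intL E a b τ (h w)) w =
      fderiv ℝ e w + intL E a b τ ∘L fderiv ℝ h w := by
    filter_upwards [ContDiffAt.eventually_hasFDerivAt he, ContDiffAt.eventually_hasFDerivAt hh]
      with w d1 d2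
    exact (d1.add ((intL E a b τ).hasFDerivAt.comp w d2)).fderiv
  have hc2 (τ : ℝ) : ContDiffAt ℝ 2 (fun w => e w + intL E a b τ (h w)) w₀ :=
    he.add ((intL E a b τ).contDiff.contDiffAt.comp w₀ hh)
  have hd1 (τ : ℝ) (v : 𝒲) : fderiv ℝ (fun w => e w + intL E a b τ (h w)) w₀ v =
      fderiv ℝ e w₀ v + intL E a b τ (fderiv ℝ h w₀ v) := by
    rw [(hd τ).self_of_nhds]
    rfl
  have hd2 (τ : ℝ) (v v' : 𝒲) : fderiv ℝ (fderiv ℝ (fun w => e w + intL E a b τ (h w))) w₀ v v' =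
      fderiv ℝ (fderiv ℝ e) w₀ v v' + intL E a b τ (fderiv ℝ (fderiv ℝ h) w₀ v v') := by
    have e1 := ContDiffAt.hasFDerivAt_fderiv_apply (hc2 τ) v'
    have e2 := (ContDiffAt.hasFDerivAt_fderiv_apply he v').add
      ((intL E a b τ).hasFDerivAt.comp w₀ (ContDiffAt.hasFDerivAt_fderiv_apply hh v'))
    have e3 := e2.congr_of_eventuallyEq ((hd τ).mono fun w hw => DFunLike.congr_fun hw v')
    exact DFunLike.congr_fun (e1.unique e3) v
  have key (x : E) (p : Lp E ∞ (volume.restrict (Icc a b))) :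
      ACDeriv (fun τ => x + intL E a b τ p) p a b := by
    refine ACDeriv.of_integral (Lp.memLp p) fun τ hτ => ?_
    rw [intL_apply hτ, intL_apply (left_mem_Icc.2 hab), intervalIntegral.integral_same, add_zero]
  refine ⟨fun w τ => e w + intL E a b τ (h w), ⟨fun τ _ => hc2 τ, fun v => ?_, fun v v' => ?_⟩,
    fun w => (key (e w) (h w)).continuousOn, ?_, h2, fun ε hε => ?_⟩
  · simp only [hd1]
    refine (key _ _).congr_deriv ?_
    filter_upwards [h3 v, hU w₀, hb v, ae_restrict_mem measurableSet_Icc] with θ e1 e2 e3 e4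
    rw [e1, e2, e3, h2 θ e4]
  · simp only [hd1, hd2]
    refine (key _ _).congr_deriv ?_
    filter_upwards [h4 v v', hU w₀, hb v, hb v', ae_restrict_mem measurableSet_Icc]
      with θ e1 e2 e3 e4 e5
    rw [e1, e2, e3, e4, h2 θ e5]
  · filter_upwards [h1] with w hw τ hτ
    congr 1
    rw [intL_apply hτ]
    refine intervalIntegral.integral_congr_ae (hsub hτ ?_)
    filter_upwards [hw, hU w] with θ e1 e2
    rw [← e2, ← e1]
  · have hcont : ContinuousAt (fun w => ‖e w - e w₀‖ + (b - a) * ‖h w - h w₀‖) w₀ :=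
      (he.continuousAt.sub_const _).norm.add ((hh.continuousAt.sub_const _).norm.const_mul _)
    have : ∀ᶠ w in 𝓝 w₀, ‖e w - e w₀‖ + (b - a) * ‖h w - h w₀‖ < ε := by
      refine hcont.eventually_lt_const ?_
      simpa using hε
    filter_upwards [this] with w hw τ hτ
    refine lt_of_le_of_lt ?_ hw
    rw [← h2 τ hτ, add_sub_add_comm, ← map_sub]
    exact (norm_add_le _ _).trans (add_le_add le_rfl (norm_intL_le hτ _))

end FlatFlow

end OptControl

namespace OptControl

/-! ### The control system in a chart. -/

section LocalForm

variable {n k : ℕ} {M : Type*} [TopologicalSpace M] [ChartedSpace (Vec n) M]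
  [IsManifold 𝓘(ℝ, Vec n) ∞ M]

namespace ControlProblem

variable (P : ControlProblem n k M)

/-- The control system and the running cost in the chart at `c`. -/
noncomputable def localField (c : M) (x : Vec k × (Vec n × ℝ)) : Vec n × ℝ :=
  (mfderiv 𝓘(ℝ, Vec n) 𝓘(ℝ, Vec n) (extChartAt 𝓘(ℝ, Vec n) c)
    ((extChartAt 𝓘(ℝ, Vec n) c).symm x.2.1)
    (P.f x.1 ((extChartAt 𝓘(ℝ, Vec n) c).symm x.2.1)),
   P.L x.1 ((extChartAt 𝓘(ℝ, Vec n) c).symm x.2.1))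

/-- The derivative of the chart is the trivialization of the tangent bundle over its domain, so this
is the smoothness of f read in that trivialization. -/
lemma contMDiffOn_chart_field (c : M) :
    ContMDiffOn (𝓘(ℝ, Vec k).prod 𝓘(ℝ, Vec n)) 𝓘(ℝ, Vec n) ∞
      (fun x : Vec k × M => (show Vec n from
        mfderiv 𝓘(ℝ, Vec n) 𝓘(ℝ, Vec n) (extChartAt 𝓘(ℝ, Vec n) c) x.2 (P.f x.1 x.2)))
      (univ ×ˢ (chartAt (Vec n) c).source) := by
  have h := P.smooth_f.contMDiffOn (s := univ ×ˢ (chartAt (Vec n) c).source)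
  rw [(trivializationAt (Vec n) (TangentSpace 𝓘(ℝ, Vec n)) c).contMDiffOn_iff (fun x hx => by
    rw [TangentBundle.trivializationAt_source]
    exact hx.2)] at h
  refine h.2.congr fun x hx => ?_
  rw [← TangentBundle.continuousLinearMapAt_trivializationAt hx.2]
  exact (trivializationAt (Vec n) (TangentSpace 𝓘(ℝ, Vec n)) c).continuousLinearMapAt_apply_of_mem
    ℝ (by rw [TangentBundle.trivializationAt_baseSet]; exact hx.2) _

lemma contDiffOn_localField (c : M) :
    ContDiffOn ℝ ∞ (P.localField c) (univ ×ˢ ((extChartAt 𝓘(ℝ, Vec n) c).target ×ˢ univ)) := by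
  have h1 : ContMDiffOn 𝓘(ℝ, Vec k × (Vec n × ℝ)) (𝓘(ℝ, Vec k).prod 𝓘(ℝ, Vec n)) ∞
      (fun x : Vec k × (Vec n × ℝ) => (x.1, (extChartAt 𝓘(ℝ, Vec n) c).symm x.2.1))
      (univ ×ˢ ((extChartAt 𝓘(ℝ, Vec n) c).target ×ˢ univ)) := by
    refine ContMDiffOn.prodMk ?_ ?_
    · exact contDiff_fst.contMDiff.contMDiffOn
    · refine (contMDiffOn_extChartAt_symm c).comp (t := (extChartAt 𝓘(ℝ, Vec n) c).target)
        (contDiff_snd.fst).contMDiff.contMDiffOn fun x hx => hx.2.1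
  have hmaps : MapsTo
      (fun x : Vec k × (Vec n × ℝ) => (x.1, (extChartAt 𝓘(ℝ, Vec n) c).symm x.2.1))
      (univ ×ˢ ((extChartAt 𝓘(ℝ, Vec n) c).target ×ˢ univ))
      (univ ×ˢ (chartAt (Vec n) c).source) := by
    intro x hx
    refine ⟨mem_univ _, ?_⟩
    rw [← extChartAt_source 𝓘(ℝ, Vec n)]
    exact (extChartAt 𝓘(ℝ, Vec n) c).map_target hx.2.1
  have h2 := (P.contMDiffOn_chart_field c).comp h1 hmaps
  have h3 := P.smooth_L.comp_contMDiffOn h1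
  exact h2.contDiffOn.prodMk h3.contDiffOn

lemma continuous_mfderiv_field {ψ : M → ℝ} (hψ : ContMDiff 𝓘(ℝ, Vec n) 𝓘(ℝ, ℝ) ∞ ψ) :
    Continuous (fun x : Vec k × M =>
      (show ℝ from mfderiv 𝓘(ℝ, Vec n) 𝓘(ℝ, ℝ) ψ x.2 (P.f x.1 x.2))) := by
  have h1 := (hψ.contMDiff_tangentMap (m := ∞) (by simp)).comp P.smooth_f
  have h2 := (contMDiff_snd_tangentBundle_modelSpace ℝ 𝓘(ℝ, ℝ) (n := ∞)).comp h1
  exact h2.continuous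

variable (n) in
/-- A smooth bump function at `c`, supported in the chart at `c`. -/
noncomputable def cutoff (c : M) : SmoothBumpFunction 𝓘(ℝ, Vec n) c := Classical.arbitrary _

/-- The local representation at `c`, multiplied by a cut-off function. -/
noncomputable def cutField (c : M) (x : Vec k × (Vec n × ℝ)) : Vec n × ℝ :=
  (cutoff n c).toContDiffBump x.2.1 • P.localField c x

omit [IsManifold 𝓘(ℝ, Vec n) ∞ M] in
lemma closedBall_subset_target (c : M) :
    Metric.closedBall (extChartAt 𝓘(ℝ, Vec n) c c) (cutoff n c).rOut ⊆
      (extChartAt 𝓘(ℝ, Vec n) c).target := by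
  have := (cutoff n c).closedBall_subset
  simpa using this

lemma contDiff_cutField (c : M) : ContDiff ℝ ∞ (P.cutField c) := by
  rw [contDiff_iff_contDiffAt]
  intro x
  by_cases hx : x.2.1 ∈ (extChartAt 𝓘(ℝ, Vec n) c).target
  · have ho : IsOpen ((univ : Set (Vec k)) ×ˢ
        ((extChartAt 𝓘(ℝ, Vec n) c).target ×ˢ (univ : Set ℝ))) :=
      isOpen_univ.prod ((isOpen_extChartAt_target c).prod isOpen_univ)
    have h1 := (P.contDiffOn_localField c).contDiffAt (ho.mem_nhds ⟨mem_univ x.1, hx, mem_univ _⟩)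
    exact ((cutoff n c).toContDiffBump.contDiff.contDiffAt.comp x
      (contDiffAt_snd.fst)).smul h1
  · have hb : x.2.1 ∈ (Metric.closedBall (extChartAt 𝓘(ℝ, Vec n) c c) (cutoff n c).rOut)ᶜ :=
      fun h => hx (closedBall_subset_target c h)
    have ho : IsOpen {y : Vec k × (Vec n × ℝ) |
        y.2.1 ∈ (Metric.closedBall (extChartAt 𝓘(ℝ, Vec n) c c) (cutoff n c).rOut)ᶜ} :=
      Metric.isClosed_closedBall.isOpen_compl.preimage (continuous_snd.fst)
    refine contDiffAt_const (c := (0 : Vec n × ℝ)) |>.congr_of_eventuallyEq ?_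
    filter_upwards [ho.mem_nhds hb] with y hy
    have : (cutoff n c).toContDiffBump y.2.1 = 0 := by
      refine (cutoff n c).toContDiffBump.zero_of_le_dist ?_
      by_contra hlt
      exact hy (Metric.mem_closedBall.2 (not_le.1 hlt).le)
    rw [cutField, this, zero_smul]

lemma cutField_eq (c : M) {x : Vec k × (Vec n × ℝ)}
    (hx : x.2.1 ∈ Metric.ball (extChartAt 𝓘(ℝ, Vec n) c c) (cutoff n c).rIn) :
    P.cutField c x = P.localField c x := by
  rw [cutField, (cutoff n c).toContDiffBump.one_of_mem_closedBall (Metric.ball_subset_closedBall hx),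
    one_smul]

/-- The derivative of the local representation is bounded for bounded controls. -/
lemma exists_fderiv_cutField_le (c : M) (R : ℝ) :
    ∃ C, 0 ≤ C ∧ ∀ x : Vec k × (Vec n × ℝ), ‖x.1‖ ≤ R → ‖fderiv ℝ (P.cutField c) x‖ ≤ C := by
  let K := Metric.closedBall (0 : Vec k) R ×ˢ
    (Metric.closedBall (extChartAt 𝓘(ℝ, Vec n) c c) (cutoff n c).rOut ×ˢ ({0} : Set ℝ))
  have hK : IsCompact K :=
    (isCompact_closedBall _ _).prod ((isCompact_closedBall _ _).prod isCompact_singleton)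
  obtain ⟨C, hC⟩ := hK.exists_bound_of_continuousOn
    ((P.contDiff_cutField c).continuous_fderiv (by simp)).continuousOn
  refine ⟨max C 0, le_max_right _ _, fun x hx => ?_⟩
  -- The field does not depend on the accumulated cost, so that unbounded coordinate may be set to
  -- zero and compactness is needed only in the control and the state.
  have hinv : fderiv ℝ (P.cutField c) x = fderiv ℝ (P.cutField c) (x.1, x.2.1, 0) := by
    have : P.cutField c = fun y => P.cutField c (y + (0, 0, -x.2.2)) := by
      funext y
      have e : y + (0, 0, -x.2.2) = (y.1, y.2.1, y.2.2 + -x.2.2) := by ext <;> simp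
      rw [e]
      rfl
    conv_lhs => rw [this]
    rw [fderiv_comp_add_right]
    congr 1
    ext <;> simp
  by_cases hb : x.2.1 ∈ Metric.closedBall (extChartAt 𝓘(ℝ, Vec n) c c) (cutoff n c).rOut
  · rw [hinv]
    exact (hC (x.1, x.2.1, 0) ⟨mem_closedBall_zero_iff.2 hx, hb, rfl⟩).trans (le_max_left _ _)
  · have ho : IsOpen {y : Vec k × (Vec n × ℝ) |
        y.2.1 ∈ (Metric.closedBall (extChartAt 𝓘(ℝ, Vec n) c c) (cutoff n c).rOut)ᶜ} :=
      Metric.isClosed_closedBall.isOpen_compl.preimage (continuous_snd.fst)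
    have : P.cutField c =ᶠ[𝓝 x] fun _ => 0 := by
      filter_upwards [ho.mem_nhds hb] with y hy
      have : (cutoff n c).toContDiffBump y.2.1 = 0 := by
        refine (cutoff n c).toContDiffBump.zero_of_le_dist ?_
        by_contra hlt
        exact hy (Metric.mem_closedBall.2 (not_le.1 hlt).le)
      rw [cutField, this, zero_smul]
    rw [this.fderiv_eq, fderiv_const_apply, norm_zero]
    exact le_max_right _ _

lemma norm_cutField_sub_le (c : M) {R C : ℝ}
    (hC : ∀ x : Vec k × (Vec n × ℝ), ‖x.1‖ ≤ R → ‖fderiv ℝ (P.cutField c) x‖ ≤ C) {u : Vec k}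
    (hu : ‖u‖ ≤ R) (y z : Vec n × ℝ) :
    ‖P.cutField c (u, y) - P.cutField c (u, z)‖ ≤ C * ‖y - z‖ := by
  have hconv : Convex ℝ ({u} ×ˢ (univ : Set (Vec n × ℝ))) :=
    (convex_singleton u).prod convex_univ
  have := hconv.norm_image_sub_le_of_norm_fderiv_le (f := P.cutField c) (C := C) (𝕜 := ℝ)
    (x := (u, z)) (y := (u, y))
    (fun x _ => (P.contDiff_cutField c).differentiable (by simp) x)
    (fun x hx => hC x (by rw [show x.1 = u from hx.1]; exact hu)) ⟨rfl, mem_univ _⟩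
    ⟨rfl, mem_univ _⟩
  refine this.trans_eq ?_
  rw [Prod.mk_sub_mk, sub_self, Prod.norm_mk, norm_zero, max_eq_right (norm_nonneg _)]

end ControlProblem

end LocalForm

end OptControl

namespace OptControl

/-! ### Trajectories on the manifold and their local equations. -/

section Trajectories

open ControlProblem

lemma ACDeriv.comp {E F : Type*} [NormedAddCommGroup E] [NormedSpace ℝ E] [NormedAddCommGroup F]
    [NormedSpace ℝ F] {y y' : ℝ → E} {a b : ℝ} (h : ACDeriv y y' a b) {s : Set E}
    (hs : MapsTo y (Icc a b) s) {g : E → F} {g' : E → E →L[ℝ] F} (hg : ∃ C, LipschitzOnWith C g s)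
    (hg' : ∀ τ ∈ Icc a b, HasFDerivAt g (g' (y τ)) (y τ)) :
    ACDeriv (fun τ => g (y τ)) (fun τ => g' (y τ) (y' τ)) a b := by
  obtain ⟨C, hC⟩ := h.lip
  obtain ⟨C', hC'⟩ := hg
  refine ⟨⟨C' * C, hC'.comp hC hs⟩, ?_⟩
  filter_upwards [h.deriv] with τ hd hτ
  exact (hg' τ (Ioo_subset_Icc_self hτ)).comp_hasDerivAt τ (hd hτ)

variable {n k : ℕ} {M : Type*} [TopologicalSpace M] [ChartedSpace (Vec n) M]

variable (n) in
/-- The neighbourhood of `c` in which local representations at `c` are used. -/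
def chartBall (c : M) : Set M :=
  (chartAt (Vec n) c).source ∩
    extChartAt 𝓘(ℝ, Vec n) c ⁻¹' Metric.ball (extChartAt 𝓘(ℝ, Vec n) c c) (cutoff n c).rIn

lemma isOpen_chartBall (c : M) : IsOpen (chartBall n c) := by
  have := (continuousOn_extChartAt (I := 𝓘(ℝ, Vec n)) c).isOpen_inter_preimage
    (isOpen_extChartAt_source c) (Metric.isOpen_ball (x := extChartAt 𝓘(ℝ, Vec n) c c)
      (ε := (cutoff n c).rIn))
  rwa [extChartAt_source] at this

lemma mem_chartBall (c : M) : c ∈ chartBall n c :=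
  ⟨mem_chart_source _ c, Metric.mem_ball_self (cutoff n c).rIn_pos⟩

lemma ball_subset_target (c : M) :
    Metric.ball (extChartAt 𝓘(ℝ, Vec n) c c) (cutoff n c).rIn ⊆
      (extChartAt 𝓘(ℝ, Vec n) c).target := fun _ hy =>
  closedBall_subset_target c (Metric.ball_subset_closedBall
    (Metric.ball_subset_ball (cutoff n c).rIn_lt_rOut.le hy))

lemma symm_mem_chartBall {c : M} {y : Vec n}
    (hy : y ∈ Metric.ball (extChartAt 𝓘(ℝ, Vec n) c c) (cutoff n c).rIn) :
    (extChartAt 𝓘(ℝ, Vec n) c).symm y ∈ chartBall n c := by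
  have ht := ball_subset_target c hy
  refine ⟨?_, ?_⟩
  · rw [← extChartAt_source 𝓘(ℝ, Vec n)]
    exact (extChartAt 𝓘(ℝ, Vec n) c).map_target ht
  · rw [mem_preimage, (extChartAt 𝓘(ℝ, Vec n) c).right_inv ht]
    exact hy

lemma memLp_comp_curve (n : ℕ) {M : Type*} [TopologicalSpace M] [ChartedSpace (Vec n) M]
    [T2Space M] [SecondCountableTopology M] {a b : ℝ} {u : ℝ → Vec k} (hu : MemLp u ∞ (volume.restrict (Icc a b)))
    {q : ℝ → M} (hq : ContinuousOn q (Icc a b)) {G : Type*} [NormedAddCommGroup G]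
    {g : Vec k × M → G} (hg : Continuous g) :
    MemLp (fun τ => g (u τ, q τ)) ∞ (volume.restrict (Icc a b)) := by
  have := ChartedSpace.locallyCompactSpace (Vec n) M
  have := TopologicalSpace.metrizableSpace_of_t3_secondCountable M
  obtain ⟨C, -, hC⟩ := MemLp.exists_norm_le hu
  obtain ⟨K, hK⟩ := ((isCompact_closedBall (0 : Vec k) C).prod
    (isCompact_Icc.image_of_continuousOn hq)).exists_bound_of_continuousOn hg.continuousOn
  refine memLp_top_of_bound (hg.comp_aestronglyMeasurable
    (hu.1.prodMk (hq.aestronglyMeasurable measurableSet_Icc))) K ?_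
  filter_upwards [hC, ae_restrict_mem measurableSet_Icc] with τ h1 h2
  exact hK _ ⟨mem_closedBall_zero_iff.2 h1, mem_image_of_mem _ h2⟩

variable [T2Space M] [SecondCountableTopology M] [IsManifold 𝓘(ℝ, Vec n) ∞ M]

namespace ControlProblem

variable {P : ControlProblem n k M} {t : ℝ} {u : ℝ → Vec k} {q : ℝ → M}

omit [T2Space M] [SecondCountableTopology M] in
lemma IsTrajectory.mono (h : P.IsTrajectory t u q) {s : ℝ} (hs : s ≤ t) : P.IsTrajectory s u q :=
  ⟨h.1.mono (Icc_subset_Icc_right hs), fun φ hφ τ hτ => h.2 φ hφ τ ⟨hτ.1, hτ.2.trans hs⟩⟩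

lemma memLp_mono_Icc {E : Type*} [NormedAddCommGroup E] {f : ℝ → E} {a b c e : ℝ}
    (h : MemLp f ∞ (volume.restrict (Icc a b))) (hac : a ≤ c) (heb : e ≤ b) :
    MemLp f ∞ (volume.restrict (Icc c e)) :=
  h.mono_measure (Measure.restrict_mono (Icc_subset_Icc hac heb) le_rfl)

omit [T2Space M] [SecondCountableTopology M] in
lemma localField_chart (P : ControlProblem n k M) {c x : M} (hx : x ∈ (chartAt (Vec n) c).source)
    (v : Vec k) (s : ℝ) :
    P.localField c (v, extChartAt 𝓘(ℝ, Vec n) c x, s) = ((show Vec n from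
      mfderiv 𝓘(ℝ, Vec n) 𝓘(ℝ, Vec n) (extChartAt 𝓘(ℝ, Vec n) c) x (P.f v x)), P.L v x) := by
  have h := (extChartAt 𝓘(ℝ, Vec n) c).left_inv (by rw [extChartAt_source]; exact hx)
  simp only [localField]
  rw [h]

omit [T2Space M] [SecondCountableTopology M] in
lemma cutField_chart (P : ControlProblem n k M) {c x : M} (hx : x ∈ chartBall n c) (v : Vec k)
    (s : ℝ) :
    P.cutField c (v, extChartAt 𝓘(ℝ, Vec n) c x, s) = ((show Vec n from
      mfderiv 𝓘(ℝ, Vec n) 𝓘(ℝ, Vec n) (extChartAt 𝓘(ℝ, Vec n) c) x (P.f v x)), P.L v x) := by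
  rw [P.cutField_eq c (x := (v, extChartAt 𝓘(ℝ, Vec n) c x, s)) hx.2, P.localField_chart hx.1]

/-- A trajectory solves the local equations. -/
lemma IsTrajectory.local_eq (h : P.IsTrajectory t u q) (hu : MemLp u ∞ (volume.restrict (Icc 0 t)))
    {a b : ℝ} (ha : 0 ≤ a) (hb : b ≤ t) {c : M} (hc : ∀ τ ∈ Icc a b, q τ ∈ chartBall n c)
    (γ : ℝ) {τ : ℝ} (hτ : τ ∈ Icc a b) :
    ((extChartAt 𝓘(ℝ, Vec n) c (q τ), γ + ∫ θ in (0 : ℝ)..τ, P.L (u θ) (q θ)) : Vec n × ℝ) =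
      (extChartAt 𝓘(ℝ, Vec n) c (q a), γ + ∫ θ in (0 : ℝ)..a, P.L (u θ) (q θ)) +
      ∫ θ in a..τ, P.cutField c (u θ, extChartAt 𝓘(ℝ, Vec n) c (q θ),
        γ + ∫ θ' in (0 : ℝ)..θ, P.L (u θ') (q θ')) := by
  have hab : a ≤ b := hτ.1.trans hτ.2
  have hat : a ∈ Icc 0 t := ⟨ha, hab.trans hb⟩
  have hτt : τ ∈ Icc 0 t := ⟨ha.trans hτ.1, hτ.2.trans hb⟩
  have h0t : (0 : ℝ) ∈ Icc 0 t := ⟨le_rfl, hat.1.trans hat.2⟩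
  set Z := fun θ => P.cutField c (u θ, extChartAt 𝓘(ℝ, Vec n) c (q θ),
    γ + ∫ θ' in (0 : ℝ)..θ, P.L (u θ') (q θ')) with hZ
  have hZθ : ∀ θ ∈ Icc a b, Z θ = ((show Vec n from mfderiv 𝓘(ℝ, Vec n) 𝓘(ℝ, Vec n)
      (extChartAt 𝓘(ℝ, Vec n) c) (q θ) (P.f (u θ) (q θ))), P.L (u θ) (q θ)) := by
    intro θ hθ
    rw [hZ]
    exact P.cutField_chart (hc θ hθ) _ _
  have hLc : Continuous (fun x : Vec k × M => P.L x.1 x.2) := P.smooth_L.continuous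
  have hLm := memLp_comp_curve n hu h.1 hLc
  have hZm : MemLp Z ∞ (volume.restrict (Icc a b)) := by
    have h1 : ContinuousOn (fun θ => extChartAt 𝓘(ℝ, Vec n) c (q θ)) (Icc a b) :=
      (continuousOn_extChartAt c).comp (h.1.mono (Icc_subset_Icc ha hb)) fun θ hθ => by
        rw [extChartAt_source]; exact (hc θ hθ).1
    have h2 : ContinuousOn (fun θ => γ + ∫ θ' in (0 : ℝ)..θ, P.L (u θ') (q θ')) (Icc a b) := by
      have := (ACDeriv.of_integral (y := fun θ => γ + ∫ θ' in (0 : ℝ)..θ, P.L (u θ') (q θ')) hLm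
        (fun θ _ => by simp)).continuousOn
      exact this.mono (Icc_subset_Icc ha hb)
    have h3 := memLp_comp_curve n (M := Vec n) (G := Vec n × ℝ)
      (g := fun x => P.cutField c (x.1, x.2, 0)) (memLp_mono_Icc hu ha hb) h1
      ((P.contDiff_cutField c).continuous.comp (by fun_prop))
    exact h3
  have hZi := memLp_top_intervalIntegrable hZm (left_mem_Icc.2 hab) hτ
  have hmem : ∀ θ ∈ uIcc a τ, θ ∈ Icc a b := fun θ hθ => by
    rw [uIcc_of_le hτ.1] at hθ
    exact ⟨hθ.1, hθ.2.trans hτ.2⟩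
  refine Prod.ext ?_ ?_
  · refine PiLp.ext fun i => ?_
    -- Trajectories are defined by testing against globally smooth functions. A coordinate function
    -- times the bump function is one, and it agrees with the coordinate near every point of the
    -- chart ball.
    have hψ : ContMDiff 𝓘(ℝ, Vec n) 𝓘(ℝ, ℝ) ∞
        (fun x => cutoff n c x • (extChartAt 𝓘(ℝ, Vec n) c x) i) :=
      (cutoff n c).contMDiff_smul (((EuclideanSpace.proj (𝕜 := ℝ) i).contDiff.contMDiff).comp_contMDiffOn
        contMDiffOn_extChartAt)
    have hev : ∀ x ∈ chartBall n c, (fun x => cutoff n c x • (extChartAt 𝓘(ℝ, Vec n) c x) i) =ᶠ[𝓝 x]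
        fun x => (extChartAt 𝓘(ℝ, Vec n) c x) i := by
      intro x hx
      filter_upwards [(cutoff n c).eventuallyEq_one_of_dist_lt hx.1 hx.2] with y hy
      rw [hy, Pi.one_apply, one_smul]
    have hd : ∀ θ ∈ Icc a b, (show ℝ from mfderiv 𝓘(ℝ, Vec n) 𝓘(ℝ, ℝ)
        (fun x => cutoff n c x • (extChartAt 𝓘(ℝ, Vec n) c x) i) (q θ) (P.f (u θ) (q θ))) =
        (Z θ).1 i := by
      intro θ hθ
      rw [hZθ θ hθ]
      have h1 : HasMFDerivAt 𝓘(ℝ, Vec n) 𝓘(ℝ, Vec n) (extChartAt 𝓘(ℝ, Vec n) c) (q θ)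
          (mfderiv 𝓘(ℝ, Vec n) 𝓘(ℝ, Vec n) (extChartAt 𝓘(ℝ, Vec n) c) (q θ)) :=
        (mdifferentiableAt_extChartAt (hc θ hθ).1).hasMFDerivAt
      have h2 := ((EuclideanSpace.proj (𝕜 := ℝ) i).hasMFDerivAt (x := extChartAt 𝓘(ℝ, Vec n) c (q θ))).comp (q θ) h1
      have h3 := (h2.congr_of_eventuallyEq (hev _ (hc θ hθ))).mfderiv
      rw [h3]
      rfl
    have e1 := h.2 _ hψ τ hτt
    have e2 := h.2 _ hψ a hat
    have hm := memLp_comp_curve n hu h.1 (P.continuous_mfderiv_field hψ)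
    have e3 := intervalIntegral.integral_add_adjacent_intervals
      (memLp_top_intervalIntegrable hm h0t hat) (memLp_top_intervalIntegrable hm hat hτt)
    have e4 : ∫ θ in a..τ, (show ℝ from mfderiv 𝓘(ℝ, Vec n) 𝓘(ℝ, ℝ)
        (fun x => cutoff n c x • (extChartAt 𝓘(ℝ, Vec n) c x) i) (q θ) (P.f (u θ) (q θ))) =
        ∫ θ in a..τ, (Z θ).1 i :=
      intervalIntegral.integral_congr fun θ hθ => hd θ (hmem θ hθ)
    have e5 : (∫ θ in a..τ, Z θ).1 i = ∫ θ in a..τ, (Z θ).1 i := by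
      exact (((EuclideanSpace.proj (𝕜 := ℝ) i) ∘L
        (ContinuousLinearMap.fst ℝ (Vec n) ℝ)).intervalIntegral_comp_comm hZi).symm
    have e6 := (hev _ (hc τ hτ)).self_of_nhds
    have e7 := (hev _ (hc a (left_mem_Icc.2 hab))).self_of_nhds
    change (extChartAt 𝓘(ℝ, Vec n) c (q τ)) i =
      (extChartAt 𝓘(ℝ, Vec n) c (q a)) i + (∫ θ in a..τ, Z θ).1 i
    rw [e5, ← e4]
    exact e6.symm.trans (e1.trans ((congrArg (_ + ·) e3.symm).trans
      ((add_assoc _ _ _).symm.trans (congrArg (· + _) (e2.symm.trans e7)))))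
  · have e3 := intervalIntegral.integral_add_adjacent_intervals
      (memLp_top_intervalIntegrable hLm h0t hat) (memLp_top_intervalIntegrable hLm hat hτt)
    have e4 : ∫ θ in a..τ, (Z θ).2 = ∫ θ in a..τ, P.L (u θ) (q θ) :=
      intervalIntegral.integral_congr fun θ hθ => by
        simp only [hZθ θ (hmem θ hθ)]
    have e5 : (∫ θ in a..τ, Z θ).2 = ∫ θ in a..τ, (Z θ).2 :=
      ((ContinuousLinearMap.snd ℝ (Vec n) ℝ).intervalIntegral_comp_comm hZi).symm
    change γ + _ = γ + _ + (∫ θ in a..τ, Z θ).2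
    rw [e5, e4, ← e3, add_assoc]

omit [T2Space M] [SecondCountableTopology M] in
lemma fderiv_comp_symm_mfderiv {ψ : M → ℝ} (hψ : ContMDiff 𝓘(ℝ, Vec n) 𝓘(ℝ, ℝ) ∞ ψ) {c x : M}
    (hx : x ∈ (chartAt (Vec n) c).source) :
    fderiv ℝ (ψ ∘ (extChartAt 𝓘(ℝ, Vec n) c).symm) (extChartAt 𝓘(ℝ, Vec n) c x) ∘L
      mfderiv 𝓘(ℝ, Vec n) 𝓘(ℝ, Vec n) (extChartAt 𝓘(ℝ, Vec n) c) x =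
      mfderiv 𝓘(ℝ, Vec n) 𝓘(ℝ, ℝ) ψ x := by
  have hx' : x ∈ (extChartAt 𝓘(ℝ, Vec n) c).source := by rwa [extChartAt_source]
  have ht := (extChartAt 𝓘(ℝ, Vec n) c).map_source hx'
  have h1 : HasMFDerivAt 𝓘(ℝ, Vec n) 𝓘(ℝ, Vec n) (extChartAt 𝓘(ℝ, Vec n) c) x
      (mfderiv 𝓘(ℝ, Vec n) 𝓘(ℝ, Vec n) (extChartAt 𝓘(ℝ, Vec n) c) x) :=
    (mdifferentiableAt_extChartAt hx).hasMFDerivAt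
  have h2 : ContMDiffOn 𝓘(ℝ, Vec n) 𝓘(ℝ, ℝ) ∞ (ψ ∘ (extChartAt 𝓘(ℝ, Vec n) c).symm)
      (extChartAt 𝓘(ℝ, Vec n) c).target := hψ.comp_contMDiffOn (contMDiffOn_extChartAt_symm c)
  have h3 := (h2.contDiffOn.contDiffAt ((isOpen_extChartAt_target c).mem_nhds ht)).differentiableAt
    (by simp)
  have h4 := h3.hasFDerivAt.hasMFDerivAt.comp x h1
  refine (HasMFDerivAt.mfderiv (h4.congr_of_eventuallyEq ?_)).symm
  filter_upwards [(isOpen_extChartAt_source (I := 𝓘(ℝ, Vec n)) c).mem_nhds hx'] with z hz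
  simp only [Function.comp]
  rw [(extChartAt 𝓘(ℝ, Vec n) c).left_inv hz]

open Classical in
/-- A solution of the local equations continues a trajectory. -/
lemma IsTrajectory.extend {a b : ℝ} (ha : 0 ≤ a) (hab : a ≤ b) (h : P.IsTrajectory a u q)
    (hu : MemLp u ∞ (volume.restrict (Icc 0 b))) {c : M} (hqa : q a ∈ chartBall n c)
    {z : ℝ → Vec n × ℝ} (hzc : ContinuousOn z (Icc a b))
    (hzb : ∀ τ ∈ Icc a b, (z τ).1 ∈
      Metric.ball (extChartAt 𝓘(ℝ, Vec n) c c) (cutoff n c).rIn)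
    (hza : (z a).1 = extChartAt 𝓘(ℝ, Vec n) c (q a))
    (hz : ∀ τ ∈ Icc a b, z τ = z a + ∫ θ in a..τ, P.cutField c (u θ, z θ)) :
    P.IsTrajectory b u (fun τ => if τ ≤ a then q τ else (extChartAt 𝓘(ℝ, Vec n) c).symm (z τ).1) := by
  set q' : ℝ → M := fun τ => if τ ≤ a then q τ else (extChartAt 𝓘(ℝ, Vec n) c).symm (z τ).1 with hq'
  have e1 : ∀ τ ≤ a, q' τ = q τ := fun τ hτ => if_pos hτ
  have e2 : ∀ τ ∈ Icc a b, q' τ = (extChartAt 𝓘(ℝ, Vec n) c).symm (z τ).1 := by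
    intro τ hτ
    rcases hτ.1.eq_or_lt with rfl | hlt
    · rw [e1 a le_rfl, hza, (extChartAt 𝓘(ℝ, Vec n) c).left_inv]
      rw [extChartAt_source]
      exact hqa.1
    · exact if_neg (not_le.2 hlt)
  have hcont : ContinuousOn q' (Icc 0 b) := by
    rw [← Icc_union_Icc_eq_Icc ha hab]
    refine ContinuousOn.union_of_isClosed ?_ ?_ isClosed_Icc isClosed_Icc
    · exact h.1.congr fun τ hτ => e1 τ hτ.2
    · refine ContinuousOn.congr ?_ e2
      exact (continuousOn_extChartAt_symm c).comp hzc.fst fun τ hτ => ball_subset_target c (hzb τ hτ)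
  refine ⟨hcont, fun ψ hψ s hs => ?_⟩
  have hm := memLp_comp_curve n hu hcont (P.continuous_mfderiv_field hψ)
  rcases le_total s a with hsa | has
  · rw [e1 s hsa, e1 0 ha, h.2 ψ hψ s ⟨hs.1, hsa⟩]
    congr 1
    refine intervalIntegral.integral_congr fun θ hθ => ?_
    rw [uIcc_of_le hs.1] at hθ
    simp only
    rw [e1 θ (hθ.2.trans hsa)]
  · have hsab : s ∈ Icc a b := ⟨has, hs.2⟩
    have haI : a ∈ Icc a b := left_mem_Icc.2 hab
    -- the composition with `ψ` in the chart
    have hAC : ACDeriv z (fun θ => P.cutField c (u θ, z θ)) a b := by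
      refine ACDeriv.of_integral ?_ hz
      exact memLp_comp_curve n (M := Vec n) (G := Vec n × ℝ)
        (g := fun x => P.cutField c (x.1, x.2, 0)) (memLp_mono_Icc hu ha le_rfl) hzc.fst
        ((P.contDiff_cutField c).continuous.comp (by fun_prop))
    have h2 : ContMDiffOn 𝓘(ℝ, Vec n) 𝓘(ℝ, ℝ) ∞ (ψ ∘ (extChartAt 𝓘(ℝ, Vec n) c).symm)
        (extChartAt 𝓘(ℝ, Vec n) c).target := hψ.comp_contMDiffOn (contMDiffOn_extChartAt_symm c)
    have hLip : ∃ C, LipschitzOnWith C (ψ ∘ (extChartAt 𝓘(ℝ, Vec n) c).symm)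
        (Metric.closedBall (extChartAt 𝓘(ℝ, Vec n) c c) (cutoff n c).rOut) :=
      (h2.contDiffOn.mono (closedBall_subset_target c)).exists_lipschitzOnWith (by simp)
        (convex_closedBall _ _) (isCompact_closedBall _ _)
    have hmaps : MapsTo (fun θ => (z θ).1) (Icc a b)
        (Metric.closedBall (extChartAt 𝓘(ℝ, Vec n) c c) (cutoff n c).rOut) := fun θ hθ =>
      Metric.ball_subset_closedBall (Metric.ball_subset_ball (cutoff n c).rIn_lt_rOut.le (hzb θ hθ))
    have hAC2 := (hAC.clm (ContinuousLinearMap.fst ℝ (Vec n) ℝ)).comp hmaps hLip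
      (g' := fun y => fderiv ℝ (ψ ∘ (extChartAt 𝓘(ℝ, Vec n) c).symm) y) fun θ hθ =>
        ((h2.contDiffOn.contDiffAt ((isOpen_extChartAt_target c).mem_nhds
          (ball_subset_target c (hzb θ hθ)))).differentiableAt (by simp)).hasFDerivAt
    have e3 := hAC2.eq_integral hsab
    have e4 : ∀ θ ∈ uIcc a s, fderiv ℝ (ψ ∘ (extChartAt 𝓘(ℝ, Vec n) c).symm) (z θ).1
        (P.cutField c (u θ, z θ)).1 =
        (show ℝ from mfderiv 𝓘(ℝ, Vec n) 𝓘(ℝ, ℝ) ψ (q' θ) (P.f (u θ) (q' θ))) := by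
      intro θ hθ
      rw [uIcc_of_le has] at hθ
      have hθ' : θ ∈ Icc a b := ⟨hθ.1, hθ.2.trans hs.2⟩
      have hmem : q' θ ∈ chartBall n c := by
        rw [e2 θ hθ']
        exact symm_mem_chartBall (hzb θ hθ')
      have hz1 : (z θ).1 = extChartAt 𝓘(ℝ, Vec n) c (q' θ) := by
        rw [e2 θ hθ', (extChartAt 𝓘(ℝ, Vec n) c).right_inv (ball_subset_target c (hzb θ hθ'))]
      have hcf := P.cutField_chart hmem (u θ) (z θ).2
      rw [← hz1] at hcf
      rw [← fderiv_comp_symm_mfderiv hψ hmem.1, ← hz1]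
      change fderiv ℝ (ψ ∘ (extChartAt 𝓘(ℝ, Vec n) c).symm) (z θ).1
        (P.cutField c (u θ, (z θ).1, (z θ).2)).1 = _
      rw [hcf]
      rfl
    have e5 := h.2 ψ hψ a ⟨ha, le_rfl⟩
    have e6 := intervalIntegral.integral_add_adjacent_intervals
      (memLp_top_intervalIntegrable hm ⟨le_rfl, ha.trans hab⟩ ⟨ha, hab⟩)
      (memLp_top_intervalIntegrable hm ⟨ha, hab⟩ hs)
    have e7 : ∫ τ in (0 : ℝ)..a,
        (show ℝ from mfderiv 𝓘(ℝ, Vec n) 𝓘(ℝ, ℝ) ψ (q' τ) (P.f (u τ) (q' τ))) =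
        ∫ τ in (0 : ℝ)..a,
          (show ℝ from mfderiv 𝓘(ℝ, Vec n) 𝓘(ℝ, ℝ) ψ (q τ) (P.f (u τ) (q τ))) := by
      refine intervalIntegral.integral_congr fun θ hθ => ?_
      rw [uIcc_of_le ha] at hθ
      simp only
      rw [e1 θ hθ.2]
    have e8 : ψ (q' s) = ψ (q' a) + ∫ τ in a..s,
        (show ℝ from mfderiv 𝓘(ℝ, Vec n) 𝓘(ℝ, ℝ) ψ (q' τ) (P.f (u τ) (q' τ))) := by
      rw [e2 s hsab, e2 a haI, ← intervalIntegral.integral_congr e4]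
      exact e3
    rw [e8, e1 a le_rfl, e5, e1 0 ha, ← e7, add_assoc]
    exact congrArg (_ + ·) e6

end ControlProblem

end Trajectories

end OptControl

namespace OptControl

open ControlProblem

/-- A Lebesgue number of the cover by the given neighbourhoods is a uniform step length, so finitely
many steps lead from 0 to any s. -/
lemma Icc_local_induction {t : ℝ} {p : ℝ → Prop} (h0 : p 0)
    (h : ∀ s ∈ Icc 0 t, ∃ ε > 0, ∀ a ∈ Icc 0 t, ∀ b ∈ Icc 0 t, |a - s| < ε → |b - s| < ε →
      a ≤ b → p a → p b) : ∀ s ∈ Icc 0 t, p s := by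
  choose! ε hε hp using h
  obtain ⟨δ, hδ, hL⟩ := lebesgue_number_lemma_of_metric (s := Icc 0 t) (ι := Icc (0 : ℝ) t)
    (c := fun s => Metric.ball s.1 (ε s)) isCompact_Icc (fun s => Metric.isOpen_ball)
    fun s hs => mem_iUnion.2 ⟨⟨s, hs⟩, Metric.mem_ball_self (hε s hs)⟩
  have step : ∀ a ∈ Icc 0 t, ∀ b ∈ Icc 0 t, a ≤ b → b < a + δ → p a → p b := by
    intro a ha b hb hab hlt hpa
    obtain ⟨⟨s, hs⟩, hsub⟩ := hL a ha
    refine hp s hs a ha b hb (hsub (Metric.mem_ball_self hδ)) (hsub ?_) hab hpa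
    rw [Metric.mem_ball, Real.dist_eq, abs_of_nonneg (sub_nonneg.2 hab)]
    linarith
  have main : ∀ m : ℕ, ∀ s ∈ Icc 0 t, s ≤ m * (δ / 2) → p s := by
    intro m
    induction m with
    | zero =>
      intro s hs hle
      have : s = 0 := le_antisymm (by simpa using hle) hs.1
      rwa [this]
    | succ m ih =>
      intro s hs hle
      push_cast at hle
      have ha : max 0 (s - δ / 2) ∈ Icc 0 t :=
        ⟨le_max_left _ _, max_le (hs.1.trans hs.2) (by linarith [hs.2])⟩
      refine step _ ha s hs (max_le hs.1 (by linarith)) ?_ (ih _ ha (max_le (by positivity) ?_))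
      · linarith [le_max_right 0 (s - δ / 2)]
      · linarith
  intro s hs
  obtain ⟨m, hm⟩ := exists_nat_ge (s / (δ / 2))
  exact main m s hs ((div_le_iff₀ (by positivity)).1 hm)

section Trajectories

variable {n k : ℕ} {M : Type*} [TopologicalSpace M] [ChartedSpace (Vec n) M] [T2Space M]
  [SecondCountableTopology M] [IsManifold 𝓘(ℝ, Vec n) ∞ M]

namespace ControlProblem

variable {P : ControlProblem n k M} {t : ℝ} {u : ℝ → Vec k} {q q₁ q₂ : ℝ → M}

omit [SecondCountableTopology M] [T2Space M] [IsManifold 𝓘(ℝ, Vec n) ∞ M] in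
lemma eventually_mem_of_continuousOn (hq : ContinuousOn q (Icc 0 t)) {s : ℝ} (hs : s ∈ Icc 0 t)
    {U : Set M} (hU : IsOpen U) (hsU : q s ∈ U) :
    ∃ ε > 0, ∀ τ ∈ Icc 0 t, |τ - s| < ε → q τ ∈ U := by
  obtain ⟨ε, hε, h⟩ := Metric.mem_nhdsWithin_iff.1 ((hq s hs) (hU.mem_nhds hsU))
  exact ⟨ε, hε, fun τ hτ hd => h ⟨by rwa [Metric.mem_ball, Real.dist_eq], hτ⟩⟩

omit [T2Space M] [SecondCountableTopology M] in
/-- Step lengths on which the local equations are contracting. -/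
lemma exists_step (P : ControlProblem n k M) (hu : MemLp u ∞ (volume.restrict (Icc 0 t))) (c : M) :
    ∃ C, 0 ≤ C ∧ (∀ᵐ θ ∂(volume.restrict (Icc 0 t)), ∀ y z : Vec n × ℝ,
      ‖fderiv ℝ (P.cutField c) (u θ, y)‖ ≤ C ∧
      ‖P.cutField c (u θ, y) - P.cutField c (u θ, z)‖ ≤ C * ‖y - z‖) ∧
      ∃ ε > 0, ∀ s a b : ℝ, |a - s| < ε → |b - s| < ε → (b - a) * C < 1 := by
  obtain ⟨R, -, hR⟩ := MemLp.exists_norm_le hu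
  obtain ⟨C, hC0, hC⟩ := P.exists_fderiv_cutField_le c R
  refine ⟨C, hC0, ?_, 1 / (2 * (C + 1)), by positivity, fun s a b ha hb => ?_⟩
  · filter_upwards [hR] with θ hθ y z
    exact ⟨hC _ hθ, P.norm_cutField_sub_le c hC hθ y z⟩
  · have h1 : b - a < 1 / (C + 1) := by
      have := abs_lt.1 ha
      have := abs_lt.1 hb
      have e : 1 / (C + 1) = 1 / (2 * (C + 1)) + 1 / (2 * (C + 1)) := by
        field_simp
        norm_num
      linarith
    rcases le_or_gt (b - a) 0 with h2 | h2
    · nlinarith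
    · have : (b - a) * (C + 1) < 1 := (lt_div_iff₀ (by positivity)).1 h1
      nlinarith

/-- Agreement propagates locally: near a time where the curves coincide, both lie in one chart and
their difference satisfies a contracting integral inequality. -/
theorem IsTrajectory.unique (h₁ : P.IsTrajectory t u q₁) (h₂ : P.IsTrajectory t u q₂)
    (hu : MemLp u ∞ (volume.restrict (Icc 0 t))) (h0 : q₁ 0 = q₂ 0) :
    ∀ s ∈ Icc 0 t, q₁ s = q₂ s := by
  refine Icc_local_induction h0 fun s hs => ?_
  by_cases hsq : q₁ s = q₂ s
  · set c := q₁ s with hc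
    obtain ⟨ε₁, hε₁, m₁⟩ := eventually_mem_of_continuousOn h₁.1 hs (isOpen_chartBall (n := n) c)
      (mem_chartBall (n := n) c)
    obtain ⟨ε₂, hε₂, m₂⟩ := eventually_mem_of_continuousOn h₂.1 hs (isOpen_chartBall (n := n) c)
      (by rw [← hsq]; exact mem_chartBall (n := n) c)
    obtain ⟨C, hC0, hC, ε₃, hε₃, m₃⟩ := P.exists_step hu c
    refine ⟨min ε₁ (min ε₂ ε₃), by positivity, fun a ha b hb has hbs hab hqa => ?_⟩
    have hI : ∀ τ ∈ Icc a b, τ ∈ Icc 0 t ∧ |τ - s| < min ε₁ (min ε₂ ε₃) := fun τ hτ =>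
      ⟨⟨ha.1.trans hτ.1, hτ.2.trans hb.2⟩, abs_lt.2 ⟨by linarith [(abs_lt.1 has).1, hτ.1],
        by linarith [(abs_lt.1 hbs).2, hτ.2]⟩⟩
    have hc₁ : ∀ τ ∈ Icc a b, q₁ τ ∈ chartBall n c := fun τ hτ =>
      m₁ τ (hI τ hτ).1 ((hI τ hτ).2.trans_le (min_le_left _ _))
    have hc₂ : ∀ τ ∈ Icc a b, q₂ τ ∈ chartBall n c := fun τ hτ =>
      m₂ τ (hI τ hτ).1 ((hI τ hτ).2.trans_le ((min_le_right _ _).trans (min_le_left _ _)))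
    have hle : min ε₁ (min ε₂ ε₃) ≤ ε₃ := (min_le_right _ _).trans (min_le_right _ _)
    have hb1 := m₃ s a b (has.trans_le hle) (hbs.trans_le hle)
    -- The cost coordinate is normalized to vanish at a, so that the extended curves start from the
    -- same point once q₁ a = q₂ a.
    let y (q : ℝ → M) (τ : ℝ) : Vec n × ℝ := (extChartAt 𝓘(ℝ, Vec n) c (q τ),
      -(∫ θ in (0 : ℝ)..a, P.L (u θ) (q θ)) + ∫ θ in (0 : ℝ)..τ, P.L (u θ) (q θ))
    have key {q : ℝ → M} (h : P.IsTrajectory t u q) (hcq : ∀ τ ∈ Icc a b, q τ ∈ chartBall n c) :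
        ACDeriv (y q) (fun θ => P.cutField c (u θ, y q θ)) a b := by
      refine ACDeriv.of_integral ?_ fun τ hτ => h.local_eq hu ha.1 hb.2 hcq _ hτ
      have hφ : ContinuousOn (fun θ => extChartAt 𝓘(ℝ, Vec n) c (q θ)) (Icc a b) :=
        (continuousOn_extChartAt c).comp (h.1.mono (Icc_subset_Icc ha.1 hb.2)) fun θ hθ => by
          rw [extChartAt_source]; exact (hcq θ hθ).1
      exact memLp_comp_curve n (M := Vec n) (G := Vec n × ℝ)
        (g := fun x => P.cutField c (x.1, x.2, 0)) (memLp_mono_Icc hu ha.1 hb.2) hφ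
        ((P.contDiff_cutField c).continuous.comp (by fun_prop))
    have hAC := (key h₁ hc₁).sub (key h₂ hc₂)
    have hya : y q₁ a - y q₂ a = 0 := by
      simp [y, hqa]
    have := eq_zero_of_integral_bound (left_mem_Icc.2 hab) hAC.continuousOn
      (fun τ hτ => by rw [hAC.eq_integral hτ, hya, zero_add]) hC0
      (by
        have := ae_mono (Measure.restrict_mono (Icc_subset_Icc ha.1 hb.2) le_rfl) hC
        filter_upwards [this] with θ hθ using (hθ _ _).2) hb1 b (right_mem_Icc.2 hab)
    have h3 : extChartAt 𝓘(ℝ, Vec n) c (q₁ b) = extChartAt 𝓘(ℝ, Vec n) c (q₂ b) :=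
      congrArg Prod.fst (sub_eq_zero.1 this)
    refine (extChartAt 𝓘(ℝ, Vec n) c).injOn ?_ ?_ h3
    · rw [extChartAt_source]; exact (hc₁ b (right_mem_Icc.2 hab)).1
    · rw [extChartAt_source]; exact (hc₂ b (right_mem_Icc.2 hab)).1
  -- If the curves differ at s, the Hausdorff property keeps them apart near s, and the induction
  -- step there is vacuous.
  · obtain ⟨U, V, hU, hV, hsU, hsV, hd⟩ := t2_separation hsq
    obtain ⟨ε₁, hε₁, m₁⟩ := eventually_mem_of_continuousOn h₁.1 hs hU hsU
    obtain ⟨ε₂, hε₂, m₂⟩ := eventually_mem_of_continuousOn h₂.1 hs hV hsV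
    refine ⟨min ε₁ ε₂, by positivity, fun a ha b hb has _ _ hqa => ?_⟩
    exfalso
    have e1 := m₁ a ha (has.trans_le (min_le_left _ _))
    have e2 := m₂ a ha (has.trans_le (min_le_right _ _))
    rw [← hqa] at e2
    exact disjoint_left.1 hd e1 e2

omit [T2Space M] [SecondCountableTopology M] in
lemma isTrajectory_trajectory {a : M} (h : ∃ q, P.IsTrajectory t u q ∧ q 0 = a) :
    P.IsTrajectory t u (P.trajectory t u a) ∧ P.trajectory t u a 0 = a := by
  rw [trajectory, dif_pos h]
  exact h.choose_spec

lemma trajectory_eq {a : M} (h : P.IsTrajectory t u q) (h0 : q 0 = a)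
    (hu : MemLp u ∞ (volume.restrict (Icc 0 t))) {s : ℝ} (hs : s ∈ Icc 0 t) :
    P.trajectory t u a s = q s := by
  have := isTrajectory_trajectory (P := P) ⟨q, h, h0⟩
  exact this.1.unique h hu (this.2.trans h0.symm) s hs

end ControlProblem

end Trajectories

end OptControl

namespace OptControl

namespace ControlProblem

/-! ### Families of trajectories depending on parameters. -/

section Family

variable {n k : ℕ} {M : Type*} [TopologicalSpace M] [ChartedSpace (Vec n) M]
  [IsManifold 𝓘(ℝ, Vec n) ∞ M]
  {𝒲 : Type*} [NormedAddCommGroup 𝒲] [NormedSpace ℝ 𝒲]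

/-- The extended curve `(q, r + ∫ L)` in the chart at `c`. -/
noncomputable def chartCurve (P : ControlProblem n k M) (c : M) (u : ℝ → Vec k) (q : ℝ → M) (r : ℝ) (τ : ℝ) :
    Vec n × ℝ :=
  (extChartAt 𝓘(ℝ, Vec n) c (q τ), r + ∫ θ in (0 : ℝ)..τ, P.L (u θ) (q θ))

omit [IsManifold 𝓘(ℝ, Vec n) ∞ M] in
lemma chartCurve_congr [IsManifold 𝓘(ℝ, Vec n) ∞ M] (P : ControlProblem n k M) (c : M)
    (u : ℝ → Vec k) {q q' : ℝ → M} (r : ℝ) {τ : ℝ} (hτ : 0 ≤ τ)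
    (h : ∀ θ ∈ Icc 0 τ, q θ = q' θ) : P.chartCurve c u q r τ = P.chartCurve c u q' r τ := by
  refine Prod.ext ?_ (congrArg (r + ·) (intervalIntegral.integral_congr fun θ hθ => ?_))
  · exact congrArg (extChartAt 𝓘(ℝ, Vec n) c) (h τ ⟨hτ, le_rfl⟩)
  · rw [uIcc_of_le hτ] at hθ
    exact congrArg (P.L (u θ)) (h θ hθ)

/-- The trajectories `qf w` of the controls `u w` exist on `[0, τ]` for `w` near `w₀`; their
end-points and costs are twice differentiable in `w`. -/
structure EndRegular (P : ControlProblem n k M) (u : 𝒲 → ℝ → Vec k) (st : 𝒲 → M) (γ : 𝒲 → ℝ)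
    (w₀ : 𝒲) (τ : ℝ) (qf : 𝒲 → ℝ → M) : Prop where
  traj : ∀ᶠ w in 𝓝 w₀, P.IsTrajectory τ (u w) (qf w) ∧ qf w 0 = st w
  smooth_end : ContMDiffAt 𝓘(ℝ, 𝒲) 𝓘(ℝ, Vec n) 2 (fun w => qf w τ) w₀
  smooth_cost : ContDiffAt ℝ 2 (fun w => γ w + ∫ θ in (0 : ℝ)..τ, P.L (u w θ) (qf w θ)) w₀

variable [T2Space M] [SecondCountableTopology M]
  {P : ControlProblem n k M} {u β : 𝒲 → ℝ → Vec k} {st : 𝒲 → M} {γ : 𝒲 → ℝ} {w₀ : 𝒲} {t : ℝ}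
  {q₀ : ℝ → M}

open Classical in
-- Continuation from a to b inside one chart: `exists_solvesVariational` solves the local equation
-- from the initial values reached at a. Uniform closeness to the reference curve keeps the
-- solutions inside the chart ball, so they can be glued to the trajectories already found.
lemma EndRegular.step [FiniteDimensional ℝ 𝒲]
    (hu : ControlFamily u β (volume.restrict (Icc 0 t)))
    (hq₀ : P.IsTrajectory t (u w₀) q₀) (hq₀0 : q₀ 0 = st w₀) {a b : ℝ} (ha : 0 ≤ a) (hab : a ≤ b)
    (hb : b ≤ t) {c : M} (hc : ∀ τ ∈ Icc a b, q₀ τ ∈ chartBall n c) {C : ℝ} (hC0 : 0 ≤ C)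
    (hC : ∀ᵐ θ ∂(volume.restrict (Icc 0 t)), ∀ y : Vec n × ℝ,
      ‖fderiv ℝ (P.cutField c) (u w₀ θ, y)‖ ≤ C) (hC1 : (b - a) * C < 1) {qf : 𝒲 → ℝ → M}
    (h : EndRegular P u st γ w₀ a qf) :
    ∃ qf' : 𝒲 → ℝ → M, (∀ᶠ w in 𝓝 w₀, P.IsTrajectory b (u w) (qf' w) ∧ qf' w 0 = st w) ∧
      SolvesVariational (P.cutField c) u β w₀ (fun w => P.chartCurve c (u w) (qf' w) (γ w)) a b ∧
      EndRegular P u st γ w₀ b qf' := by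
  have hle : volume.restrict (Icc a b) ≤ volume.restrict (Icc 0 t) :=
    Measure.restrict_mono (Icc_subset_Icc ha hb) le_rfl
  have haI : a ∈ Icc a b := left_mem_Icc.2 hab
  have hbI : b ∈ Icc a b := right_mem_Icc.2 hab
  have hqa : ∀ θ ∈ Icc 0 a, qf w₀ θ = q₀ θ := by
    have := h.traj.self_of_nhds
    exact this.1.unique (hq₀.mono (hab.trans hb))
      (memLp_mono_Icc (hu.mem_control w₀) le_rfl (hab.trans hb)) (this.2.trans hq₀0.symm)
  have hqaa : qf w₀ a = q₀ a := hqa a ⟨ha, le_rfl⟩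
  set e : 𝒲 → Vec n × ℝ := fun w => P.chartCurve c (u w) (qf w) (γ w) a with he_def
  have he : ContDiffAt ℝ 2 e w₀ := by
    refine ContDiffAt.prodMk ?_ h.smooth_cost
    rw [← contMDiffAt_iff_contDiffAt]
    refine ContMDiffAt.comp w₀ (g := extChartAt 𝓘(ℝ, Vec n) c) ?_ h.smooth_end
    refine (contMDiffAt_extChartAt' (I := 𝓘(ℝ, Vec n)) (n := ∞) (x := c) ?_).of_le ?_
    · rw [hqaa]; exact (hc a haI).1
    · exact WithTop.coe_le_coe.2 (le_top (a := (2 : ℕ∞)))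
  have he0 : e w₀ = P.chartCurve c (u w₀) q₀ (γ w₀) a := P.chartCurve_congr c _ _ ha hqa
  have hLm := memLp_comp_curve n (hu.mem_control w₀) hq₀.1
    (g := fun x : Vec k × M => P.L x.1 x.2) P.smooth_L.continuous
  have hy₀c : ContinuousOn (P.chartCurve c (u w₀) q₀ (γ w₀)) (Icc a b) := by
    refine ContinuousOn.prodMk ?_ ?_
    · exact (continuousOn_extChartAt c).comp (hq₀.1.mono (Icc_subset_Icc ha hb)) fun θ hθ => by
        rw [extChartAt_source]; exact (hc θ hθ).1
    · exact ((ACDeriv.of_integral (y := fun θ => γ w₀ + ∫ θ' in (0 : ℝ)..θ, P.L (u w₀ θ') (q₀ θ'))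
        hLm (fun θ _ => by simp)).continuousOn).mono (Icc_subset_Icc ha hb)
  obtain ⟨y, hy1, hy2, hy3, hy4, hy5⟩ := exists_solvesVariational hab (P.contDiff_cutField c)
    (hu.mono hle) w₀ he hy₀c
    (fun τ hτ => by
      rw [he0]
      exact hq₀.local_eq (hu.mem_control w₀) ha hb hc (γ w₀) hτ) hC0
    (by filter_upwards [ae_mono hle hC] with θ hθ using hθ _) hC1
  -- a uniform margin inside the chart
  obtain ⟨δ, hδ, hδs⟩ := (isCompact_Icc.image_of_continuousOn hy₀c.fst).exists_thickening_subset_open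
    (Metric.isOpen_ball (x := extChartAt 𝓘(ℝ, Vec n) c c) (ε := (cutoff n c).rIn)) (by
      rintro _ ⟨τ, hτ, rfl⟩
      exact (hc τ hτ).2)
  have hball : ∀ᶠ w in 𝓝 w₀, ∀ τ ∈ Icc a b, (y w τ).1 ∈
      Metric.ball (extChartAt 𝓘(ℝ, Vec n) c c) (cutoff n c).rIn := by
    filter_upwards [hy5 δ hδ] with w hw τ hτ
    refine hδs (Metric.mem_thickening_iff.2 ⟨_, mem_image_of_mem _ hτ, ?_⟩)
    rw [dist_eq_norm]
    exact (norm_fst_le _).trans_lt (hw τ hτ)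
  have hqfa : ∀ᶠ w in 𝓝 w₀, qf w a ∈ chartBall n c := by
    refine h.smooth_end.continuousAt.eventually_mem ((isOpen_chartBall (n := n) c).mem_nhds ?_)
    rw [hqaa]
    exact hc a haI
  set qf' : 𝒲 → ℝ → M := fun w τ =>
    if τ ≤ a then qf w τ else (extChartAt 𝓘(ℝ, Vec n) c).symm (y w τ).1 with hqf'
  have hy3a : ∀ᶠ w in 𝓝 w₀, y w a = e w := by
    filter_upwards [hy3] with w hw
    rw [hw a haI, intervalIntegral.integral_same, add_zero]
  have htraj : ∀ᶠ w in 𝓝 w₀, P.IsTrajectory b (u w) (qf' w) ∧ qf' w 0 = st w := by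
    filter_upwards [h.traj, hball, hqfa, hy3, hy3a] with w h1 h2 h3 h4 h5
    refine ⟨IsTrajectory.extend ha hab h1.1 (memLp_mono_Icc (hu.mem_control w) le_rfl hb) h3
      (hy2 w) h2 (by rw [h5]; rfl) (fun τ hτ => by rw [h5]; exact h4 τ hτ), ?_⟩
    rw [← h1.2]
    exact if_pos ha
  -- The states agree by construction of the gluing. The costs agree because both curves satisfy the
  -- same integral equation, whose integrand does not involve the cost.
  have hcurve : ∀ᶠ w in 𝓝 w₀, ∀ τ ∈ Icc a b,
      qf' w τ = (extChartAt 𝓘(ℝ, Vec n) c).symm (y w τ).1 ∧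
      P.chartCurve c (u w) (qf' w) (γ w) τ = y w τ := by
    filter_upwards [htraj, hball, hqfa, hy3, hy3a] with w h1 h2 h3 h4 h5
    have e1 : ∀ τ ≤ a, qf' w τ = qf w τ := fun τ hτ => if_pos hτ
    have e2 : ∀ τ ∈ Icc a b, qf' w τ = (extChartAt 𝓘(ℝ, Vec n) c).symm (y w τ).1 := by
      intro τ hτ
      rcases hτ.1.eq_or_lt with rfl | hlt
      · rw [e1 a le_rfl, h5]
        refine ((extChartAt 𝓘(ℝ, Vec n) c).left_inv ?_).symm
        rw [extChartAt_source]
        exact h3.1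
      · exact if_neg (not_le.2 hlt)
    have hmem : ∀ τ ∈ Icc a b, qf' w τ ∈ chartBall n c := fun τ hτ => by
      rw [e2 τ hτ]; exact symm_mem_chartBall (h2 τ hτ)
    have e3 : ∀ τ ∈ Icc a b, extChartAt 𝓘(ℝ, Vec n) c (qf' w τ) = (y w τ).1 := fun τ hτ => by
      rw [e2 τ hτ, (extChartAt 𝓘(ℝ, Vec n) c).right_inv (ball_subset_target c (h2 τ hτ))]
    intro τ hτ
    refine ⟨e2 τ hτ, ?_⟩
    have e4 := h1.1.local_eq (memLp_mono_Icc (hu.mem_control w) le_rfl hb) ha le_rfl hmem (γ w) hτ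
    refine e4.trans ?_
    rw [h4 τ hτ]
    refine congrArg₂ (· + ·) (P.chartCurve_congr c (u w) (γ w) ha fun θ hθ => e1 θ hθ.2)
      (intervalIntegral.integral_congr fun θ hθ => ?_)
    rw [uIcc_of_le hτ.1] at hθ
    exact congrArg (fun x => P.cutField c (u w θ, x, (y w θ).2)) (e3 θ ⟨hθ.1, hθ.2.trans hτ.2⟩)
  have hsv : SolvesVariational (P.cutField c) u β w₀
      (fun w => P.chartCurve c (u w) (qf' w) (γ w)) a b :=
    hy1.congr fun τ hτ => hcurve.mono fun w hw => (hw τ hτ).2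
  refine ⟨qf', htraj, hsv, htraj, ?_, (hsv.contDiffAt b hbI).snd⟩
  have e5 : ContMDiffAt 𝓘(ℝ, 𝒲) 𝓘(ℝ, Vec n) 2
      (fun w => (extChartAt 𝓘(ℝ, Vec n) c).symm (y w b).1) w₀ := by
    refine ContMDiffAt.comp w₀ (g := (extChartAt 𝓘(ℝ, Vec n) c).symm) (f := fun w => (y w b).1)
      (I' := 𝓘(ℝ, Vec n)) ?_ (contMDiffAt_iff_contDiffAt.2 (hy1.contDiffAt b hbI).fst)
    refine ((contMDiffOn_extChartAt_symm (I := 𝓘(ℝ, Vec n)) (n := ∞) c).contMDiffAt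
      ((isOpen_extChartAt_target c).mem_nhds
        (ball_subset_target c (hball.self_of_nhds b hbI)))).of_le ?_
    exact WithTop.coe_le_coe.2 (le_top (a := (2 : ℕ∞)))
  exact e5.congr_of_eventuallyEq (hcurve.mono fun w hw => (hw b hbI).1)

/-- Trajectories depend twice differentiably on initial points and controls, and their derivatives
solve the variational equations in charts. -/
theorem trajectory_family [FiniteDimensional ℝ 𝒲]
    (hu : ControlFamily u β (volume.restrict (Icc 0 t))) (ht : 0 ≤ t)
    (hst : ContMDiffAt 𝓘(ℝ, 𝒲) 𝓘(ℝ, Vec n) 2 st w₀) (hγ : ContDiffAt ℝ 2 γ w₀)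
    (hq₀ : P.IsTrajectory t (u w₀) q₀) (hq₀0 : q₀ 0 = st w₀) :
    (∀ᶠ w in 𝓝 w₀, P.IsTrajectory t (u w) (P.trajectory t (u w) (st w)) ∧
      P.trajectory t (u w) (st w) 0 = st w) ∧
    (∀ τ ∈ Icc 0 t, P.trajectory t (u w₀) (st w₀) τ = q₀ τ) ∧
    (∀ τ ∈ Icc 0 t, ContMDiffAt 𝓘(ℝ, 𝒲) 𝓘(ℝ, Vec n) 2
      (fun w => P.trajectory t (u w) (st w) τ) w₀) ∧
    ∀ s ∈ Icc 0 t, ∃ ε > 0, ∀ a ∈ Icc 0 t, ∀ b ∈ Icc 0 t, |a - s| < ε → |b - s| < ε → a ≤ b →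
      (∀ τ ∈ Icc a b, q₀ τ ∈ chartBall n (q₀ s)) ∧
      SolvesVariational (P.cutField (q₀ s)) u β w₀
        (fun w => P.chartCurve (q₀ s) (u w) (P.trajectory t (u w) (st w)) (γ w)) a b := by
  have key : ∀ s ∈ Icc 0 t, ∃ ε > 0, ∀ a ∈ Icc 0 t, ∀ b ∈ Icc 0 t, |a - s| < ε → |b - s| < ε →
      a ≤ b → (∀ τ ∈ Icc a b, q₀ τ ∈ chartBall n (q₀ s)) ∧
      ((∃ qf, EndRegular P u st γ w₀ a qf) → 
        ∃ qf' : 𝒲 → ℝ → M, (∀ᶠ w in 𝓝 w₀, P.IsTrajectory b (u w) (qf' w) ∧ qf' w 0 = st w) ∧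
        SolvesVariational (P.cutField (q₀ s)) u β w₀
          (fun w => P.chartCurve (q₀ s) (u w) (qf' w) (γ w)) a b ∧
        EndRegular P u st γ w₀ b qf') := by
    intro s hs
    obtain ⟨ε₁, hε₁, m₁⟩ := eventually_mem_of_continuousOn hq₀.1 hs
      (isOpen_chartBall (n := n) (q₀ s)) (mem_chartBall (n := n) (q₀ s))
    obtain ⟨C, hC0, hC, ε₂, hε₂, m₂⟩ := P.exists_step (hu.mem_control w₀) (q₀ s)
    refine ⟨min ε₁ ε₂, by positivity, fun a ha b hb has hbs hab => ?_⟩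
    have hc : ∀ τ ∈ Icc a b, q₀ τ ∈ chartBall n (q₀ s) := fun τ hτ =>
      m₁ τ ⟨ha.1.trans hτ.1, hτ.2.trans hb.2⟩ ((abs_lt.2 ⟨by linarith [(abs_lt.1 has).1, hτ.1],
        by linarith [(abs_lt.1 hbs).2, hτ.2]⟩ : |τ - s| < min ε₁ ε₂).trans_le (min_le_left _ _))
    refine ⟨hc, fun ⟨qf, hqf⟩ => ?_⟩
    exact hqf.step hu hq₀ hq₀0 ha.1 hab hb.2 hc hC0
      (by filter_upwards [hC] with θ hθ y using (hθ y y).1)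
      (m₂ s a b (has.trans_le (min_le_right _ _)) (hbs.trans_le (min_le_right _ _)))
  have h0 : ∃ qf, EndRegular P u st γ w₀ 0 qf := by
    refine ⟨fun w _ => st w, Eventually.of_forall fun w => ⟨⟨continuousOn_const, fun φ _ s hs => ?_⟩,
      rfl⟩, hst, ?_⟩
    · have : s = 0 := le_antisymm hs.2 hs.1
      rw [this, intervalIntegral.integral_same, add_zero]
    · simpa using hγ
  have good := Icc_local_induction (p := fun τ => ∃ qf, EndRegular P u st γ w₀ τ qf) h0
    fun s hs => by
      obtain ⟨ε, hε, h⟩ := key s hs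
      refine ⟨ε, hε, fun a ha b hb has hbs hab hg => ?_⟩
      obtain ⟨qf', -, -, h'⟩ := (h a ha b hb has hbs hab).2 hg
      exact ⟨qf', h'⟩
  obtain ⟨qf, hqf⟩ := good t ⟨ht, le_rfl⟩
  have h1 : ∀ᶠ w in 𝓝 w₀, P.IsTrajectory t (u w) (P.trajectory t (u w) (st w)) ∧
      P.trajectory t (u w) (st w) 0 = st w :=
    hqf.traj.mono fun w hw => isTrajectory_trajectory ⟨qf w, hw⟩
  refine ⟨h1, fun τ hτ => trajectory_eq hq₀ hq₀0 (hu.mem_control w₀) hτ, fun τ hτ => ?_,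
    fun s hs => ?_⟩
  · obtain ⟨qf', hqf'⟩ := good τ hτ
    refine hqf'.smooth_end.congr_of_eventuallyEq ?_
    filter_upwards [h1, hqf'.traj] with w e1 e2
    exact (e1.1.mono hτ.2).unique e2.1 (memLp_mono_Icc (hu.mem_control w) le_rfl hτ.2)
      (e1.2.trans e2.2.symm) τ ⟨hτ.1, le_rfl⟩
  obtain ⟨ε, hε, h⟩ := key s hs
  refine ⟨ε, hε, fun a ha b hb has hbs hab => ?_⟩
  obtain ⟨hc, h2⟩ := h a ha b hb has hbs hab
  obtain ⟨qf', h3, h4, -⟩ := h2 (good a ha)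
  -- Uniqueness identifies the family constructed piece by piece with the chosen `trajectory`.
  refine ⟨hc, h4.congr fun τ hτ => ?_⟩
  filter_upwards [h1, h3] with w e1 e2
  refine P.chartCurve_congr _ _ _ (ha.1.trans hτ.1) fun θ hθ => ?_
  exact (e1.1.mono hb.2).unique e2.1 (memLp_mono_Icc (hu.mem_control w) le_rfl hb.2)
    (e1.2.trans e2.2.symm) θ ⟨hθ.1, hθ.2.trans hτ.2⟩

end Family

end ControlProblem

end OptControl

namespace OptControl

/-! ### Assembling operators from vectors and curves from pieces. -/

section Assembly

variable {E F : Type*} [NormedAddCommGroup E] [NormedSpace ℝ E] [FiniteDimensional ℝ E]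
  [NormedAddCommGroup F] [NormedSpace ℝ F]

lemma clm_eq_sum (A : E →L[ℝ] F) :
    A = ∑ i, ContinuousLinearMap.smulRightL ℝ E F
      (LinearMap.toContinuousLinearMap ((Module.finBasis ℝ E).coord i))
        (A (Module.finBasis ℝ E i)) := by
  ext x
  conv_lhs => rw [← (Module.finBasis ℝ E).sum_repr x, map_sum]
  simp

omit [FiniteDimensional ℝ E] in
lemma ACDeriv.sum {ι : Type*} (s : Finset ι) {y y' : ι → ℝ → F} {a b : ℝ}
    (h : ∀ i ∈ s, ACDeriv (y i) (y' i) a b) :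
    ACDeriv (fun τ => ∑ i ∈ s, y i τ) (fun τ => ∑ i ∈ s, y' i τ) a b := by
  classical
  induction s using Finset.induction_on with
  | empty => simpa using ACDeriv.const (0 : F)
  | insert i s hi ih =>
    simp only [Finset.sum_insert hi]
    exact (h i (Finset.mem_insert_self i s)).add
      (ih fun j hj => h j (Finset.mem_insert_of_mem hj))

lemma ACDeriv.of_apply {A A' : ℝ → E →L[ℝ] F} {a b : ℝ}
    (h : ∀ v, ACDeriv (fun τ => A τ v) (fun τ => A' τ v) a b) : ACDeriv A A' a b := by
  have := ACDeriv.sum Finset.univ (a := a) (b := b) fun i _ =>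
    (h (Module.finBasis ℝ E i)).clm (ContinuousLinearMap.smulRightL ℝ E F
      (LinearMap.toContinuousLinearMap ((Module.finBasis ℝ E).coord i)))
  simpa only [← clm_eq_sum] using this

lemma memLp_of_apply {α : Type*} [MeasurableSpace α] {μ : Measure α} {p : ℝ≥0∞}
    {A : α → E →L[ℝ] F} (h : ∀ v, MemLp (fun τ => A τ v) p μ) : MemLp A p μ := by
  have := memLp_finsetSum (μ := μ) (p := p) Finset.univ (f := fun i τ =>
    (ContinuousLinearMap.smulRightL ℝ E F
      (LinearMap.toContinuousLinearMap ((Module.finBasis ℝ E).coord i)))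
        (A τ (Module.finBasis ℝ E i))) fun i _ => ContinuousLinearMap.comp_memLp' _ (h _)
  simpa only [← clm_eq_sum] using this

omit [FiniteDimensional ℝ E] in
lemma MemLp.bilin_top {α : Type*} [MeasurableSpace α] {μ : Measure α} {G : Type*}
    [NormedAddCommGroup G] [NormedSpace ℝ G] (B : E →L[ℝ] F →L[ℝ] G) {y : α → E} {z : α → F}
    (hy : MemLp y ∞ μ) (hz : MemLp z ∞ μ) : MemLp (fun τ => B (y τ) (z τ)) ∞ μ := by
  obtain ⟨C, hC0, hC⟩ := MemLp.exists_norm_le hy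
  obtain ⟨C', hC0', hC'⟩ := MemLp.exists_norm_le hz
  refine memLp_top_of_bound (B.aestronglyMeasurable_comp₂ hy.1 hz.1) (‖B‖ * C * C') ?_
  filter_upwards [hC, hC'] with τ h1 h2
  refine (B.le_opNorm₂ _ _).trans ?_
  gcongr

omit [FiniteDimensional ℝ E] in
lemma ACDeriv.glue {y y' : ℝ → F} {a b c : ℝ} (hab : a ≤ b) (hbc : b ≤ c)
    (h₁ : ACDeriv y y' a b) (h₂ : ACDeriv y y' b c) : ACDeriv y y' a c := by
  obtain ⟨C₁, l₁⟩ := h₁.lip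
  obtain ⟨C₂, l₂⟩ := h₂.lip
  constructor
  · have m₁ := fun x hx y hy => (l₁.dist_le_mul x hx y hy).trans
      (mul_le_mul_of_nonneg_right (NNReal.coe_le_coe.2 (le_max_left C₁ C₂)) dist_nonneg)
    have m₂ := fun x hx y hy => (l₂.dist_le_mul x hx y hy).trans
      (mul_le_mul_of_nonneg_right (NNReal.coe_le_coe.2 (le_max_right C₁ C₂)) dist_nonneg)
    have key : ∀ x ∈ Icc a c, ∀ z ∈ Icc a c, x ≤ z →
        dist (y x) (y z) ≤ (max C₁ C₂ : NNReal) * dist x z := by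
      intro x hx z hz hxz
      rcases le_total z b with h | h
      · exact m₁ x ⟨hx.1, hxz.trans h⟩ z ⟨hz.1, h⟩
      rcases le_total x b with h' | h'
      · have e1 := m₁ x ⟨hx.1, h'⟩ b ⟨hab, le_rfl⟩
        have e2 := m₂ b ⟨le_rfl, hbc⟩ z ⟨h, hz.2⟩
        have e3 : dist x z = dist x b + dist b z := by
          rw [Real.dist_eq, Real.dist_eq, Real.dist_eq, abs_of_nonpos (by linarith),
            abs_of_nonpos (by linarith), abs_of_nonpos (by linarith)]
          ring
        rw [e3, mul_add]
        exact (dist_triangle _ (y b) _).trans (add_le_add e1 e2)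
      · exact m₂ x ⟨h', hx.2⟩ z ⟨h, hz.2⟩
    refine ⟨max C₁ C₂, LipschitzOnWith.of_dist_le_mul fun x hx z hz => ?_⟩
    rcases le_total x z with h | h
    · exact key x hx z hz h
    · rw [dist_comm (y x), dist_comm x]
      exact key z hz x hx h
  · have hb : ∀ᵐ τ : ℝ, τ ≠ b := by
      simp [ae_iff, measure_singleton]
    filter_upwards [h₁.deriv, h₂.deriv, hb] with τ d₁ d₂ hne hτ
    rcases lt_or_gt_of_ne hne with h | h
    · exact d₁ ⟨hτ.1, h⟩
    · exact d₂ ⟨h, hτ.2⟩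

omit [FiniteDimensional ℝ E] [NormedSpace ℝ F] in
lemma memLp_top_glue {f : ℝ → F} {a b c : ℝ} (hab : a ≤ b) (hbc : b ≤ c)
    (h₁ : MemLp f ∞ (volume.restrict (Icc a b))) (h₂ : MemLp f ∞ (volume.restrict (Icc b c))) :
    MemLp f ∞ (volume.restrict (Icc a c)) := by
  obtain ⟨C₁, -, b₁⟩ := MemLp.exists_norm_le h₁
  obtain ⟨C₂, -, b₂⟩ := MemLp.exists_norm_le h₂
  rw [← Icc_union_Icc_eq_Icc hab hbc]
  refine memLp_top_of_bound (aestronglyMeasurable_union_iff.2 ⟨h₁.1, h₂.1⟩) (max C₁ C₂) ?_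
  rw [ae_restrict_union_iff]
  exact ⟨b₁.mono fun x hx => hx.trans (le_max_left _ _),
    b₂.mono fun x hx => hx.trans (le_max_right _ _)⟩

end Assembly

/-! ### Derivatives of a family pulled back by a flow. -/

section Pull

variable {W E : Type*} [NormedAddCommGroup W] [NormedSpace ℝ W] [NormedAddCommGroup E]
  [NormedSpace ℝ E]

lemma ringInverse_apply {A : E →L[ℝ] E} (h : IsUnit A) (x : E) : A (Ring.inverse A x) = x :=
  DFunLike.congr_fun (Ring.mul_inverse_cancel A h) x

lemma ringInverse_apply_eq {A : E →L[ℝ] E} (h : IsUnit A) {x z : E} :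
    Ring.inverse A x = z ↔ A z = x := by
  constructor
  · rintro rfl
    exact ringInverse_apply h x
  · rintro rfl
    exact DFunLike.congr_fun (Ring.inverse_mul_cancel A h) z

/-- The differential at `w₀` of `p⁻¹ ∘ y`. -/
noncomputable def pull (p : E → E) (x₀ : E) (y : W → E) (w₀ : W) (v : W) : E :=
  Ring.inverse (fderiv ℝ p x₀) (fderiv ℝ y w₀ v)

/-- The second differential at `w₀` of `p⁻¹ ∘ y`. -/
noncomputable def pull₂ (p : E → E) (x₀ : E) (y : W → E) (w₀ : W) (v v' : W) : E :=
  Ring.inverse (fderiv ℝ p x₀) (fderiv ℝ (fderiv ℝ y) w₀ v v' -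
    fderiv ℝ (fderiv ℝ p) x₀ (pull p x₀ y w₀ v) (pull p x₀ y w₀ v'))

lemma fderiv_comp_two {E' : Type*} [NormedAddCommGroup E'] [NormedSpace ℝ E'] {κ : E → E'}
    {f : W → E} {w : W} (hκ : ContDiffAt ℝ 2 κ (f w)) (hf : ContDiffAt ℝ 2 f w) (v v' : W) :
    fderiv ℝ (fun x => κ (f x)) w v = fderiv ℝ κ (f w) (fderiv ℝ f w v) ∧
    fderiv ℝ (fderiv ℝ (fun x => κ (f x))) w v v' =
      fderiv ℝ (fderiv ℝ κ) (f w) (fderiv ℝ f w v) (fderiv ℝ f w v') +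
        fderiv ℝ κ (f w) (fderiv ℝ (fderiv ℝ f) w v v') := by
  have h1 : ∀ᶠ x in 𝓝 w, HasFDerivAt (fun x => κ (f x)) (fderiv ℝ κ (f x) ∘L fderiv ℝ f x) x := by
    filter_upwards [ContDiffAt.eventually_hasFDerivAt hf,
      hf.continuousAt.eventually (ContDiffAt.eventually_hasFDerivAt hκ)] with x d1 d2
    exact HasFDerivAt.comp (𝕜 := ℝ) (g := κ) (f := f) x d2 d1
  refine ⟨DFunLike.congr_fun h1.self_of_nhds.fderiv v, ?_⟩
  have e1 := ContDiffAt.hasFDerivAt_fderiv_apply (hκ.comp w hf) v'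
  have d1 : HasFDerivAt (fun x => fderiv ℝ κ (f x))
      (fderiv ℝ (fderiv ℝ κ) (f w) ∘L fderiv ℝ f w) w := by
    refine HasFDerivAt.comp (𝕜 := ℝ) (g := fderiv ℝ κ) (f := f) w ?_
      (ContDiffAt.eventually_hasFDerivAt hf).self_of_nhds
    exact ((hκ.fderiv_right (m := 1) (by norm_num)).differentiableAt one_ne_zero).hasFDerivAt
  have e2 := d1.clm_apply (ContDiffAt.hasFDerivAt_fderiv_apply hf v')
  have e3 : (fun x => fderiv ℝ (κ ∘ f) x v') =ᶠ[𝓝 w] fun x => fderiv ℝ κ (f x) (fderiv ℝ f x v') :=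
    h1.mono fun x hx => DFunLike.congr_fun hx.fderiv v'
  have e4 := e1.unique (e2.congr_of_eventuallyEq e3)
  have e5 := DFunLike.congr_fun e4 v
  have e6 : (κ ∘ f) = fun x => κ (f x) := rfl
  rw [e6] at e5
  simpa [add_comm] using e5

/-- A change of coordinates κ is composed with both p and y and cancels in p⁻¹ ∘ y; the terms with
the second derivative of κ cancel likewise. Hence pulled-back variations do not depend on the chart.
-/
lemma pull_congr {p p' : E → E} {x₀ : E} {y y' : W → E} {w₀ : W} {κ : E → E}
    (hκ : ContDiffAt ℝ 2 κ (p x₀)) (hp : ContDiffAt ℝ 2 p x₀) (hy : ContDiffAt ℝ 2 y w₀)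
    (hxy : y w₀ = p x₀) (hA₀ : IsUnit (fderiv ℝ p x₀)) (hκu : IsUnit (fderiv ℝ κ (p x₀)))
    (hp' : p' =ᶠ[𝓝 x₀] fun x => κ (p x)) (hy' : y' =ᶠ[𝓝 w₀] fun w => κ (y w)) (v v' : W) :
    pull p' x₀ y' w₀ v = pull p x₀ y w₀ v ∧ pull₂ p' x₀ y' w₀ v v' = pull₂ p x₀ y w₀ v v' := by
  have hκ' : ContDiffAt ℝ 2 κ (y w₀) := by rwa [hxy]
  have a1 := fun a b => fderiv_comp_two hκ hp a b
  have a2 := fun a b => fderiv_comp_two hκ' hy a b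
  have b1 := hp'.fderiv_eq (𝕜 := ℝ)
  have b2 := hy'.fderiv_eq (𝕜 := ℝ)
  have c1 := (hp'.fderiv (𝕜 := ℝ)).fderiv_eq (𝕜 := ℝ)
  have c2 := (hy'.fderiv (𝕜 := ℝ)).fderiv_eq (𝕜 := ℝ)
  have e1 : fderiv ℝ p' x₀ = fderiv ℝ κ (p x₀) * fderiv ℝ p x₀ := by
    ext a
    rw [b1, (a1 a a).1]
    rfl
  have hu : IsUnit (fderiv ℝ p' x₀) := e1 ▸ hκu.mul hA₀
  have key : ∀ v, pull p' x₀ y' w₀ v = pull p x₀ y w₀ v := by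
    intro v
    rw [pull, ringInverse_apply_eq hu, e1, mul_apply_eq_comp, pull,
      ringInverse_apply hA₀, b2, (a2 v v).1, hxy]
  refine ⟨key v, ?_⟩
  have hP : ∀ v, fderiv ℝ p x₀ (pull p x₀ y w₀ v) = fderiv ℝ y w₀ v := fun v =>
    ringInverse_apply hA₀ _
  rw [pull₂, ringInverse_apply_eq hu, e1, mul_apply_eq_comp, pull₂,
    ringInverse_apply hA₀, key, key, c1, c2, (a1 _ _).2, (a2 _ _).2, hP, hP, hxy, map_sub]
  abel

end Pull

/-! ### The equations of the pulled-back variations. -/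

section PullODE

universe w

variable {𝒲 : Type*} [NormedAddCommGroup 𝒲] [NormedSpace ℝ 𝒲]
  {E K : Type w} [NormedAddCommGroup E] [NormedSpace ℝ E] [FiniteDimensional ℝ E]
  [NormedAddCommGroup K] [NormedSpace ℝ K] {a b : ℝ}
  {F : K × E → E} {u₀ : ℝ → K} {p : E → ℝ → E} {x₀ : E}

omit [FiniteDimensional ℝ E] in
lemma ACDeriv.congr_fun_deriv {F : Type*} [NormedAddCommGroup F] [NormedSpace ℝ F]
    {y y' z z' : ℝ → F} (h : ACDeriv y y' a b) (h1 : EqOn z y (Icc a b))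
    (h2 : ∀ τ ∈ Icc a b, y' τ = z' τ) : ACDeriv z z' a b := by
  refine (h.congr h1).congr_deriv ?_
  filter_upwards [ae_restrict_mem measurableSet_Icc] with τ hτ
  exact (h2 τ hτ).symm

lemma SolvesVariational.flow_first
    (hp : SolvesVariational F (fun _ => u₀) (fun _ _ => 0) x₀ p a b) :
    ACDeriv (fun τ => fderiv ℝ (fun x => p x τ) x₀)
      (fun τ => (fderiv ℝ F (u₀ τ, p x₀ τ) ∘L ContinuousLinearMap.inr ℝ K E) ∘L
        fderiv ℝ (fun x => p x τ) x₀) a b :=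
  ACDeriv.of_apply fun v => hp.first v

lemma SolvesVariational.flow_second
    (hp : SolvesVariational F (fun _ => u₀) (fun _ _ => 0) x₀ p a b) :
    ∃ R : ℝ → E →L[ℝ] E →L[ℝ] E,
    ACDeriv (fun τ => fderiv ℝ (fderiv ℝ (fun x => p x τ)) x₀) R a b ∧
    ∀ τ v v', R τ v v' = fderiv ℝ (fderiv ℝ F) (u₀ τ, p x₀ τ)
        (0, fderiv ℝ (fun x => p x τ) x₀ v) (0, fderiv ℝ (fun x => p x τ) x₀ v') +
      fderiv ℝ F (u₀ τ, p x₀ τ) (0, fderiv ℝ (fderiv ℝ (fun x => p x τ)) x₀ v v') := by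
  let ι := ContinuousLinearMap.inr ℝ K E
  let R : ℝ → E →L[ℝ] E →L[ℝ] E := fun τ =>
    ((ContinuousLinearMap.compL ℝ E (K × E) E).flip (ι ∘L fderiv ℝ (fun x => p x τ) x₀)) ∘L
      (fderiv ℝ (fderiv ℝ F) (u₀ τ, p x₀ τ) ∘L (ι ∘L fderiv ℝ (fun x => p x τ) x₀)) +
    (ContinuousLinearMap.compL ℝ E E E (fderiv ℝ F (u₀ τ, p x₀ τ) ∘L ι)) ∘L
      fderiv ℝ (fderiv ℝ (fun x => p x τ)) x₀
  exact ⟨R, ACDeriv.of_apply fun v => ACDeriv.of_apply fun v' => hp.second v v', fun _ _ _ => rfl⟩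

/-- The derivative of `pull₂` along a family of controls, at given `(u₀ τ, p x₀ τ)`. -/
noncomputable def pullRate (F : K × E → E) (c : K) (p : E → E) (x₀ : E) (v : K) : E :=
  Ring.inverse (fderiv ℝ p x₀) (fderiv ℝ F (c, p x₀) (v, 0))

/-- The derivative at x₀ in the direction a of the pulled-back control field x ↦ (dp_x)⁻¹ ∂_u F(c, p
x) v; the term with the second derivative of p comes from differentiating the inverse. -/
noncomputable def pullMixed (F : K × E → E) (c : K) (p : E → E) (x₀ : E) (v : K) (a : E) : E :=
  Ring.inverse (fderiv ℝ p x₀) (fderiv ℝ (fderiv ℝ F) (c, p x₀) (v, 0) (0, fderiv ℝ p x₀ a) -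
    fderiv ℝ (fderiv ℝ p) x₀ (pullRate F c p x₀ v) a)

noncomputable def pullRate₂ (F : K × E → E) (c : K) (p : E → E) (x₀ : E) (v v' : K) : E :=
  Ring.inverse (fderiv ℝ p x₀) (fderiv ℝ (fderiv ℝ F) (c, p x₀) (v, 0) (v', 0))

/-- Variation of constants to second order. The drift in the equations of y is also the drift in the
equations of the flow p, so it cancels in p⁻¹ ∘ y and only terms with at least one control variation
remain. -/
theorem SolvesVariational.pull_ode {u β : 𝒲 → ℝ → K} {w₀ : 𝒲} {y : 𝒲 → ℝ → E}
    (hF : ContDiff ℝ ∞ F)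
    (hp : SolvesVariational F (fun _ => u₀) (fun _ _ => 0) x₀ p a b)
    (hy : SolvesVariational F u β w₀ y a b)
    (hu : ∀ᵐ τ ∂(volume.restrict (Icc a b)), u w₀ τ = u₀ τ)
    (h0 : ∀ τ ∈ Icc a b, y w₀ τ = p x₀ τ)
    (hA₀ : ∀ τ ∈ Icc a b, IsUnit (fderiv ℝ (fun x => p x τ) x₀)) (v v' : 𝒲) :
    ACDeriv (fun τ => pull (fun x => p x τ) x₀ (fun w => y w τ) w₀ v)
      (fun τ => pullRate F (u₀ τ) (fun x => p x τ) x₀ (β v τ)) a b ∧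
    ACDeriv (fun τ => pull₂ (fun x => p x τ) x₀ (fun w => y w τ) w₀ v v')
      (fun τ => pullRate₂ F (u₀ τ) (fun x => p x τ) x₀ (β v τ) (β v' τ) +
        pullMixed F (u₀ τ) (fun x => p x τ) x₀ (β v τ)
          (pull (fun x => p x τ) x₀ (fun w => y w τ) w₀ v') +
        pullMixed F (u₀ τ) (fun x => p x τ) x₀ (β v' τ)
          (pull (fun x => p x τ) x₀ (fun w => y w τ) w₀ v)) a b := by
  have := FiniteDimensional.complete ℝ E
  have hI := hp.flow_first.inverse hA₀
  have D : ∀ v, ACDeriv (fun τ => pull (fun x => p x τ) x₀ (fun w => y w τ) w₀ v)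
      (fun τ => pullRate F (u₀ τ) (fun x => p x τ) x₀ (β v τ)) a b := by
    intro v
    refine (hI.clm_apply (hy.first v)).congr_deriv ?_
    filter_upwards [hu, ae_restrict_mem measurableSet_Icc] with τ h1 h2
    rw [h1, h0 τ h2]
    set A := fderiv ℝ (fun x => p x τ) x₀
    have hA : IsUnit A := hA₀ τ h2
    have e : fderiv ℝ F (u₀ τ, p x₀ τ) (β v τ, fderiv ℝ (fun w => y w τ) w₀ v) =
        fderiv ℝ F (u₀ τ, p x₀ τ) (β v τ, 0) +
        fderiv ℝ F (u₀ τ, p x₀ τ) (0, fderiv ℝ (fun w => y w τ) w₀ v) := by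
      rw [← map_add, Prod.mk_add_mk, add_zero, zero_add]
    rw [e, map_add, pullRate]
    simp only [neg_apply, mul_apply_eq_comp, ContinuousLinearMap.comp_apply,
      ringInverse_apply hA, ContinuousLinearMap.inr_apply]
    abel
  refine ⟨D v, ?_⟩
  obtain ⟨R, hR, hRf⟩ := hp.flow_second
  -- The vector to which (dp)⁻¹ is applied in `pull₂`.
  have hB := (hy.second v v').sub ((hR.clm_apply (D v)).clm_apply (D v'))
  refine (hI.clm_apply hB).congr_deriv ?_
  filter_upwards [hu, ae_restrict_mem measurableSet_Icc] with τ h1 h2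
  rw [h1, h0 τ h2]
  set A := fderiv ℝ (fun x => p x τ) x₀ with hAdef
  set P2 := fderiv ℝ (fderiv ℝ (fun x => p x τ)) x₀ with hP2
  have hA : IsUnit A := hA₀ τ h2
  have hP : ∀ v, A (pull (fun x => p x τ) x₀ (fun w => y w τ) w₀ v) =
      fderiv ℝ (fun w => y w τ) w₀ v := fun v => ringInverse_apply hA _
  have hs1 : ∀ x z, P2 x z = P2 z x := by
    have := (hp.contDiffAt τ h2).isSymmSndFDerivAt (by simp)
    exact fun x z => this x z
  have hs2 : ∀ x z, fderiv ℝ (fderiv ℝ F) (u₀ τ, p x₀ τ) x z =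
      fderiv ℝ (fderiv ℝ F) (u₀ τ, p x₀ τ) z x := by
    have := ((contDiff_infty.1 hF 2).contDiffAt (x := (u₀ τ, p x₀ τ))).isSymmSndFDerivAt (by simp)
    exact fun x z => this x z
  -- Splitting the second derivative of F by types: the state-state part cancels against the
  -- equation of the second derivative of the flow, the control-control part is `pullRate₂`, and the
  -- two mixed parts enter `pullMixed`.
  have e : fderiv ℝ (fderiv ℝ F) (u₀ τ, p x₀ τ)
        (β v τ, fderiv ℝ (fun w => y w τ) w₀ v) (β v' τ, fderiv ℝ (fun w => y w τ) w₀ v') =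
      fderiv ℝ (fderiv ℝ F) (u₀ τ, p x₀ τ) (β v τ, 0) (β v' τ, 0) +
      fderiv ℝ (fderiv ℝ F) (u₀ τ, p x₀ τ) (β v τ, 0) (0, fderiv ℝ (fun w => y w τ) w₀ v') +
      fderiv ℝ (fderiv ℝ F) (u₀ τ, p x₀ τ) (β v' τ, 0) (0, fderiv ℝ (fun w => y w τ) w₀ v) +
      fderiv ℝ (fderiv ℝ F) (u₀ τ, p x₀ τ) (0, fderiv ℝ (fun w => y w τ) w₀ v)
        (0, fderiv ℝ (fun w => y w τ) w₀ v') := by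
    have e1 : ∀ (x : K) (z : E), ((x, z) : K × E) = (x, 0) + (0, z) := fun x z => by simp
    rw [e1 (β v τ), e1 (β v' τ), hs2 (β v' τ, 0) (0, _)]
    simp only [map_add, add_apply]
    abel
  rw [e]
  simp only [hRf, ← hAdef, ← hP2, hP, pullRate₂, pullMixed, map_add, map_sub, neg_apply, add_apply,
    mul_apply_eq_comp, ContinuousLinearMap.comp_apply, ringInverse_apply hA,
    ContinuousLinearMap.inr_apply]
  rw [hs1 (pull (fun x => p x τ) x₀ (fun w => y w τ) w₀ v)
    (pullRate F (u₀ τ) (fun x => p x τ) x₀ (β v' τ))]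
  abel

end PullODE

end OptControl

namespace OptControl

/-! ### Transition maps on extended states. -/

section ChartChange

variable {n k : ℕ} {M : Type*} [TopologicalSpace M] [ChartedSpace (Vec n) M]

variable (n) in
/-- The transition from the chart at `c` to the chart at `c'`, on extended states. -/
noncomputable def chartChange (c c' : M) (y : Vec n × ℝ) : Vec n × ℝ :=
  (extChartAt 𝓘(ℝ, Vec n) c' ((extChartAt 𝓘(ℝ, Vec n) c).symm y.1), y.2)

lemma chartChange_apply {c c' x : M} (hx : x ∈ (chartAt (Vec n) c).source) (r : ℝ) :
    chartChange n c c' (extChartAt 𝓘(ℝ, Vec n) c x, r) = (extChartAt 𝓘(ℝ, Vec n) c' x, r) := by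
  rw [chartChange, (extChartAt 𝓘(ℝ, Vec n) c).left_inv (by rwa [extChartAt_source])]

variable [IsManifold 𝓘(ℝ, Vec n) ∞ M]

lemma contDiffAt_coordChange {c c' x : M} (hx : x ∈ (chartAt (Vec n) c).source)
    (hx' : x ∈ (chartAt (Vec n) c').source) :
    ContDiffAt ℝ ∞ (fun y => extChartAt 𝓘(ℝ, Vec n) c' ((extChartAt 𝓘(ℝ, Vec n) c).symm y))
      (extChartAt 𝓘(ℝ, Vec n) c x) := by
  have h := (extChartAt 𝓘(ℝ, Vec n) c).left_inv (by rwa [extChartAt_source])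
  have ht := (extChartAt 𝓘(ℝ, Vec n) c).map_source (by rwa [extChartAt_source])
  rw [← contMDiffAt_iff_contDiffAt]
  refine ContMDiffAt.comp _ (g := extChartAt 𝓘(ℝ, Vec n) c')
    (f := (extChartAt 𝓘(ℝ, Vec n) c).symm) ?_
    ((contMDiffOn_extChartAt_symm c).contMDiffAt ((isOpen_extChartAt_target c).mem_nhds ht))
  rw [h]
  exact contMDiffAt_extChartAt' hx'

lemma contDiffAt_chartChange {c c' x : M} (hx : x ∈ (chartAt (Vec n) c).source)
    (hx' : x ∈ (chartAt (Vec n) c').source) (r : ℝ) :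
    ContDiffAt ℝ ∞ (chartChange n c c') (extChartAt 𝓘(ℝ, Vec n) c x, r) := by
  refine ContDiffAt.prodMk ?_ contDiffAt_snd
  exact ContDiffAt.comp (f := Prod.fst)
    (g := fun y => extChartAt 𝓘(ℝ, Vec n) c' ((extChartAt 𝓘(ℝ, Vec n) c).symm y))
    (extChartAt 𝓘(ℝ, Vec n) c x, r) (contDiffAt_coordChange hx hx') contDiffAt_fst

lemma fderiv_chartChange {c c' x : M} (hx : x ∈ (chartAt (Vec n) c).source)
    (hx' : x ∈ (chartAt (Vec n) c').source) (r : ℝ) (a : Vec n × ℝ) :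
    fderiv ℝ (chartChange n c c') (extChartAt 𝓘(ℝ, Vec n) c x, r) a =
      (fderiv ℝ (fun y => extChartAt 𝓘(ℝ, Vec n) c' ((extChartAt 𝓘(ℝ, Vec n) c).symm y))
        (extChartAt 𝓘(ℝ, Vec n) c x) a.1, a.2) := by
  have h1 := ((contDiffAt_coordChange hx hx').differentiableAt (by simp)).hasFDerivAt
  have h2 := HasFDerivAt.comp (𝕜 := ℝ) (f := Prod.fst (α := Vec n) (β := ℝ))
    (extChartAt 𝓘(ℝ, Vec n) c x, r) h1 hasFDerivAt_fst
  have h3 := h2.prodMk (hasFDerivAt_snd (𝕜 := ℝ) (p := (extChartAt 𝓘(ℝ, Vec n) c x, r)))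
  exact DFunLike.congr_fun (HasFDerivAt.fderiv (f := chartChange n c c') h3) a

lemma fderiv_chartChange_mul {c c' x : M} (hx : x ∈ (chartAt (Vec n) c).source)
    (hx' : x ∈ (chartAt (Vec n) c').source) (r : ℝ) :
    fderiv ℝ (chartChange n c' c) (extChartAt 𝓘(ℝ, Vec n) c' x, r) *
      fderiv ℝ (chartChange n c c') (extChartAt 𝓘(ℝ, Vec n) c x, r) = 1 := by
  have h1 := ((contDiffAt_chartChange hx hx' r).differentiableAt (by simp)).hasFDerivAt
  have h2 := ((contDiffAt_chartChange hx' hx r).differentiableAt (by simp)).hasFDerivAt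
  rw [← chartChange_apply hx r] at h2
  have h3 := HasFDerivAt.comp (𝕜 := ℝ) (f := chartChange n c c') _ h2 h1
  rw [chartChange_apply hx r] at h3
  refine h3.unique ((hasFDerivAt_id _).congr_of_eventuallyEq ?_)
  have hs : (extChartAt 𝓘(ℝ, Vec n) c).symm ⁻¹' (chartAt (Vec n) c').source ∈
      𝓝 (extChartAt 𝓘(ℝ, Vec n) c x) := by
    refine (continuousAt_extChartAt_symm' (by rwa [extChartAt_source])).preimage_mem_nhds ?_
    rw [(extChartAt 𝓘(ℝ, Vec n) c).left_inv (by rwa [extChartAt_source])]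
    exact (chartAt (Vec n) c').open_source.mem_nhds hx'
  have ht : (extChartAt 𝓘(ℝ, Vec n) c).target ∈ 𝓝 (extChartAt 𝓘(ℝ, Vec n) c x) :=
    (isOpen_extChartAt_target c).mem_nhds
      ((extChartAt 𝓘(ℝ, Vec n) c).map_source (by rwa [extChartAt_source]))
  filter_upwards [(continuousAt_fst (p := (extChartAt 𝓘(ℝ, Vec n) c x, r))).preimage_mem_nhds
    (inter_mem hs ht)] with y hy
  simp only [Function.comp, chartChange, id]
  rw [(extChartAt 𝓘(ℝ, Vec n) c').left_inv (by rw [extChartAt_source]; exact hy.1),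
    (extChartAt 𝓘(ℝ, Vec n) c).right_inv hy.2]

lemma isUnit_fderiv_chartChange {c c' x : M} (hx : x ∈ (chartAt (Vec n) c).source)
    (hx' : x ∈ (chartAt (Vec n) c').source) (r : ℝ) :
    IsUnit (fderiv ℝ (chartChange n c c') (extChartAt 𝓘(ℝ, Vec n) c x, r)) :=
  ⟨⟨_, _, fderiv_chartChange_mul hx' hx r, fderiv_chartChange_mul hx hx' r⟩, rfl⟩

lemma mfderiv_coordChange {c c' x : M} (hx : x ∈ (chartAt (Vec n) c).source)
    (hx' : x ∈ (chartAt (Vec n) c').source) :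
    fderiv ℝ (fun y => extChartAt 𝓘(ℝ, Vec n) c' ((extChartAt 𝓘(ℝ, Vec n) c).symm y))
        (extChartAt 𝓘(ℝ, Vec n) c x) ∘L
      mfderiv 𝓘(ℝ, Vec n) 𝓘(ℝ, Vec n) (extChartAt 𝓘(ℝ, Vec n) c) x =
      mfderiv 𝓘(ℝ, Vec n) 𝓘(ℝ, Vec n) (extChartAt 𝓘(ℝ, Vec n) c') x := by
  have h1 : HasMFDerivAt 𝓘(ℝ, Vec n) 𝓘(ℝ, Vec n) (extChartAt 𝓘(ℝ, Vec n) c) x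
      (mfderiv 𝓘(ℝ, Vec n) 𝓘(ℝ, Vec n) (extChartAt 𝓘(ℝ, Vec n) c) x) :=
    (mdifferentiableAt_extChartAt hx).hasMFDerivAt
  have h3 := (contDiffAt_coordChange hx hx').differentiableAt (by simp)
  have h4 := h3.hasFDerivAt.hasMFDerivAt.comp x h1
  refine (HasMFDerivAt.mfderiv (h4.congr_of_eventuallyEq ?_)).symm
  filter_upwards [(chartAt (Vec n) c).open_source.mem_nhds hx] with z hz
  simp only [Function.comp]
  rw [(extChartAt 𝓘(ℝ, Vec n) c).left_inv (by rwa [extChartAt_source])]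

lemma ControlProblem.localField_chartChange (P : ControlProblem n k M) {c c' x : M}
    (hx : x ∈ (chartAt (Vec n) c).source) (hx' : x ∈ (chartAt (Vec n) c').source) (v : Vec k)
    (r : ℝ) :
    P.localField c' (v, extChartAt 𝓘(ℝ, Vec n) c' x, r) =
      fderiv ℝ (chartChange n c c') (extChartAt 𝓘(ℝ, Vec n) c x, r)
        (P.localField c (v, extChartAt 𝓘(ℝ, Vec n) c x, r)) := by
  rw [P.localField_chart hx', P.localField_chart hx, fderiv_chartChange hx hx',
    ← mfderiv_coordChange hx hx']
  rfl

lemma ControlProblem.chartCurve_chartChange (P : ControlProblem n k M) {c c' : M} {u : ℝ → Vec k}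
    {q : ℝ → M} {τ : ℝ} (hx : q τ ∈ (chartAt (Vec n) c).source) (r : ℝ) :
    chartChange n c c' (P.chartCurve c u q r τ) = P.chartCurve c' u q r τ :=
  chartChange_apply hx _

end ChartChange

end OptControl

namespace OptControl

open ControlProblem

/-! ### The flow of the reference control. -/

section ReferenceFlow

variable {n k d : ℕ} {M : Type*} [TopologicalSpace M] [ChartedSpace (Vec n) M]
  [IsManifold 𝓘(ℝ, Vec n) ∞ M]
  {N : Type*} [TopologicalSpace N] [ChartedSpace (Vec d) N] [IsManifold 𝓘(ℝ, Vec d) ∞ N]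
  (S : Reference n k d M N)

namespace Reference

/-- The trajectory of the reference control with initial point `x` in the chart at `q(0)`. -/
noncomputable def flowTraj (x : Vec n × ℝ) : ℝ → M :=
  S.trajectory S.T S.u ((S.chart 0).symm x.1)

/-- The flow of the reference control on extended states, with values in the chart at `c`. -/
noncomputable def flowCurve (c : M) (x : Vec n × ℝ) (τ : ℝ) : Vec n × ℝ :=
  S.chartCurve c S.u (S.flowTraj x) x.2 τ

/-- The reference initial point. -/
noncomputable def base : Vec n × ℝ := (S.chart 0 (S.q 0), 0)

variable [T2Space M] [SecondCountableTopology M]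

/-- Regularity of the flow of the reference control near the reference trajectory. -/
lemma flow_family (hT : 0 ≤ S.T) :
    (∀ᶠ x in 𝓝 S.base, S.IsTrajectory S.T S.u (S.flowTraj x) ∧
      S.flowTraj x 0 = (S.chart 0).symm x.1) ∧
    (∀ τ ∈ Icc 0 S.T, S.flowTraj S.base τ = S.q τ) ∧
    (∀ τ ∈ Icc 0 S.T, ContMDiffAt 𝓘(ℝ, Vec n × ℝ) 𝓘(ℝ, Vec n) 2
      (fun x => S.flowTraj x τ) S.base) ∧
    ∀ s ∈ Icc 0 S.T, ∃ ε > 0, ∀ a ∈ Icc 0 S.T, ∀ b ∈ Icc 0 S.T, |a - s| < ε → |b - s| < ε →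
      a ≤ b → (∀ τ ∈ Icc a b, S.q τ ∈ chartBall n (S.q s)) ∧
      SolvesVariational (S.cutField (S.q s)) (fun _ => S.u) (fun _ _ => 0) S.base
        (S.flowCurve (S.q s)) a b := by
  have h0 := (S.chart 0).left_inv (mem_extChartAt_source (I := 𝓘(ℝ, Vec n)) (S.q 0))
  refine trajectory_family (𝒲 := Vec n × ℝ) (P := S.toControlProblem) (u := fun _ => S.u)
    (β := fun _ _ => 0) (st := fun x => (S.chart 0).symm x.1) (γ := Prod.snd) (w₀ := S.base)
    (t := S.T) (q₀ := S.q) ?_ hT ?_ contDiffAt_snd S.traj h0.symm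
  · exact ⟨S.u_mem, fun _ => MemLp.zero', fun _ _ => by simp, fun _ _ => by simp, fun _ => by simp⟩
  · refine ContMDiffAt.comp S.base (g := (S.chart 0).symm) (f := Prod.fst) (I' := 𝓘(ℝ, Vec n))
      ?_ contDiffAt_fst.contMDiffAt
    refine ((contMDiffOn_extChartAt_symm (I := 𝓘(ℝ, Vec n)) (n := ∞) (S.q 0)).contMDiffAt
      ((isOpen_extChartAt_target (S.q 0)).mem_nhds (mem_extChartAt_target (S.q 0)))).of_le ?_
    exact WithTop.coe_le_coe.2 (le_top (a := (2 : ℕ∞)))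

variable {S} {τ : ℝ}

lemma flowCurve_base (hτ : τ ∈ Icc 0 S.T) (c : M) :
    (S.flowCurve c S.base τ) = S.chartCurve c S.u S.q 0 τ :=
  S.chartCurve_congr c S.u 0 hτ.1 fun θ hθ =>
    (S.flow_family (hτ.1.trans hτ.2)).2.1 θ ⟨hθ.1, hθ.2.trans hτ.2⟩

lemma eventually_flowTraj_mem (hτ : τ ∈ Icc 0 S.T) {U : Set M} (hU : IsOpen U) (h : S.q τ ∈ U) :
    ∀ᶠ x in 𝓝 S.base, S.flowTraj x τ ∈ U := by
  have hf := S.flow_family (hτ.1.trans hτ.2)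
  refine (hf.2.2.1 τ hτ).continuousAt.eventually_mem (hU.mem_nhds ?_)
  rw [hf.2.1 τ hτ]
  exact h

lemma contDiffAt_flowCurve (hτ : τ ∈ Icc 0 S.T) {c : M} (hc : S.q τ ∈ (chartAt (Vec n) c).source) :
    ContDiffAt ℝ 2 (fun x => S.flowCurve c x τ) S.base := by
  have hf := S.flow_family (hτ.1.trans hτ.2)
  obtain ⟨ε, hε, h⟩ := hf.2.2.2 τ hτ
  have h1 := (h τ hτ τ hτ (by simpa) (by simpa) le_rfl).2.contDiffAt τ ⟨le_rfl, le_rfl⟩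
  refine ContDiffAt.prodMk ?_ h1.snd
  rw [← contMDiffAt_iff_contDiffAt]
  refine ContMDiffAt.comp S.base (g := extChartAt 𝓘(ℝ, Vec n) c) ?_ (hf.2.2.1 τ hτ)
  refine (contMDiffAt_extChartAt' (I := 𝓘(ℝ, Vec n)) (n := ∞) (x := c) ?_).of_le ?_
  · rw [hf.2.1 τ hτ]; exact hc
  · exact WithTop.coe_le_coe.2 (le_top (a := (2 : ℕ∞)))

lemma eventually_flowCurve_chartChange (hτ : τ ∈ Icc 0 S.T) {c : M} (c' : M)
    (hc : S.q τ ∈ (chartAt (Vec n) c).source) :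
    (fun x => S.flowCurve c' x τ) =ᶠ[𝓝 S.base] fun x => chartChange n c c' (S.flowCurve c x τ) := by
  filter_upwards [eventually_flowTraj_mem hτ (chartAt (Vec n) c).open_source hc] with x hx
  exact (S.chartCurve_chartChange hx _).symm

lemma fderiv_flowCurve_chartChange (hτ : τ ∈ Icc 0 S.T) {c c' : M}
    (hc : S.q τ ∈ (chartAt (Vec n) c).source) (hc' : S.q τ ∈ (chartAt (Vec n) c').source) :
    fderiv ℝ (fun x => S.flowCurve c' x τ) S.base =
      fderiv ℝ (chartChange n c c') (S.flowCurve c S.base τ) *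
        fderiv ℝ (fun x => S.flowCurve c x τ) S.base := by
  rw [(eventually_flowCurve_chartChange hτ c' hc).fderiv_eq (𝕜 := ℝ)]
  have h1 := ((contDiffAt_flowCurve hτ hc).differentiableAt (by simp)).hasFDerivAt
  have h2 := ((contDiffAt_chartChange hc hc' (S.flowCurve c S.base τ).2).differentiableAt
    (by simp)).hasFDerivAt
  rw [flowCurve_base hτ c] at h2 ⊢
  refine (HasFDerivAt.comp (𝕜 := ℝ) (g := chartChange n c c') (f := fun x => S.flowCurve c x τ)
    S.base ?_ h1).fderiv
  rw [flowCurve_base hτ c]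
  exact h2

lemma isUnit_of_chart (hτ : τ ∈ Icc 0 S.T) {c c' : M}
    (hc : S.q τ ∈ (chartAt (Vec n) c).source) (hc' : S.q τ ∈ (chartAt (Vec n) c').source)
    (h : IsUnit (fderiv ℝ (fun x => S.flowCurve c x τ) S.base)) :
    IsUnit (fderiv ℝ (fun x => S.flowCurve c' x τ) S.base) := by
  rw [fderiv_flowCurve_chartChange hτ hc hc']
  refine IsUnit.mul ?_ h
  rw [flowCurve_base hτ c]
  exact isUnit_fderiv_chartChange hc hc' _

lemma flowCurve_zero (hT : 0 ≤ S.T) : (fun x => S.flowCurve (S.q 0) x 0) =ᶠ[𝓝 S.base] id := by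
  have hf := (S.flow_family hT).1
  have ht : ∀ᶠ x in 𝓝 S.base, x.1 ∈ (S.chart 0).target :=
    (continuousAt_fst (p := S.base)).eventually_mem
      ((isOpen_extChartAt_target (S.q 0)).mem_nhds (mem_extChartAt_target (S.q 0)))
  filter_upwards [hf, ht] with x h1 h2
  refine Prod.ext ?_ ?_
  · change S.chart 0 (S.flowTraj x 0) = x.1
    rw [h1.2, (S.chart 0).right_inv h2]
  · change x.2 + _ = x.2
    rw [intervalIntegral.integral_same, add_zero]

/-- The flow of the reference control is a local diffeomorphism. -/
lemma isUnit_fderiv_flowCurve (hτ : τ ∈ Icc 0 S.T) {c : M}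
    (hc : S.q τ ∈ (chartAt (Vec n) c).source) :
    IsUnit (fderiv ℝ (fun x => S.flowCurve c x τ) S.base) := by
  have hT : 0 ≤ S.T := hτ.1.trans hτ.2
  have hsrc : ∀ τ, S.q τ ∈ (chartAt (Vec n) (S.q τ)).source := fun τ => mem_chart_source _ _
  refine isUnit_of_chart hτ (hsrc τ) hc ?_
  revert τ
  suffices h : ∀ τ ∈ Icc 0 S.T, IsUnit (fderiv ℝ (fun x => S.flowCurve (S.q τ) x τ) S.base) from
    fun {τ} hτ _ => h τ hτ
  refine Icc_local_induction (p := fun τ =>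
    IsUnit (fderiv ℝ (fun x => S.flowCurve (S.q τ) x τ) S.base)) ?_ fun s hs => ?_
  · rw [(flowCurve_zero hT).fderiv_eq (𝕜 := ℝ), fderiv_id]
    exact isUnit_one
  obtain ⟨ε₁, hε₁, h₁⟩ := (S.flow_family hT).2.2.2 s hs
  obtain ⟨C, hC0, hC, ε₂, hε₂, h₂⟩ := S.exists_step S.u_mem (S.q s)
  refine ⟨min ε₁ ε₂, by positivity, fun a ha b hb has hbs hab hu => ?_⟩
  obtain ⟨hball, hV⟩ := h₁ a ha b hb (has.trans_le (min_le_left _ _))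
    (hbs.trans_le (min_le_left _ _)) hab
  have hb1 := h₂ s a b (has.trans_le (min_le_right _ _)) (hbs.trans_le (min_le_right _ _))
  have haI : a ∈ Icc a b := left_mem_Icc.2 hab
  have hbI : b ∈ Icc a b := right_mem_Icc.2 hab
  refine isUnit_of_chart hb (hball b hbI).1 (hsrc b) ?_
  have hua := isUnit_of_chart ha (hsrc a) (hball a haI).1 hu
  set A := fun τ => fderiv ℝ (fun x => S.flowCurve (S.q s) x τ) S.base with hA
  rw [ContinuousLinearMap.isUnit_iff_bijective] at hua ⊢
  -- A vector annihilated at time b solves a linear equation with zero terminal value, so it is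
  -- already annihilated at a; the uniqueness lemma is applied with base point b.
  have hinj : Function.Injective (A b) := by
    rw [injective_iff_map_eq_zero]
    intro v hv
    have hAC := hV.first v
    have := eq_zero_of_integral_bound (δ := fun τ => A τ v) hbI hAC.continuousOn
      (g := fun τ => fderiv ℝ (S.cutField (S.q s)) (S.u τ, S.flowCurve (S.q s) S.base τ) (0, A τ v))
      (fun τ hτ => by
        have e1 := hAC.eq_integral hτ
        have e2 := hAC.eq_integral hbI
        have hI := memLp_top_intervalIntegrable hAC.memLp haI hbI
        have e3 := intervalIntegral.integral_interval_sub_left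
          (memLp_top_intervalIntegrable hAC.memLp haI hτ) hI
        rw [← e3]
        refine e1.trans ?_
        rw [eq_sub_iff_add_eq, add_right_comm, ← e2, add_eq_right]
        exact hv) hC0
      (by
        filter_upwards [ae_mono (Measure.restrict_mono (Icc_subset_Icc ha.1 hb.2) le_rfl) hC]
          with θ hθ
        refine (ContinuousLinearMap.le_opNorm _ _).trans ?_
        refine mul_le_mul (hθ _ 0).1 ?_ (norm_nonneg _) hC0
        simp [Prod.norm_def]) hb1 a haI
    exact (injective_iff_map_eq_zero _).1 hua.1 v this
  exact ⟨hinj, LinearMap.injective_iff_surjective (f := (A b).toLinearMap).1 hinj⟩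

end Reference

end ReferenceFlow

end OptControl

namespace OptControl

open ControlProblem

/-! ### Independence of the pulled-back field of the coordinates. -/

section PullField

universe w

variable {E K : Type w} [NormedAddCommGroup E] [NormedSpace ℝ E] [NormedAddCommGroup K]
  [NormedSpace ℝ K]

lemma hasFDerivAt_partial_fst {G : Type*} [NormedAddCommGroup G] [NormedSpace ℝ G] {F : K × E → G}
    {c : K} {y : E} {A : K × E →L[ℝ] G} (h : HasFDerivAt F A (c, y)) :
    HasFDerivAt (fun c => F (c, y)) (A ∘L ContinuousLinearMap.inl ℝ K E) c :=
  HasFDerivAt.comp (𝕜 := ℝ) (g := F) (f := fun c => (c, y)) c h (hasFDerivAt_prodMk_left c y)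

lemma hasFDerivAt_partial_snd {G : Type*} [NormedAddCommGroup G] [NormedSpace ℝ G] {F : K × E → G}
    {c : K} {y : E} {A : K × E →L[ℝ] G} (h : HasFDerivAt F A (c, y)) :
    HasFDerivAt (fun y => F (c, y)) (A ∘L ContinuousLinearMap.inr ℝ K E) y :=
  HasFDerivAt.comp (𝕜 := ℝ) (g := F) (f := fun y => (c, y)) y h (hasFDerivAt_prodMk_right c y)

/-- The rates do not depend on the coordinates. -/
lemma pullRate_congr {F F' : K × E → E} (hF : ContDiff ℝ ∞ F) (hF' : ContDiff ℝ ∞ F')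
    {p p' : E → E} {x₀ : E} {κ : E → E} (hκ : ContDiffAt ℝ 2 κ (p x₀))
    (hp : ContDiffAt ℝ 2 p x₀) (hA : IsUnit (fderiv ℝ p x₀))
    (hκu : IsUnit (fderiv ℝ κ (p x₀))) (hp' : p' =ᶠ[𝓝 x₀] fun x => κ (p x))
    (hFF : ∀ᶠ y in 𝓝 (p x₀), ∀ v, F' (v, κ y) = fderiv ℝ κ y (F (v, y))) (c v v' : K) (a : E) :
    pullRate F' c p' x₀ v = pullRate F c p x₀ v ∧
    pullRate₂ F' c p' x₀ v v' = pullRate₂ F c p x₀ v v' ∧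
    pullMixed F' c p' x₀ v a = pullMixed F c p x₀ v a := by
  have hF2 := contDiff_infty.1 hF 2
  have hF2' := contDiff_infty.1 hF' 2
  have dF : ∀ x, HasFDerivAt F (fderiv ℝ F x) x := fun x =>
    ((contDiff_infty.1 hF 1).differentiable one_ne_zero x).hasFDerivAt
  have dF' : ∀ x, HasFDerivAt F' (fderiv ℝ F' x) x := fun x =>
    ((contDiff_infty.1 hF' 1).differentiable one_ne_zero x).hasFDerivAt
  have a1 := fun a b => fderiv_comp_two hκ hp a b
  have b1 := hp'.fderiv_eq (𝕜 := ℝ)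
  have c1 := (hp'.fderiv (𝕜 := ℝ)).fderiv_eq (𝕜 := ℝ)
  have p0 := hp'.self_of_nhds
  have e1 : fderiv ℝ p' x₀ = fderiv ℝ κ (p x₀) * fderiv ℝ p x₀ := by
    ext a
    rw [b1, (a1 a a).1]
    rfl
  have hu : IsUnit (fderiv ℝ p' x₀) := e1 ▸ hκu.mul hA
  have R1 : ∀ᶠ y in 𝓝 (p x₀), ∀ c v,
      fderiv ℝ F' (c, κ y) (v, 0) = fderiv ℝ κ y (fderiv ℝ F (c, y) (v, 0)) := by
    filter_upwards [hFF] with y hy c v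
    have h1 := hasFDerivAt_partial_fst (dF' (c, κ y))
    have h2 := (fderiv ℝ κ y).hasFDerivAt.comp c (hasFDerivAt_partial_fst (dF (c, y)))
    have h3 : (fun c => F' (c, κ y)) = fun c => fderiv ℝ κ y (F (c, y)) := funext hy
    rw [h3] at h1
    exact DFunLike.congr_fun (h1.unique h2) v
  have R10 := R1.self_of_nhds
  have R2 : fderiv ℝ (fderiv ℝ F') (c, κ (p x₀)) (v, 0) (v', 0) =
      fderiv ℝ κ (p x₀) (fderiv ℝ (fderiv ℝ F) (c, p x₀) (v, 0) (v', 0)) := by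
    have h1 := hasFDerivAt_partial_fst
      (ContDiffAt.hasFDerivAt_fderiv_apply (hF2'.contDiffAt (x := (c, κ (p x₀)))) (v', 0))
    have h2 := (fderiv ℝ κ (p x₀)).hasFDerivAt.comp c (hasFDerivAt_partial_fst
      (ContDiffAt.hasFDerivAt_fderiv_apply (hF2.contDiffAt (x := (c, p x₀))) (v', 0)))
    have h3 : (fun c => fderiv ℝ F' (c, κ (p x₀)) (v', 0)) =
        fun c => fderiv ℝ κ (p x₀) (fderiv ℝ F (c, p x₀) (v', 0)) := funext fun c => R10 c v'
    rw [h3] at h1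
    exact DFunLike.congr_fun (h1.unique h2) v
  -- Differentiating the transformation rule of the field in the state produces a term with the
  -- second derivative of κ. The second derivative of κ ∘ p contains the same term, and they cancel
  -- in `pullMixed`.
  have R3 : ∀ z, fderiv ℝ (fderiv ℝ F') (c, κ (p x₀)) (0, fderiv ℝ κ (p x₀) z) (v, 0) =
      fderiv ℝ (fderiv ℝ κ) (p x₀) z (fderiv ℝ F (c, p x₀) (v, 0)) +
        fderiv ℝ κ (p x₀) (fderiv ℝ (fderiv ℝ F) (c, p x₀) (0, z) (v, 0)) := by
    intro z
    have h1 := HasFDerivAt.comp (𝕜 := ℝ) (f := κ) (g := fun y => fderiv ℝ F' (c, y) (v, 0)) (p x₀)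
      (hasFDerivAt_partial_snd (ContDiffAt.hasFDerivAt_fderiv_apply
        (hF2'.contDiffAt (x := (c, κ (p x₀)))) (v, 0)))
      (ContDiffAt.eventually_hasFDerivAt hκ).self_of_nhds
    have d1 := ((hκ.fderiv_right (m := 1) (by norm_num)).differentiableAt one_ne_zero).hasFDerivAt
    have h2 := d1.clm_apply (hasFDerivAt_partial_snd
      (ContDiffAt.hasFDerivAt_fderiv_apply (hF2.contDiffAt (x := (c, p x₀))) (v, 0)))
    have h3 := h1.unique (h2.congr_of_eventuallyEq (R1.mono fun y hy => hy c v))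
    have h4 := DFunLike.congr_fun h3 z
    rw [add_comm]
    exact h4
  have hs : ∀ x z, fderiv ℝ (fderiv ℝ F) (c, p x₀) x z = fderiv ℝ (fderiv ℝ F) (c, p x₀) z x :=
    fun x z => (hF2.contDiffAt (x := (c, p x₀))).isSymmSndFDerivAt (by simp) x z
  have hs' : ∀ x z, fderiv ℝ (fderiv ℝ F') (c, κ (p x₀)) x z =
      fderiv ℝ (fderiv ℝ F') (c, κ (p x₀)) z x :=
    fun x z => (hF2'.contDiffAt (x := (c, κ (p x₀)))).isSymmSndFDerivAt (by simp) x z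
  have hsκ : ∀ x z, fderiv ℝ (fderiv ℝ κ) (p x₀) x z = fderiv ℝ (fderiv ℝ κ) (p x₀) z x :=
    fun x z => hκ.isSymmSndFDerivAt (by simp) x z
  have rate : ∀ v, pullRate F' c p' x₀ v = pullRate F c p x₀ v := by
    intro v
    rw [pullRate, ringInverse_apply_eq hu, e1, mul_apply_eq_comp, pullRate,
      ringInverse_apply hA, p0, R10]
  have hr : fderiv ℝ p x₀ (pullRate F c p x₀ v) = fderiv ℝ F (c, p x₀) (v, 0) :=
    ringInverse_apply hA _
  refine ⟨rate v, ?_, ?_⟩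
  · rw [pullRate₂, ringInverse_apply_eq hu, e1, mul_apply_eq_comp, pullRate₂,
      ringInverse_apply hA, p0, R2]
  · rw [pullMixed, ringInverse_apply_eq hu, pullMixed, c1, (a1 _ _).2, rate, hr, e1,
      mul_apply_eq_comp, ringInverse_apply hA, p0, hs', mul_apply_eq_comp, R3, hs (0, _),
      hsκ (fderiv ℝ p x₀ a), map_sub]
    abel

end PullField

/-! ### First and second variations along the reference trajectory. -/

section Family

variable {n k d : ℕ} {M : Type*} [TopologicalSpace M] [ChartedSpace (Vec n) M]
  [IsManifold 𝓘(ℝ, Vec n) ∞ M]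
  {N : Type*} [TopologicalSpace N] [ChartedSpace (Vec d) N] [IsManifold 𝓘(ℝ, Vec d) ∞ N]
  {𝒲 : Type*} [NormedAddCommGroup 𝒲] [NormedSpace ℝ 𝒲]

namespace Reference

/-- A family of controls and of initial points that contains the reference data. -/
structure IsFamily (S : Reference n k d M N) (t : ℝ) (u β : 𝒲 → ℝ → Vec k) (st : 𝒲 → M)
    (w₀ : 𝒲) : Prop where
  time : t ∈ Icc 0 S.T
  ctrl : ControlFamily u β (volume.restrict (Icc 0 t))
  start : ContMDiffAt 𝓘(ℝ, 𝒲) 𝓘(ℝ, Vec n) 2 st w₀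
  start_eq : st w₀ = S.q 0
  ctrl_eq : ∀ᵐ τ ∂(volume.restrict (Icc 0 t)), u w₀ τ = S.u τ

/-- The extended trajectories of a family in the chart at `c`. -/
noncomputable def famCurve (S : Reference n k d M N) (t : ℝ) (u : 𝒲 → ℝ → Vec k) (st : 𝒲 → M)
    (c : M) (w : 𝒲) (τ : ℝ) : Vec n × ℝ :=
  S.chartCurve c (u w) (S.trajectory t (u w) (st w)) 0 τ

/-- First variation of a family, transported to time zero by the reference flow. -/
noncomputable def var₁ (S : Reference n k d M N) (t : ℝ) (u : 𝒲 → ℝ → Vec k) (st : 𝒲 → M) (w₀ : 𝒲)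
    (τ : ℝ) (v : 𝒲) : Vec n × ℝ :=
  pull (fun x => S.flowCurve (S.q τ) x τ) S.base (fun w => S.famCurve t u st (S.q τ) w τ) w₀ v

/-- Second variation of a family, transported to time zero by the reference flow. -/
noncomputable def var₂ (S : Reference n k d M N) (t : ℝ) (u : 𝒲 → ℝ → Vec k) (st : 𝒲 → M) (w₀ : 𝒲)
    (τ : ℝ) (v v' : 𝒲) : Vec n × ℝ :=
  pull₂ (fun x => S.flowCurve (S.q τ) x τ) S.base (fun w => S.famCurve t u st (S.q τ) w τ) w₀ v v'

/-- The chart at q(τ) changes with τ; by `rates_eq` any chart ball containing q(τ) gives the same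
values, so one chart can be used on a short interval. -/
noncomputable def rate (S : Reference n k d M N) (τ : ℝ) (v : Vec k) : Vec n × ℝ :=
  pullRate (S.cutField (S.q τ)) (S.u τ) (fun x => S.flowCurve (S.q τ) x τ) S.base v

noncomputable def rate₂ (S : Reference n k d M N) (τ : ℝ) (v v' : Vec k) : Vec n × ℝ :=
  pullRate₂ (S.cutField (S.q τ)) (S.u τ) (fun x => S.flowCurve (S.q τ) x τ) S.base v v'

noncomputable def mixed (S : Reference n k d M N) (τ : ℝ) (v : Vec k) (a : Vec n × ℝ) :
    Vec n × ℝ :=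
  pullMixed (S.cutField (S.q τ)) (S.u τ) (fun x => S.flowCurve (S.q τ) x τ) S.base v a

variable [T2Space M] [SecondCountableTopology M] {S : Reference n k d M N} {t τ : ℝ}
  {u β : 𝒲 → ℝ → Vec k} {st : 𝒲 → M} {w₀ : 𝒲}

omit [T2Space M] [SecondCountableTopology M] in
lemma IsTrajectory_congr_control {P : ControlProblem n k M} {u u' : ℝ → Vec k} {q : ℝ → M}
    (h : P.IsTrajectory t u q) (hu : ∀ᵐ τ ∂(volume.restrict (Icc 0 t)), u τ = u' τ) :
    P.IsTrajectory t u' q := by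
  refine ⟨h.1, fun φ hφ s hs => (h.2 φ hφ s hs).trans (congrArg (_ + ·) ?_)⟩
  refine intervalIntegral.integral_congr_ae ?_
  rw [ae_restrict_iff' measurableSet_Icc] at hu
  filter_upwards [hu] with τ h1 h2
  rw [uIoc_of_le hs.1] at h2
  rw [h1 ⟨h2.1.le, h2.2.trans hs.2⟩]

lemma rates_eq (hτ : τ ∈ Icc 0 S.T) {c : M} (hc : S.q τ ∈ chartBall n c) (v v' : Vec k)
    (a : Vec n × ℝ) :
    pullRate (S.cutField c) (S.u τ) (fun x => S.flowCurve c x τ) S.base v = S.rate τ v ∧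
    pullRate₂ (S.cutField c) (S.u τ) (fun x => S.flowCurve c x τ) S.base v v' = S.rate₂ τ v v' ∧
    pullMixed (S.cutField c) (S.u τ) (fun x => S.flowCurve c x τ) S.base v a = S.mixed τ v a := by
  have hq := mem_chartBall (n := n) (S.q τ)
  have hb := flowCurve_base hτ (S.q τ)
  refine pullRate_congr (κ := chartChange n (S.q τ) c) (S.contDiff_cutField _)
    (S.contDiff_cutField _) ?_ (contDiffAt_flowCurve hτ hq.1) (isUnit_fderiv_flowCurve hτ hq.1) ?_
    (eventually_flowCurve_chartChange hτ c hq.1) ?_ _ _ _ _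
  · rw [hb]
    exact (contDiffAt_chartChange hq.1 hc.1 _).of_le
      (WithTop.coe_le_coe.2 (le_top (a := (2 : ℕ∞))))
  · rw [hb]
    exact isUnit_fderiv_chartChange hq.1 hc.1 _
  · have h1 : ∀ᶠ y in 𝓝 (S.flowCurve (S.q τ) S.base τ),
        y.1 ∈ (extChartAt 𝓘(ℝ, Vec n) (S.q τ)).target ∩
          (extChartAt 𝓘(ℝ, Vec n) (S.q τ)).symm ⁻¹' (chartBall n (S.q τ) ∩ chartBall n c) := by
      rw [hb]
      refine (continuousAt_fst (p := S.chartCurve (S.q τ) S.u S.q 0 τ)).eventually_mem ?_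
      have h2 := (extChartAt 𝓘(ℝ, Vec n) (S.q τ)).map_source (mem_extChartAt_source (I := 𝓘(ℝ, Vec n)) (S.q τ))
      refine inter_mem ((isOpen_extChartAt_target _).mem_nhds h2) ?_
      refine (continuousAt_extChartAt_symm' (mem_extChartAt_source (I := 𝓘(ℝ, Vec n)) (S.q τ))).preimage_mem_nhds ?_
      rw [(extChartAt 𝓘(ℝ, Vec n) (S.q τ)).left_inv (mem_extChartAt_source (I := 𝓘(ℝ, Vec n)) (S.q τ))]
      exact ((isOpen_chartBall (n := n) _).inter (isOpen_chartBall (n := n) _)).mem_nhds ⟨hq, hc⟩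
    filter_upwards [h1] with y hy v
    obtain ⟨x, hx⟩ : ∃ x, x = (extChartAt 𝓘(ℝ, Vec n) (S.q τ)).symm y.1 := ⟨_, rfl⟩
    have hy1 : y = (extChartAt 𝓘(ℝ, Vec n) (S.q τ) x, y.2) := by
      rw [hx, (extChartAt 𝓘(ℝ, Vec n) (S.q τ)).right_inv hy.1]
    have hx2 := hy.2
    rw [mem_preimage, ← hx] at hx2
    rw [hy1, chartChange_apply (n := n) (c' := c) hx2.1.1 y.2,
      S.cutField_eq c (x := (v, extChartAt 𝓘(ℝ, Vec n) c x, y.2)) hx2.2.2,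
      S.cutField_eq (S.q τ) (x := (v, extChartAt 𝓘(ℝ, Vec n) (S.q τ) x, y.2)) hx2.1.2]
    exact S.localField_chartChange hx2.1.1 hx2.2.1 v _

section

variable [FiniteDimensional ℝ 𝒲]

lemma IsFamily.flow (h : S.IsFamily t u β st w₀) :
    (∀ᶠ w in 𝓝 w₀, S.IsTrajectory t (u w) (S.trajectory t (u w) (st w)) ∧
      S.trajectory t (u w) (st w) 0 = st w) ∧
    (∀ τ ∈ Icc 0 t, S.trajectory t (u w₀) (st w₀) τ = S.q τ) ∧
    (∀ τ ∈ Icc 0 t, ContMDiffAt 𝓘(ℝ, 𝒲) 𝓘(ℝ, Vec n) 2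
      (fun w => S.trajectory t (u w) (st w) τ) w₀) ∧
    ∀ s ∈ Icc 0 t, ∃ ε > 0, ∀ a ∈ Icc 0 t, ∀ b ∈ Icc 0 t, |a - s| < ε → |b - s| < ε → a ≤ b →
      (∀ τ ∈ Icc a b, S.q τ ∈ chartBall n (S.q s)) ∧
      SolvesVariational (S.cutField (S.q s)) u β w₀ (S.famCurve t u st (S.q s)) a b :=
  trajectory_family h.ctrl h.time.1 h.start contDiffAt_const
    (IsTrajectory_congr_control (S.traj.mono h.time.2)
      (h.ctrl_eq.mono fun _ e => e.symm)) h.start_eq.symm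

lemma IsFamily.famCurve_ref (h : S.IsFamily t u β st w₀) (hτ : τ ∈ Icc 0 t) (c : M) :
    S.famCurve t u st c w₀ τ = S.flowCurve c S.base τ := by
  rw [flowCurve_base ⟨hτ.1, hτ.2.trans h.time.2⟩]
  refine Prod.ext (congrArg (extChartAt 𝓘(ℝ, Vec n) c) (h.flow.2.1 τ hτ))
    (congrArg (0 + ·) (intervalIntegral.integral_congr_ae ?_))
  have hu := h.ctrl_eq
  rw [ae_restrict_iff' measurableSet_Icc] at hu
  filter_upwards [hu] with θ h1 h2
  rw [uIoc_of_le hτ.1] at h2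
  have h3 : θ ∈ Icc 0 t := ⟨h2.1.le, h2.2.trans hτ.2⟩
  rw [h1 h3, h.flow.2.1 θ h3]

lemma IsFamily.contDiffAt_famCurve (h : S.IsFamily t u β st w₀) (hτ : τ ∈ Icc 0 t) {c : M}
    (hc : S.q τ ∈ (chartAt (Vec n) c).source) :
    ContDiffAt ℝ 2 (fun w => S.famCurve t u st c w τ) w₀ := by
  have hf := h.flow
  obtain ⟨ε, hε, h⟩ := hf.2.2.2 τ hτ
  have h1 := (h τ hτ τ hτ (by simpa) (by simpa) le_rfl).2.contDiffAt τ ⟨le_rfl, le_rfl⟩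
  refine ContDiffAt.prodMk ?_ h1.snd
  rw [← contMDiffAt_iff_contDiffAt]
  refine ContMDiffAt.comp w₀ (g := extChartAt 𝓘(ℝ, Vec n) c) ?_ (hf.2.2.1 τ hτ)
  refine (contMDiffAt_extChartAt' (I := 𝓘(ℝ, Vec n)) (n := ∞) (x := c) ?_).of_le ?_
  · rw [hf.2.1 τ hτ]; exact hc
  · exact WithTop.coe_le_coe.2 (le_top (a := (2 : ℕ∞)))

lemma IsFamily.famCurve_chartChange (h : S.IsFamily t u β st w₀) (hτ : τ ∈ Icc 0 t) {c : M}
    (c' : M) (hc : S.q τ ∈ (chartAt (Vec n) c).source) :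
    (fun w => S.famCurve t u st c' w τ) =ᶠ[𝓝 w₀]
      fun w => chartChange n c c' (S.famCurve t u st c w τ) := by
  have h1 := (h.flow.2.2.1 τ hτ).continuousAt.eventually_mem
    ((chartAt (Vec n) c).open_source.mem_nhds (by rw [h.flow.2.1 τ hτ]; exact hc))
  filter_upwards [h1] with w hw
  exact (S.chartCurve_chartChange hw _).symm

lemma IsFamily.pull_eq (h : S.IsFamily t u β st w₀) (hτ : τ ∈ Icc 0 t) {c : M}
    (hc : S.q τ ∈ (chartAt (Vec n) c).source) (v v' : 𝒲) :
    pull (fun x => S.flowCurve c x τ) S.base (fun w => S.famCurve t u st c w τ) w₀ v =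
      S.var₁ t u st w₀ τ v ∧
    pull₂ (fun x => S.flowCurve c x τ) S.base (fun w => S.famCurve t u st c w τ) w₀ v v' =
      S.var₂ t u st w₀ τ v v' := by
  have hτT : τ ∈ Icc 0 S.T := ⟨hτ.1, hτ.2.trans h.time.2⟩
  have hq := mem_chart_source (Vec n) (S.q τ)
  have hb := flowCurve_base hτT (S.q τ)
  refine pull_congr (κ := chartChange n (S.q τ) c) ?_ (contDiffAt_flowCurve hτT hq)
    (h.contDiffAt_famCurve hτ hq) (h.famCurve_ref hτ _) (isUnit_fderiv_flowCurve hτT hq) ?_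
    (eventually_flowCurve_chartChange hτT c hq) (h.famCurve_chartChange hτ c hq) v v'
  · rw [hb]
    exact (contDiffAt_chartChange hq hc _).of_le
      (WithTop.coe_le_coe.2 (le_top (a := (2 : ℕ∞))))
  · rw [hb]
    exact isUnit_fderiv_chartChange hq hc _

omit [FiniteDimensional ℝ 𝒲] [T2Space M] [SecondCountableTopology M] in
lemma ACDeriv_of_subsingleton {F : Type*} [NormedAddCommGroup F] [NormedSpace ℝ F] (y y' : ℝ → F)
    (a : ℝ) : ACDeriv y y' a a := by
  refine ⟨⟨0, LipschitzOnWith.of_dist_le_mul fun x hx z hz => ?_⟩,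
    Eventually.of_forall fun τ hτ => absurd (hτ.1.trans hτ.2) (lt_irrefl _)⟩
  have e1 := le_antisymm hx.2 hx.1
  have e2 := le_antisymm hz.2 hz.1
  simp [e1, e2]

/-- The equations of the first and of the second variation. -/
theorem IsFamily.variation_ode (h : S.IsFamily t u β st w₀) (v v' : 𝒲) :
    ACDeriv (fun τ => S.var₁ t u st w₀ τ v) (fun τ => S.rate τ (β v τ)) 0 t ∧
    ACDeriv (fun τ => S.var₂ t u st w₀ τ v v') (fun τ => S.rate₂ τ (β v τ) (β v' τ) +
        S.mixed τ (β v τ) (S.var₁ t u st w₀ τ v') +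
        S.mixed τ (β v' τ) (S.var₁ t u st w₀ τ v)) 0 t := by
  refine Icc_local_induction (t := t) (p := fun e =>
    ACDeriv (fun τ => S.var₁ t u st w₀ τ v) (fun τ => S.rate τ (β v τ)) 0 e ∧
    ACDeriv (fun τ => S.var₂ t u st w₀ τ v v') (fun τ => S.rate₂ τ (β v τ) (β v' τ) +
        S.mixed τ (β v τ) (S.var₁ t u st w₀ τ v') +
        S.mixed τ (β v' τ) (S.var₁ t u st w₀ τ v)) 0 e)
    ⟨ACDeriv_of_subsingleton _ _ _, ACDeriv_of_subsingleton _ _ _⟩ (fun s hs => ?_) t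
    ⟨h.time.1, le_rfl⟩
  have hsT : s ∈ Icc 0 S.T := ⟨hs.1, hs.2.trans h.time.2⟩
  obtain ⟨ε₁, hε₁, h₁⟩ := (S.flow_family (hsT.1.trans hsT.2)).2.2.2 s hsT
  obtain ⟨ε₂, hε₂, h₂⟩ := h.flow.2.2.2 s hs
  refine ⟨min ε₁ ε₂, by positivity, fun a ha b hb has hbs hab hg => ?_⟩
  have haT : a ∈ Icc 0 S.T := ⟨ha.1, ha.2.trans h.time.2⟩
  have hbT : b ∈ Icc 0 S.T := ⟨hb.1, hb.2.trans h.time.2⟩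
  obtain ⟨hball, hV⟩ := h₁ a haT b hbT (has.trans_le (min_le_left _ _))
    (hbs.trans_le (min_le_left _ _)) hab
  obtain ⟨-, hW⟩ := h₂ a ha b hb (has.trans_le (min_le_right _ _))
    (hbs.trans_le (min_le_right _ _)) hab
  have hI : ∀ τ ∈ Icc a b, τ ∈ Icc 0 t := fun τ hτ => ⟨ha.1.trans hτ.1, hτ.2.trans hb.2⟩
  have hIT : ∀ τ ∈ Icc a b, τ ∈ Icc 0 S.T := fun τ hτ =>
    ⟨(hI τ hτ).1, (hI τ hτ).2.trans h.time.2⟩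
  -- On a short interval the chart at q(s) is fixed. Chart independence of the variations and of the
  -- rates turns the result into the global quantities, which can be glued.
  have key := SolvesVariational.pull_ode (S.contDiff_cutField (S.q s)) hV hW
    (ae_mono (Measure.restrict_mono (Icc_subset_Icc ha.1 hb.2) le_rfl) h.ctrl_eq)
    (fun τ hτ => h.famCurve_ref (hI τ hτ) _)
    (fun τ hτ => isUnit_fderiv_flowCurve (hIT τ hτ) (hball τ hτ).1) v v'
  refine ⟨hg.1.glue ha.1 hab (key.1.congr_fun_deriv ?_ ?_),
    hg.2.glue ha.1 hab (key.2.congr_fun_deriv ?_ ?_)⟩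
  · exact fun τ hτ => (h.pull_eq (hI τ hτ) (hball τ hτ).1 v v).1.symm
  · exact fun τ hτ => (rates_eq (hIT τ hτ) (hball τ hτ) _ 0 0).1
  · exact fun τ hτ => (h.pull_eq (hI τ hτ) (hball τ hτ).1 v v').2.symm
  · intro τ hτ
    rw [(rates_eq (hIT τ hτ) (hball τ hτ) _ _ 0).2.1, (rates_eq (hIT τ hτ) (hball τ hτ) _ 0 _).2.2,
      (rates_eq (hIT τ hτ) (hball τ hτ) _ 0 _).2.2, (h.pull_eq (hI τ hτ) (hball τ hτ).1 v v).1,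
      (h.pull_eq (hI τ hτ) (hball τ hτ).1 v' v).1]

/-- Initial values of the variations. -/
lemma IsFamily.variation_zero (h : S.IsFamily t u β st w₀) (v v' : 𝒲) :
    S.var₁ t u st w₀ 0 v = (fderiv ℝ (fun w => S.chart 0 (st w)) w₀ v, 0) ∧
    S.var₂ t u st w₀ 0 v v' =
      (fderiv ℝ (fderiv ℝ (fun w => S.chart 0 (st w))) w₀ v v', 0) := by
  have hT : 0 ≤ S.T := h.time.1.trans h.time.2
  have h0t : (0 : ℝ) ∈ Icc 0 t := ⟨le_rfl, h.time.1⟩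
  have e1 := (flowCurve_zero hT).fderiv_eq (𝕜 := ℝ)
  rw [fderiv_id] at e1
  have e2 : fderiv ℝ (fderiv ℝ (fun x => S.flowCurve (S.q 0) x 0)) S.base = 0 := by
    have := ((flowCurve_zero hT).fderiv (𝕜 := ℝ)).fderiv_eq (𝕜 := ℝ)
    have e : fderiv ℝ (id : Vec n × ℝ → Vec n × ℝ) = fun _ => ContinuousLinearMap.id ℝ _ :=
      funext fun x => fderiv_id
    rw [this, e]
    exact (hasFDerivAt_const _ _).fderiv
  have e3 : (fun w => S.famCurve t u st (S.q 0) w 0) =ᶠ[𝓝 w₀]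
      fun w => ContinuousLinearMap.inl ℝ (Vec n) ℝ (S.chart 0 (st w)) := by
    filter_upwards [h.flow.1] with w hw
    refine Prod.ext ?_ ?_
    · change S.chart 0 (S.trajectory t (u w) (st w) 0) = _
      rw [hw.2]
      rfl
    · change (0 : ℝ) + _ = 0
      rw [intervalIntegral.integral_same, add_zero]
  have hst : ContDiffAt ℝ 2 (fun w => S.chart 0 (st w)) w₀ := by
    have := (h.contDiffAt_famCurve h0t (mem_chart_source (Vec n) (S.q 0))).fst
    refine this.congr_of_eventuallyEq ?_
    filter_upwards [e3] with w hw
    rw [hw]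
    rfl
  have f1 := fun v v' => fderiv_comp_two (κ := ContinuousLinearMap.inl ℝ (Vec n) ℝ)
    (ContinuousLinearMap.inl ℝ (Vec n) ℝ).contDiff.contDiffAt hst v v'
  have f2 : ∀ v, S.var₁ t u st w₀ 0 v = (fderiv ℝ (fun w => S.chart 0 (st w)) w₀ v, 0) := by
    intro v
    rw [var₁, pull, e1, e3.fderiv_eq (𝕜 := ℝ), (f1 v v).1, ContinuousLinearMap.fderiv]
    exact (ringInverse_apply_eq isUnit_one).2 rfl
  refine ⟨f2 v, ?_⟩
  rw [var₂, pull₂, e1, e2, (e3.fderiv (𝕜 := ℝ)).fderiv_eq (𝕜 := ℝ), (f1 v v').2]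
  have f3 : fderiv ℝ (fderiv ℝ (ContinuousLinearMap.inl ℝ (Vec n) ℝ)) (S.chart 0 (st w₀)) = 0 := by
    have e : fderiv ℝ (ContinuousLinearMap.inl ℝ (Vec n) ℝ) = fun _ =>
        ContinuousLinearMap.inl ℝ (Vec n) ℝ := funext fun x => ContinuousLinearMap.fderiv _
    rw [e]
    exact (hasFDerivAt_const _ _).fderiv
  rw [f3, ContinuousLinearMap.fderiv]
  refine (ringInverse_apply_eq isUnit_one).2 ?_
  simp

end

end Reference

end Family

end OptControl

namespace OptControl

open ControlProblem

section Weak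

variable {E F : Type*} [NormedAddCommGroup E] [NormedSpace ℝ E] [NormedAddCommGroup F]
  [InnerProductSpace ℝ F] [FiniteDimensional ℝ F]

lemma differentiableAt_of_inner {f : E → F} {x : E}
    (h : ∀ ζ, DifferentiableAt ℝ (fun u => ⟪ζ, f u⟫_ℝ) x) : DifferentiableAt ℝ f x := by
  have h1 : DifferentiableAt ℝ (fun u => ∑ i, ⟪stdOrthonormalBasis ℝ F i, f u⟫_ℝ •
      stdOrthonormalBasis ℝ F i) x := by
    refine DifferentiableAt.fun_sum fun i _ => ?_
    exact (h _).smul_const _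
  refine h1.congr_of_eventuallyEq (Eventually.of_forall fun u => ?_)
  exact ((stdOrthonormalBasis ℝ F).sum_repr' (f u)).symm

omit [FiniteDimensional ℝ F] in
lemma inner_fderiv {f : E → F} {x : E} (h : DifferentiableAt ℝ f x) (ζ : F) (v : E) :
    ⟪ζ, fderiv ℝ f x v⟫_ℝ = fderiv ℝ (fun u => ⟪ζ, f u⟫_ℝ) x v := by
  have := ((innerSL ℝ ζ).hasFDerivAt.comp x h.hasFDerivAt).fderiv
  exact (DFunLike.congr_fun this v).symm

end Weak

/-! ### The Hamiltonian flow and its differential. -/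

section Hamiltonian

variable {n k d : ℕ} {M : Type*} [TopologicalSpace M] [ChartedSpace (Vec n) M]
  [IsManifold 𝓘(ℝ, Vec n) ∞ M]
  {N : Type*} [TopologicalSpace N] [ChartedSpace (Vec d) N] [IsManifold 𝓘(ℝ, Vec d) ∞ N]

namespace Reference

/-- The extended covector `(p, -ν)`. -/
noncomputable def cov (S : Reference n k d M N) (p : Vec n) : Vec n × ℝ →L[ℝ] ℝ :=
  innerSL ℝ p ∘L ContinuousLinearMap.fst ℝ (Vec n) ℝ - S.ν • ContinuousLinearMap.snd ℝ (Vec n) ℝ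

lemma cov_apply (S : Reference n k d M N) (p : Vec n) (y : Vec n × ℝ) :
    S.cov p y = ⟪p, y.1⟫_ℝ - S.ν * y.2 := rfl

lemma ham_eq_cov (S : Reference n k d M N) (τ : ℝ) (u : Vec k) (z : Phase n) (r : ℝ) :
    S.ham τ u z = S.cov z.fst (S.localField (S.q τ) (u, z.snd, r)) := rfl

variable {S : Reference n k d M N} {τ : ℝ}

/-- The accumulated cost acts by translations. Consequently the differential of the flow is the
identity on the cost direction, and its second differential vanishes there. -/
lemma flowCurve_add (c : M) (x : Vec n × ℝ) (r : ℝ) :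
    S.flowCurve c (x + (0, r)) τ = S.flowCurve c x τ + (0, r) := by
  refine Prod.ext ?_ ?_
  · simp [flowCurve, chartCurve, flowTraj]
  · simp [flowCurve, chartCurve, flowTraj]
    ring

lemma fderiv_flowCurve_add (c : M) (x : Vec n × ℝ) (r : ℝ) :
    fderiv ℝ (fun x => S.flowCurve c x τ) (x + (0, r)) = fderiv ℝ (fun x => S.flowCurve c x τ) x := by
  have h : (fun x => S.flowCurve c (x + (0, r)) τ) = fun x => S.flowCurve c x τ + (0, r) :=
    funext fun x => flowCurve_add c x r
  rw [← fderiv_comp_add_right (f := fun x => S.flowCurve c x τ), h, fderiv_add_const]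

lemma fderiv_flowCurve_snd {c : M} {x : Vec n × ℝ}
    (h : DifferentiableAt ℝ (fun x => S.flowCurve c x τ) x) (r : ℝ) :
    fderiv ℝ (fun x => S.flowCurve c x τ) x (0, r) = (0, r) := by
  have h1 : HasDerivAt (fun s : ℝ => S.flowCurve c (x + s • (0, r)) τ)
      (fderiv ℝ (fun x => S.flowCurve c x τ) x (0, r)) 0 :=
    h.hasFDerivAt.hasLineDerivAt (0, r)
  have h2 : HasDerivAt (fun s : ℝ => S.flowCurve c x τ + s • ((0, r) : Vec n × ℝ)) (0, r) 0 := by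
    have := ((hasDerivAt_id (0 : ℝ)).smul_const ((0, r) : Vec n × ℝ)).const_add (S.flowCurve c x τ)
    simpa using this
  refine h1.unique (h2.congr_of_eventuallyEq (Eventually.of_forall fun s => ?_))
  have := flowCurve_add (S := S) (τ := τ) c x (s * r)
  simpa using this

lemma cutField_add (P : ControlProblem n k M) (c : M) (x : Vec k × (Vec n × ℝ)) (r : ℝ) :
    P.cutField c (x + (0, 0, r)) = P.cutField c x := by
  have h : P.cutField c (x + (0, 0, r)) = P.cutField c (x.1 + 0, x.2.1 + 0, x.2.2) := rfl
  rw [h, add_zero, add_zero]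

lemma fderiv_cutField_snd (P : ControlProblem n k M) (c : M) (x : Vec k × (Vec n × ℝ)) (r : ℝ) :
    fderiv ℝ (P.cutField c) x (0, 0, r) = 0 := by
  have h : DifferentiableAt ℝ (P.cutField c) x :=
    (contDiff_infty.1 (P.contDiff_cutField c) 1).differentiable one_ne_zero x
  have h1 := h.hasFDerivAt.hasLineDerivAt (0, 0, r)
  refine HasDerivAt.unique h1 ((hasDerivAt_const (0 : ℝ) (P.cutField c x)).congr_of_eventuallyEq
    (Eventually.of_forall fun s => ?_))
  have := cutField_add P c x (s * r)
  simpa using this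

lemma fderiv_two_cutField_snd (P : ControlProblem n k M) (c : M) (x v : Vec k × (Vec n × ℝ))
    (r : ℝ) : fderiv ℝ (fderiv ℝ (P.cutField c)) x v (0, 0, r) = 0 := by
  have h := ContDiffAt.hasFDerivAt_fderiv_apply
    ((contDiff_infty.1 (P.contDiff_cutField c) 2).contDiffAt (x := x)) (0, 0, r)
  simp only [fderiv_cutField_snd] at h
  exact DFunLike.congr_fun (h.unique (hasFDerivAt_const (0 : Vec n × ℝ) x)) v

variable [T2Space M] [SecondCountableTopology M]

/-- The differential of the reference flow at the reference point. -/
noncomputable def flowD (S : Reference n k d M N) (τ : ℝ) (x : Vec n × ℝ) :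
    Vec n × ℝ →L[ℝ] Vec n × ℝ :=
  fderiv ℝ (fun x => S.flowCurve (S.q τ) x τ) x

lemma contDiffAt_flow (hτ : τ ∈ Icc 0 S.T) :
    ContDiffAt ℝ 2 (fun x => S.flowCurve (S.q τ) x τ) S.base :=
  contDiffAt_flowCurve hτ (mem_chart_source _ _)

lemma isUnit_flowD (hτ : τ ∈ Icc 0 S.T) : IsUnit (S.flowD τ S.base) :=
  isUnit_fderiv_flowCurve hτ (mem_chart_source _ _)

lemma hasFDerivAt_flowD (hτ : τ ∈ Icc 0 S.T) :
    HasFDerivAt (S.flowD τ) (fderiv ℝ (S.flowD τ) S.base) S.base :=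
  (((contDiffAt_flow hτ).fderiv_right (m := 1) (by norm_num)).differentiableAt
    one_ne_zero).hasFDerivAt

lemma flowD_two_symm (hτ : τ ∈ Icc 0 S.T) (a b : Vec n × ℝ) :
    fderiv ℝ (S.flowD τ) S.base a b = fderiv ℝ (S.flowD τ) S.base b a :=
  (contDiffAt_flow hτ).isSymmSndFDerivAt (by simp) a b

lemma flowD_two_snd (hτ : τ ∈ Icc 0 S.T) (r : ℝ) :
    fderiv ℝ (S.flowD τ) S.base (0, r) = 0 := by
  have h1 := (hasFDerivAt_flowD hτ).hasLineDerivAt (0, r)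
  refine HasDerivAt.unique h1 ((hasDerivAt_const (0 : ℝ) (S.flowD τ S.base)).congr_of_eventuallyEq
    (Eventually.of_forall fun s => ?_))
  have := fderiv_flowCurve_add (S := S) (τ := τ) (S.q τ) S.base (s * r)
  simpa [flowD] using this

lemma flowD_two_fst (hτ : τ ∈ Icc 0 S.T) (a b : Vec n × ℝ) :
    fderiv ℝ (S.flowD τ) S.base (a.1, 0) b = fderiv ℝ (S.flowD τ) S.base a b := by
  have : a = (a.1, 0) + (0, a.2) := by simp
  conv_rhs => rw [this, map_add, flowD_two_snd hτ, add_zero]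

lemma flowD_snd (hτ : τ ∈ Icc 0 S.T) (r : ℝ) : S.flowD τ S.base (0, r) = (0, r) :=
  fderiv_flowCurve_snd ((contDiffAt_flow hτ).differentiableAt (by simp)) r

/-- Neither the field nor the differential of the flow depends on the accumulated cost, so the cost
component of a does not contribute. -/
lemma mixed_fst (hτ : τ ∈ Icc 0 S.T) (v : Vec k) (a : Vec n × ℝ) :
    S.mixed τ v (a.1, 0) = S.mixed τ v a := by
  have e : a = (a.1, 0) + (0, a.2) := by simp
  have h0 := flowD_snd hτ a.2
  have h1 : fderiv ℝ (fderiv ℝ fun x => S.flowCurve (S.q τ) x τ) S.base (0, a.2) = 0 :=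
    flowD_two_snd hτ a.2
  simp only [flowD] at h0
  have h2 : ∀ b, fderiv ℝ (fderiv ℝ fun x => S.flowCurve (S.q τ) x τ) S.base b (0, a.2) = 0 := by
    intro b
    exact (flowD_two_symm hτ b (0, a.2)).trans (DFunLike.congr_fun h1 b)
  have h3 : fderiv ℝ (fderiv ℝ (S.cutField (S.q τ))) (S.u τ, S.flowCurve (S.q τ) S.base τ) (v, 0)
      (0, fderiv ℝ (fun x => S.flowCurve (S.q τ) x τ) S.base a) =
      fderiv ℝ (fderiv ℝ (S.cutField (S.q τ))) (S.u τ, S.flowCurve (S.q τ) S.base τ) (v, 0)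
      (0, fderiv ℝ (fun x => S.flowCurve (S.q τ) x τ) S.base (a.1, 0)) := by
    have e2 : ((0, fderiv ℝ (fun x => S.flowCurve (S.q τ) x τ) S.base a) : Vec k × (Vec n × ℝ)) =
        (0, fderiv ℝ (fun x => S.flowCurve (S.q τ) x τ) S.base (a.1, 0)) + (0, 0, a.2) := by
      conv_lhs => rw [e, map_add, h0]
      simp
    rw [e2, map_add, fderiv_two_cutField_snd, add_zero]
  have h4 : ∀ b, fderiv ℝ (fderiv ℝ fun x => S.flowCurve (S.q τ) x τ) S.base b a =
      fderiv ℝ (fderiv ℝ fun x => S.flowCurve (S.q τ) x τ) S.base b (a.1, 0) := by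
    intro b
    conv_lhs => rw [e, map_add, h2, add_zero]
  rw [mixed, mixed, pullMixed, pullMixed, h3, h4]

omit [T2Space M] [SecondCountableTopology M] in
lemma tendsto_inl (S : Reference n k d M N) :
    Tendsto (fun x : Vec n => ((x, 0) : Vec n × ℝ)) (𝓝 S.base.1) (𝓝 S.base) :=
  (continuous_id.prodMk continuous_const).tendsto' _ _ rfl

/-- The reference flow and cost with horizon `τ`. -/
lemma eventually_refFlow (hτ : τ ∈ Icc 0 S.T) :
    ∀ᶠ x in 𝓝 S.base.1, S.refFlow τ x = (S.flowCurve (S.q τ) (x, 0) τ).1 ∧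
      S.refCost τ x = (S.flowCurve (S.q τ) (x, 0) τ).2 := by
  have h := S.tendsto_inl.eventually (S.flow_family (hτ.1.trans hτ.2)).1
  filter_upwards [h] with x hx
  have key : ∀ θ ∈ Icc 0 τ, S.trajectory τ S.u ((S.chart 0).symm x) θ = S.flowTraj (x, 0) θ :=
    fun θ hθ => trajectory_eq (hx.1.mono hτ.2) hx.2 (memLp_mono_Icc S.u_mem le_rfl hτ.2) hθ
  refine ⟨congrArg (S.chart τ) (key τ ⟨hτ.1, le_rfl⟩), ?_⟩
  change ∫ θ in (0 : ℝ)..τ, S.L (S.u θ) (S.trajectory τ S.u ((S.chart 0).symm x) θ) = 0 + _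
  rw [zero_add]
  refine intervalIntegral.integral_congr fun θ hθ => ?_
  rw [uIcc_of_le hτ.1] at hθ
  exact congrArg (S.L (S.u θ)) (key θ hθ)

/-- The Hamiltonian flow transports extended covectors by the inverse of the reference flow. -/
lemma eventually_cov_hamFlow (hτ : τ ∈ Icc 0 S.T) :
    ∀ᶠ z in 𝓝 S.z0, (S.hamFlow τ z).snd = (S.flowCurve (S.q τ) (z.snd, 0) τ).1 ∧
      ∀ y, S.cov (S.hamFlow τ z).fst y =
        S.cov z.fst (Ring.inverse (S.flowD τ (z.snd, 0)) y) := by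
  have hsnd : Tendsto (fun z : Phase n => z.snd) (𝓝 S.z0) (𝓝 S.base.1) :=
    (WithLp.prod_continuous_ofLp 2 (Vec n) (Vec n)).snd.tendsto' _ _ rfl
  have hu : ∀ᶠ x in 𝓝 S.base.1, IsUnit (S.flowD τ (x, 0)) := by
    refine S.tendsto_inl.eventually (p := fun x => IsUnit (S.flowD τ x)) ?_
    exact (hasFDerivAt_flowD hτ).continuousAt.eventually_mem (Units.isOpen.mem_nhds (isUnit_flowD hτ))
  have hd := S.tendsto_inl.eventually (ContDiffAt.eventually_hasFDerivAt (contDiffAt_flow hτ))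
  have hr := eventually_eventually_nhds.2 (eventually_refFlow hτ)
  filter_upwards [hsnd.eventually hu, hsnd.eventually hd, hsnd.eventually hr] with z hz1 hz2 hz3
  obtain ⟨x, hx⟩ : ∃ x, x = z.snd := ⟨_, rfl⟩
  obtain ⟨p, hp⟩ : ∃ p, p = z.fst := ⟨_, rfl⟩
  change (S.refFlow τ z.snd) = _ ∧ ∀ y, S.cov (ContinuousLinearMap.adjoint
    (fderiv ℝ (S.refFlow τ) z.snd).inverse (z.fst + S.ν • gradient (S.refCost τ) z.snd)) y = _
  rw [← hx] at hz1 hz2 hz3 ⊢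
  rw [← hp]
  refine ⟨hz3.self_of_nhds.1, fun y => ?_⟩
  set A := S.flowD τ (x, 0) with hA
  have hA' : HasFDerivAt (fun x => S.flowCurve (S.q τ) x τ) A (x, 0) := hz2
  have hinl : HasFDerivAt (fun x : Vec n => ((x, 0) : Vec n × ℝ))
    (ContinuousLinearMap.inl ℝ (Vec n) ℝ) x := hasFDerivAt_prodMk_left x 0
  have hc := HasFDerivAt.comp (𝕜 := ℝ) (g := fun x => S.flowCurve (S.q τ) x τ)
    (f := fun x : Vec n => ((x, 0) : Vec n × ℝ)) x hA' hinl
  have hB : fderiv ℝ (S.refFlow τ) x = (ContinuousLinearMap.fst ℝ (Vec n) ℝ ∘L A) ∘L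
      ContinuousLinearMap.inl ℝ (Vec n) ℝ :=
    ((hasFDerivAt_fst.comp x hc).congr_of_eventuallyEq (hz3.mono fun _ h => h.1)).fderiv
  have hJ : HasFDerivAt (S.refCost τ) ((ContinuousLinearMap.snd ℝ (Vec n) ℝ ∘L A) ∘L
      ContinuousLinearMap.inl ℝ (Vec n) ℝ) x :=
    (hasFDerivAt_snd.comp x hc).congr_of_eventuallyEq (hz3.mono fun _ h => h.2)
  have hA2 : ∀ b r, A (b, r) = A (b, 0) + (0, r) := by
    intro b r
    have : ((b, r) : Vec n × ℝ) = (b, 0) + (0, r) := by simp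
    conv_lhs => rw [this, map_add, hA, flowD, fderiv_flowCurve_snd hA'.differentiableAt]
    rfl
  set B := fderiv ℝ (S.refFlow τ) x with hBdef
  have hBa : ∀ b, B b = (A (b, 0)).1 := fun b => by rw [hB]; rfl
  -- The extended differential A is block triangular with the identity on the cost, so its state
  -- block B inherits invertibility.
  have hBu : IsUnit B := by
    rw [ContinuousLinearMap.isUnit_iff_bijective]
    have hinj : Function.Injective B := by
      rw [injective_iff_map_eq_zero]
      intro b hb
      rw [hBa] at hb
      have : A (b, -(A (b, 0)).2) = 0 := by
        rw [hA2]
        exact Prod.ext (by simp [hb]) (by simp)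
      have h2 := (ContinuousLinearMap.isUnit_iff_bijective.1 hz1).1
      have h3 := (injective_iff_map_eq_zero A).1 h2 _ this
      exact congrArg Prod.fst h3
    exact ⟨hinj, LinearMap.injective_iff_surjective (f := B.toLinearMap).1 hinj⟩
  obtain ⟨⟨b, r⟩, hbr⟩ : ∃ w, w = Ring.inverse A y := ⟨_, rfl⟩
  have hy : A (b, r) = y := (ringInverse_apply_eq hz1).1 hbr.symm
  rw [← hbr, ← hy, hA2, cov_apply, cov_apply, ContinuousLinearMap.adjoint_inner_left,
    ← ContinuousLinearMap.ringInverse_eq_inverse]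
  have e1 : Ring.inverse B ((A (b, 0) + (0, r)).1) = b := by
    rw [ringInverse_apply_eq hBu, hBa]
    simp
  rw [e1, inner_add_left, inner_smul_left, gradient, InnerProductSpace.toDual_symm_apply, hJ.fderiv]
  simp
  ring

end Reference

end Hamiltonian

end OptControl

namespace OptControl

open ControlProblem

section Hamiltonian

variable {n k d : ℕ} {M : Type*} [TopologicalSpace M] [ChartedSpace (Vec n) M]
  [IsManifold 𝓘(ℝ, Vec n) ∞ M]
  {N : Type*} [TopologicalSpace N] [ChartedSpace (Vec d) N] [IsManifold 𝓘(ℝ, Vec d) ∞ N]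

namespace Reference

lemma hasFDerivAt_cov (S : Reference n k d M N) {G : Vec n → Vec n × ℝ} {G' : Vec n →L[ℝ] Vec n × ℝ}
    (h : HasFDerivAt G G' S.base.1) :
    ∃ B : Phase n →L[ℝ] ℝ, HasFDerivAt (fun z : Phase n => S.cov z.fst (G z.snd)) B S.z0 ∧
      ∀ ζ, B ζ = ⟪ζ.fst, (G S.base.1).1⟫_ℝ + S.cov S.z0.fst (G' ζ.snd) := by
  have h1 : HasFDerivAt (fun z : Phase n => z.fst) (WithLp.fstL 2 ℝ (Vec n) (Vec n)) S.z0 :=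
    (WithLp.fstL 2 ℝ (Vec n) (Vec n)).hasFDerivAt
  have h2 : HasFDerivAt (fun z : Phase n => z.snd) (WithLp.sndL 2 ℝ (Vec n) (Vec n)) S.z0 :=
    (WithLp.sndL 2 ℝ (Vec n) (Vec n)).hasFDerivAt
  have h3 : HasFDerivAt (fun z : Phase n => G z.snd) (G' ∘L WithLp.sndL 2 ℝ (Vec n) (Vec n)) S.z0 :=
    HasFDerivAt.comp (𝕜 := ℝ) (g := G) (f := fun z : Phase n => z.snd) S.z0 h h2
  have h4 := (h1.inner ℝ h3.fst).sub (h3.snd.const_mul S.ν)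
  refine ⟨_, h4, fun ζ => ?_⟩
  rw [cov_apply]
  simp [fderivInnerCLM_apply]
  have : S.z0.snd = S.base.1 := rfl
  rw [this]
  ring

variable [T2Space M] [SecondCountableTopology M] {S : Reference n k d M N} {τ : ℝ}

lemma hasFDerivAt_inverse_flowD (hτ : τ ∈ Icc 0 S.T) {G : Vec n → Vec n × ℝ}
    {G' : Vec n →L[ℝ] Vec n × ℝ} (h : HasFDerivAt G G' S.base.1) :
    ∃ B : Vec n →L[ℝ] Vec n × ℝ,
      HasFDerivAt (fun x => Ring.inverse (S.flowD τ (x, 0)) (G x)) B S.base.1 ∧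
      ∀ a, B a = Ring.inverse (S.flowD τ S.base) (G' a - fderiv ℝ (S.flowD τ) S.base (a, 0)
        (Ring.inverse (S.flowD τ S.base) (G S.base.1))) := by
  obtain ⟨A, hA⟩ := isUnit_flowD hτ
  have h1 := hasFDerivAt_ringInverse (𝕜 := ℝ) A
  rw [hA] at h1
  have h2 := HasFDerivAt.comp (𝕜 := ℝ) (g := S.flowD τ) (f := fun x : Vec n => ((x, 0) : Vec n × ℝ))
    S.base.1 (hasFDerivAt_flowD hτ) (hasFDerivAt_prodMk_left S.base.1 (0 : ℝ))
  have h3 := HasFDerivAt.comp (𝕜 := ℝ) (g := Ring.inverse)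
    (f := fun x : Vec n => S.flowD τ (x, 0)) S.base.1 h1 h2
  have h4 := h3.clm_apply h
  refine ⟨_, h4, fun a => ?_⟩
  have e : Ring.inverse (S.flowD τ S.base) = (A⁻¹ : (Vec n × ℝ →L[ℝ] Vec n × ℝ)ˣ) := by
    rw [← hA, Ring.inverse_unit]
  have e2 : S.flowD τ (S.base.1, 0) = S.flowD τ S.base := rfl
  simp only [Function.comp, e2, e, map_sub]
  simp
  abel

/-- The differential of the Hamiltonian flow. -/
theorem fderiv_hamFlow (hτ : τ ∈ Icc 0 S.T) (ζ : Phase n) :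
    (fderiv ℝ (S.hamFlow τ) S.z0 ζ).snd = (S.flowD τ S.base (ζ.snd, 0)).1 ∧
    ∀ y, ⟪(fderiv ℝ (S.hamFlow τ) S.z0 ζ).fst, y.1⟫_ℝ =
      ⟪ζ.fst, (Ring.inverse (S.flowD τ S.base) y).1⟫_ℝ - S.cov S.z0.fst
        (Ring.inverse (S.flowD τ S.base) (fderiv ℝ (S.flowD τ) S.base (ζ.snd, 0)
          (Ring.inverse (S.flowD τ S.base) y))) := by
  have hev := eventually_cov_hamFlow hτ
  have hx : HasFDerivAt (fun x : Vec n => S.flowCurve (S.q τ) (x, 0) τ)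
      (S.flowD τ S.base ∘L ContinuousLinearMap.inl ℝ (Vec n) ℝ) S.base.1 :=
    HasFDerivAt.comp (𝕜 := ℝ) (g := fun x => S.flowCurve (S.q τ) x τ)
      (f := fun x : Vec n => ((x, 0) : Vec n × ℝ)) S.base.1
      ((contDiffAt_flow hτ).differentiableAt (by simp)).hasFDerivAt
      (hasFDerivAt_prodMk_left S.base.1 (0 : ℝ))
  have h2 : HasFDerivAt (fun z : Phase n => z.snd) (WithLp.sndL 2 ℝ (Vec n) (Vec n)) S.z0 :=
    (WithLp.sndL 2 ℝ (Vec n) (Vec n)).hasFDerivAt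
  have hsnd : HasFDerivAt (fun z => (S.hamFlow τ z).snd)
      (ContinuousLinearMap.fst ℝ (Vec n) ℝ ∘L
        (S.flowD τ S.base ∘L ContinuousLinearMap.inl ℝ (Vec n) ℝ) ∘L
        WithLp.sndL 2 ℝ (Vec n) (Vec n)) S.z0 := by
    have h3 := (HasFDerivAt.comp (𝕜 := ℝ) (g := fun x : Vec n => S.flowCurve (S.q τ) (x, 0) τ)
      (f := fun z : Phase n => z.snd) S.z0 hx h2).fst
    exact h3.congr_of_eventuallyEq (hev.mono fun z hz => hz.1)
  -- The momentum of the flow is known only through its pairings with vectors; ν y.2 is a constant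
  -- that turns the extended covector into its momentum. Differentiability of the flow is assembled
  -- from these pairings.
  have hfst : ∀ y, ∃ B : Phase n →L[ℝ] ℝ,
      HasFDerivAt (fun z => ⟪(S.hamFlow τ z).fst, y.1⟫_ℝ) B S.z0 ∧
      ∀ ζ, B ζ = ⟪ζ.fst, (Ring.inverse (S.flowD τ S.base) y).1⟫_ℝ - S.cov S.z0.fst
        (Ring.inverse (S.flowD τ S.base) (fderiv ℝ (S.flowD τ) S.base (ζ.snd, 0)
          (Ring.inverse (S.flowD τ S.base) y))) := by
    intro y
    obtain ⟨B, hB, hB'⟩ := hasFDerivAt_inverse_flowD hτ (hasFDerivAt_const y S.base.1)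
    obtain ⟨C, hC, hC'⟩ := S.hasFDerivAt_cov hB
    refine ⟨C, ?_, fun ζ => ?_⟩
    · refine (hC.add_const (S.ν * y.2)).congr_of_eventuallyEq (hev.mono fun z hz => ?_)
      have := hz.2 y
      rw [cov_apply] at this
      change _ = S.cov z.fst _ + _
      rw [← this]
      ring
    · rw [hC', hB']
      simp only [zero_apply, zero_sub, map_neg]
      rw [← sub_eq_add_neg]
      rfl
  have hdiff : DifferentiableAt ℝ (S.hamFlow τ) S.z0 := by
    refine differentiableAt_of_inner fun ζ => ?_
    obtain ⟨B, hB, -⟩ := hfst (ζ.fst, 0)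
    have := (hB.differentiableAt).add
      ((differentiableAt_const ζ.snd).inner ℝ hsnd.differentiableAt)
    refine this.congr_of_eventuallyEq (Eventually.of_forall fun z => ?_)
    simp only [phase_inner, Pi.add_apply]
    rw [real_inner_comm]
  constructor
  · have := (WithLp.sndL 2 ℝ (Vec n) (Vec n)).hasFDerivAt.comp S.z0 hdiff.hasFDerivAt
    exact DFunLike.congr_fun (this.unique hsnd) ζ
  · intro y
    obtain ⟨B, hB, hB'⟩ := hfst y
    have h5 := (WithLp.fstL 2 ℝ (Vec n) (Vec n)).hasFDerivAt.comp S.z0 hdiff.hasFDerivAt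
    have h6 := h5.inner ℝ (hasFDerivAt_const y.1 S.z0)
    have h7 := DFunLike.congr_fun (h6.unique hB) ζ
    rw [hB'] at h7
    rw [← h7]
    simp [fderivInnerCLM_apply]

lemma cov_lam (hτ : τ ∈ Icc 0 S.T) (y : Vec n × ℝ) :
    S.cov (S.lam τ).fst y = S.cov S.z0.fst (Ring.inverse (S.flowD τ S.base) y) :=
  (eventually_cov_hamFlow hτ).self_of_nhds.2 y

/-- The Hamiltonian along the flow, near the reference point. -/
lemma eventually_ham (hτ : τ ∈ Icc 0 S.T) : ∀ᶠ z in 𝓝 S.z0, ∀ u,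
    S.ham τ u (S.hamFlow τ z) = S.cov z.fst (Ring.inverse (S.flowD τ (z.snd, 0))
      (S.cutField (S.q τ) (u, S.flowCurve (S.q τ) (z.snd, 0) τ))) := by
  have hsnd : Tendsto (fun z : Phase n => z.snd) (𝓝 S.z0) (𝓝 S.base.1) :=
    (WithLp.prod_continuous_ofLp 2 (Vec n) (Vec n)).snd.tendsto' _ _ rfl
  have hb : ∀ᶠ x in 𝓝 S.base, (S.flowCurve (S.q τ) x τ).1 ∈
      Metric.ball (extChartAt 𝓘(ℝ, Vec n) (S.q τ) (S.q τ)) (cutoff n (S.q τ)).rIn := by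
    refine (contDiffAt_flow hτ).continuousAt.fst.eventually_mem (Metric.isOpen_ball.mem_nhds ?_)
    rw [flowCurve_base hτ]
    exact (mem_chartBall (n := n) (S.q τ)).2
  filter_upwards [eventually_cov_hamFlow hτ, (S.tendsto_inl.comp hsnd).eventually hb]
    with z h1 h2 u
  rw [S.ham_eq_cov τ u _ (S.flowCurve (S.q τ) (z.snd, 0) τ).2, h1.1, h1.2,
    ← S.cutField_eq (S.q τ) (x := (u, (S.flowCurve (S.q τ) (z.snd, 0) τ).1,
      (S.flowCurve (S.q τ) (z.snd, 0) τ).2)) h2]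

/-- Along the reference curve the Hamiltonian in u is a fixed linear functional of the local field
at a fixed state, namely the extended covector composed with the inverse differential of the flow.
-/
theorem fderiv_two_ham (hτ : τ ∈ Icc 0 S.T) (v w : Vec k) :
    fderiv ℝ (fderiv ℝ (fun u => S.ham τ u (S.lam τ))) (S.u τ) v w =
      S.cov S.z0.fst (S.rate₂ τ v w) := by
  have h := (eventually_ham hτ).self_of_nhds
  set F := S.cutField (S.q τ) with hF
  set y := S.flowCurve (S.q τ) S.base τ with hy
  set ρ : Vec n × ℝ →L[ℝ] ℝ := S.cov S.z0.fst ∘L Ring.inverse (S.flowD τ S.base) with hρ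
  have h1 : (fun u => S.ham τ u (S.lam τ)) = fun u => ρ (F (u, y)) := funext h
  have hF2 : ContDiff ℝ 2 F := contDiff_infty.1 (S.contDiff_cutField _) 2
  have h2 : ∀ u, HasFDerivAt (fun u => ρ (F (u, y)))
      (ρ ∘L (fderiv ℝ F (u, y) ∘L ContinuousLinearMap.inl ℝ (Vec k) (Vec n × ℝ))) u := fun u =>
    ρ.hasFDerivAt.comp u (hasFDerivAt_partial_fst (hF2.differentiable (by simp) _).hasFDerivAt)
  have hC : ContDiff ℝ 2 (fun u => ρ (F (u, y))) :=
    ρ.contDiff.comp (hF2.comp (contDiff_id.prodMk contDiff_const))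
  have h3 := ContDiffAt.hasFDerivAt_fderiv_apply (hC.contDiffAt (x := S.u τ)) w
  have h4 : (fun u => fderiv ℝ (fun u => ρ (F (u, y))) u w) =
      fun u => ρ (fderiv ℝ F (u, y) (w, 0)) := funext fun u => by rw [(h2 u).fderiv]; rfl
  rw [h4] at h3
  have h5 := ρ.hasFDerivAt.comp (S.u τ) (hasFDerivAt_partial_fst
    (ContDiffAt.hasFDerivAt_fderiv_apply (hF2.contDiffAt (x := (S.u τ, y))) (w, 0)))
  have h6 := DFunLike.congr_fun (h3.unique h5) v
  rw [h1]
  exact h6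

/-- The field `X` before projection. -/
theorem fderiv_pulledField (hτ : τ ∈ Icc 0 S.T) (v : Vec k) (ζ : Phase n) :
    ⟪ζ, fderiv ℝ (S.pulledField τ) (S.u τ) v⟫_ℝ =
      ⟪ζ.snd, (S.rate τ v).1⟫_ℝ - S.cov S.z0.fst (S.mixed τ v (ζ.fst, 0)) := by
  set F := S.cutField (S.q τ) with hF
  set y := S.flowCurve (S.q τ) S.base τ with hy
  set R := Ring.inverse (S.flowD τ S.base) with hR
  have hF2 : ContDiff ℝ 2 F := contDiff_infty.1 (S.contDiff_cutField _) 2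
  have hx : HasFDerivAt (fun x : Vec n => S.flowCurve (S.q τ) (x, 0) τ)
      (S.flowD τ S.base ∘L ContinuousLinearMap.inl ℝ (Vec n) ℝ) S.base.1 :=
    HasFDerivAt.comp (𝕜 := ℝ) (g := fun x => S.flowCurve (S.q τ) x τ)
      (f := fun x : Vec n => ((x, 0) : Vec n × ℝ)) S.base.1
      ((contDiffAt_flow hτ).differentiableAt (by simp)).hasFDerivAt
      (hasFDerivAt_prodMk_left S.base.1 (0 : ℝ))
  -- the differential of the Hamiltonian in the state
  have key : ∀ u, ∃ B : Phase n →L[ℝ] ℝ, HasFDerivAt (fun z => S.cov z.fst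
      (Ring.inverse (S.flowD τ (z.snd, 0)) (F (u, S.flowCurve (S.q τ) (z.snd, 0) τ)))) B S.z0 ∧
      ∀ ζ, B ζ = ⟪ζ.fst, (R (F (u, y))).1⟫_ℝ + S.cov S.z0.fst (R
        (fderiv ℝ F (u, y) (0, S.flowD τ S.base (ζ.snd, 0)) -
          fderiv ℝ (S.flowD τ) S.base (ζ.snd, 0) (R (F (u, y))))) := by
    intro u
    have h1 := HasFDerivAt.comp (𝕜 := ℝ) (g := fun y => F (u, y))
      (f := fun x : Vec n => S.flowCurve (S.q τ) (x, 0) τ) S.base.1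
      (hasFDerivAt_partial_snd (hF2.differentiable (by simp) (u, y)).hasFDerivAt) hx
    obtain ⟨B, hB, hB'⟩ := hasFDerivAt_inverse_flowD hτ h1
    obtain ⟨C, hC, hC'⟩ := S.hasFDerivAt_cov hB
    refine ⟨C, hC, fun ζ => ?_⟩
    rw [hC', hB']
    rfl
  choose B hB hB' using key
  -- The subtracted term with the reference control is constant in u, and so disappears when the
  -- field is differentiated in u.
  have hpull : ∀ u, HasFDerivAt (S.pulledHam τ u) (B u - B (S.u τ)) S.z0 := fun u =>
    ((hB u).sub (hB (S.u τ))).congr_of_eventuallyEq ((eventually_ham hτ).mono fun z hz =>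
      congrArg₂ (· - ·) (hz u) (hz (S.u τ)))
  -- Pairing ζ with a Hamiltonian field gives the differential of the Hamiltonian at Jζ = (ζ.snd,
  -- -ζ.fst).
  have hinner : ∀ ζ : Phase n, (fun u => ⟪ζ, S.pulledField τ u⟫_ℝ) = fun u =>
      B u (WithLp.toLp 2 (ζ.snd, -ζ.fst)) - B (S.u τ) (WithLp.toLp 2 (ζ.snd, -ζ.fst)) := by
    intro ζ
    funext u
    have h1 : ⟪gradient (S.pulledHam τ u) S.z0, (WithLp.toLp 2 (ζ.snd, -ζ.fst) : Phase n)⟫_ℝ =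
        (B u - B (S.u τ)) (WithLp.toLp 2 (ζ.snd, -ζ.fst)) := by
      rw [gradient, InnerProductSpace.toDual_symm_apply, (hpull u).fderiv]
    rw [sub_apply] at h1
    rw [← h1, phase_inner, phase_inner]
    simp only [pulledField, inner_neg_right, WithLp.toLp_fst, WithLp.toLp_snd]
    rw [real_inner_comm (gradient (S.pulledHam τ u) S.z0).fst,
      real_inner_comm (gradient (S.pulledHam τ u) S.z0).snd]
    ring
  have hder : ∀ ζ : Phase n, ∃ C : Vec k →L[ℝ] ℝ,
      HasFDerivAt (fun u => ⟪ζ, S.pulledField τ u⟫_ℝ) C (S.u τ) ∧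
      ∀ v, C v = ⟪ζ.snd, (S.rate τ v).1⟫_ℝ - S.cov S.z0.fst (S.mixed τ v (ζ.fst, 0)) := by
    intro ζ
    rw [hinner ζ]
    simp only [hB']
    have d1 : HasFDerivAt (fun u => R (F (u, y))) (R ∘L (fderiv ℝ F (S.u τ, y) ∘L
        ContinuousLinearMap.inl ℝ (Vec k) (Vec n × ℝ))) (S.u τ) :=
      R.hasFDerivAt.comp (S.u τ)
        (hasFDerivAt_partial_fst (hF2.differentiable (by simp) (S.u τ, y)).hasFDerivAt)
    have d2 := hasFDerivAt_partial_fst (ContDiffAt.hasFDerivAt_fderiv_apply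
      (hF2.contDiffAt (x := (S.u τ, y))) (0, S.flowD τ S.base (-ζ.fst, 0)))
    have d3 := (fderiv ℝ (S.flowD τ) S.base (-ζ.fst, 0)).hasFDerivAt.comp (S.u τ) d1
    have d4 := (S.cov S.z0.fst ∘L R).hasFDerivAt.comp (S.u τ) (d2.sub d3)
    have d5 := (innerSL ℝ ζ.snd).hasFDerivAt.comp (S.u τ) d1.fst
    refine ⟨_, (d5.add d4).sub_const _, fun v => ?_⟩
    have e1 : ∀ a : Vec n, ((-a, 0) : Vec n × ℝ) = -(a, 0) := fun a => by simp
    have e2 : ∀ a : Vec n × ℝ, ((0, -a) : Vec k × (Vec n × ℝ)) = -(0, a) := fun a => by simp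
    have e3 : S.mixed τ v (ζ.fst, 0) = R (fderiv ℝ (fderiv ℝ F) (S.u τ, y) (v, 0)
        (0, S.flowD τ S.base (ζ.fst, 0)) -
        fderiv ℝ (S.flowD τ) S.base (ζ.fst, 0) (S.rate τ v)) := by
      rw [flowD_two_symm hτ]
      rfl
    have e4 : S.rate τ v = R (fderiv ℝ F (S.u τ, y) (v, 0)) := rfl
    have e5 : fderiv ℝ (fderiv ℝ F) (S.u τ, y) (v, 0) (0, S.flowD τ S.base (-ζ.fst, 0)) =
        -fderiv ℝ (fderiv ℝ F) (S.u τ, y) (v, 0) (0, S.flowD τ S.base (ζ.fst, 0)) := by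
      rw [e1, map_neg, e2, map_neg]
    have e6 : fderiv ℝ (S.flowD τ) S.base (-ζ.fst, 0) =
        -fderiv ℝ (S.flowD τ) S.base (ζ.fst, 0) := by
      rw [e1, map_neg]
    rw [e3, e4]
    simp [e5, e6]
    ring
  have hdiff : DifferentiableAt ℝ (S.pulledField τ) (S.u τ) := by
    refine differentiableAt_of_inner fun ζ => ?_
    obtain ⟨C, hC, -⟩ := hder ζ
    exact hC.differentiableAt
  obtain ⟨C, hC, hC'⟩ := hder ζ
  rw [inner_fderiv hdiff, hC.fderiv, hC']

end Reference

end Hamiltonian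

end OptControl

namespace OptControl

open ControlProblem

/-! ### End-point and cost derivatives in terms of X and b. -/

section Variations

lemma fderiv_clm_two {W E G : Type*} [NormedAddCommGroup W] [NormedSpace ℝ W]
    [NormedAddCommGroup E] [NormedSpace ℝ E] [NormedAddCommGroup G] [NormedSpace ℝ G]
    (π : E →L[ℝ] G) {Y : W → E} {x : W} (hY : ContDiffAt ℝ 2 Y x) (v w : W) :
    fderiv ℝ (fun x => π (Y x)) x v = π (fderiv ℝ Y x v) ∧
      fderiv ℝ (fderiv ℝ (fun x => π (Y x))) x v w = π (fderiv ℝ (fderiv ℝ Y) x v w) := by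
  have h3 := fderiv_comp_two (κ := π) π.contDiff.contDiffAt hY v w
  have e : fderiv ℝ π = fun _ => π := funext fun x => ContinuousLinearMap.fderiv _
  have e2 : fderiv ℝ (fderiv ℝ π) (Y x) = 0 := by
    rw [e]
    exact (hasFDerivAt_const _ _).fderiv
  rw [e2, e] at h3
  simpa using h3

variable {n k d : ℕ} {M : Type*} [TopologicalSpace M] [ChartedSpace (Vec n) M]
  [IsManifold 𝓘(ℝ, Vec n) ∞ M]
  {N : Type*} [TopologicalSpace N] [ChartedSpace (Vec d) N] [IsManifold 𝓘(ℝ, Vec d) ∞ N]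

namespace Reference

variable {S : Reference n k d M N} {t τ : ℝ}

lemma memLp_proj (S : Reference n k d M N) : MemLp S.proj ∞ (volume.restrict (Icc 0 S.T)) :=
  memLp_top_of_bound S.proj_meas 1 (Eventually.of_forall fun τ => (S.proj_star τ).norm_le)

/-- The start of a variation, in the chart at the reference initial point. -/
noncomputable def startChart (S : Reference n k d M N) (y : Vec d) : Vec n :=
  S.chart 0 (S.start y)

lemma start_zero (S : Reference n k d M N) : S.start 0 = S.q 0 := by
  rw [start, add_zero, (extChartAt 𝓘(ℝ, Vec d) S.x0).left_inv (mem_extChartAt_source _), S.q_zero]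

lemma contMDiffAt_start (S : Reference n k d M N) :
    ContMDiffAt 𝓘(ℝ, Vec d) 𝓘(ℝ, Vec n) 2 S.start 0 := by
  have h1 : ContMDiffAt 𝓘(ℝ, Vec d) 𝓘(ℝ, Vec d) ∞
      (fun y : Vec d => extChartAt 𝓘(ℝ, Vec d) S.x0 S.x0 + y) 0 :=
    (contDiff_const.add contDiff_id).contMDiff.contMDiffAt
  have h2 : ContMDiffAt 𝓘(ℝ, Vec d) 𝓘(ℝ, Vec n) ∞ S.start 0 := by
    refine S.smooth_ι.contMDiffAt.comp (0 : Vec d) (ContMDiffAt.comp (0 : Vec d)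
      (g := (extChartAt 𝓘(ℝ, Vec d) S.x0).symm) ?_ h1)
    rw [add_zero]
    exact (contMDiffOn_extChartAt_symm (I := 𝓘(ℝ, Vec d)) (n := ∞) S.x0).contMDiffAt
      ((isOpen_extChartAt_target S.x0).mem_nhds (mem_extChartAt_target S.x0))
  exact h2.of_le (WithTop.coe_le_coe.2 (le_top (a := (2 : ℕ∞))))

lemma contDiffAt_startChart (S : Reference n k d M N) : ContDiffAt ℝ 2 S.startChart 0 := by
  rw [← contMDiffAt_iff_contDiffAt]
  refine ContMDiffAt.comp (0 : Vec d) (g := S.chart 0) ?_ S.contMDiffAt_start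
  refine (contMDiffAt_extChartAt' (I := 𝓘(ℝ, Vec n)) (n := ∞) (x := S.q 0) ?_).of_le
    (WithTop.coe_le_coe.2 (le_top (a := (2 : ℕ∞))))
  rw [S.start_zero]
  exact mem_chart_source _ _

/-- The variations in a finite-dimensional space form a family. -/
lemma isFamily_var (ht : t ∈ Icc 0 S.T) (V : Submodule ℝ (Var d k t)) [FiniteDimensional ℝ V] :
    S.IsFamily t (fun w : V => S.control t w) (fun (w : V) τ => S.proj τ (w.1.2 τ))
      (fun w : V => S.start w.1.1) 0 := by
  have hle : volume.restrict (Icc 0 t) ≤ volume.restrict (Icc 0 S.T) :=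
    Measure.restrict_mono (Icc_subset_Icc_right ht.2) le_rfl
  have hβ : ∀ w : V, MemLp (fun τ => S.proj τ (w.1.2 τ)) ∞ (volume.restrict (Icc 0 t)) := fun w =>
    MemLp.bilin_top (ContinuousLinearMap.id ℝ _) (S.memLp_proj.mono_measure hle) (Lp.memLp _)
  have h0 : ∀ᵐ τ ∂(volume.restrict (Icc 0 t)), ((0 : V).1.2 : ℝ → Vec k) τ = 0 :=
    Lp.coeFn_zero _ _ _
  refine ⟨ht, ⟨(S.u_mem.mono_measure hle).add (hβ 0), hβ, fun w w' => ?_, fun c w => ?_,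
    fun w => ?_⟩, ?_, S.start_zero, ?_⟩
  · filter_upwards [Lp.coeFn_add w.1.2 w'.1.2] with τ h
    rw [← map_add]
    exact congrArg (S.proj τ) h
  · filter_upwards [Lp.coeFn_smul c w.1.2] with τ h
    rw [← map_smul]
    exact congrArg (S.proj τ) h
  · filter_upwards [h0] with τ h
    simp only [control]
    rw [h, map_zero, add_zero]
  · have h1 : ContMDiff 𝓘(ℝ, V) 𝓘(ℝ, Vec d) 2 (fun w : V => w.1.1) :=
      ((ContinuousLinearMap.fst ℝ (Vec d) _) ∘L V.subtypeL).contDiff.contMDiff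
    exact ContMDiffAt.comp (0 : V) (g := S.start) (f := fun w : V => w.1.1) S.contMDiffAt_start
      h1.contMDiffAt
  · filter_upwards [h0] with τ h
    simp only [control]
    rw [h, map_zero, add_zero]

/-- Extended end-points of the variations in `V`. -/
noncomputable def varCurve (S : Reference n k d M N) (t : ℝ) (V : Submodule ℝ (Var d k t)) (w : V) :
    Vec n × ℝ :=
  S.famCurve t (fun w : V => S.control t w) (fun w : V => S.start w.1.1) (S.q t) w t

/-- First variation along `V`. -/
noncomputable def varVec (S : Reference n k d M N) (t : ℝ) (V : Submodule ℝ (Var d k t)) (τ : ℝ)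
    (v : V) : Vec n × ℝ :=
  S.var₁ t (fun w : V => S.control t w) (fun w : V => S.start w.1.1) 0 τ v

/-- First variation along `V` (the position). -/
noncomputable def varD (S : Reference n k d M N) (t : ℝ) (V : Submodule ℝ (Var d k t)) (τ : ℝ)
    (v : V) : Vec n :=
  (S.varVec t V τ v).1

/-- The second variation along `V`. -/
noncomputable def varQ (S : Reference n k d M N) (t : ℝ) (V : Submodule ℝ (Var d k t)) (τ : ℝ)
    (v w : V) : ℝ :=
  S.cov S.z0.fst (S.var₂ t (fun w : V => S.control t w) (fun w : V => S.start w.1.1) 0 τ v w)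

variable [T2Space M] [SecondCountableTopology M]

lemma flowD_fst_eq_iff (hτ : τ ∈ Icc 0 S.T) (a b : Vec n × ℝ) :
    (S.flowD τ S.base a).1 = (S.flowD τ S.base b).1 ↔ a.1 = b.1 := by
  have hinj := (ContinuousLinearMap.isUnit_iff_bijective.1 (isUnit_flowD hτ)).1
  have e : ∀ a : Vec n × ℝ, S.flowD τ S.base a = S.flowD τ S.base (a.1, 0) + (0, a.2) := by
    intro a
    have : a = (a.1, 0) + (0, a.2) := by simp
    conv_lhs => rw [this, map_add, flowD_snd hτ]
  constructor
  · intro h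
    have h1 : S.flowD τ S.base (a.1 - b.1, -(S.flowD τ S.base (a.1 - b.1, 0)).2) = 0 := by
      rw [e]
      refine Prod.ext ?_ (by simp)
      have : (a.1 - b.1, (0 : ℝ)) = (a.1, 0) - (b.1, 0) := by simp
      simp only [this, map_sub]
      rw [e a, e b] at h
      simpa [sub_eq_zero] using h
    have h2 := (injective_iff_map_eq_zero _).1 hinj _ h1
    exact sub_eq_zero.1 (congrArg Prod.fst h2)
  · intro h
    rw [e a, e b, h]
    simp

section

variable {V : Submodule ℝ (Var d k t)} [FiniteDimensional ℝ V]

lemma contDiffAt_varCurve (ht : t ∈ Icc 0 S.T) : ContDiffAt ℝ 2 (S.varCurve t V) 0 :=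
  (isFamily_var ht V).contDiffAt_famCurve ⟨ht.1, le_rfl⟩ (mem_chart_source _ _)

lemma d1_eq_varCurve (ht : t ∈ Icc 0 S.T) (v : V) :
    d1 (S.endMap t) V v = (fderiv ℝ (S.varCurve t V) 0 v).1 :=
  (fderiv_clm_two (ContinuousLinearMap.fst ℝ (Vec n) ℝ) (contDiffAt_varCurve ht) v v).1

lemma qForm_eq_varCurve (ht : t ∈ Icc 0 S.T) (p : Vec n) (v w : V) :
    qForm (S.endMap t) (S.costMap t) p S.ν V v w =
      S.cov p (fderiv ℝ (fderiv ℝ (S.varCurve t V)) 0 v w) := by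
  have k1 := (fderiv_clm_two (ContinuousLinearMap.fst ℝ (Vec n) ℝ)
    (contDiffAt_varCurve (V := V) ht) v w).2
  have k2 := (fderiv_clm_two (ContinuousLinearMap.snd ℝ (Vec n) ℝ)
    (contDiffAt_varCurve (V := V) ht) v w).2
  have h2 : (fun x : V => S.costMap t x) =
      fun x => ContinuousLinearMap.snd ℝ (Vec n) ℝ (S.varCurve t V x) :=
    funext fun x => (zero_add _).symm
  rw [← h2] at k2
  exact congrArg₂ (fun (a : Vec n) (b : ℝ) => ⟪p, a⟫_ℝ - S.ν * b) k1 k2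

/-- Solving the definitions of `pull` and `pull₂` for the derivatives of the end-point curve. The
second derivative acquires a correction with the second differential of the flow. -/
lemma d_eq (ht : t ∈ Icc 0 S.T) (v w : V) :
    d1 (S.endMap t) V v = (S.flowD t S.base (S.varVec t V t v)).1 ∧
    qForm (S.endMap t) (S.costMap t) (S.lam t).fst S.ν V v w =
      S.varQ t V t v w + S.cov S.z0.fst (Ring.inverse (S.flowD t S.base)
        (fderiv ℝ (S.flowD t) S.base (S.varVec t V t v) (S.varVec t V t w))) := by
  have hv : S.flowD t S.base (S.varVec t V t v) = fderiv ℝ (S.varCurve t V) 0 v :=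
    ringInverse_apply (isUnit_flowD ht) _
  refine ⟨?_, ?_⟩
  · rw [hv, d1_eq_varCurve ht]
  · have h5 : S.varQ t V t v w = S.cov S.z0.fst (Ring.inverse (S.flowD t S.base)
      (fderiv ℝ (fderiv ℝ (S.varCurve t V)) 0 v w -
        fderiv ℝ (S.flowD t) S.base (S.varVec t V t v) (S.varVec t V t w))) := rfl
    rw [qForm_eq_varCurve ht, cov_lam ht, h5, ← map_add, ← map_add, sub_add_cancel]

/-- The Jacobi spaces over `V` in terms of the variations. -/
theorem mem_jacobiOver (ht : t ∈ Icc 0 S.T) (z : Phase n) :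
    z ∈ S.jacobiOver t V ↔ ∃ v : V, z.snd = S.varD t V t v ∧
      ∀ w : V, ⟪z.fst, S.varD t V t w⟫_ℝ + S.varQ t V t v w = 0 := by
  have hz := fderiv_hamFlow ht z
  change (fderiv ℝ (S.hamFlow t) S.z0 z) ∈ lDeriv _ _ _ _ V ↔ _
  change (∃ v : V, _ ∧ _) ↔ _
  refine exists_congr fun v => ?_
  rw [hz.1, (d_eq ht v v).1, flowD_fst_eq_iff ht]
  refine and_congr_right fun hv => forall_congr' fun w => ?_
  -- The correction with the second differential of the flow in the form cancels the corresponding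
  -- term in the momentum component of the Hamiltonian flow's differential.
  rw [(d_eq ht w w).1, hz.2, (d_eq ht v w).2,
    (ringInverse_apply_eq (isUnit_flowD ht)).2 rfl]
  simp only at hv
  rw [hv, flowD_two_fst ht]
  rw [varD]
  constructor <;> intro h <;> linarith

lemma d1_eq_zero_iff (ht : t ∈ Icc 0 S.T) :
    d1 (S.endMap t) V = 0 ↔ ∀ v : V, S.varD t V t v = 0 := by
  rw [ContinuousLinearMap.ext_iff]
  refine forall_congr' fun v => ?_
  have h := flowD_fst_eq_iff ht (S.varVec t V t v) 0
  rw [map_zero] at h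
  rw [(d_eq ht v v).1]
  exact h

lemma hessForm_eq (ht : t ∈ Icc 0 S.T) (v : V) (hv : S.varD t V t v = 0) :
    hessForm (S.endMap t) (S.costMap t) (S.lam t).fst S.ν V v = -S.varQ t V t v v := by
  rw [hessForm, (d_eq ht v v).2, ← flowD_two_fst ht]
  rw [varD] at hv
  rw [hv]
  simp [← Prod.zero_eq_mk]

lemma inner_X (hτ : τ ∈ Icc 0 S.T) (v : Vec k) (ζ : Phase n) :
    ⟪ζ, S.X τ v⟫_ℝ = ⟪ζ.snd, (S.rate τ (S.proj τ v)).1⟫_ℝ -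
      S.cov S.z0.fst (S.mixed τ (S.proj τ v) (ζ.fst, 0)) :=
  fderiv_pulledField hτ _ ζ

lemma snd_X (hτ : τ ∈ Icc 0 S.T) (v : Vec k) :
    (S.X τ v).snd = (S.rate τ (S.proj τ v)).1 := by
  refine ext_inner_left ℝ fun a => ?_
  have h := inner_X hτ v (WithLp.toLp 2 (0, a))
  have h0 : S.mixed τ (S.proj τ v) 0 = 0 := by simp [mixed, pullMixed, ← Prod.zero_eq_mk]
  rw [phase_inner] at h
  simp only [WithLp.toLp_fst, WithLp.toLp_snd, inner_zero_left, zero_add, ← Prod.zero_eq_mk, h0,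
    map_zero, sub_zero] at h
  exact h

lemma inner_fst_X (hτ : τ ∈ Icc 0 S.T) (v : Vec k) (a : Vec n × ℝ) :
    ⟪(S.X τ v).fst, a.1⟫_ℝ = -S.cov S.z0.fst (S.mixed τ (S.proj τ v) a) := by
  have h := inner_X hτ v (WithLp.toLp 2 (a.1, 0))
  rw [phase_inner] at h
  simp only [WithLp.toLp_fst, WithLp.toLp_snd, inner_zero_left, zero_sub, add_zero,
    mixed_fst hτ] at h
  rw [real_inner_comm]
  exact h

lemma b_eq (hτ : τ ∈ Icc 0 S.T) (v w : Vec k) :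
    S.b τ v w = S.cov S.z0.fst (S.rate₂ τ (S.proj τ v) (S.proj τ w)) :=
  fderiv_two_ham hτ _ _

/-- The equations of the variations in terms of `X` and `b`. -/
theorem varD_ode (ht : t ∈ Icc 0 S.T) (v w : V) :
    ACDeriv (fun τ => S.varD t V τ v) (fun τ => (S.X τ (v.1.2 τ)).snd) 0 t ∧
    ACDeriv (fun τ => S.varQ t V τ v w) (fun τ => S.b τ (v.1.2 τ) (w.1.2 τ) -
      ⟪(S.X τ (v.1.2 τ)).fst, S.varD t V τ w⟫_ℝ - ⟪(S.X τ (w.1.2 τ)).fst, S.varD t V τ v⟫_ℝ) 0 t := by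
  obtain ⟨h1, h2⟩ := (isFamily_var ht V).variation_ode v w
  constructor
  · refine (h1.clm (ContinuousLinearMap.fst ℝ (Vec n) ℝ)).congr_fun_deriv (fun τ _ => rfl)
      fun τ hτ => ?_
    rw [snd_X ⟨hτ.1, hτ.2.trans ht.2⟩]
    rfl
  · refine (h2.clm (S.cov S.z0.fst)).congr_fun_deriv (fun τ _ => rfl) fun τ hτ => ?_
    have hτT : τ ∈ Icc 0 S.T := ⟨hτ.1, hτ.2.trans ht.2⟩
    rw [varD, varD, inner_fst_X hτT, inner_fst_X hτT, b_eq hτT, map_add, map_add, varVec, varVec]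
    ring

lemma varD_zero (ht : t ∈ Icc 0 S.T) (v w : V) :
    S.varD t V 0 v = fderiv ℝ S.startChart 0 v.1.1 ∧
    S.varQ t V 0 v w =
      ⟪S.z0.fst, fderiv ℝ (fderiv ℝ S.startChart) 0 v.1.1 w.1.1⟫_ℝ := by
  obtain ⟨h1, h2⟩ := (isFamily_var ht V).variation_zero v w
  let π : V →L[ℝ] Vec d := (ContinuousLinearMap.fst ℝ (Vec d) _) ∘L V.subtypeL
  have h3 := fderiv_comp_two (κ := S.startChart) (f := π) (w := 0)
    (by rw [map_zero]; exact S.contDiffAt_startChart) π.contDiff.contDiffAt v w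
  have e : fderiv ℝ π = fun _ => π := funext fun x => ContinuousLinearMap.fderiv _
  have e2 : fderiv ℝ (fderiv ℝ π) 0 = 0 := by
    rw [e]
    exact (hasFDerivAt_const _ _).fderiv
  rw [e2, e, map_zero] at h3
  refine ⟨(congrArg Prod.fst h1).trans h3.1, (congrArg (S.cov S.z0.fst) h2).trans ?_⟩
  rw [cov_apply]
  change ⟪S.z0.fst, fderiv ℝ (fderiv ℝ (fun w => S.startChart (π w))) 0 v w⟫_ℝ - S.ν * 0 = _
  rw [h3.2]
  simp [π]

end

end Reference

end Variations

end OptControl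

namespace OptControl

open ControlProblem

/-! ### Boundedness and measurability of X and b. -/

section Regularity

lemma memLp_of_inner {α : Type*} [MeasurableSpace α] {μ : Measure α} {p : ℝ≥0∞} {F : Type*}
    [NormedAddCommGroup F] [InnerProductSpace ℝ F] [FiniteDimensional ℝ F] {f : α → F}
    (h : ∀ ζ : F, MemLp (fun τ => ⟪ζ, f τ⟫_ℝ) p μ) : MemLp f p μ := by
  have h1 := memLp_finsetSum (μ := μ) (p := p) Finset.univ (f := fun i τ =>
    ContinuousLinearMap.toSpanSingleton ℝ (stdOrthonormalBasis ℝ F i)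
      ⟪stdOrthonormalBasis ℝ F i, f τ⟫_ℝ) fun i _ => ContinuousLinearMap.comp_memLp' _ (h _)
  refine h1.ae_eq (Eventually.of_forall fun τ => ?_)
  exact (stdOrthonormalBasis ℝ F).sum_repr' (f τ)

variable {n k d : ℕ} {M : Type*} [TopologicalSpace M] [ChartedSpace (Vec n) M]
  [IsManifold 𝓘(ℝ, Vec n) ∞ M]
  {N : Type*} [TopologicalSpace N] [ChartedSpace (Vec d) N] [IsManifold 𝓘(ℝ, Vec d) ∞ N]

namespace Reference

variable {S : Reference n k d M N} {t τ : ℝ}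

/-- The family of all constant variations of the control and all initial points. -/
lemma isFamily_const (hT : 0 ≤ S.T) :
    S.IsFamily S.T (fun (w : Vec n × Vec k) τ => S.u τ + w.2) (fun w _ => w.2)
      (fun w => (S.chart 0).symm (S.base.1 + w.1)) 0 := by
  refine ⟨⟨hT, le_rfl⟩, ⟨?_, fun w => memLp_top_const _, fun w w' => ?_, fun c w => ?_,
    fun w => ?_⟩, ?_, ?_, ?_⟩
  · simpa using S.u_mem
  · exact Eventually.of_forall fun τ => rfl
  · exact Eventually.of_forall fun τ => rfl
  · exact Eventually.of_forall fun τ => by simp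
  · have h1 : ContMDiffAt 𝓘(ℝ, Vec n × Vec k) 𝓘(ℝ, Vec n) ∞
        (fun w : Vec n × Vec k => S.base.1 + w.1) 0 :=
      (contDiff_const.add contDiff_fst).contMDiff.contMDiffAt
    refine (ContMDiffAt.comp (0 : Vec n × Vec k) (g := (S.chart 0).symm) ?_ h1).of_le
      (WithTop.coe_le_coe.2 (le_top (a := (2 : ℕ∞))))
    rw [Prod.fst_zero, add_zero]
    exact (contMDiffOn_extChartAt_symm (I := 𝓘(ℝ, Vec n)) (n := ∞) (S.q 0)).contMDiffAt
      ((isOpen_extChartAt_target (S.q 0)).mem_nhds (mem_extChartAt_target (S.q 0)))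
  · rw [Prod.fst_zero, add_zero]
    exact (extChartAt 𝓘(ℝ, Vec n) (S.q 0)).left_inv (mem_extChartAt_source _)
  · exact Eventually.of_forall fun τ => by simp

lemma rates_zero (S : Reference n k d M N) (τ : ℝ) (v : Vec k) (a : Vec n × ℝ) :
    S.rate τ 0 = 0 ∧ S.mixed τ 0 a = 0 ∧ S.rate₂ τ v 0 = 0 := by
  have h : S.rate τ 0 = 0 := by simp [rate, pullRate, ← Prod.zero_eq_mk]
  refine ⟨h, ?_, by simp [rate₂, pullRate₂, ← Prod.zero_eq_mk]⟩
  rw [rate] at h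
  rw [mixed, pullMixed, h]
  simp [← Prod.zero_eq_mk]

lemma rate₂_symm (S : Reference n k d M N) (τ : ℝ) (v w : Vec k) :
    S.rate₂ τ v w = S.rate₂ τ w v := by
  have hF2 : ContDiff ℝ 2 (S.cutField (S.q τ)) := contDiff_infty.1 (S.contDiff_cutField _) 2
  rw [rate₂, pullRate₂,
    (hF2.contDiffAt (x := (S.u τ, _))).isSymmSndFDerivAt (by simp) (v, 0) (w, 0)]
  rfl

/-- The form `b` as a bilinear map. -/
noncomputable def bForm (S : Reference n k d M N) (τ : ℝ) : Vec k →L[ℝ] Vec k →L[ℝ] ℝ :=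
  let D : Vec k →L[ℝ] Vec k →L[ℝ] ℝ := fderiv ℝ (fderiv ℝ (fun u => S.ham τ u (S.lam τ))) (S.u τ)
  D.bilinearComp (S.proj τ) (S.proj τ)

variable [T2Space M] [SecondCountableTopology M]

/-- Without a variation of the control the pulled-back first variation has zero derivative, so it
keeps its initial value. Pairing such a variation with a constant control variation isolates
`mixed`. -/
lemma var₁_const (hT : 0 ≤ S.T) (hτ : τ ∈ Icc 0 S.T) (a : Vec n) :
    S.var₁ S.T (fun (w : Vec n × Vec k) τ => S.u τ + w.2)
      (fun w => (S.chart 0).symm (S.base.1 + w.1)) 0 τ (a, 0) = (a, 0) := by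
  have hf := isFamily_const hT (S := S)
  have h := (hf.variation_ode (a, 0) 0).1.eq_integral hτ
  have h0 := (hf.variation_zero (a, 0) 0).1
  have h1 : (fun w : Vec n × Vec k => S.chart 0 ((S.chart 0).symm (S.base.1 + w.1))) =ᶠ[𝓝 0]
      fun w => S.base.1 + ContinuousLinearMap.fst ℝ (Vec n) (Vec k) w := by
    have hc : ContinuousAt (fun w : Vec n × Vec k => S.base.1 + w.1) 0 :=
      (continuous_const.add continuous_fst).continuousAt
    have := hc.eventually_mem ((isOpen_extChartAt_target (I := 𝓘(ℝ, Vec n)) (S.q 0)).mem_nhds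
      (by rw [Prod.fst_zero, add_zero]; exact mem_extChartAt_target _))
    filter_upwards [this] with w hw
    exact (S.chart 0).right_inv hw
  rw [h1.fderiv_eq (𝕜 := ℝ), fderiv_const_add, ContinuousLinearMap.fderiv] at h0
  simp only [(S.rates_zero _ 0 0).1, intervalIntegral.integral_zero, add_zero] at h
  rw [h, h0]
  rfl

lemma memLp_rate (hT : 0 ≤ S.T) (v : Vec k) :
    MemLp (fun τ => S.rate τ v) ∞ (volume.restrict (Icc 0 S.T)) :=
  ((isFamily_const hT).variation_ode (0, v) 0).1.memLp

/-- For the directions (0, v) and (a, 0) the derivative of the second variation is just `mixed τ v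
(a, 0)`; derivatives of Lipschitz curves are bounded and measurable. -/
lemma memLp_mixed (hT : 0 ≤ S.T) (v : Vec k) (a : Vec n) :
    MemLp (fun τ => S.mixed τ v (a, 0)) ∞ (volume.restrict (Icc 0 S.T)) := by
  have h := ((isFamily_const hT (S := S)).variation_ode (0, v) (a, 0)).2.memLp
  refine h.ae_eq ?_
  filter_upwards [ae_restrict_mem measurableSet_Icc] with τ hτ
  simp only [(S.rates_zero τ v _).2.1, (S.rates_zero τ v 0).2.2, var₁_const hT hτ]
  simp

/-- The derivative of the pulled back field, without the projection. -/
lemma memLp_fderiv_pulledField (hT : 0 ≤ S.T) :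
    MemLp (fun τ => fderiv ℝ (S.pulledField τ) (S.u τ)) ∞ (volume.restrict (Icc 0 S.T)) := by
  refine memLp_of_apply fun v => memLp_of_inner fun ζ => ?_
  have h1 := ((innerSL ℝ ζ.snd) ∘L (ContinuousLinearMap.fst ℝ (Vec n) ℝ)).comp_memLp'
    (memLp_rate hT v (S := S))
  have h2 := (S.cov S.z0.fst).comp_memLp' (memLp_mixed hT v ζ.fst (S := S))
  refine (h1.sub h2).ae_eq ?_
  filter_upwards [ae_restrict_mem measurableSet_Icc] with τ hτ
  exact (fderiv_pulledField hτ v ζ).symm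

/-- With an argument depending on time, the mixed term is rewritten as a pairing of that argument
with the derivative of the pulled-back field, whose regularity is already known. -/
lemma memLp_cov_mixed (hT : 0 ≤ S.T) (v : Vec k) {y : ℝ → Vec n × ℝ}
    (hy : MemLp y ∞ (volume.restrict (Icc 0 S.T))) :
    MemLp (fun τ => S.cov S.z0.fst (S.mixed τ v (y τ))) ∞ (volume.restrict (Icc 0 S.T)) := by
  have h1 := MemLp.bilin_top (ContinuousLinearMap.id ℝ (Vec k →L[ℝ] Phase n))
    (memLp_fderiv_pulledField hT (S := S)) (memLp_top_const v)
  have h2 := MemLp.bilin_top (innerSL ℝ) ((WithLp.fstL 2 ℝ (Vec n) (Vec n)).comp_memLp' h1)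
    ((ContinuousLinearMap.fst ℝ (Vec n) ℝ).comp_memLp' hy)
  refine h2.neg.ae_eq ?_
  filter_upwards [ae_restrict_mem measurableSet_Icc] with τ hτ
  have h := fderiv_pulledField hτ v (WithLp.toLp 2 ((y τ).1, 0))
  rw [phase_inner] at h
  simp only [WithLp.toLp_fst, WithLp.toLp_snd, inner_zero_left, zero_sub, add_zero,
    mixed_fst hτ] at h
  rw [real_inner_comm] at h
  change -⟪(fderiv ℝ (S.pulledField τ) (S.u τ) v).fst, (y τ).1⟫_ℝ = _
  rw [h, neg_neg]

/-- For two constant control variations the derivative of the second variation is the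
control-control term plus two mixed terms; the latter have known regularity and are subtracted. -/
lemma memLp_fderiv_two_ham (hT : 0 ≤ S.T) :
    MemLp (fun τ => fderiv ℝ (fderiv ℝ (fun u => S.ham τ u (S.lam τ))) (S.u τ)) ∞
      (volume.restrict (Icc 0 S.T)) := by
  refine memLp_of_apply fun v => memLp_of_apply fun w => ?_
  have hf := isFamily_const hT (S := S)
  have hy : ∀ v : Vec k, MemLp (fun τ => S.var₁ S.T (fun (w : Vec n × Vec k) τ => S.u τ + w.2)
      (fun w => (S.chart 0).symm (S.base.1 + w.1)) 0 τ (0, v)) ∞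
      (volume.restrict (Icc 0 S.T)) := by
    intro v
    have h := (hf.variation_ode (0, v) 0).1
    obtain ⟨C, -, hC⟩ := h.exists_bound
    refine memLp_top_of_bound (h.continuousOn.aestronglyMeasurable measurableSet_Icc) C ?_
    filter_upwards [ae_restrict_mem measurableSet_Icc] with τ hτ using hC τ hτ
  have h := (S.cov S.z0.fst).comp_memLp' (hf.variation_ode (0, v) (0, w)).2.memLp
  refine ((h.sub (memLp_cov_mixed hT v (hy w))).sub (memLp_cov_mixed hT w (hy v))).ae_eq ?_
  filter_upwards [ae_restrict_mem measurableSet_Icc] with τ hτ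
  rw [fderiv_two_ham hτ]
  simp only [Pi.sub_apply, Function.comp_apply, map_add]
  ring

lemma memLp_X (hT : 0 ≤ S.T) : MemLp S.X ∞ (volume.restrict (Icc 0 S.T)) :=
  MemLp.bilin_top (ContinuousLinearMap.compL ℝ (Vec k) (Vec k) (Phase n))
    (memLp_fderiv_pulledField hT) S.memLp_proj


omit [T2Space M] [SecondCountableTopology M] in
lemma bForm_apply (S : Reference n k d M N) (τ : ℝ) (v w : Vec k) :
    S.bForm τ v w = S.b τ v w := rfl

lemma bForm_symm (hτ : τ ∈ Icc 0 S.T) (v w : Vec k) : S.bForm τ v w = S.bForm τ w v := by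
  rw [bForm_apply, bForm_apply, b_eq hτ, b_eq hτ, rate₂_symm]

lemma memLp_bForm (hT : 0 ≤ S.T) {a b : ℝ} (ha : 0 ≤ a) (hb : b ≤ S.T) :
    MemLp S.bForm ∞ (volume.restrict (Icc a b)) := by
  have hp : ∀ v, MemLp (fun τ => S.proj τ v) ∞ (volume.restrict (Icc 0 S.T)) := fun v =>
    MemLp.bilin_top (ContinuousLinearMap.id ℝ _) S.memLp_proj (memLp_top_const v)
  have hD := memLp_fderiv_two_ham hT (S := S)
  refine memLp_of_apply fun v => memLp_of_apply fun w => ?_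
  have h1 := MemLp.bilin_top (E := Vec k →L[ℝ] Vec k →L[ℝ] ℝ) (F := Vec k) (G := Vec k →L[ℝ] ℝ)
    (ContinuousLinearMap.id ℝ (Vec k →L[ℝ] Vec k →L[ℝ] ℝ)) hD (hp v)
  have h2 := MemLp.bilin_top (E := Vec k →L[ℝ] ℝ) (F := Vec k) (G := ℝ)
    (ContinuousLinearMap.id ℝ (Vec k →L[ℝ] ℝ)) h1 (hp w)
  refine (h2.mono_measure (Measure.restrict_mono (Icc_subset_Icc ha hb) le_rfl)).ae_eq
    (Eventually.of_forall fun τ => ?_)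
  simp only [ContinuousLinearMap.id_apply]
  rfl

end Reference

end Regularity

end OptControl

namespace OptControl

/-! ### Operators on square integrable functions of an interval. -/

section Interval

/-- Square integrable functions on an interval. -/
abbrev L2 (a b : ℝ) (E : Type*) [NormedAddCommGroup E] : Type _ :=
  Lp E 2 (volume.restrict (Icc a b))

variable {E F : Type*} [NormedAddCommGroup E] [NormedSpace ℝ E] [NormedAddCommGroup F]
  [NormedSpace ℝ F] {a b : ℝ}

/-- Multiplication by a bounded operator-valued function. -/
noncomputable def mulL {A : ℝ → E →L[ℝ] F} (hA : MemLp A ∞ (volume.restrict (Icc a b))) :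
    L2 a b E →L[ℝ] L2 a b F :=
  (ContinuousLinearMap.id ℝ (E →L[ℝ] F)).holderL (volume.restrict (Icc a b)) ∞ 2 2 (hA.toLp A)

lemma mulL_ae {A : ℝ → E →L[ℝ] F} (hA : MemLp A ∞ (volume.restrict (Icc a b))) (v : L2 a b E) :
    ∀ᵐ τ ∂(volume.restrict (Icc a b)), mulL hA v τ = A τ (v τ) := by
  have h := ContinuousLinearMap.coeFn_holder (r := 2) (ContinuousLinearMap.id ℝ (E →L[ℝ] F))
    (hA.toLp A) v
  filter_upwards [h, hA.coeFn_toLp] with τ h1 h2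
  rw [h2] at h1
  exact h1

variable [CompleteSpace F]

/-- The integral from `a` to `τ`. -/
noncomputable def primL (a b τ : ℝ) : L2 a b F →L[ℝ] F :=
  (ContinuousLinearMap.lsmul ℝ ℝ).lpPairing (volume.restrict (Icc a b)) 2 2
    (indicatorConstLp 2 (measurableSet_Icc (a := a) (b := τ))
      (measure_ne_top (volume.restrict (Icc a b)) _) (1 : ℝ))

lemma primL_apply {τ : ℝ} (hτ : τ ∈ Icc a b) (f : L2 a b F) :
    primL a b τ f = ∫ θ in a..τ, f θ := by
  rw [primL, ContinuousLinearMap.lpPairing_eq_integral, intervalIntegral.integral_of_le hτ.1,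
    ← integral_Icc_eq_integral_Ioc]
  have h : ∀ᵐ θ ∂(volume.restrict (Icc a b)), (ContinuousLinearMap.lsmul ℝ ℝ)
      ((indicatorConstLp 2 (measurableSet_Icc (a := a) (b := τ))
        (measure_ne_top (volume.restrict (Icc a b)) _) (1 : ℝ) : ℝ → ℝ) θ) (f θ) =
      (Icc a τ).indicator f θ := by
    filter_upwards [indicatorConstLp_coeFn (p := 2) (hs := measurableSet_Icc (a := a) (b := τ))
      (hμs := measure_ne_top (volume.restrict (Icc a b)) _) (c := (1 : ℝ))] with θ hθ
    rw [hθ]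
    by_cases h : θ ∈ Icc a τ
    · rw [indicator_of_mem h, indicator_of_mem h]
      exact one_smul ℝ _
    · rw [indicator_of_notMem h, indicator_of_notMem h]
      exact zero_smul ℝ _
  rw [integral_congr_ae h, setIntegral_indicator measurableSet_Icc,
    inter_eq_right.2 (Icc_subset_Icc_right hτ.2)]

lemma exists_norm_primL_le (a b : ℝ) (F : Type*) [NormedAddCommGroup F] [NormedSpace ℝ F]
    [CompleteSpace F] : ∃ C, 0 ≤ C ∧ ∀ τ, ∀ f : L2 a b F, ‖primL a b τ f‖ ≤ C * ‖f‖ := by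
  refine ⟨‖(ContinuousLinearMap.lsmul ℝ ℝ : ℝ →L[ℝ] F →L[ℝ] F).lpPairing
    (volume.restrict (Icc a b)) 2 2‖ * (volume.restrict (Icc a b)).real univ ^ ((2 : ℝ)⁻¹),
    by positivity, fun τ f => ?_⟩
  refine (ContinuousLinearMap.le_opNorm₂ _ _ _).trans ?_
  gcongr
  refine norm_indicatorConstLp_le.trans ?_
  rw [norm_one, one_mul, one_div]
  exact Real.rpow_le_rpow measureReal_nonneg (measureReal_mono (subset_univ _)) (by simp)

lemma L2.integrableOn {F : Type*} [NormedAddCommGroup F] (f : L2 a b F) :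
    IntegrableOn f (Icc a b) :=
  ((Lp.memLp f).mono_exponent (p := 1) (by norm_num)).integrable le_rfl

lemma memLp_primL (f : L2 a b F) :
    MemLp (fun τ => ∫ θ in a..τ, f θ) 2 (volume.restrict (Icc a b)) := by
  obtain ⟨C, hC0, hC⟩ := exists_norm_primL_le a b F
  have key : ∀ g : ℝ → F, IntegrableOn g (Icc a b) →
      ContinuousOn (fun τ => ∫ θ in a..τ, g θ) (Icc a b) := by
    intro g hg
    rcases le_or_gt a b with hab | hab
    · rw [← uIcc_of_le hab] at hg ⊢
      exact intervalIntegral.continuousOn_primitive_interval hg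
    · rw [Icc_eq_empty (not_le.2 hab)]
      exact continuousOn_empty _
  have h1 := key f (L2.integrableOn f)
  refine (memLp_top_of_bound (h1.aestronglyMeasurable measurableSet_Icc) (C * ‖f‖) ?_).mono_exponent
    le_top
  filter_upwards [ae_restrict_mem measurableSet_Icc] with τ hτ
  rw [← primL_apply hτ]
  exact hC τ f

/-- The primitive that vanishes at `a`. -/
noncomputable def primitiveL2 (a b : ℝ) (F : Type*) [NormedAddCommGroup F] [NormedSpace ℝ F]
    [CompleteSpace F] : L2 a b F →L[ℝ] L2 a b F :=
  LinearMap.mkContinuousOfExistsBound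
    { toFun := fun f => (memLp_primL f).toLp _
      map_add' := fun f g => by
        rw [← MemLp.toLp_add]
        refine MemLp.toLp_congr _ _ ?_
        filter_upwards [ae_restrict_mem measurableSet_Icc] with τ hτ
        rw [Pi.add_apply, ← primL_apply hτ, ← primL_apply hτ, ← primL_apply hτ, map_add]
      map_smul' := fun c f => by
        rw [RingHom.id_apply, ← MemLp.toLp_const_smul]
        refine MemLp.toLp_congr _ _ ?_
        filter_upwards [ae_restrict_mem measurableSet_Icc] with τ hτ
        rw [Pi.smul_apply, ← primL_apply hτ, ← primL_apply hτ, map_smul] } <| by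
    obtain ⟨C, hC0, hC⟩ := exists_norm_primL_le a b F
    refine ⟨(volume.restrict (Icc a b)).real univ ^ ((2 : ℝ≥0∞).toReal⁻¹) * C, fun f => ?_⟩
    rw [mul_assoc]
    refine Lp.norm_le_of_ae_bound (by positivity) ?_
    filter_upwards [ae_restrict_mem measurableSet_Icc, (memLp_primL f).coeFn_toLp] with τ hτ h
    refine (le_of_eq (congrArg _ h)).trans ?_
    rw [← primL_apply hτ]
    exact hC τ f

lemma primitiveL2_ae (f : L2 a b F) :
    ∀ᵐ τ ∂(volume.restrict (Icc a b)), primitiveL2 a b F f τ = ∫ θ in a..τ, f θ :=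
  (memLp_primL f).coeFn_toLp

/-- Essentially bounded functions are square integrable. -/
noncomputable def bddToL2 (a b : ℝ) (E : Type*) [NormedAddCommGroup E] [NormedSpace ℝ E] :
    Lp E ∞ (volume.restrict (Icc a b)) →ₗ[ℝ] L2 a b E where
  toFun f := ((Lp.memLp f).mono_exponent (p := 2) le_top).toLp f
  map_add' f g := by
    rw [← MemLp.toLp_add]
    exact MemLp.toLp_congr _ _ (Lp.coeFn_add f g)
  map_smul' c f := by
    rw [RingHom.id_apply, ← MemLp.toLp_const_smul]
    exact MemLp.toLp_congr _ _ (Lp.coeFn_smul c f)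

omit [CompleteSpace F] in
lemma bddToL2_ae (f : Lp F ∞ (volume.restrict (Icc a b))) :
    ∀ᵐ τ ∂(volume.restrict (Icc a b)), bddToL2 a b F f τ = f τ :=
  ((Lp.memLp f).mono_exponent (p := 2) le_top).coeFn_toLp

omit [CompleteSpace F] in
lemma denseRange_bddToL2 : DenseRange (bddToL2 a b F) := by
  refine (Lp.simpleFunc.denseRange (E := F) (μ := volume.restrict (Icc a b)) (p := 2)
    (by norm_num)).mono ?_
  rintro _ ⟨f, rfl⟩
  have h1 := Lp.simpleFunc.toSimpleFunc_eq_toFun f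
  have h2 : MemLp (Lp.simpleFunc.toSimpleFunc f) ∞ (volume.restrict (Icc a b)) :=
    SimpleFunc.memLp_top _ _
  refine ⟨h2.toLp _, Lp.ext ?_⟩
  filter_upwards [h1, h2.coeFn_toLp, bddToL2_ae (h2.toLp _)] with τ e1 e2 e3
  rw [e3, e2, e1]

omit [CompleteSpace F] in
lemma bddToL2_injective : Function.Injective (bddToL2 a b F) := by
  intro f g h
  refine Lp.ext ?_
  filter_upwards [bddToL2_ae f, bddToL2_ae g] with τ e1 e2
  rw [← e1, ← e2, h]

end Interval

end OptControl

namespace OptControl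

/-! ### The map and the form of control variations on an interval. -/

section ControlForm

variable {n k : ℕ} {a b : ℝ} {X : ℝ → Vec k →L[ℝ] Phase n} {β : ℝ → Vec k →L[ℝ] Vec k →L[ℝ] ℝ}

/-- The symplectic form as a bounded bilinear form. -/
noncomputable def symplB (n : ℕ) : Phase n →L[ℝ] Phase n →L[ℝ] ℝ :=
  (innerSL ℝ).bilinearComp (ContinuousLinearMap.id ℝ (Phase n))
    (LinearMap.toContinuousLinearMap (symplJ n))

lemma symplB_apply (z w : Phase n) : symplB n z w = sympl z w := (sympl_eq_inner z w).symm

/-- `v ↦ ∫ X v`. -/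
noncomputable def ctrlMap (hX : MemLp X ∞ (volume.restrict (Icc a b))) :
    L2 a b (Vec k) →L[ℝ] Phase n :=
  primL a b b ∘L mulL hX

/-- `(v, w) ↦ ∫ σ(∫ X v, X w) + β(v, w)`. -/
noncomputable def ctrlForm (hX : MemLp X ∞ (volume.restrict (Icc a b)))
    (hβ : MemLp β ∞ (volume.restrict (Icc a b))) :
    L2 a b (Vec k) →L[ℝ] L2 a b (Vec k) →L[ℝ] ℝ :=
  ((symplB n).lpPairing (volume.restrict (Icc a b)) 2 2).bilinearComp
      (primitiveL2 a b (Phase n) ∘L mulL hX) (mulL hX) +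
    (ContinuousLinearMap.id ℝ (Vec k →L[ℝ] ℝ)).lpPairing (volume.restrict (Icc a b)) 2 2 ∘L
      mulL hβ

lemma integral_mulL (hX : MemLp X ∞ (volume.restrict (Icc a b))) (v : L2 a b (Vec k)) {τ : ℝ}
    (hτ : τ ∈ Icc a b) : ∫ θ in a..τ, mulL hX v θ = ∫ θ in a..τ, X θ (v θ) := by
  have h := mulL_ae hX v
  rw [ae_restrict_iff' measurableSet_Icc] at h
  refine intervalIntegral.integral_congr_ae ?_
  filter_upwards [h] with θ h1 h2
  rw [uIoc_of_le hτ.1] at h2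
  exact h1 ⟨h2.1.le, h2.2.trans hτ.2⟩

lemma ctrlMap_apply (hab : a ≤ b) (hX : MemLp X ∞ (volume.restrict (Icc a b)))
    (v : L2 a b (Vec k)) : ctrlMap hX v = ∫ θ in a..b, X θ (v θ) := by
  rw [ctrlMap, ContinuousLinearMap.comp_apply, primL_apply ⟨hab, le_rfl⟩,
    integral_mulL hX v ⟨hab, le_rfl⟩]

/-- This turns the constraint of `kext` into the integral condition that defines the extensions in
the theorem. -/
lemma sympl_add_ctrlForm (hab : a ≤ b) (hX : MemLp X ∞ (volume.restrict (Icc a b)))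
    (hβ : MemLp β ∞ (volume.restrict (Icc a b))) (c : Phase n) (v w : L2 a b (Vec k)) :
    sympl c (ctrlMap hX w) + ctrlForm hX hβ v w = ∫ τ in a..b,
      (sympl (c + ∫ θ in a..τ, X θ (v θ)) (X τ (w τ)) + β τ (v τ) (w τ)) := by
  have e1 : ctrlForm hX hβ v w =
      (∫ τ in Icc a b, symplB n (primitiveL2 a b _ (mulL hX v) τ) (mulL hX w τ)) +
        ∫ τ in Icc a b, mulL hβ v τ (w τ) := by
    rw [← ContinuousLinearMap.lpPairing_eq_integral, ctrlForm, add_apply, add_apply]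
    refine congrArg _ ?_
    exact ContinuousLinearMap.lpPairing_eq_integral (ContinuousLinearMap.id ℝ (Vec k →L[ℝ] ℝ)) _ _
  have e2 : sympl c (ctrlMap hX w) = ∫ τ in Icc a b, symplB n c (mulL hX w τ) := by
    rw [ContinuousLinearMap.integral_comp_comm _ (L2.integrableOn _), symplB_apply, ctrlMap,
      ContinuousLinearMap.comp_apply, primL_apply ⟨hab, le_rfl⟩,
      intervalIntegral.integral_of_le hab, integral_Icc_eq_integral_Ioc]
  have i1 : Integrable (fun τ => symplB n (primitiveL2 a b _ (mulL hX v) τ) (mulL hX w τ))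
      (volume.restrict (Icc a b)) :=
    memLp_one_iff_integrable.1 (ContinuousLinearMap.memLp_of_bilin 1 (symplB n)
      (Lp.memLp (primitiveL2 a b _ (mulL hX v))) (Lp.memLp (mulL hX w)))
  have i2 : Integrable (fun τ => mulL hβ v τ (w τ)) (volume.restrict (Icc a b)) :=
    memLp_one_iff_integrable.1 (ContinuousLinearMap.memLp_of_bilin 1
      (ContinuousLinearMap.id ℝ (Vec k →L[ℝ] ℝ)) (Lp.memLp (mulL hβ v)) (Lp.memLp w))
  have i3 : Integrable (fun τ => symplB n c (mulL hX w τ)) (volume.restrict (Icc a b)) :=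
    (symplB n c).integrable_comp (L2.integrableOn _)
  have i4 : Integrable (fun τ => symplB n (primitiveL2 a b _ (mulL hX v) τ) (mulL hX w τ) +
    mulL hβ v τ (w τ)) (volume.restrict (Icc a b)) := i1.add i2
  rw [e1, e2, ← integral_add i1 i2, ← integral_add i3 i4, intervalIntegral.integral_of_le hab,
    ← integral_Icc_eq_integral_Ioc]
  refine integral_congr_ae ?_
  filter_upwards [mulL_ae hX w, mulL_ae hβ v, primitiveL2_ae (mulL hX v),
    ae_restrict_mem measurableSet_Icc] with τ h1 h2 h3 hτ
  rw [h1, h2, h3, integral_mulL hX v hτ, symplB_apply, symplB_apply, sympl_add_left, add_assoc]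

lemma ctrlForm_apply (hab : a ≤ b) (hX : MemLp X ∞ (volume.restrict (Icc a b)))
    (hβ : MemLp β ∞ (volume.restrict (Icc a b))) (v w : L2 a b (Vec k)) :
    ctrlForm hX hβ v w = ∫ τ in a..b,
      (sympl (∫ θ in a..τ, X θ (v θ)) (X τ (w τ)) + β τ (v τ) (w τ)) := by
  simpa using sympl_add_ctrlForm hab hX hβ 0 v w

lemma memLp_apply_bddToL2 (hX : MemLp X ∞ (volume.restrict (Icc a b)))
    (f : Lp (Vec k) ∞ (volume.restrict (Icc a b))) :
    MemLp (fun τ => X τ (bddToL2 a b _ f τ)) ∞ (volume.restrict (Icc a b)) := by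
  refine (MemLp.bilin_top (ContinuousLinearMap.id ℝ _) hX (Lp.memLp f)).ae_eq ?_
  filter_upwards [bddToL2_ae f] with τ h
  rw [h]
  rfl

lemma ACDeriv_ctrl (hX : MemLp X ∞ (volume.restrict (Icc a b)))
    (f : Lp (Vec k) ∞ (volume.restrict (Icc a b))) :
    ACDeriv (fun τ => ∫ θ in a..τ, X θ (bddToL2 a b _ f θ))
      (fun τ => X τ (bddToL2 a b _ f τ)) a b :=
  ACDeriv.of_integral (memLp_apply_bddToL2 hX f) fun τ hτ => by simp

/-- Integration by parts for τ ↦ σ(∫ X v, ∫ X w), the symmetric part β cancelling. Both sides are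
continuous on L², so bounded controls suffice, and for them the primitives are Lipschitz. -/
theorem compatible_ctrl (hab : a ≤ b) (hX : MemLp X ∞ (volume.restrict (Icc a b)))
    (hβ : MemLp β ∞ (volume.restrict (Icc a b)))
    (hs : ∀ τ ∈ Icc a b, ∀ v w, β τ v w = β τ w v) (v w : L2 a b (Vec k)) :
    ctrlForm hX hβ v w - ctrlForm hX hβ w v = sympl (ctrlMap hX v) (ctrlMap hX w) := by
  simp only [← symplB_apply]
  refine denseRange_bddToL2.induction_on₂ (p := fun v w => ctrlForm hX hβ v w -
    ctrlForm hX hβ w v = symplB n (ctrlMap hX v) (ctrlMap hX w)) (isClosed_eq (by fun_prop)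
      (by fun_prop)) (fun f g => ?_) v w
  have h1 := ACDeriv_ctrl hX f
  have h2 := ACDeriv_ctrl hX g
  have h3 := (h1.bilin (symplB n) h2).eq_integral ⟨hab, le_rfl⟩
  have hint : ∀ f g : Lp (Vec k) ∞ (volume.restrict (Icc a b)), IntervalIntegrable
      (fun τ => sympl (∫ θ in a..τ, X θ (bddToL2 a b _ f θ)) (X τ (bddToL2 a b _ g τ)) +
        β τ (bddToL2 a b _ f τ) (bddToL2 a b _ g τ)) volume a b := by
    intro f g
    have hf := ACDeriv_ctrl hX f
    obtain ⟨C, -, hC⟩ := hf.exists_bound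
    have m1 : MemLp (fun τ => ∫ θ in a..τ, X θ (bddToL2 a b _ f θ)) ∞
        (volume.restrict (Icc a b)) := by
      refine memLp_top_of_bound (hf.continuousOn.aestronglyMeasurable measurableSet_Icc) C ?_
      filter_upwards [ae_restrict_mem measurableSet_Icc] with τ hτ using hC τ hτ
    have m2 := MemLp.bilin_top (symplB n) m1 (memLp_apply_bddToL2 hX g)
    have m3 := MemLp.bilin_top (E := Vec k →L[ℝ] ℝ) (F := Vec k) (G := ℝ)
      (ContinuousLinearMap.id ℝ (Vec k →L[ℝ] ℝ)) (MemLp.bilin_top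
        (E := Vec k →L[ℝ] Vec k →L[ℝ] ℝ) (F := Vec k) (G := Vec k →L[ℝ] ℝ)
        (ContinuousLinearMap.id ℝ (Vec k →L[ℝ] Vec k →L[ℝ] ℝ)) hβ (Lp.memLp f)) (Lp.memLp g)
    refine memLp_top_intervalIntegrable ((m2.add m3).ae_eq ?_) ⟨le_rfl, hab⟩ ⟨hab, le_rfl⟩
    filter_upwards [bddToL2_ae f, bddToL2_ae g] with τ e1 e2
    simp only [Pi.add_apply, symplB_apply, ContinuousLinearMap.id_apply, e1, e2]
  rw [ctrlForm_apply hab, ctrlForm_apply hab, ctrlMap_apply hab, ctrlMap_apply hab, h3,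
    intervalIntegral.integral_same, map_zero, zero_apply, zero_add,
    ← intervalIntegral.integral_sub (hint f g) (hint g f)]
  refine intervalIntegral.integral_congr fun τ hτ => ?_
  rw [uIcc_of_le hab] at hτ
  simp only [symplB_apply]
  rw [hs τ hτ (bddToL2 a b _ f τ), sympl_swap (∫ θ in a..τ, X θ (bddToL2 a b _ g θ))]
  ring

end ControlForm

end OptControl

namespace OptControl

open ControlProblem

/-! ### Jacobi spaces as extensions of the vertical subspace. -/

section JacobiSpace

/-- Restriction of essentially bounded functions to a subinterval. -/
noncomputable def resL {E : Type*} [NormedAddCommGroup E] [NormedSpace ℝ E] {a b c e : ℝ}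
    (h : Icc c e ⊆ Icc a b) : Lp E ∞ (volume.restrict (Icc a b)) →ₗ[ℝ] L2 c e E where
  toFun f := (((Lp.memLp f).mono_measure (Measure.restrict_mono h le_rfl)).mono_exponent
    (p := 2) le_top).toLp f
  map_add' f g := by
    rw [← MemLp.toLp_add]
    exact MemLp.toLp_congr _ _ (ae_mono (Measure.restrict_mono h le_rfl) (Lp.coeFn_add f g))
  map_smul' r f := by
    rw [RingHom.id_apply, ← MemLp.toLp_const_smul]
    exact MemLp.toLp_congr _ _ (ae_mono (Measure.restrict_mono h le_rfl) (Lp.coeFn_smul r f))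

lemma resL_ae {E : Type*} [NormedAddCommGroup E] [NormedSpace ℝ E] {a b c e : ℝ}
    (h : Icc c e ⊆ Icc a b) (f : Lp E ∞ (volume.restrict (Icc a b))) :
    ∀ᵐ τ ∂(volume.restrict (Icc c e)), resL h f τ = f τ :=
  (((Lp.memLp f).mono_measure (Measure.restrict_mono h le_rfl)).mono_exponent
    (p := 2) le_top).coeFn_toLp

variable {n k d : ℕ}

/-- The threshold V₀ lies in the range of ι, so it is the image of its preimage, which is
finite-dimensional by injectivity; larger subspaces have images containing V₀. -/
lemma ConvAlong.isGeneralizedLimit {W H : Type*} [AddCommGroup W] [Module ℝ W] [AddCommGroup H]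
    [Module ℝ H] {ι : W →ₗ[ℝ] H} (hι : Function.Injective ι)
    {L : FinSub W → Submodule ℝ (Phase n)} {K : Submodule ℝ H → Submodule ℝ (Phase n)}
    {Λ : Submodule ℝ (Phase n)} (h : ConvAlong (LinearMap.range ι) K Λ)
    (hL : ∀ V, L V = K (V.1.map ι)) : IsGeneralizedLimit L Λ := by
  refine Metric.tendsto_nhds.2 fun ε hε => ?_
  obtain ⟨V₀, hle, hfd, hV₀⟩ := h (ε / 2) (half_pos hε)
  have hfd' : FiniteDimensional ℝ (V₀.comap ι) := by
    refine Module.Finite.of_injective (ι.restrict (p := V₀.comap ι) (q := V₀) fun x hx => hx) ?_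
    intro x y hxy
    exact Subtype.ext (hι (congrArg Subtype.val hxy))
  filter_upwards [eventually_ge_atTop (⟨V₀.comap ι, hfd'⟩ : FinSub W)] with V hV
  have hVfd := V.2
  have h1 : V₀ ≤ V.1.map ι := by
    rw [← inf_eq_right.2 hle, ← Submodule.map_comap_eq]
    exact Submodule.map_mono hV
  have h2 := hV₀ (V.1.map ι) inferInstance h1
  rw [dist_eq_norm]
  simp only [hL]
  exact h2.trans_lt (half_lt_self hε)

variable {M : Type*} [TopologicalSpace M] [ChartedSpace (Vec n) M]
  [IsManifold 𝓘(ℝ, Vec n) ∞ M]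
  {N : Type*} [TopologicalSpace N] [ChartedSpace (Vec d) N] [IsManifold 𝓘(ℝ, Vec d) ∞ N]

namespace Reference

variable {S : Reference n k d M N} {t τ : ℝ}

/-- The tangent space of the initial submanifold in the phase space. -/
noncomputable def startMap (S : Reference n k d M N) : Vec d →ₗ[ℝ] Phase n :=
  (WithLp.linearEquiv 2 ℝ (Vec n × Vec n)).symm.toLinearMap ∘ₗ
    LinearMap.inr ℝ (Vec n) (Vec n) ∘ₗ (fderiv ℝ S.startChart 0).toLinearMap

/-- The second differential of the initial submanifold along the multiplier. -/
noncomputable def startForm (S : Reference n k d M N) : Vec d →ₗ[ℝ] Vec d →ₗ[ℝ] ℝ :=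
  LinearMap.mk₂ ℝ (fun y y' => ⟪S.z0.fst, fderiv ℝ (fderiv ℝ S.startChart) 0 y y'⟫_ℝ)
    (by simp [inner_add_right]) (by simp [inner_smul_right]) (by simp [inner_add_right])
    (by simp [inner_smul_right])

lemma startMap_fst (S : Reference n k d M N) (y : Vec d) : (S.startMap y).fst = 0 := rfl

lemma startForm_apply (S : Reference n k d M N) (y y' : Vec d) :
    S.startForm y y' = ⟪S.z0.fst, fderiv ℝ (fderiv ℝ S.startChart) 0 y y'⟫_ℝ := rfl

lemma compatible_start (S : Reference n k d M N) : Compatible S.startMap S.startForm := by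
  intro y y'
  rw [startForm_apply, startForm_apply, S.contDiffAt_startChart.isSymmSndFDerivAt (by simp) y y',
    sub_self, sympl, startMap_fst, startMap_fst, inner_zero_left, inner_zero_left, sub_zero]

/-- The first variation in the phase space at time zero. -/
noncomputable def varPath (S : Reference n k d M N) {t : ℝ} (v : Var d k t) (τ : ℝ) : Phase n :=
  S.startMap v.1 + ∫ θ in (0 : ℝ)..τ, S.X θ (v.2 θ)

variable [T2Space M] [SecondCountableTopology M]

lemma ACDeriv_varPath (ht : t ∈ Icc 0 S.T) (v : Var d k t) :
    ACDeriv (S.varPath v) (fun τ => S.X τ (v.2 τ)) 0 t := by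
  have hX := memLp_mono_Icc (memLp_X (S := S) (ht.1.trans ht.2)) le_rfl ht.2
  have hm := MemLp.bilin_top (E := Vec k →L[ℝ] Phase n) (F := Vec k) (G := Phase n)
    (ContinuousLinearMap.id ℝ (Vec k →L[ℝ] Phase n)) hX (Lp.memLp v.2)
  refine ACDeriv.of_integral hm fun τ hτ => ?_
  rw [varPath, varPath, intervalIntegral.integral_same, add_zero]

section

variable {V : Submodule ℝ (Var d k t)} [FiniteDimensional ℝ V]

lemma varPath_snd (ht : t ∈ Icc 0 S.T) (v : V) (hτ : τ ∈ Icc 0 t) :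
    (S.varPath v.1 τ).snd = S.varD t V τ v := by
  have h1 := ((ACDeriv_varPath ht v.1).clm (WithLp.sndL 2 ℝ (Vec n) (Vec n))).eq_integral hτ
  have h2 := (varD_ode ht v v).1.eq_integral hτ
  rw [(varD_zero ht v v).1] at h2
  refine h1.trans (Eq.trans ?_ h2.symm)
  refine congrArg (· + _) ?_
  change (S.varPath v.1 0).snd = _
  rw [varPath, intervalIntegral.integral_same, add_zero]
  rfl

/-- The second variation along a subinterval. -/
lemma varQ_step (ht : t ∈ Icc 0 S.T) (v w : V) {a b : ℝ} (ha : 0 ≤ a) (hab : a ≤ b) (hb : b ≤ t) :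
    S.varQ t V b v w + ⟪(S.varPath v.1 b).fst, S.varD t V b w⟫_ℝ =
      S.varQ t V a v w + ⟪(S.varPath v.1 a).fst, S.varD t V a w⟫_ℝ +
        ∫ τ in a..b, (sympl (S.varPath v.1 τ) (S.X τ (w.1.2 τ)) +
          S.b τ (v.1.2 τ) (w.1.2 τ)) := by
  -- Adding the pairing of the momentum of v with the position of w cancels one mixed term of the
  -- second variation and completes the other to a symplectic product.
  have h1 := ((ACDeriv_varPath ht v.1).clm (WithLp.fstL 2 ℝ (Vec n) (Vec n))).bilin (innerSL ℝ)
    (varD_ode ht w w).1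
  have h2 := ((varD_ode ht v w).2.add h1).mono ha hb
  refine (h2.eq_integral ⟨hab, le_rfl⟩).trans ?_
  refine congrArg _ (intervalIntegral.integral_congr fun τ hτ => ?_)
  rw [uIcc_of_le hab] at hτ
  have h3 := varPath_snd ht v ⟨ha.trans hτ.1, hτ.2.trans hb⟩
  simp only [sympl, h3]
  change _ - ⟪(S.X τ (v.1.2 τ)).fst, S.varD t V τ w⟫_ℝ - _ + (⟪(S.X τ (v.1.2 τ)).fst,
    S.varD t V τ w⟫_ℝ + ⟪(S.varPath v.1 τ).fst, (S.X τ (w.1.2 τ)).snd⟫_ℝ) = _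
  ring

lemma varQ_step_zero (ht : t ∈ Icc 0 S.T) (v w : V) :
    S.varQ t V 0 v w + ⟪(S.varPath v.1 0).fst, S.varD t V 0 w⟫_ℝ =
      S.startForm v.1.1 w.1.1 := by
  rw [(varD_zero ht v w).2, varPath, intervalIntegral.integral_same, add_zero, startMap_fst,
    inner_zero_left, add_zero, startForm_apply]

/-- By `mem_kext_vert` the form of the extension is s - ⟨(Y·).fst, (Y·).snd⟩, which the hypothesis
on s makes equal to the second variation. -/
theorem jacobiOver_eq_kext (ht : t ∈ Icc 0 S.T) {H : Type*} [NormedAddCommGroup H]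
    [NormedSpace ℝ H] (Y : H →ₗ[ℝ] Phase n) (s : H →ₗ[ℝ] H →ₗ[ℝ] ℝ) (ι : Var d k t →ₗ[ℝ] H)
    (hY : ∀ v, Y (ι v) = S.varPath v t)
    (hs : ∀ v w : V, s (ι v) (ι w) = S.varQ t V t v w +
      ⟪(S.varPath v.1 t).fst, S.varD t V t w⟫_ℝ) :
    S.jacobiOver t V = kext (vert n) Y s (V.map ι) := by
  have htt : t ∈ Icc 0 t := ⟨ht.1, le_rfl⟩
  ext z
  rw [mem_jacobiOver ht, mem_kext_vert]
  constructor
  · rintro ⟨v, h1, h2⟩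
    refine ⟨ι v, ⟨v, v.2, rfl⟩, by rw [hY, varPath_snd ht v htt, h1], ?_⟩
    rintro _ ⟨w, hw, rfl⟩
    have := h2 ⟨w, hw⟩
    rw [hs v ⟨w, hw⟩, hY, hY, varPath_snd ht ⟨w, hw⟩ htt]
    linarith
  · rintro ⟨_, ⟨v, hv, rfl⟩, h1, h2⟩
    refine ⟨⟨v, hv⟩, by rw [h1, hY, ← varPath_snd ht ⟨v, hv⟩ htt], fun w => ?_⟩
    have := h2 (ι w) ⟨w, w.2, rfl⟩
    rw [hs ⟨v, hv⟩ w, hY, hY, varPath_snd ht w htt] at this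
    linarith

end

end Reference

end JacobiSpace

end OptControl

namespace OptControl

open ControlProblem

/-! ### Concatenation of variations on adjacent intervals. -/

section Additivity

lemma integral_congr_Icc {F : Type*} [NormedAddCommGroup F] [NormedSpace ℝ F] {a b τ : ℝ}
    {f g : ℝ → F} (h : ∀ᵐ τ ∂(volume.restrict (Icc a b)), f τ = g τ) (hτ : τ ∈ Icc a b) :
    ∫ θ in a..τ, f θ = ∫ θ in a..τ, g θ := by
  rw [ae_restrict_iff' measurableSet_Icc] at h
  refine intervalIntegral.integral_congr_ae ?_
  filter_upwards [h] with θ h1 h2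
  rw [uIoc_of_le hτ.1] at h2
  exact h1 ⟨h2.1.le, h2.2.trans hτ.2⟩

/-- The restrictions of a bounded function to two adjacent intervals. -/
lemma exists_resL_eq {E : Type*} [NormedAddCommGroup E] [NormedSpace ℝ E] {a b c : ℝ}
    (hab : a ≤ b) (hbc : b ≤ c) (f : Lp E ∞ (volume.restrict (Icc a b)))
    (g : Lp E ∞ (volume.restrict (Icc b c))) :
    ∃ h : Lp E ∞ (volume.restrict (Icc a c)),
      resL (Icc_subset_Icc_right hbc) h = resL Subset.rfl f ∧
      resL (Icc_subset_Icc_left hab) h = resL Subset.rfl g := by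
  classical
  have e1 : ∀ᵐ τ ∂(volume.restrict (Icc a b)), (if τ ≤ b then f τ else g τ) = f τ := by
    filter_upwards [ae_restrict_mem measurableSet_Icc] with τ hτ
    rw [if_pos hτ.2]
  have e2 : ∀ᵐ τ ∂(volume.restrict (Icc b c)), (if τ ≤ b then f τ else g τ) = g τ := by
    filter_upwards [ae_restrict_mem measurableSet_Icc, ae_restrict_of_ae (Measure.ae_ne volume b)]
      with τ hτ hne
    rw [if_neg (not_le.2 (lt_of_le_of_ne hτ.1 hne.symm))]
  have hm : MemLp (fun τ => if τ ≤ b then f τ else g τ) ∞ (volume.restrict (Icc a c)) :=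
    memLp_top_glue hab hbc ((Lp.memLp f).ae_eq (e1.mono fun _ h => h.symm))
      ((Lp.memLp g).ae_eq (e2.mono fun _ h => h.symm))
  refine ⟨hm.toLp _, Lp.ext ?_, Lp.ext ?_⟩
  · filter_upwards [e1, resL_ae (Icc_subset_Icc_right hbc) (hm.toLp _), resL_ae Subset.rfl f,
      ae_mono (Measure.restrict_mono (Icc_subset_Icc_right hbc) le_rfl) hm.coeFn_toLp]
      with τ h1 h2 h3 h4
    rw [h2, h4, h1, h3]
  · filter_upwards [e2, resL_ae (Icc_subset_Icc_left hab) (hm.toLp _), resL_ae Subset.rfl g,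
      ae_mono (Measure.restrict_mono (Icc_subset_Icc_left hab) le_rfl) hm.coeFn_toLp]
      with τ h1 h2 h3 h4
    rw [h2, h4, h1, h3]

lemma eq_of_resL_eq {E : Type*} [NormedAddCommGroup E] [NormedSpace ℝ E] {a b c : ℝ}
    (hab : a ≤ b) (hbc : b ≤ c) {f g : Lp E ∞ (volume.restrict (Icc a c))}
    (h1 : resL (Icc_subset_Icc_right hbc) f = resL (Icc_subset_Icc_right hbc) g)
    (h2 : resL (Icc_subset_Icc_left hab) f = resL (Icc_subset_Icc_left hab) g) : f = g := by
  refine Lp.ext ?_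
  refine (congrArg (fun s => ∀ᵐ τ ∂(volume.restrict s), f τ = g τ)
    (Icc_union_Icc_eq_Icc hab hbc)).mp ((ae_restrict_union_iff _ _ _).2 ⟨?_, ?_⟩)
  · filter_upwards [resL_ae (Icc_subset_Icc_right hbc) f, resL_ae (Icc_subset_Icc_right hbc) g]
      with τ e1 e2
    rw [← e1, ← e2, h1]
  · filter_upwards [resL_ae (Icc_subset_Icc_left hab) f, resL_ae (Icc_subset_Icc_left hab) g]
      with τ e1 e2
    rw [← e1, ← e2, h2]

variable {n k d : ℕ} {M : Type*} [TopologicalSpace M] [ChartedSpace (Vec n) M]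
  [IsManifold 𝓘(ℝ, Vec n) ∞ M]
  {N : Type*} [TopologicalSpace N] [ChartedSpace (Vec d) N] [IsManifold 𝓘(ℝ, Vec d) ∞ N]

namespace Reference

variable {S : Reference n k d M N} {t a b : ℝ}

variable [T2Space M] [SecondCountableTopology M]

lemma varPath_step (ht : t ∈ Icc 0 S.T) (ha : 0 ≤ a) (hb : b ≤ t)
    (v : Var d k t) {τ : ℝ} (hτ : τ ∈ Icc a b) :
    S.varPath v τ = S.varPath v a +
      ∫ θ in a..τ, S.X θ (resL (Icc_subset_Icc ha hb) v.2 θ) := by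
  rw [((ACDeriv_varPath ht v).mono ha hb).eq_integral hτ]
  refine congrArg _ (integral_congr_Icc ?_ hτ)
  filter_upwards [resL_ae (Icc_subset_Icc ha hb) v.2] with θ h
  rw [h]

section

variable {V : Submodule ℝ (Var d k t)} [FiniteDimensional ℝ V]

/-- The second variation along a subinterval in terms of the form of the subinterval. -/
lemma varQ_step_ctrl (ht : t ∈ Icc 0 S.T) (ha : 0 ≤ a) (hab : a ≤ b) (hb : b ≤ t)
    (hX : MemLp S.X ∞ (volume.restrict (Icc a b)))
    (hβ : MemLp S.bForm ∞ (volume.restrict (Icc a b))) (v w : V) :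
    S.varQ t V b v w + ⟪(S.varPath v.1 b).fst, S.varD t V b w⟫_ℝ =
      S.varQ t V a v w + ⟪(S.varPath v.1 a).fst, S.varD t V a w⟫_ℝ +
        (sympl (S.varPath v.1 a) (ctrlMap hX (resL (Icc_subset_Icc ha hb) w.1.2)) +
          ctrlForm hX hβ (resL (Icc_subset_Icc ha hb) v.1.2)
            (resL (Icc_subset_Icc ha hb) w.1.2)) := by
  rw [varQ_step ht v w ha hab hb, sympl_add_ctrlForm hab]
  refine congrArg _ (integral_congr_Icc ?_ ⟨hab, le_rfl⟩)
  filter_upwards [ae_restrict_mem measurableSet_Icc, resL_ae (Icc_subset_Icc ha hb) v.1.2,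
    resL_ae (Icc_subset_Icc ha hb) w.1.2] with τ hτ h1 h2
  rw [varPath_step ht ha hb v.1 hτ, h1, h2, bForm_apply]

end

/-- A space of variations with a map and a form that represent the variations in the
phase space. -/
structure Represents (S : Reference n k d M N) (t : ℝ) {H : Type*} [NormedAddCommGroup H]
    [NormedSpace ℝ H] (Y : H →ₗ[ℝ] Phase n) (s : H →ₗ[ℝ] H →ₗ[ℝ] ℝ) (ι : Var d k t →ₗ[ℝ] H) :
    Prop where
  injective : Function.Injective ι
  map : ∀ v, Y (ι v) = S.varPath v t
  form : ∀ (V : Submodule ℝ (Var d k t)) [FiniteDimensional ℝ V] (v w : V),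
    s (ι v) (ι w) = S.varQ t V t v w + ⟪(S.varPath v.1 t).fst, S.varD t V t w⟫_ℝ

section

variable {H : Type*} [NormedAddCommGroup H] [NormedSpace ℝ H] {Y : H →ₗ[ℝ] Phase n}
  {s : H →ₗ[ℝ] H →ₗ[ℝ] ℝ} {ι : Var d k t →ₗ[ℝ] H}

lemma Represents.isJacobi (h : S.Represents t Y s ι) (ht : t ∈ Icc 0 S.T)
    {Λ : Submodule ℝ (Phase n)} (hΛ : ConvAlong (LinearMap.range ι) (kext (vert n) Y s) Λ) :
    S.IsJacobi t Λ := by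
  refine hΛ.isGeneralizedLimit h.injective fun V => ?_
  have := V.2
  exact jacobiOver_eq_kext ht Y s ι h.map (h.form V.1)

/-- Where the position variation vanishes, the correction term in the form vanishes too, so s is
minus the Hessian on the kernel of the differential. -/
lemma Represents.exists_comap (h : S.Represents t Y s ι) (ht : t ∈ Icc 0 S.T) {V : Submodule ℝ H}
    (hV : V ≤ LinearMap.range ι) [FiniteDimensional ℝ V] (h0 : ∀ v ∈ V, (Y v).snd = 0) :
    ∃ V' : FinSub (Var d k t), d1 (S.endMap t) V'.1 = 0 ∧
      Module.finrank ℝ V = Module.finrank ℝ V'.1 ∧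
      ∀ v : V'.1, ι v ∈ V ∧ (v ≠ 0 → ι v ≠ 0) ∧
        hessForm (S.endMap t) (S.costMap t) (S.lam t).fst S.ν V'.1 v = -s (ι v) (ι v) := by
  have e : V = (V.comap ι).map ι := by
    rw [Submodule.map_comap_eq, inf_eq_right.2 hV]
  have hfd : FiniteDimensional ℝ (V.comap ι) := by
    refine Module.Finite.of_injective (ι.restrict (p := V.comap ι) (q := V) fun x hx => hx) ?_
    intro x y hxy
    exact Subtype.ext (h.injective (congrArg Subtype.val hxy))
  have hD : ∀ v : V.comap ι, S.varD t (V.comap ι) t v = 0 := by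
    intro v
    rw [← varPath_snd ht v ⟨ht.1, le_rfl⟩, ← h.map]
    exact h0 _ v.2
  refine ⟨⟨V.comap ι, hfd⟩, (d1_eq_zero_iff ht).2 hD, ?_, fun v => ⟨v.2, fun hv hv0 => hv ?_, ?_⟩⟩
  · conv_lhs => rw [e]
    exact (Submodule.equivMapOfInjective ι h.injective (V.comap ι)).finrank_eq.symm
  · exact Subtype.ext (h.injective (hv0.trans (map_zero ι).symm))
  · rw [hessForm_eq ht v (hD v), h.form _ v v, hD v, inner_zero_right, add_zero]

/-- The sign change between s and the Hessian exchanges the indices: negative subspaces of s are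
counted by the positive index of the Hessian. -/
lemma Represents.finrank_le_posIndex (h : S.Represents t Y s ι) (ht : t ∈ Icc 0 S.T)
    (hfin : hessPosIndex (S.endMap t) (S.costMap t) (S.lam t).fst S.ν < ⊤) :
    ∃ r : ℕ, ∀ V ≤ LinearMap.range ι, FiniteDimensional ℝ V → (∀ v ∈ V, (Y v).snd = 0) →
      (∀ v ∈ V, v ≠ 0 → s v v < 0) → Module.finrank ℝ V ≤ r := by
  refine ⟨ENat.toNat (hessPosIndex (S.endMap t) (S.costMap t) (S.lam t).fst S.ν),
    fun V hV hfd h0 hs => ?_⟩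
  obtain ⟨V', h1, h2, h3⟩ := h.exists_comap ht hV h0
  rw [h2, ← ENat.natCast_le_natCast, ENat.natCast_toNat hfin.ne]
  refine le_iSup (fun V : {V : FinSub (Var d k t) // d1 (S.endMap t) V.1 = 0 ∧ ∀ v : V.1, v ≠ 0 →
    0 < hessForm (S.endMap t) (S.costMap t) (S.lam t).fst S.ν V.1 v} =>
      (Module.finrank ℝ V.1.1 : ℕ∞)) ⟨V', h1, fun v hv => ?_⟩
  rw [(h3 v).2.2]
  exact neg_pos.2 (hs _ (h3 v).1 ((h3 v).2.1 hv))

lemma Represents.finrank_le_negIndex (h : S.Represents t Y s ι) (ht : t ∈ Icc 0 S.T)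
    (hfin : hessNegIndex (S.endMap t) (S.costMap t) (S.lam t).fst S.ν < ⊤) :
    ∃ r : ℕ, ∀ V ≤ LinearMap.range ι, FiniteDimensional ℝ V → (∀ v ∈ V, (Y v).snd = 0) →
      (∀ v ∈ V, v ≠ 0 → 0 < s v v) → Module.finrank ℝ V ≤ r := by
  refine ⟨ENat.toNat (hessNegIndex (S.endMap t) (S.costMap t) (S.lam t).fst S.ν),
    fun V hV hfd h0 hs => ?_⟩
  obtain ⟨V', h1, h2, h3⟩ := h.exists_comap ht hV h0
  rw [h2, ← ENat.natCast_le_natCast, ENat.natCast_toNat hfin.ne]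
  refine le_iSup (fun V : {V : FinSub (Var d k t) // d1 (S.endMap t) V.1 = 0 ∧ ∀ v : V.1, v ≠ 0 →
    hessForm (S.endMap t) (S.costMap t) (S.lam t).fst S.ν V.1 v < 0} =>
      (Module.finrank ℝ V.1.1 : ℕ∞)) ⟨V', h1, fun v hv => ?_⟩
  rw [(h3 v).2.2]
  exact neg_lt_zero.2 (hs _ (h3 v).1 ((h3 v).2.1 hv))

end

end Reference

end Additivity

end OptControl

namespace OptControl

open ControlProblem

/-! ### Proof of the additivity of the Jacobi curve. -/

section Main

/-- A bounded bilinear form as a bilinear form. -/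
noncomputable def toForm {E : Type*} [NormedAddCommGroup E] [NormedSpace ℝ E]
    (B : E →L[ℝ] E →L[ℝ] ℝ) : E →ₗ[ℝ] E →ₗ[ℝ] ℝ :=
  B.toLinearMap₁₂

lemma toForm_apply {E : Type*} [NormedAddCommGroup E] [NormedSpace ℝ E] (B : E →L[ℝ] E →L[ℝ] ℝ)
    (v w : E) : toForm B v w = B v w := rfl

lemma mem_kext {n : ℕ} {H : Type*} [AddCommGroup H] [Module ℝ H] {Λ : Submodule ℝ (Phase n)}
    {Y : H →ₗ[ℝ] Phase n} {s : H →ₗ[ℝ] H →ₗ[ℝ] ℝ} {V : Submodule ℝ H} {z : Phase n} :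
    z ∈ kext Λ Y s V ↔
      ∃ l ∈ Λ, ∃ v ∈ V, (∀ w ∈ V, sympl l (Y w) + s v w = 0) ∧ z = l + Y v :=
  Iff.rfl

variable {n k d : ℕ} {M : Type*} [TopologicalSpace M] [ChartedSpace (Vec n) M]
  [IsManifold 𝓘(ℝ, Vec n) ∞ M]
  {N : Type*} [TopologicalSpace N] [ChartedSpace (Vec d) N] [IsManifold 𝓘(ℝ, Vec d) ∞ N]

namespace Reference

variable {S : Reference n k d M N} {t₁ t₂ t a b : ℝ}

/-- The first variation on `[0, t]` for square integrable variations of the control. -/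
noncomputable def jacobiMap (S : Reference n k d M N) {t : ℝ}
    (hX : MemLp S.X ∞ (volume.restrict (Icc 0 t))) : Vec d × L2 0 t (Vec k) →ₗ[ℝ] Phase n :=
  S.startMap.coprod (ctrlMap hX).toLinearMap

/-- The second variation on `[0, t]` for square integrable variations of the control. -/
noncomputable def jacobiForm (S : Reference n k d M N) {t : ℝ}
    (hX : MemLp S.X ∞ (volume.restrict (Icc 0 t)))
    (hβ : MemLp S.bForm ∞ (volume.restrict (Icc 0 t))) :
    Vec d × L2 0 t (Vec k) →ₗ[ℝ] Vec d × L2 0 t (Vec k) →ₗ[ℝ] ℝ :=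
  prodForm S.startMap S.startForm (ctrlMap hX).toLinearMap (toForm (ctrlForm hX hβ))

/-- The variation of the initial point together with the restriction of the control. -/
noncomputable def resVar (d k : ℕ) {t a : ℝ} (ha : a ≤ t) :
    Var d k t →ₗ[ℝ] Vec d × L2 0 a (Vec k) :=
  LinearMap.prodMap LinearMap.id (resL (Icc_subset_Icc_right ha))

lemma resVar_apply {t a : ℝ} (ha : a ≤ t) (v : Var d k t) :
    resVar d k ha v = (v.1, resL (Icc_subset_Icc_right ha) v.2) :=
  LinearMap.prodMap_apply _ _ _

lemma jacobiMap_apply (hX : MemLp S.X ∞ (volume.restrict (Icc 0 t)))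
    (p : Vec d × L2 0 t (Vec k)) : S.jacobiMap hX p = S.startMap p.1 + ctrlMap hX p.2 :=
  LinearMap.coprod_apply _ _ _

lemma jacobiForm_apply (hX : MemLp S.X ∞ (volume.restrict (Icc 0 t)))
    (hβ : MemLp S.bForm ∞ (volume.restrict (Icc 0 t))) (p q : Vec d × L2 0 t (Vec k)) :
    S.jacobiForm hX hβ p q = S.startForm p.1 q.1 + ctrlForm hX hβ p.2 q.2 +
      sympl (S.startMap p.1) (ctrlMap hX q.2) := by
  rw [jacobiForm, prodForm_apply, toForm_apply, ContinuousLinearMap.coe_coe]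

lemma continuous_jacobiMap (hX : MemLp S.X ∞ (volume.restrict (Icc 0 t))) :
    Continuous (S.jacobiMap hX) := by
  have : Continuous fun p : Vec d × L2 0 t (Vec k) => S.startMap p.1 + ctrlMap hX p.2 :=
    (S.startMap.continuous_of_finiteDimensional.comp continuous_fst).add
      ((ctrlMap hX).continuous.comp continuous_snd)
  exact this.congr fun p => (S.jacobiMap_apply hX p).symm

lemma continuous_jacobiForm (hX : MemLp S.X ∞ (volume.restrict (Icc 0 t)))
    (hβ : MemLp S.bForm ∞ (volume.restrict (Icc 0 t))) :
    Continuous fun p : (Vec d × L2 0 t (Vec k)) × (Vec d × L2 0 t (Vec k)) =>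
      S.jacobiForm hX hβ p.1 p.2 := by
  have h1 : Continuous fun p : (Vec d × L2 0 t (Vec k)) × (Vec d × L2 0 t (Vec k)) =>
      S.startForm p.1.1 p.2.1 := by
    simp only [startForm_apply]
    fun_prop
  have h2 : Continuous S.startMap := S.startMap.continuous_of_finiteDimensional
  have h3 : Continuous fun p : (Vec d × L2 0 t (Vec k)) × (Vec d × L2 0 t (Vec k)) =>
      S.startForm p.1.1 p.2.1 + ctrlForm hX hβ p.1.2 p.2.2 +
        symplB n (S.startMap p.1.1) (ctrlMap hX p.2.2) := by
    fun_prop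
  refine h3.congr fun p => ?_
  rw [symplB_apply, jacobiForm_apply]

variable [T2Space M] [SecondCountableTopology M]

lemma compatible_ctrl_sub (ha : 0 ≤ a) (hab : a ≤ b) (hb : b ≤ S.T)
    (hX : MemLp S.X ∞ (volume.restrict (Icc a b)))
    (hβ : MemLp S.bForm ∞ (volume.restrict (Icc a b))) :
    Compatible (ctrlMap hX).toLinearMap (toForm (ctrlForm hX hβ)) :=
  fun v w => by
    rw [toForm_apply, toForm_apply, ContinuousLinearMap.coe_coe]
    exact compatible_ctrl hab hX hβ (fun _ hτ _ _ =>
      bForm_symm ⟨ha.trans hτ.1, hτ.2.trans hb⟩ _ _) v w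

lemma jacobiMap_resVar (ht : t ∈ Icc 0 S.T) (ha : 0 ≤ a) (hat : a ≤ t)
    (hX : MemLp S.X ∞ (volume.restrict (Icc 0 a))) (v : Var d k t) :
    S.jacobiMap hX (resVar d k hat v) = S.varPath v a := by
  rw [varPath_step ht le_rfl hat v ⟨ha, le_rfl⟩, varPath, intervalIntegral.integral_same, add_zero,
    ← ctrlMap_apply ha hX, jacobiMap_apply, resVar_apply]

lemma jacobiForm_resVar (ht : t ∈ Icc 0 S.T) (ha : 0 ≤ a) (hat : a ≤ t)
    (hX : MemLp S.X ∞ (volume.restrict (Icc 0 a)))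
    (hβ : MemLp S.bForm ∞ (volume.restrict (Icc 0 a))) (V : Submodule ℝ (Var d k t))
    [FiniteDimensional ℝ V] (v w : V) :
    S.jacobiForm hX hβ (resVar d k hat v) (resVar d k hat w) =
      S.varQ t V a v w + ⟪(S.varPath v.1 a).fst, S.varD t V a w⟫_ℝ := by
  rw [varQ_step_ctrl ht le_rfl ha hat hX hβ, varQ_step_zero ht, varPath,
    intervalIntegral.integral_same, add_zero, jacobiForm_apply, resVar_apply, resVar_apply,
    add_assoc, add_comm (sympl _ _)]

lemma represents_jacobi (ht : t ∈ Icc 0 S.T) (hX : MemLp S.X ∞ (volume.restrict (Icc 0 t)))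
    (hβ : MemLp S.bForm ∞ (volume.restrict (Icc 0 t))) :
    S.Represents t (S.jacobiMap hX) (S.jacobiForm hX hβ) (resVar d k le_rfl) where
  injective v w h := by
    rw [resVar_apply, resVar_apply] at h
    refine Prod.ext (congrArg (fun p => p.1) h) (bddToL2_injective (Lp.ext ?_))
    have h2 : resL (Icc_subset_Icc_right le_rfl) v.2 = resL (Icc_subset_Icc_right le_rfl) w.2 :=
      congrArg (fun p => p.2) h
    filter_upwards [bddToL2_ae v.2, bddToL2_ae w.2, resL_ae (Icc_subset_Icc_right le_rfl) v.2,
      resL_ae (Icc_subset_Icc_right le_rfl) w.2] with τ e1 e2 e3 e4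
    rw [e1, e2, ← e3, ← e4, h2]
  map v := jacobiMap_resVar ht ht.1 le_rfl hX v
  form V _ v w := jacobiForm_resVar ht ht.1 le_rfl hX hβ V v w

/-- A variation on `[0, t₂]` as a pair of variations on `[0, t₁]` and on `[t₁, t₂]`. -/
noncomputable def splitVar (d k : ℕ) (h0 : 0 ≤ t₁) (h12 : t₁ ≤ t₂) :
    Var d k t₂ →ₗ[ℝ] (Vec d × L2 0 t₁ (Vec k)) × L2 t₁ t₂ (Vec k) :=
  (resVar d k h12).prod (resL (Icc_subset_Icc_left h0) ∘ₗ LinearMap.snd ℝ _ _)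

omit [T2Space M] [SecondCountableTopology M] in
lemma splitVar_apply (h0 : 0 ≤ t₁) (h12 : t₁ ≤ t₂) (v : Var d k t₂) :
    splitVar d k h0 h12 v = ((v.1, resL (Icc_subset_Icc_right h12) v.2),
      resL (Icc_subset_Icc_left h0) v.2) := by
  rw [← resVar_apply h12 v]
  exact LinearMap.prod_apply _ _ _

omit [T2Space M] [SecondCountableTopology M] in
lemma splitVar_injective (h0 : 0 ≤ t₁) (h12 : t₁ ≤ t₂) :
    Function.Injective (splitVar d k h0 h12) := by
  intro v w h
  rw [splitVar_apply, splitVar_apply, Prod.mk.injEq, Prod.mk.injEq] at h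
  exact Prod.ext h.1.1 (eq_of_resL_eq h0 h12 h.1.2 h.2)

lemma coprod_splitVar (h0 : 0 ≤ t₁) (h12 : t₁ ≤ t₂) (h2T : t₂ ≤ S.T)
    (hX₁ : MemLp S.X ∞ (volume.restrict (Icc 0 t₁)))
    (hX₂ : MemLp S.X ∞ (volume.restrict (Icc t₁ t₂))) (v : Var d k t₂) :
    (S.jacobiMap hX₁).coprod (ctrlMap hX₂).toLinearMap (splitVar d k h0 h12 v) =
      S.varPath v t₂ := by
  have ht : t₂ ∈ Icc 0 S.T := ⟨h0.trans h12, h2T⟩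
  rw [varPath_step ht h0 le_rfl v ⟨h12, le_rfl⟩, ← ctrlMap_apply h12 hX₂,
    ← jacobiMap_resVar ht h0 h12 hX₁, splitVar_apply, resVar_apply, LinearMap.coprod_apply,
    ContinuousLinearMap.coe_coe]

lemma prodForm_splitVar (h0 : 0 ≤ t₁) (h12 : t₁ ≤ t₂) (h2T : t₂ ≤ S.T)
    (hX₁ : MemLp S.X ∞ (volume.restrict (Icc 0 t₁)))
    (hβ₁ : MemLp S.bForm ∞ (volume.restrict (Icc 0 t₁)))
    (hX₂ : MemLp S.X ∞ (volume.restrict (Icc t₁ t₂)))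
    (hβ₂ : MemLp S.bForm ∞ (volume.restrict (Icc t₁ t₂))) (V : Submodule ℝ (Var d k t₂))
    [FiniteDimensional ℝ V] (v w : V) :
    prodForm (S.jacobiMap hX₁) (S.jacobiForm hX₁ hβ₁) (ctrlMap hX₂).toLinearMap
        (toForm (ctrlForm hX₂ hβ₂)) (splitVar d k h0 h12 v) (splitVar d k h0 h12 w) =
      S.varQ t₂ V t₂ v w + ⟪(S.varPath v.1 t₂).fst, S.varD t₂ V t₂ w⟫_ℝ := by
  have ht : t₂ ∈ Icc 0 S.T := ⟨h0.trans h12, h2T⟩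
  rw [varQ_step_ctrl ht h0 h12 le_rfl hX₂ hβ₂, ← jacobiForm_resVar ht h0 h12 hX₁ hβ₁,
    ← jacobiMap_resVar ht h0 h12 hX₁, prodForm_apply, add_assoc, add_comm (sympl _ _),
    splitVar_apply, splitVar_apply, resVar_apply, resVar_apply, toForm_apply,
    ContinuousLinearMap.coe_coe]

/-- The second time is represented on a product, with the cut at t₁ built in, instead of by a single
interval; this puts it in the form required by the abstract additivity theorem. -/
lemma represents_split (h0 : 0 ≤ t₁) (h12 : t₁ ≤ t₂) (h2T : t₂ ≤ S.T)
    (hX₁ : MemLp S.X ∞ (volume.restrict (Icc 0 t₁)))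
    (hβ₁ : MemLp S.bForm ∞ (volume.restrict (Icc 0 t₁)))
    (hX₂ : MemLp S.X ∞ (volume.restrict (Icc t₁ t₂)))
    (hβ₂ : MemLp S.bForm ∞ (volume.restrict (Icc t₁ t₂))) :
    S.Represents t₂ ((S.jacobiMap hX₁).coprod (ctrlMap hX₂).toLinearMap)
      (prodForm (S.jacobiMap hX₁) (S.jacobiForm hX₁ hβ₁) (ctrlMap hX₂).toLinearMap
        (toForm (ctrlForm hX₂ hβ₂))) (splitVar d k h0 h12) where
  injective := splitVar_injective h0 h12
  map := coprod_splitVar h0 h12 h2T hX₁ hX₂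
  form V _ := prodForm_splitVar h0 h12 h2T hX₁ hβ₁ hX₂ hβ₂ V

omit [T2Space M] [SecondCountableTopology M] in
lemma dense_range_resVar (d k : ℕ) (t : ℝ) :
    Dense (LinearMap.range (resVar d k (le_refl t)) : Set (Vec d × L2 0 t (Vec k))) := by
  refine (Function.surjective_id.denseRange.prodMap denseRange_bddToL2).mono ?_
  rintro _ ⟨v, rfl⟩
  exact ⟨v, resVar_apply _ _⟩

omit [T2Space M] [SecondCountableTopology M] in
lemma dense_range_splitVar (h0 : 0 ≤ t₁) (h12 : t₁ ≤ t₂) :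
    Dense (LinearMap.range (splitVar d k h0 h12) :
      Set ((Vec d × L2 0 t₁ (Vec k)) × L2 t₁ t₂ (Vec k))) := by
  refine ((Function.surjective_id.denseRange.prodMap denseRange_bddToL2).prodMap
    denseRange_bddToL2).mono ?_
  rintro _ ⟨⟨⟨y, f⟩, g⟩, rfl⟩
  obtain ⟨h, e1, e2⟩ := exists_resL_eq h0 h12 f g
  refine ⟨(y, h), ?_⟩
  rw [splitVar_apply, e1, e2]
  rfl

omit [T2Space M] [SecondCountableTopology M] in
lemma mem_range_splitVar (h0 : 0 ≤ t₁) (h12 : t₁ ≤ t₂) (w : Vec d × L2 0 t₁ (Vec k))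
    (hw : w ∈ LinearMap.range (resVar d k (le_refl t₁))) :
    (w, (0 : L2 t₁ t₂ (Vec k))) ∈ LinearMap.range (splitVar d k h0 h12) := by
  obtain ⟨⟨y, f⟩, rfl⟩ := hw
  obtain ⟨h, e1, e2⟩ := exists_resL_eq h0 h12 f 0
  refine ⟨(y, h), ?_⟩
  rw [splitVar_apply, resVar_apply, e1, e2, map_zero]

omit [T2Space M] [SecondCountableTopology M] in
lemma coe_kext_ctrl (h12 : t₁ ≤ t₂) (hX : MemLp S.X ∞ (volume.restrict (Icc t₁ t₂)))
    (hβ : MemLp S.bForm ∞ (volume.restrict (Icc t₁ t₂))) (Λ : Submodule ℝ (Phase n))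
    (V : Submodule ℝ (L2 t₁ t₂ (Vec k))) :
    (kext Λ (ctrlMap hX).toLinearMap (toForm (ctrlForm hX hβ)) V : Set (Phase n)) =
      S.extension t₁ t₂ Λ V := by
  ext z
  rw [SetLike.mem_coe, mem_kext, extension, mem_ofPred_eq]
  simp only [ContinuousLinearMap.coe_coe, toForm_apply, sympl_add_ctrlForm h12]
  simp only [ctrlMap_apply h12, bForm_apply]

/-- The Jacobi curve at `t₂` is the limit of the extensions of its value at `t₁`. -/
theorem exists_isJacobi_extension (h0 : 0 < t₁) (h12 : t₁ < t₂) (h2T : t₂ ≤ S.T)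
    (hfin : S.HessIndexFinite t₂) :
    ∃ Λ₁ Λ₂ : Submodule ℝ (Phase n), S.IsJacobi t₁ Λ₁ ∧ IsLagrangian Λ₁ ∧
      S.IsJacobi t₂ Λ₂ ∧ IsLagrangian Λ₂ ∧
      ∃ K : FinSub (L2 t₁ t₂ (Vec k)) → Submodule ℝ (Phase n),
        (∀ V, (K V : Set (Phase n)) = S.extension t₁ t₂ Λ₁ V.1 ∧ IsLagrangian (K V)) ∧
        IsGeneralizedLimit K Λ₂ := by
  have ht₁ : t₁ ∈ Icc 0 S.T := ⟨h0.le, h12.le.trans h2T⟩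
  have ht₂ : t₂ ∈ Icc 0 S.T := ⟨(h0.trans h12).le, h2T⟩
  have hT : 0 ≤ S.T := ht₁.1.trans ht₁.2
  have hX₁ := memLp_mono_Icc (memLp_X (S := S) hT) le_rfl ht₁.2
  have hX₂ := memLp_mono_Icc (memLp_X (S := S) hT) h0.le h2T
  have hβ₁ := memLp_bForm (S := S) hT le_rfl ht₁.2
  have hβ₂ := memLp_bForm (S := S) hT h0.le h2T
  have hc₁ : Compatible (S.jacobiMap hX₁) (S.jacobiForm hX₁ hβ₁) :=
    S.compatible_start.prod (compatible_ctrl_sub le_rfl h0.le ht₁.2 hX₁ hβ₁)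
  have hc₂ := compatible_ctrl_sub (S := S) h0.le h12.le h2T hX₂ hβ₂
  have r₁ := represents_jacobi ht₁ hX₁ hβ₁
  have r₂ := represents_split h0.le h12.le h2T hX₁ hβ₁ hX₂ hβ₂
  -- The Jacobi limits run over bounded variations, which form dense subspaces of the square
  -- integrable ones, while the extensions run over all square integrable variations, that is, along
  -- ⊤.
  suffices h : ∃ Λ₁ Λ₂ : Submodule ℝ (Phase n), IsLagrangian Λ₁ ∧ IsLagrangian Λ₂ ∧
      ConvAlong (LinearMap.range (resVar d k (le_refl t₁)))
        (kext (vert n) (S.jacobiMap hX₁) (S.jacobiForm hX₁ hβ₁)) Λ₁ ∧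
      ConvAlong (LinearMap.range (splitVar d k h0.le h12.le))
        (kext (vert n) ((S.jacobiMap hX₁).coprod (ctrlMap hX₂).toLinearMap)
          (prodForm (S.jacobiMap hX₁) (S.jacobiForm hX₁ hβ₁) (ctrlMap hX₂).toLinearMap
            (toForm (ctrlForm hX₂ hβ₂)))) Λ₂ ∧
      ConvAlong ⊤ (kext Λ₁ (ctrlMap hX₂).toLinearMap (toForm (ctrlForm hX₂ hβ₂))) Λ₂ by
    obtain ⟨Λ₁, Λ₂, l₁, l₂, c₁, c₂, c₃⟩ := h
    refine ⟨Λ₁, Λ₂, r₁.isJacobi ht₁ c₁, l₁, r₂.isJacobi ht₂ c₂, l₂,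
      fun V => kext Λ₁ (ctrlMap hX₂).toLinearMap (toForm (ctrlForm hX₂ hβ₂)) V.1,
      fun V => ⟨coe_kext_ctrl h12.le hX₂ hβ₂ Λ₁ V.1, ?_⟩, ?_⟩
    · have := V.2
      exact kext_isLagrangian hc₂ l₁ V.1
    · rw [← LinearMap.range_id] at c₃
      exact c₃.isGeneralizedLimit Function.injective_id fun V => by rw [Submodule.map_id]
  have hco : Continuous fun p : L2 t₁ t₂ (Vec k) × L2 t₁ t₂ (Vec k) =>
      (toForm (ctrlForm hX₂ hβ₂)) p.1 p.2 := by
    have : Continuous fun p : L2 t₁ t₂ (Vec k) × L2 t₁ t₂ (Vec k) => ctrlForm hX₂ hβ₂ p.1 p.2 := by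
      fun_prop
    exact this.congr fun p => (toForm_apply _ _ _).symm
  -- Since s is minus the Hessian, a finite negative index of the Hessian calls for the
  -- positive-index version, and conversely.
  rcases hfin with hfin | hfin
  · obtain ⟨r, hr⟩ := r₂.finrank_le_negIndex ht₂ hfin
    exact additivity_of_posIndex _ _ hc₁ _ _ hc₂ (continuous_jacobiMap hX₁) (ctrlMap hX₂).continuous
      (continuous_jacobiForm hX₁ hβ₁) hco _ (dense_range_resVar d k t₁) _
      (dense_range_splitVar h0.le h12.le) (mem_range_splitVar h0.le h12.le) r hr
  · obtain ⟨r, hr⟩ := r₂.finrank_le_posIndex ht₂ hfin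
    exact additivity_of_negIndex _ _ hc₁ _ _ hc₂ (continuous_jacobiMap hX₁) (ctrlMap hX₂).continuous
      (continuous_jacobiForm hX₁ hβ₁) hco _ (dense_range_resVar d k t₁) _
      (dense_range_splitVar h0.le h12.le) (mem_range_splitVar h0.le h12.le) r hr

end Reference

end Main

end OptControl

theorem mainTheorem6 {n k d : ℕ}
    {M : Type*} [TopologicalSpace M] [T2Space M] [SecondCountableTopology M]
    [ChartedSpace (OptControl.Vec n) M] [IsManifold 𝓘(ℝ, OptControl.Vec n) ∞ M]
    {N : Type*} [TopologicalSpace N] [ChartedSpace (OptControl.Vec d) N]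
    [IsManifold 𝓘(ℝ, OptControl.Vec d) ∞ N]
    (S : OptControl.Reference n k d M N) (hS : S.IsExtremal S.T)
    (t₁ t₂ : ℝ) (h0 : 0 < t₁) (h12 : t₁ < t₂) (h2T : t₂ ≤ S.T) (hfin : S.HessIndexFinite t₂) :
    ∃ Λ₁ Λ₂ : Submodule ℝ (OptControl.Phase n),
      S.IsJacobi t₁ Λ₁ ∧ OptControl.IsLagrangian Λ₁ ∧
      S.IsJacobi t₂ Λ₂ ∧ OptControl.IsLagrangian Λ₂ ∧
      ∃ K : OptControl.FinSub (Lp (OptControl.Vec k) 2 (volume.restrict (Icc t₁ t₂))) →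
          Submodule ℝ (OptControl.Phase n),
        (∀ V, (K V : Set (OptControl.Phase n)) = S.extension t₁ t₂ Λ₁ V.1 ∧
          OptControl.IsLagrangian (K V)) ∧
        OptControl.IsGeneralizedLimit K Λ₂ := by
  exact OptControl.Reference.exists_isJacobi_extension h0 h12 h2T hfin
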